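/- Let $\Bbbk$ be an algebraically closed field of characteristic $0$ and let $A=\begin{pmatrix}2&-2\\-2&2\end{pmatrix}$ be the Cartan matrix of type $A_1^{(1)}$, with nodes $1$ (the affine node) and $2$. Let $G=\widetilde{LSL}_2$ be the derived minimal Kac–Moody group of $A$ over $\Bbbk$, with coroot subgroups $\varphi_i:SL_2\to G$, and write $x_i(t)=\varphi_i\begin{pmatrix}1&t\\0&1\end{pmatrix}$, $x_{\bar\imath}(t)=\varphi_i\begin{pmatrix}1&0\\t&1\end{pmatrix}$, $t^{\alpha_i^\vee}=\varphi_i\begin{pmatrix}t&0\\0&t^{-1}\end{pmatrix}$, $\overline{s_i}=\varphi_i\begin{pmatrix}0&-1\\1&0\end{pmatrix}$. Let $B_\pm$ be the standard Borel subgroups, $c=s_1s_2$, $\overline c=\overline{s_1}\,\overline{s_2}$, and let $G^{c,c^{-1}}=B_+\overline cB_+\cap B_-\overline c^{\,-1}B_-$ be the Coxeter double Bruhat cell. For $i=1,2$ let $\Delta_{\omega_i}$ be the principal minor of the irreducible representation of highest weight $\omega_i$, that is, $\Delta_{\omega_i}(g)$ is the coefficient of the highest weight vector $v_{\omega_i}$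 in $g\,v_{\omega_i}$, and put $\Delta^{\omega_i}_{c\omega_i}(g)=\Delta_{\omega_i}(g\,\overline c)$, $\Delta^{c\omega_i}_{\omega_i}(g)=\Delta_{\omega_i}(\overline c^{\,-1}g)$. Let $\mathcal A_{dp}(c)$ be the cluster algebra over $\Bbbk$ of geometric type (with invertible frozen variables) with initial cluster variables $x_{\omega_1;c},x_{\omega_2;c}$, frozen variables $z_{1;c},z_{2;c},z_{\bar1;c},z_{\bar2;c}$ and extended exchange matrix obtained by stacking $B_c=\begin{pmatrix}0&2\\-2&0\end{pmatrix}$, $\mathrm{Id}_2$ and $\mathrm{Id}_2$. Let $n\ge 0$ and $\mathbf a=(a_1,\dots,a_n)\in(\Bbbk^\times)^n$, and let $V=\Bbbk^2$ with standard basis vector $v=(1,0)$. Let $V(\mathbf a)$ be the representation of $G$ on $\Bbbk[u^{\pm1}]\otimes V^{\otimes n}=(V[u^{\pm1}])^{\otimes n}$ (the last tensor power is taken over $\Bbbk[u^{\pm1}]$) in which $x_1(t)$, $x_{\bar1}(t)$, $x_2(t)$, $x_{\bar2}(t)$ act on the $l$-th tensor factor by $$\begin{pmatrix}1&0\\a_ltu&1\end{pmatrix},\quad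 \begin{pmatrix}1&a_l^{-1}tu^{-1}\\0&1\end{pmatrix},\quad \begin{pmatrix}1&t\\0&1\end{pmatrix},\quad \begin{pmatrix}1&0\\t&1\end{pmatrix}$$ respectively. Let $\Delta_{V(\mathbf a),n\omega^\circ}(g)$, with $\omega^\circ=-\omega_1+\omega_2$, be the coefficient of $u^0\otimes v\otimes\cdots\otimes v$ in $g\cdot(u^0\otimes v\otimes\cdots\otimes v)$, with respect to the basis of $V(\mathbf a)$ formed by the tensors of a power of $u$ and standard basis vectors of $V$. Put $$S_{\mathbf a,r}=\sum_{\substack{I,J\subseteq[1,n]\\ |I|=|J|=r,\ I\cap J=\varnothing}}\frac{\prod_{i\in I}a_i}{\prod_{j\in J}a_j},\qquad d_{\mathbf a}(m,k)=\sum_{r=0}^{m}\binom{m-r}{k}\binom{n-2r}{m-r}S_{\mathbf a,r}$$ (the terms with $2r>n$ vanish since $S_{\mathbf a,r}=0$ for them). **Proposition.** (1) For all $t_{\bar1},t_{\bar2},h_1,h_2,t_1,t_2\in\Bbbk^\times$, the value of $\Delta_{V(\mathbf a),n\omega^\circ}$ at $g=x_{\bar1}(t_{\bar1})\,x_{\bar2}(t_{\bar2})\,h_1^{\alpha_1^\vee}h_2^{\alpha_2^\vee}\,x_2(t_2)\,x_1(t_1)$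 is $$\Delta_{V(\mathbf a),n\omega^\circ}(g)=\sum_{0\le k\le m\le n}d_{\mathbf a}(m,k)\,t_{\bar1}^{m}\,t_{\bar2}^{m-k}\,h_1^{2k-n}\,h_2^{n-2k}\,t_2^{m-k}\,t_1^{m}.$$ (2) There is an isomorphism of $\Bbbk$-algebras $\Phi:\mathcal A_{dp}(c)\to\Bbbk[G^{c,c^{-1}}]$ such that, for $i=1,2$, $$\Phi(x_{\omega_i;c})=\Delta_{\omega_i},\qquad \Phi(z_{i;c})=\Delta^{\omega_i}_{c\omega_i}\prod_{j<i}\bigl(\Delta^{\omega_j}_{c\omega_j}\bigr)^{a_{ji}},\qquad \Phi(z_{\bar\imath;c})=\Delta^{c\omega_i}_{\omega_i}\prod_{j<i}\bigl(\Delta^{c\omega_j}_{\omega_j}\bigr)^{a_{ji}}$$ (restricted to $G^{c,c^{-1}}$; the exponents $a_{ji}$ are entries of $A$). For every such $\Phi$, the restriction of $\Delta_{V(\mathbf a),n\omega^\circ}$ to $G^{c,c^{-1}}$ is a regular function, the element $$x^{\mathbf a}_{n\omega^\circ;c}:=x_{\omega_1;c}^{-n}x_{\omega_2;c}^{-n}\sum_{0\le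 k\le m\le n}d_{\mathbf a}(m,k)\,z_{\bar1;c}^{m}z_{1;c}^{m}z_{\bar2;c}^{m-k}z_{2;c}^{m-k}x_{\omega_1;c}^{2(m-k)}x_{\omega_2;c}^{2(n-m)}$$ of the ambient field lies in $\mathcal A_{dp}(c)$, and $\Phi(x^{\mathbf a}_{n\omega^\circ;c})=\Delta_{V(\mathbf a),n\omega^\circ}\big|_{G^{c,c^{-1}}}$. -/

import Mathlib

open scoped TensorProduct LaurentPolynomial

attribute [local instance 100] LieRing.ofAssociativeRing

noncomputable section

namespace KacMoody

universe u

section Exponential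
variable {k V : Type u} [Field k] [AddCommGroup V] [Module k V]

/-- Every vector is killed by a power of `T`. -/
def LocallyNilpotent (T : Module.End k V) : Prop := ∀ v, ∃ n : ℕ, (T ^ n) v = 0

theorem pow_apply_eq_zero {T : Module.End k V} {v : V} {N n : ℕ} (h : (T ^ N) v = 0)
    (hn : N ≤ n) : (T ^ n) v = 0 := by
  obtain ⟨m, rfl⟩ := Nat.exists_eq_add_of_le hn
  rw [add_comm, pow_add, Module.End.mul_apply, h, map_zero]

theorem finsum_exp_eq {T : Module.End k V} {v : V} {N : ℕ} (h : (T ^ N) v = 0) :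
    (∑ᶠ n : ℕ, ((n.factorial : k)⁻¹) • (T ^ n) v)
      = ∑ n ∈ Finset.range N, ((n.factorial : k)⁻¹) • (T ^ n) v := by
  refine finsum_eq_sum_of_support_subset _ fun n hn => ?_
  by_contra h'
  exact hn (by simp only [pow_apply_eq_zero h (by simpa using h'), smul_zero])

/-- The exponential `∑ n, T ^ n / n!` of a locally nilpotent operator. -/
def expEnd (T : Module.End k V) (hT : LocallyNilpotent T) : Module.End k V where
  toFun v := ∑ᶠ n : ℕ, ((n.factorial : k)⁻¹) • (T ^ n) v
  map_add' v w := by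
    obtain ⟨a, ha⟩ := hT v
    obtain ⟨b, hb⟩ := hT w
    have ha' := pow_apply_eq_zero ha (le_max_left a b)
    have hb' := pow_apply_eq_zero hb (le_max_right a b)
    rw [finsum_exp_eq ha', finsum_exp_eq hb', finsum_exp_eq (N := max a b)
      (by rw [map_add, ha', hb', add_zero])]
    simp [Finset.sum_add_distrib]
  map_smul' c v := by
    obtain ⟨a, ha⟩ := hT v
    rw [finsum_exp_eq ha, finsum_exp_eq (N := a) (by rw [map_smul, ha, smul_zero])]
    simp [Finset.smul_sum, smul_comm c]

theorem expEnd_apply {T : Module.End k V} (hT : LocallyNilpotent T) {v : V} {N : ℕ}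
    (h : (T ^ N) v = 0) : expEnd T hT v
      = ∑ n ∈ Finset.range N, ((n.factorial : k)⁻¹) • (T ^ n) v := finsum_exp_eq h

theorem LocallyNilpotent.smul {T : Module.End k V} (hT : LocallyNilpotent T) (t : k) :
    LocallyNilpotent (t • T) := fun v => by
  obtain ⟨n, hn⟩ := hT v
  exact ⟨n, by rw [smul_pow, LinearMap.smul_apply, hn, smul_zero]⟩

theorem expEnd_mul [CharZero k] {T : Module.End k V} (hT : LocallyNilpotent T) (t : k) :
    expEnd (t • T) (hT.smul t) * expEnd ((-t) • T) (hT.smul (-t)) = 1 := by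
  ext v
  obtain ⟨N, hN⟩ := hT v
  have hS : ∀ s : k, ((s • T) ^ N) v = 0 := fun s => by
    rw [smul_pow, LinearMap.smul_apply, hN, smul_zero]
  set w := expEnd ((-t) • T) (hT.smul (-t)) v with hw
  set f : PowerSeries k := PowerSeries.rescale t (PowerSeries.exp k)
  set g : PowerSeries k := PowerSeries.rescale (-t) (PowerSeries.exp k)
  have hfg : f * g = 1 := by
    have := PowerSeries.exp_mul_exp_eq_exp_add (A := k) t (-t)
    simpa [f, g] using this
  have key : ∀ s : k, ∀ x : V, ((s • T) ^ N) x = 0 →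
      expEnd (s • T) (hT.smul s) x = Polynomial.aeval T
        (PowerSeries.trunc N (PowerSeries.rescale s (PowerSeries.exp k))) x := by
    intro s x hx
    rw [expEnd_apply _ hx, Polynomial.aeval_def, PowerSeries.eval₂_trunc_eq_sum_range,
      LinearMap.sum_apply]
    refine Finset.sum_congr rfl fun n _ => ?_
    simp [PowerSeries.coeff_rescale, PowerSeries.coeff_exp, smul_pow,
      Module.algebraMap_end_eq_smul_id, smul_smul, mul_comm]
  have hw' : w = Polynomial.aeval T (PowerSeries.trunc N g) v := key _ _ (hS _)
  have hcomm : ((t • T) ^ N) w = 0 := by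
    rw [smul_pow, LinearMap.smul_apply, hw', ← Module.End.mul_apply]
    have : Commute (T ^ N) (Polynomial.aeval T (PowerSeries.trunc N g)) := by
      have := Polynomial.aeval_X (R := k) T
      nth_rw 1 [← this]
      rw [← map_pow]
      exact (Commute.all _ _).map (Polynomial.aeval (R := k) T)
    rw [this.eq, Module.End.mul_apply, hN, map_zero, smul_zero]
  have hdvd : (Polynomial.X ^ N : Polynomial k) ∣
      PowerSeries.trunc N f * PowerSeries.trunc N g - 1 := by
    rw [Polynomial.X_pow_dvd_iff]
    intro d hd
    have h := PowerSeries.coeff_mul_eq_coeff_trunc_mul_trunc f g hd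
    rw [hfg, ← Polynomial.coe_mul, Polynomial.coeff_coe, ← Polynomial.coe_one,
      Polynomial.coeff_coe] at h
    rw [Polynomial.coeff_sub, ← h, sub_self]
  obtain ⟨q, hq⟩ := hdvd
  rw [Module.End.mul_apply, key _ _ hcomm, hw', ← Module.End.mul_apply, ← map_mul,
    sub_eq_iff_eq_add.1 hq, mul_comm, map_add, map_mul, LinearMap.add_apply, Module.End.mul_apply,
    map_pow, Polynomial.aeval_X, hN]
  simp
end Exponential

section LieAlgebra

variable (k : Type u) [Field k] {r : ℕ} (A : Matrix (Fin r) (Fin r) ℤ)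

/-- The derived Kac-Moody algebra with generalized Cartan matrix `A` (Serre presentation). -/
abbrev LieAlg : Type u := A.ToLieAlgebra k

/-- The image of a Chevalley generator. -/
def gen (x : CartanMatrix.Generators (Fin r)) : LieAlg k A :=
  LieSubmodule.Quotient.mk (N := CartanMatrix.Relations.toIdeal k A) (FreeLieAlgebra.of k x)

/-- The Chevalley generator `e_i`. -/
def e (i : Fin r) : LieAlg k A := gen k A (.E i)
/-- The Chevalley generator `f_i`. -/
def f (i : Fin r) : LieAlg k A := gen k A (.F i)
/-- The simple coroot `h_i = α_i^∨`. -/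
def h (i : Fin r) : LieAlg k A := gen k A (.H i)

variable {k A}

/-- Integrable representations: all `e i` and `f i` act locally nilpotently. -/
def IsIntegrable {V : Type u} [AddCommGroup V] [Module k V]
    (ρ : LieAlg k A →ₗ⁅k⁆ Module.End k V) : Prop :=
  ∀ i, LocallyNilpotent (ρ (e k A i)) ∧ LocallyNilpotent (ρ (f k A i))

/-- The universal property of the Serre presentation. -/
def liftRep {L : Type u} [LieRing L] [LieAlgebra k L]
    (φ : CartanMatrix.Generators (Fin r) → L)
    (hφ : ∀ x ∈ CartanMatrix.Relations.toSet k A, FreeLieAlgebra.lift k φ x = 0) :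
    LieAlg k A →ₗ⁅k⁆ L where
  toLinearMap := Submodule.liftQ (CartanMatrix.Relations.toIdeal k A).toSubmodule
    (FreeLieAlgebra.lift k φ : FreeLieAlgebra k _ →ₗ[k] L) (by
      have h1 : CartanMatrix.Relations.toIdeal k A ≤ (FreeLieAlgebra.lift k φ).ker :=
        LieSubmodule.lieSpan_le.2 fun x hx => (LieHom.mem_ker ..).2 (hφ x hx)
      intro x hx
      exact (LieHom.mem_ker ..).1 (h1 hx))
  map_lie' {x y} := by
    obtain ⟨x, rfl⟩ := LieSubmodule.Quotient.surjective_mk' _ x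
    obtain ⟨y, rfl⟩ := LieSubmodule.Quotient.surjective_mk' _ y
    exact LieHom.map_lie (FreeLieAlgebra.lift k φ) x y

end LieAlgebra

section Group

variable (k : Type u) [Field k] {r : ℕ} (A : Matrix (Fin r) (Fin r) ℤ)

/-- `(Sum.inl i, t)` stands for the one-parameter subgroup element `x_i(t)` and
`(Sum.inr i, t)` for `x_{\bar i}(t)`. -/
abbrev Symbols (k : Type u) (r : ℕ) : Type u := (Fin r ⊕ Fin r) × k

variable {k A}

/-- The Chevalley generator `e i` or `f i`. -/
def rootVector : Fin r ⊕ Fin r → LieAlg k A := Sum.elim (e k A) (f k A)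

section Action

variable {V : Type u} [AddCommGroup V] [Module k V]

theorem IsIntegrable.locallyNilpotent {ρ : LieAlg k A →ₗ⁅k⁆ Module.End k V}
    (hρ : IsIntegrable ρ) : ∀ s, LocallyNilpotent (ρ (rootVector s))
  | .inl i => (hρ i).1
  | .inr i => (hρ i).2

variable [CharZero k]

/-- `exp (t e_i)` or `exp (t f_i)` as an automorphism of an integrable representation. -/
def expUnit {ρ : LieAlg k A →ₗ⁅k⁆ Module.End k V} (hρ : IsIntegrable ρ) (s : Symbols k r) :
    (Module.End k V)ˣ where
  val := expEnd (s.2 • ρ (rootVector s.1)) ((hρ.locallyNilpotent s.1).smul _)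
  inv := expEnd ((-s.2) • ρ (rootVector s.1)) ((hρ.locallyNilpotent s.1).smul _)
  val_inv := expEnd_mul (hρ.locallyNilpotent s.1) s.2
  inv_val := by simpa using expEnd_mul (hρ.locallyNilpotent s.1) (-s.2)

/-- Words in the one-parameter subgroups act on every integrable representation. -/
def wordAction {ρ : LieAlg k A →ₗ⁅k⁆ Module.End k V} (hρ : IsIntegrable ρ) :
    FreeGroup (Symbols k r) →* (Module.End k V)ˣ :=
  FreeGroup.lift (expUnit hρ)

end Action

variable (k A) [CharZero k]

/-- The words which act trivially on all integrable representations. -/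
def trivialWords : Subgroup (FreeGroup (Symbols k r)) where
  carrier := {w | ∀ (V : Type u) [AddCommGroup V] [Module k V]
    (ρ : LieAlg k A →ₗ⁅k⁆ Module.End k V) (hρ : IsIntegrable ρ), wordAction hρ w = 1}
  one_mem' _ _ _ _ _ := map_one _
  mul_mem' ha hb V _ _ ρ hρ := by rw [map_mul, ha V ρ hρ, hb V ρ hρ, one_mul]
  inv_mem' ha V _ _ ρ hρ := by rw [map_inv, ha V ρ hρ, inv_one]

instance trivialWords_normal :
    (trivialWords k A).Normal where
  conj_mem w hw g V _ _ ρ hρ := by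
    rw [map_mul, map_mul, hw V ρ hρ, mul_one, ← map_mul, mul_inv_cancel, map_one]

/-- The (derived, minimal) Kac-Moody group, as constructed by Kac and Peterson. -/
abbrev Grp : Type u := FreeGroup (Symbols k r) ⧸ trivialWords k A

variable {k A}

/-- The action of the Kac-Moody group on an integrable representation. -/
def action {V : Type u} [AddCommGroup V] [Module k V]
    {ρ : LieAlg k A →ₗ⁅k⁆ Module.End k V} (hρ : IsIntegrable ρ) :
    Grp k A →* (Module.End k V)ˣ :=
  QuotientGroup.lift (trivialWords k A) (wordAction hρ) fun _ hw => hw V ρ hρ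

open Classical in
/-- The operator by which `g` acts on a representation; the zero operator if the representation
is not integrable (this case does not occur for the representations used below). -/
def act {V : Type u} [AddCommGroup V] [Module k V]
    (ρ : LieAlg k A →ₗ⁅k⁆ Module.End k V) (g : Grp k A) : Module.End k V :=
  if hρ : IsIntegrable ρ then (action hρ g : Module.End k V) else 0

variable (k A)

/-- `x_i(t)`. -/
def x (i : Fin r) (t : k) : Grp k A := QuotientGroup.mk (FreeGroup.of (Sum.inl i, t))

/-- `x_{\bar i}(t)`. -/
def xbar (i : Fin r) (t : k) : Grp k A := QuotientGroup.mk (FreeGroup.of (Sum.inr i, t))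

/-- The image of the matrix `(0, -1; 1, 0)` under the coroot subgroup `φ_i : SL₂ → G`,
which is `(1, -1; 0, 1) (1, 0; 1, 1) (1, -1; 0, 1)`. -/
def sbar (i : Fin r) : Grp k A := x k A i (-1) * xbar k A i 1 * x k A i (-1)

/-- The image `t ^ α_i^∨` of the matrix `(t, 0; 0, t⁻¹)` under the coroot subgroup
`φ_i : SL₂ → G`, which is `(1, t; 0, 1) (1, 0; -t⁻¹, 1) (1, t; 0, 1) (0, -1; 1, 0)`. -/
def corootElt (i : Fin r) (t : kˣ) : Grp k A :=
  x k A i t * xbar k A i (-(t⁻¹ : kˣ)) * x k A i t * sbar k A i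

/-- The torus `H`. -/
def torus : Subgroup (Grp k A) := Subgroup.closure {g | ∃ i t, g = corootElt k A i t}

/-- The simple reflection `s_i` on the root lattice with basis the simple roots. -/
def reflect (i : Fin r) (β : Fin r → ℤ) : Fin r → ℤ := β - Pi.single i (∑ j, A i j * β j)

/-- The root `w α_i` for the Weyl group element `w` with the given word. -/
def realRoot (w : List (Fin r)) (i : Fin r) : Fin r → ℤ :=
  w.foldr (reflect A) (Pi.single i 1)

/-- The product of the `sbar i` over a word. -/
def wordLift (w : List (Fin r)) : Grp k A := (w.map (sbar k A)).prod

/-- `U_+`, generated by the root subgroups of the positive real roots. -/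
def unipotentPos : Subgroup (Grp k A) :=
  Subgroup.closure {g | ∃ (w : List (Fin r)) (i : Fin r) (t : k), 0 ≤ realRoot A w i ∧
    g = wordLift k A w * x k A i t * (wordLift k A w)⁻¹}

/-- `U_-`, generated by the root subgroups of the negative real roots. -/
def unipotentNeg : Subgroup (Grp k A) :=
  Subgroup.closure {g | ∃ (w : List (Fin r)) (i : Fin r) (t : k), realRoot A w i ≤ 0 ∧
    g = wordLift k A w * x k A i t * (wordLift k A w)⁻¹}

/-- `B_+`. -/
def borelPos : Subgroup (Grp k A) := torus k A ⊔ unipotentPos k A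

/-- `B_-`. -/
def borelNeg : Subgroup (Grp k A) := torus k A ⊔ unipotentNeg k A

/-- The lift of the Coxeter element `c = s_1 ⋯ s_r`. -/
def coxeterLift : Grp k A := wordLift k A (List.finRange r)

/-- The Coxeter double Bruhat cell `B_+ c B_+ ∩ B_- c⁻¹ B_-`. -/
def coxeterCell : Set (Grp k A) :=
  DoubleCoset.doubleCoset (coxeterLift k A) (borelPos k A) (borelPos k A) ∩
    DoubleCoset.doubleCoset (coxeterLift k A)⁻¹ (borelNeg k A) (borelNeg k A)

/-- The algebra of functions on the group generated by the matrix coefficients of the integrable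
representations. -/
def polynomialFunctions : Subalgebra k (Grp k A → k) :=
  Algebra.adjoin k {F | ∃ (V : Type u) (_ : AddCommGroup V) (_ : Module k V)
    (ρ : LieAlg k A →ₗ⁅k⁆ Module.End k V) (hρ : IsIntegrable ρ) (v : V) (ξ : V →ₗ[k] k),
    F = fun g => ξ ((action hρ g : Module.End k V) v)}

/-- The coordinate ring of (the locally closed subvariety with set of points) `X`: the functions
on `X` which are, locally in the Zariski topology, quotients of polynomial functions. -/
def coordinateRing (X : Set (Grp k A)) : Subalgebra k (X → k) where
  carrier := {F | ∀ p : X, ∃ P ∈ polynomialFunctions k A, ∃ Q ∈ polynomialFunctions k A,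
    Q p ≠ 0 ∧ ∀ g : X, Q g ≠ 0 → F g = P g / Q g}
  mul_mem' {F₁ F₂} h₁ h₂ p := by
    obtain ⟨P₁, hP₁, Q₁, hQ₁, hp₁, H₁⟩ := h₁ p
    obtain ⟨P₂, hP₂, Q₂, hQ₂, hp₂, H₂⟩ := h₂ p
    refine ⟨P₁ * P₂, mul_mem hP₁ hP₂, Q₁ * Q₂, mul_mem hQ₁ hQ₂, mul_ne_zero hp₁ hp₂,
      fun g hg => ?_⟩
    have hg' : Q₁ g ≠ 0 ∧ Q₂ g ≠ 0 := mul_ne_zero_iff.1 hg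
    simp [H₁ g hg'.1, H₂ g hg'.2, div_mul_div_comm]
  add_mem' {F₁ F₂} h₁ h₂ p := by
    obtain ⟨P₁, hP₁, Q₁, hQ₁, hp₁, H₁⟩ := h₁ p
    obtain ⟨P₂, hP₂, Q₂, hQ₂, hp₂, H₂⟩ := h₂ p
    refine ⟨P₁ * Q₂ + Q₁ * P₂, add_mem (mul_mem hP₁ hQ₂) (mul_mem hQ₁ hP₂), Q₁ * Q₂,
      mul_mem hQ₁ hQ₂, mul_ne_zero hp₁ hp₂, fun g hg => ?_⟩
    have hg' : Q₁ g ≠ 0 ∧ Q₂ g ≠ 0 := mul_ne_zero_iff.1 hg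
    simp [H₁ g hg'.1, H₂ g hg'.2, div_add_div _ _ hg'.1 hg'.2]
  algebraMap_mem' c p := ⟨algebraMap k _ c, algebraMap_mem _ c, 1, one_mem _, one_ne_zero,
    fun g _ => by simp⟩

end Group

section HighestWeight

variable (k : Type u) [Field k] {r : ℕ} (A : Matrix (Fin r) (Fin r) ℤ)

/-- The universal enveloping algebra. -/
abbrev Env : Type u := UniversalEnvelopingAlgebra k (LieAlg k A)

/-- The subspace `𝔫₋ U + U 𝔫₊ + ∑ i, U (h i - lam i)` of the enveloping algebra `U`. Its image in
the Verma module of highest weight `lam` is the sum of the lower weight spaces. -/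
def lowerPart (lam : Fin r → ℤ) : Submodule k (Env k A) :=
  Submodule.span k {y | ∃ (i : Fin r) (z : Env k A),
    y = UniversalEnvelopingAlgebra.ι k (f k A i) * z ∨
    y = z * UniversalEnvelopingAlgebra.ι k (e k A i) ∨
    y = z * (UniversalEnvelopingAlgebra.ι k (h k A i) - algebraMap k (Env k A) (lam i))}

/-- The largest left ideal contained in `lowerPart`. The quotient of the enveloping algebra by it
is the quotient of the Verma module by its largest submodule that does not meet the highest
weight space. -/
def highestWeightIdeal (lam : Fin r → ℤ) : Ideal (Env k A) where
  carrier := {y | ∀ z, z * y ∈ lowerPart k A lam}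
  zero_mem' z := by simp
  add_mem' ha hb z := by rw [mul_add]; exact add_mem (ha z) (hb z)
  smul_mem' c y hy z := by rw [smul_eq_mul, ← mul_assoc]; exact hy _

/-- The irreducible representation `V(lam)` of highest weight `lam = ∑ i, lam i • ω_i`. -/
abbrev HighestWeightModule (lam : Fin r → ℤ) : Type u := Env k A ⧸ highestWeightIdeal k A lam

/-- The action of the Lie algebra on `V(lam)`. -/
def highestWeightRep (lam : Fin r → ℤ) :
    LieAlg k A →ₗ⁅k⁆ Module.End k (HighestWeightModule k A lam) :=
  (Algebra.lsmul k k (HighestWeightModule k A lam) : Env k A →ₐ[k] _).toLieHom.comp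
    (UniversalEnvelopingAlgebra.ι k)

/-- The highest weight vector of `V(lam)`. -/
def highestWeightVector (lam : Fin r → ℤ) : HighestWeightModule k A lam :=
  Submodule.Quotient.mk 1

/-- The projection of `V(lam)` to its highest weight line along the lower weight spaces, as a
linear form: the unique linear form which takes the value `1` at the highest weight vector and
vanishes on `𝔫₋ V(lam)`. -/
def highestWeightProj (lam : Fin r → ℤ) : HighestWeightModule k A lam →ₗ[k] k :=
  Classical.epsilon fun π => π (highestWeightVector k A lam) = 1 ∧
    ∀ i v, π (highestWeightRep k A lam (f k A i) v) = 0

variable [CharZero k]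

/-- The principal minor `Δ_{ω_i}`. -/
def fundMinor (i : Fin r) (g : Grp k A) : k :=
  highestWeightProj k A (Pi.single i 1)
    (act (highestWeightRep k A (Pi.single i 1)) g (highestWeightVector k A (Pi.single i 1)))

/-- The minor `Δ^{ω_i}_{c ω_i}`. -/
def minorRight (i : Fin r) (g : Grp k A) : k := fundMinor k A i (g * coxeterLift k A)

/-- The minor `Δ^{c ω_i}_{ω_i}`. -/
def minorLeft (i : Fin r) (g : Grp k A) : k := fundMinor k A i ((coxeterLift k A)⁻¹ * g)

end HighestWeight

section Cluster

/-- A (labelled) seed with mutable indices `ι` and frozen indices `φ` in the field `K`. -/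
structure Seed (K ι φ : Type*) where
  var : ι ⊕ φ → K
  mat : Matrix (ι ⊕ φ) ι ℤ

variable {K ι φ : Type*} [Field K] [Fintype ι] [Fintype φ] [DecidableEq ι] [DecidableEq φ]

/-- Seed mutation in direction `l`. -/
def Seed.mutate (s : Seed K ι φ) (l : ι) : Seed K ι φ where
  var := Function.update s.var (Sum.inl l)
    ((∏ i, s.var i ^ (s.mat i l).toNat + ∏ i, s.var i ^ (-s.mat i l).toNat) / s.var (Sum.inl l))
  mat := Matrix.of fun i j =>
    if i = Sum.inl l ∨ j = l then -s.mat i j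
    else s.mat i j + max (s.mat i l) 0 * max (s.mat (Sum.inl l) j) 0
      - max (-s.mat i l) 0 * max (-s.mat (Sum.inl l) j) 0

/-- The seeds obtained from `s` by sequences of mutations. -/
inductive Seed.Reachable (s : Seed K ι φ) : Seed K ι φ → Prop
  | refl : Seed.Reachable s s
  | mutate {s' : Seed K ι φ} (l : ι) : Seed.Reachable s s' → Seed.Reachable s (s'.mutate l)

variable (k : Type*) [Field k]

/-- The field of rational functions in the initial cluster variables and the frozen variables. -/
abbrev AmbientField (ι φ : Type*) : Type _ := FractionRing (MvPolynomial (ι ⊕ φ) k)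

/-- The initial seed with extended exchange matrix `B`. -/
def initialSeed (B : Matrix (ι ⊕ φ) ι ℤ) : Seed (AmbientField k ι φ) ι φ where
  var i := algebraMap (MvPolynomial (ι ⊕ φ) k) _ (MvPolynomial.X i)
  mat := B

/-- The cluster algebra of geometric type with initial extended exchange matrix `B`: it is
generated by the cluster variables of all seeds, the frozen variables and their inverses. -/
def clusterAlgebra (B : Matrix (ι ⊕ φ) ι ℤ) : Subalgebra k (AmbientField k ι φ) :=
  Algebra.adjoin k {y |
    (∃ s, Seed.Reachable (initialSeed k B) s ∧ ∃ i : ι, y = s.var (Sum.inl i)) ∨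
    (∃ j : φ, y = (initialSeed k B).var (Sum.inr j)) ∨
    (∃ j : φ, y = ((initialSeed k B).var (Sum.inr j))⁻¹)}

/-- The exchange matrix `B_c` for `c = s_1 ⋯ s_r`. -/
def coxeterMatrix {r : ℕ} (A : Matrix (Fin r) (Fin r) ℤ) : Matrix (Fin r) (Fin r) ℤ :=
  Matrix.of fun i j => if i = j then 0 else if j < i then A i j else -A i j

variable {r : ℕ} (A : Matrix (Fin r) (Fin r) ℤ)

/-- The extended exchange matrix with blocks `B_c`, `1`, `1`. -/
def dpMatrix : Matrix (Fin r ⊕ (Fin r ⊕ Fin r)) (Fin r) ℤ :=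
  Matrix.fromRows (coxeterMatrix A) (Matrix.fromRows 1 1)

/-- The ambient field of the cluster algebra with doubled principal coefficients. -/
abbrev DPField (k : Type*) [Field k] (r : ℕ) : Type _ := AmbientField k (Fin r) (Fin r ⊕ Fin r)

/-- The cluster algebra `A_dp(c)` with doubled principal coefficients. -/
abbrev clusterDP : Subalgebra k (DPField k r) := clusterAlgebra k (dpMatrix A)

/-- The initial cluster variable `x_{ω_i}`. -/
def clX (i : Fin r) : clusterDP k A :=
  ⟨(initialSeed k (dpMatrix A)).var (Sum.inl i),
    Algebra.subset_adjoin (Or.inl ⟨_, Seed.Reachable.refl, i, rfl⟩)⟩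

/-- The frozen variable `z_i`. -/
def clZ (i : Fin r) : clusterDP k A :=
  ⟨(initialSeed k (dpMatrix A)).var (Sum.inr (Sum.inl i)),
    Algebra.subset_adjoin (Or.inr (Or.inl ⟨_, rfl⟩))⟩

/-- The frozen variable `z_{\bar i}`. -/
def clZbar (i : Fin r) : clusterDP k A :=
  ⟨(initialSeed k (dpMatrix A)).var (Sum.inr (Sum.inr i)),
    Algebra.subset_adjoin (Or.inr (Or.inl ⟨_, rfl⟩))⟩

end Cluster

section Iso

variable (k : Type u) [Field k] [CharZero k] {r : ℕ} (A : Matrix (Fin r) (Fin r) ℤ)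

/-- `Φ` is the isomorphism of the cluster algebra `A_dp(c)` with the coordinate ring of the Coxeter
double Bruhat cell which identifies the initial cluster variables and the frozen variables with
the prescribed monomials in generalized minors. -/
def IsStandardIso (Φ : clusterDP k A ≃ₐ[k] coordinateRing k A (coxeterCell k A)) : Prop :=
  ∀ (i : Fin r) (g : coxeterCell k A),
    (Φ (clX k A i) : coxeterCell k A → k) g = fundMinor k A i g ∧
    (Φ (clZ k A i) : coxeterCell k A → k) g
      = minorRight k A i g * ∏ j ∈ Finset.Iio i, minorRight k A j g ^ A j i ∧
    (Φ (clZbar k A i) : coxeterCell k A → k) g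
      = minorLeft k A i g * ∏ j ∈ Finset.Iio i, minorLeft k A j g ^ A j i

end Iso

section Evaluation

/-- The Cartan matrix of type `A_1^(1)`; the index `0` is the affine node. -/
def affineA1 : Matrix (Fin 2) (Fin 2) ℤ := !![2, -2; -2, 2]

variable (k : Type u) [Field k] (n : ℕ)

/-- The tensor power `V^{⊗ n}` of the vector representation `V = k²`. -/
abbrev TensorPower : Type u := ⨂[k] _ : Fin n, (Fin 2 → k)

/-- The underlying space `k[u^{±1}] ⊗ V^{⊗ n}`. -/
abbrev EvalSpace : Type u := k[T;T⁻¹] ⊗[k] TensorPower k n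

variable {k n}

/-- The operator `1 ⊗ ⋯ ⊗ S ⊗ ⋯ ⊗ 1` (`S` in position `i`). -/
def slot (i : Fin n) (S : Module.End k (Fin 2 → k)) : Module.End k (TensorPower k n) :=
  PiTensorProduct.map (Pi.mulSingle (M := fun _ : Fin n => Module.End k (Fin 2 → k)) i S)

/-- The operator `∑ i, 1 ⊗ ⋯ ⊗ X i ⊗ ⋯ ⊗ 1` (`X i` in position `i`). -/
def slotSum (X : Fin n → Matrix (Fin 2) (Fin 2) k) : Module.End k (TensorPower k n) :=
  ∑ i, slot i (Matrix.toLin' (X i))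

/-- The operator `u ^ p ⊗ slotSum X`. -/
def evalOp (p : ℤ) (X : Fin n → Matrix (Fin 2) (Fin 2) k) : Module.End k (EvalSpace k n) :=
  TensorProduct.map (LinearMap.mulLeft k (LaurentPolynomial.T p : k[T;T⁻¹])) (slotSum X)

/-- The action of the Chevalley generators on `V(a)`. After exponentiating, `x_1(t)`,
`x_{\bar 1}(t)`, `x_2(t)`, `x_{\bar 2}(t)` act on
`k[u^{±1}] ⊗ V^{⊗ n} = (V[u^{±1}])^{⊗ n}` (tensor power over `k[u^{±1}]`) through the matrices
`(1, 0; a_l t u, 1)`, `(1, a_l⁻¹ t u⁻¹; 0, 1)`, `(1, t; 0, 1)`, `(1, 0; t, 1)` in the `l`-th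
tensor factor. -/
def evalGen (a : Fin n → kˣ) :
    CartanMatrix.Generators (Fin 2) → Module.End k (EvalSpace k n)
  | .E i => if i = 0 then evalOp 1 (fun l => !![0, 0; (a l : k), 0])
      else evalOp 0 (fun _ => !![0, 1; 0, 0])
  | .F i => if i = 0 then evalOp (-1) (fun l => !![0, (((a l)⁻¹ : kˣ) : k); 0, 0])
      else evalOp 0 (fun _ => !![0, 0; 1, 0])
  | .H i => if i = 0 then evalOp 0 (fun _ => !![-1, 0; 0, 1])
      else evalOp 0 (fun _ => !![1, 0; 0, -1])

theorem slot_add (i : Fin n) (S S' : Module.End k (Fin 2 → k)) :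
    slot i (S + S') = slot i S + slot i S' :=
  PiTensorProduct.map_update_add (R := k) (1 : Fin n → Module.End k (Fin 2 → k)) i S S'

theorem slot_smul (i : Fin n) (c : k) (S : Module.End k (Fin 2 → k)) :
    slot i (c • S) = c • slot i S :=
  PiTensorProduct.map_update_smul (R := k) (1 : Fin n → Module.End k (Fin 2 → k)) i c S

theorem slot_mul (i : Fin n) (S S' : Module.End k (Fin 2 → k)) :
    slot i (S * S') = slot i S * slot i S' := by
  rw [slot, Pi.mulSingle_mul]
  exact PiTensorProduct.map_mul _ _

theorem slot_commute {i j : Fin n} (hij : i ≠ j) (S S' : Module.End k (Fin 2 → k)) :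
    Commute (slot i S) (slot j S') :=
  (Pi.mulSingle_commute (f := fun _ : Fin n => Module.End k (Fin 2 → k)) hij S S').map
    (PiTensorProduct.mapMonoidHom (R := k))

theorem slotSum_lie (X Y : Fin n → Matrix (Fin 2) (Fin 2) k) :
    slotSum X * slotSum Y - slotSum Y * slotSum X = slotSum (X * Y - Y * X) := by
  rw [slotSum, slotSum, slotSum, Finset.sum_mul_sum,
    Finset.sum_mul_sum, Finset.sum_comm (s := Finset.univ) (t := Finset.univ)
      (f := fun i j => slot i (Matrix.toLin' (Y i)) * slot j (Matrix.toLin' (X j)))]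
  refine (Finset.sum_sub_distrib (G := Module.End k (TensorPower k n)) _ _).symm.trans
    (Finset.sum_congr rfl fun i _ => ?_)
  refine (Finset.sum_sub_distrib (G := Module.End k (TensorPower k n)) _ _).symm.trans ?_
  rw [Finset.sum_eq_single i]
  · rw [← slot_mul, ← slot_mul, sub_eq_iff_eq_add, ← slot_add]
    congr 1
    rw [Pi.sub_apply, Pi.mul_apply, Pi.mul_apply, map_sub, Matrix.toLin'_mul, Matrix.toLin'_mul]
    exact (sub_add_cancel _ _).symm
  · intro j _ hj
    rw [(slot_commute hj.symm _ _).eq, sub_self]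
  · simp

theorem evalOp_lie (p q : ℤ) (X Y : Fin n → Matrix (Fin 2) (Fin 2) k) :
    evalOp p X * evalOp q Y - evalOp q Y * evalOp p X = evalOp (p + q) (X * Y - Y * X) := by
  have hT : ∀ p q : ℤ, LinearMap.mulLeft k (LaurentPolynomial.T p : k[T;T⁻¹]) *
      LinearMap.mulLeft k (LaurentPolynomial.T q) = LinearMap.mulLeft k
        (LaurentPolynomial.T (p + q) : k[T;T⁻¹]) := fun p q => LinearMap.ext fun y => by
    rw [Module.End.mul_apply, LinearMap.mulLeft_apply, LinearMap.mulLeft_apply,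
      LinearMap.mulLeft_apply, LaurentPolynomial.T_add, mul_assoc]
  have hm : ∀ (p q : ℤ) (X Y : Fin n → Matrix (Fin 2) (Fin 2) k), evalOp p X * evalOp q Y =
      TensorProduct.map (LinearMap.mulLeft k (LaurentPolynomial.T (p + q) : k[T;T⁻¹]))
        (slotSum X * slotSum Y) := fun p q X Y => by
    rw [evalOp, evalOp, ← TensorProduct.map_mul, hT]
  rw [hm, hm, add_comm q p]
  refine Eq.trans ?_ (congrArg (TensorProduct.map
    (LinearMap.mulLeft k (LaurentPolynomial.T (p + q) : k[T;T⁻¹]))) (slotSum_lie X Y))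
  exact (map_sub (TensorProduct.mapBilinear (RingHom.id k) k[T;T⁻¹] (TensorPower k n) k[T;T⁻¹]
    (TensorPower k n) (LinearMap.mulLeft k (LaurentPolynomial.T (p + q) : k[T;T⁻¹]))) _ _).symm

theorem evalOp_zero (p : ℤ) : evalOp p (0 : Fin n → Matrix (Fin 2) (Fin 2) k) = 0 := by
  have : slotSum (0 : Fin n → Matrix (Fin 2) (Fin 2) k) = 0 := by
    refine Finset.sum_eq_zero fun i _ => ?_
    have h := slot_smul (n := n) (k := k) i (0 : k) 0
    rw [zero_smul, zero_smul] at h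
    simpa using h
  rw [evalOp, this, TensorProduct.map_zero_right]

theorem slotSum_smul (c : k) (X : Fin n → Matrix (Fin 2) (Fin 2) k) :
    slotSum (c • X) = c • slotSum X := by
  rw [slotSum, slotSum, Finset.smul_sum]
  exact Finset.sum_congr rfl fun i _ => by rw [Pi.smul_apply, map_smul, slot_smul]

theorem evalOp_smul (c : k) (p : ℤ) (X : Fin n → Matrix (Fin 2) (Fin 2) k) :
    evalOp p (c • X) = c • evalOp p X := by
  rw [evalOp, evalOp, slotSum_smul, TensorProduct.map_smul_right]

set_option maxHeartbeats 1600000 in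
theorem evalGen_relations (a : Fin n → kˣ) : ∀ x ∈ CartanMatrix.Relations.toSet k affineA1,
    FreeLieAlgebra.lift k (evalGen a) x = 0 := by
  have hz : ∀ (c p : ℤ) (X : Fin n → Matrix (Fin 2) (Fin 2) k),
      c • evalOp p X = evalOp p ((c : k) • X) := fun c p X => by
    rw [evalOp_smul]; exact (Int.cast_smul_eq_zsmul (M := Module.End k (EvalSpace k n)) k c _).symm
  have h0 : ∀ (p : ℤ) (X : Fin n → Matrix (Fin 2) (Fin 2) k), X = 0 → evalOp p X = 0 := by
    rintro p X rfl; exact evalOp_zero p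
  have hadd : ∀ (p : ℤ) (X Y : Fin n → Matrix (Fin 2) (Fin 2) k), X + Y = 0 →
      evalOp p X + evalOp p Y = 0 := by
    intro p X Y hXY
    rw [eq_neg_of_add_eq_zero_left hXY, ← neg_one_smul k Y, evalOp_smul]
    exact (congrArg (· + evalOp p Y) (neg_one_smul k (evalOp p Y))).trans
      (neg_add_cancel (evalOp p Y))
  have hsub : ∀ (p : ℤ) (X Y : Fin n → Matrix (Fin 2) (Fin 2) k), X = Y →
      evalOp p X - evalOp p Y = 0 := by
    rintro p X Y rfl; exact sub_self (evalOp p X)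
  have hA : affineA1 0 0 = 2 ∧ affineA1 0 1 = -2 ∧ affineA1 1 0 = -2 ∧ affineA1 1 1 = 2 :=
    ⟨rfl, rfl, rfl, rfl⟩
  obtain ⟨hA00, hA01, hA10, hA11⟩ := hA
  have hE0 : evalGen a (.E 0) = evalOp 1 (fun l => !![0, 0; (a l : k), 0]) := rfl
  have hE1 : evalGen a (.E 1) = evalOp 0 (fun _ => !![0, 1; 0, 0]) := rfl
  have hF0 : evalGen a (.F 0) = evalOp (-1) (fun l => !![0, (((a l)⁻¹ : kˣ) : k); 0, 0]) := rfl
  have hF1 : evalGen a (.F 1) = evalOp 0 (fun _ => !![0, 0; 1, 0]) := rfl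
  have hH0 : evalGen a (.H 0) = evalOp 0 (fun _ => !![-1, 0; 0, 1]) := rfl
  have hH1 : evalGen a (.H 1) = evalOp 0 (fun _ => !![1, 0; 0, -1]) := rfl
  have hn2 : (-2 : ℤ).toNat = 0 := rfl
  have hp2 : (2 : ℤ).toNat = 2 := rfl
  have hm : ∀ x y, FreeLieAlgebra.lift k (evalGen a) ⁅x, y⁆
      = FreeLieAlgebra.lift k (evalGen a) x * FreeLieAlgebra.lift k (evalGen a) y
        - FreeLieAlgebra.lift k (evalGen a) y * FreeLieAlgebra.lift k (evalGen a) x :=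
    fun x y => LieHom.map_lie _ _ _
  have hzm : ∀ (c : ℤ) x, FreeLieAlgebra.lift k (evalGen a) (c • x)
      = c • FreeLieAlgebra.lift k (evalGen a) x := fun c x => by
    rw [← Int.cast_smul_eq_zsmul k c x, map_smul]
    exact Int.cast_smul_eq_zsmul (M := Module.End k (EvalSpace k n)) k c _
  rintro x (((((⟨⟨i, j⟩, rfl⟩ | ⟨⟨i, j⟩, rfl⟩) | ⟨⟨i, j⟩, rfl⟩) | ⟨⟨i, j⟩, rfl⟩) | ⟨⟨i, j⟩, rfl⟩) |
    ⟨⟨i, j⟩, rfl⟩)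
  · fin_cases i <;> fin_cases j <;>
    simp only [CartanMatrix.Relations.HH, Function.uncurry, Function.comp, hm,
      FreeLieAlgebra.lift_of_apply, Fin.zero_eta, Fin.mk_one, hH0, hH1, evalOp_lie]
    all_goals
      refine h0 _ _ (funext fun l => ?_)
      ext i j; fin_cases i <;> fin_cases j <;> simp
  · fin_cases i <;> fin_cases j <;>
    simp only [CartanMatrix.Relations.EF, Function.uncurry, Function.comp, hm, map_sub, if_true,
      FreeLieAlgebra.lift_of_apply, Fin.zero_eta, Fin.mk_one, hH0, hH1, hE0, hE1, hF0, hF1,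
      evalOp_lie, zero_ne_one, one_ne_zero, if_false]
    · refine hsub _ _ _ (funext fun l => ?_)
      ext i j; fin_cases i <;> fin_cases j <;> simp
    · refine h0 _ _ (funext fun l => ?_)
      ext i j; fin_cases i <;> fin_cases j <;> simp
    · refine h0 _ _ (funext fun l => ?_)
      ext i j; fin_cases i <;> fin_cases j <;> simp
    · refine hsub _ _ _ (funext fun l => ?_)
      ext i j; fin_cases i <;> fin_cases j <;> simp
  · fin_cases i <;> fin_cases j <;>
    simp only [CartanMatrix.Relations.HE, Function.uncurry, Function.comp, hm, map_sub, hzm,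
      FreeLieAlgebra.lift_of_apply, Fin.zero_eta, Fin.mk_one, hH0, hH1, hE0, hE1,
      evalOp_lie, hA00, hA01, hA10, hA11, hz]
    all_goals
      refine hsub _ _ _ (funext fun l => ?_)
      ext i j; fin_cases i <;> fin_cases j <;> simp <;> ring
  · fin_cases i <;> fin_cases j <;>
    simp only [CartanMatrix.Relations.HF, Function.uncurry, Function.comp, hm, map_add, hzm,
      FreeLieAlgebra.lift_of_apply, Fin.zero_eta, Fin.mk_one, hH0, hH1, hF0, hF1,
      evalOp_lie, hA00, hA01, hA10, hA11, hz]
    all_goals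
      refine hadd _ _ _ (funext fun l => ?_)
      ext i j; fin_cases i <;> fin_cases j <;> simp <;> ring
  · fin_cases i <;> fin_cases j <;>
    simp only [CartanMatrix.Relations.adE, Function.uncurry, Function.comp, hm,
      FreeLieAlgebra.lift_of_apply, Fin.zero_eta, Fin.mk_one, hE0, hE1, neg_neg, hn2, hp2,
      evalOp_lie, hA00, hA01, hA10, hA11, pow_zero, pow_two, Module.End.mul_apply,
      Module.End.one_apply, LieAlgebra.ad_apply]
    all_goals
      refine h0 _ _ (funext fun l => ?_)
      ext i j; fin_cases i <;> fin_cases j <;> simp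
  · fin_cases i <;> fin_cases j <;>
    simp only [CartanMatrix.Relations.adF, Function.uncurry, Function.comp, hm,
      FreeLieAlgebra.lift_of_apply, Fin.zero_eta, Fin.mk_one, hF0, hF1, neg_neg, hn2, hp2,
      evalOp_lie, hA00, hA01, hA10, hA11, pow_zero, pow_two, Module.End.mul_apply,
      Module.End.one_apply, LieAlgebra.ad_apply]
    all_goals
      refine h0 _ _ (funext fun l => ?_)
      ext i j; fin_cases i <;> fin_cases j <;> simp

/-- The representation `V(a)`. -/
def evalRep (a : Fin n → kˣ) : LieAlg k affineA1 →ₗ⁅k⁆ Module.End k (EvalSpace k n) :=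
  liftRep (evalGen a) (evalGen_relations a)

variable (k n)

/-- The vector `v ⊗ ⋯ ⊗ v` for the highest weight vector `v = (1, 0)` of `V`. -/
def evalVector : EvalSpace k n := 1 ⊗ₜ[k] PiTensorProduct.tprod k (fun _ => Pi.single 0 1)

/-- The projection to the line of `v ⊗ ⋯ ⊗ v`, as a linear form: the coefficient of
`u ^ 0 ⊗ v ⊗ ⋯ ⊗ v`. It factors through the projection to the weight space
`k[u^{±1}] ⊗ v ⊗ ⋯ ⊗ v` and kills `u ^ m ⊗ v ⊗ ⋯ ⊗ v` for `m ≠ 0`. -/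
def evalProj : EvalSpace k n →ₗ[k] k :=
  LinearMap.mul' k k ∘ₗ TensorProduct.map
    (Finsupp.lapply (0 : ℤ) ∘ₗ (AddMonoidAlgebra.coeffLinearEquiv k).toLinearMap)
    (PiTensorProduct.lift ((MultilinearMap.mkPiAlgebra k (Fin n) k).compLinearMap
      fun _ => LinearMap.proj 0))

variable {k n}

/-- The minor `Δ_{V(a), n ω°}`. -/
def evalMinor [CharZero k] (a : Fin n → kˣ) (g : Grp k affineA1) : k :=
  evalProj k n (act (evalRep a) g (evalVector k n))

/-- `S_{a,r}`. -/
def sCoeff (a : Fin n → kˣ) (r : ℕ) : k :=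
  ∑ p : Finset (Fin n) × Finset (Fin n) with p.1.card = r ∧ p.2.card = r ∧ Disjoint p.1 p.2,
    (∏ i ∈ p.1, (a i : k)) / ∏ j ∈ p.2, (a j : k)

/-- `d_a(m,l)`. The terms with `n < 2 r` vanish because `S_{a,r} = 0` for them. -/
def dCoeff (a : Fin n → kˣ) (m l : ℕ) : k :=
  ∑ r ∈ Finset.range (m + 1),
    ((m - r).choose l : k) * ((n - 2 * r).choose (m - r) : k) * sCoeff a r

/-- The element `x^a_{n ω°}`, as a rational function in the initial variables. -/
def evalElement (a : Fin n → kˣ) : DPField k 2 :=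
  (clX k affineA1 0 : DPField k 2)⁻¹ ^ n * (clX k affineA1 1 : DPField k 2)⁻¹ ^ n *
    ∑ m ∈ Finset.range (n + 1), ∑ l ∈ Finset.range (m + 1),
      algebraMap k (DPField k 2) (dCoeff a m l) *
        (clZbar k affineA1 0 : DPField k 2) ^ m * (clZ k affineA1 0 : DPField k 2) ^ m *
        (clZbar k affineA1 1 : DPField k 2) ^ (m - l) *
        (clZ k affineA1 1 : DPField k 2) ^ (m - l) *
        (clX k affineA1 0 : DPField k 2) ^ (2 * (m - l)) *
        (clX k affineA1 1 : DPField k 2) ^ (2 * (n - m))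

end Evaluation

end KacMoody

end

/-!
The nodes of the Dynkin diagram are `0` (the affine one) and `1`.

*The minor of `V(a)`.* A Chevalley generator acts on `V(a)` as a sum of commuting square-zero
operators, one for each tensor factor, so that the group acts factor by factor through matrices over
`k[u^{±1}]` (`expEnd_evalOp`, `loopHom`), and the minor is the constant term of the product of their
upper left entries (`evalMinor_eq`). At a factored element these entries are trinomials
`α + β a u + γ / (a u)`; the constant term produces the sums `S_{a,r}`, and a binomial resummation
gives the coefficients `d_a(m, l)` (`evalMinor_factored`).

*The cell.* Besides the functions `cellX`, `cellZ`, `cellZbar` prescribed by the theorem, the twists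
`cellX'` of `cellX` by an involution of the cell are used. Where `Δ_{ω_0}` does not vanish the cell
has an explicit chart (`exists_chartPt_of_mem`), and this chart and its twist cover the cell
(`fundMinor_zero_ne_zero_or`). On the chart all functions are computed in the fundamental
representations, which shows that they satisfy exchange relations (`cell_relations`), and that the
cell is the affine variety cut out by these (`exists_cell`). The chart rests on the fact that a
parabolic subgroup meets an opposite one in the Levi subgroup (`exists_eq_torus_mul_x`). It is proved
in the loop group of `SL₂`: the positive unipotent group embeds there, by a ping-pong argument
(`eq_one_of_loopHom_eq_one`), and a loop which is polynomial both in `u` and in `u⁻¹` is constant.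

*The coordinate ring.* Chart coordinates are fractions of the functions above, hence matrix
coefficients are polynomials in these functions and the inverses of the frozen ones
(`polynomialFunctions_restrict_mem`). By the Nullstellensatz the locally regular functions on the
cell are no more than that (`coordinateRing_eq_cellAlg`).

*The cluster algebra.* For an exchange matrix with mutable part `(0, ±2; ∓2, 0)` mutation does not
enlarge the algebra generated by a cluster, its neighbours and the frozen variables
(`Seed.lowerBound_mutate_le`). So the cluster algebra is generated by four cluster variables and the
frozen ones, with the same exchange relations as on the cell (`clusterDP_eq_adjoin`). The points of
the cell at which the initial variables do not vanish form a torus, which is dense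
(`eq_zero_of_eq_zero_on_torus`); all relations between the generators on either side can be tested
there, so matching the generators yields an isomorphism (`exists_isStandardIso`).

*The image.* The points of this torus are factored elements (`chartPt_eq_factored`). By density the
evaluation formula becomes an identity on the cell (`cellX_pow_mul_evalMinor`), in which the
denominators are cleared; any isomorphism with the prescribed values transports it to the cluster
algebra (`IsStandardIso.map_evalElement`).
-/


open scoped TensorProduct LaurentPolynomial

attribute [local instance 100] LieRing.ofAssociativeRing

set_option linter.unusedSectionVars false

noncomputable section

namespace KacMoody

universe u

/-! ### Exponentials of locally nilpotent operators -/

section ExpCalculus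
variable {k V W : Type u} [Field k] [CharZero k] [AddCommGroup V] [Module k V]
  [AddCommGroup W] [Module k W]

theorem pow_apply_leibniz {S : Module.End k V} {R : Module.End k W} {D : ℕ → V →ₗ[k] W}
    (hD : ∀ j v, R (D j v) = D (j + 1) v + D j (S v)) (n : ℕ) (v : V) :
    (R ^ n) (D 0 v) = ∑ j ∈ Finset.range (n + 1), (n.choose j : k) • D j ((S ^ (n - j)) v) := by
  induction n with
  | zero => simp
  | succ n ih =>
    rw [pow_succ', Module.End.mul_apply, ih, map_sum]
    simp only [map_smul, hD, smul_add, Finset.sum_add_distrib]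
    rw [Finset.sum_range_succ' _ (n + 1)]
    simp only [Nat.choose_succ_succ, Nat.cast_add, add_smul, Finset.sum_add_distrib,
      Nat.succ_sub_succ]
    rw [add_assoc]
    congr 1
    rw [Finset.sum_range_succ' (fun j => (n.choose j : k) • D j (S ((S ^ (n - j)) v))) n,
      Finset.sum_range_succ (fun j => (n.choose (j + 1) : k) • D (j + 1) ((S ^ (n - j)) v)) n]
    simp only [Nat.choose_succ_self, Nat.cast_zero, zero_smul, add_zero, Nat.choose_zero_right,
      Nat.sub_zero, pow_succ', Module.End.mul_apply]
    congr 1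
    refine Finset.sum_congr rfl fun j hj => ?_
    have : n - j = (n - (j + 1)) + 1 := by have := Finset.mem_range.1 hj; omega
    rw [this, pow_succ', Module.End.mul_apply]

/-- The Leibniz rule for exponentials: if `R` acts on the maps `D j` through `D j ↦ D (j + 1)` and
through `S` on their argument, then `exp R` acts through `∑ j, D j / j!` and through `exp S`. -/
theorem expEnd_leibniz {S : Module.End k V} (hS : LocallyNilpotent S) {R : Module.End k W}
    (hR : LocallyNilpotent R) {D : ℕ → V →ₗ[k] W} {J : ℕ}
    (hD : ∀ j v, R (D j v) = D (j + 1) v + D j (S v)) {v : V}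
    (hJ : ∀ j, J ≤ j → ∀ m, D j ((S ^ m) v) = 0) :
    expEnd R hR (D 0 v) = ∑ j ∈ Finset.range J, (j.factorial : k)⁻¹ • D j (expEnd S hS v) := by
  obtain ⟨N, hN⟩ := hS v
  have hterm : ∀ j m : ℕ, J ≤ j ∨ N ≤ m → D j ((S ^ m) v) = 0 := by
    rintro j m (h | h)
    · exact hJ j h m
    · rw [pow_apply_eq_zero hN h, map_zero]
  have hR0 : (R ^ (J + N)) (D 0 v) = 0 := by
    rw [pow_apply_leibniz hD]
    refine Finset.sum_eq_zero fun j _ => ?_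
    rw [hterm j _ (by omega), smul_zero]
  rw [expEnd_apply hR hR0, expEnd_apply hS hN]
  simp only [pow_apply_leibniz hD, map_sum, map_smul, Finset.smul_sum, smul_smul]
  have h1 : ∀ n ∈ Finset.range (J + N), ∑ j ∈ Finset.range (n + 1),
      ((n.factorial : k)⁻¹ * (n.choose j : k)) • D j ((S ^ (n - j)) v)
      = ∑ j ∈ Finset.range (n + 1), (fun j m => ((j.factorial : k)⁻¹ * (m.factorial : k)⁻¹) •
          D j ((S ^ m) v)) j (n - j) := by
    intro n _
    refine Finset.sum_congr rfl fun j hj => ?_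
    have hj' : j ≤ n := by have := Finset.mem_range.1 hj; omega
    have h0 : ∀ m : ℕ, (m.factorial : k) ≠ 0 := fun m => Nat.cast_ne_zero.2 m.factorial_ne_zero
    congr 1
    rw [Nat.cast_choose k hj']
    have := h0 n; have := h0 j; have := h0 (n - j)
    field_simp
  rw [Finset.sum_congr rfl h1]
  refine (Finset.sum_range_diag_flip (J + N) fun j m =>
    ((j.factorial : k)⁻¹ * (m.factorial : k)⁻¹) • D j ((S ^ m) v)).trans ?_
  rw [← Finset.sum_subset (Finset.range_mono (Nat.le_add_right J N))]
  · refine Finset.sum_congr rfl fun j hj => ?_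
    have hj' := Finset.mem_range.1 hj
    rw [← Finset.sum_subset (Finset.range_mono (show N ≤ J + N - j by omega))]
    intro m _ hm
    rw [hterm j m (Or.inr (by simpa using hm)), smul_zero]
  · intro j _ hj
    refine Finset.sum_eq_zero fun m _ => ?_
    rw [hterm j m (Or.inl (by simpa using hj)), smul_zero]

theorem expEnd_intertwine {S : Module.End k V} (hS : LocallyNilpotent S) {R : Module.End k W}
    (hR : LocallyNilpotent R) (φ : V →ₗ[k] W) (h : ∀ v, R (φ v) = φ (S v)) (v : V) :
    expEnd R hR (φ v) = φ (expEnd S hS v) := by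
  have := expEnd_leibniz hS hR (D := fun j => if j = 0 then φ else 0) (J := 1) (v := v)
    (fun j v => by rcases j with _ | j <;> simp [h]) (fun j hj m => by rw [if_neg (by omega), LinearMap.zero_apply])
  simpa using this

theorem expEnd_bilin {U : Type u} [AddCommGroup U] [Module k U] {T : Module.End k U}
    (hT : LocallyNilpotent T) {S : Module.End k V} (hS : LocallyNilpotent S) {R : Module.End k W}
    (hR : LocallyNilpotent R) (m : U →ₗ[k] V →ₗ[k] W)
    (h : ∀ u v, R (m u v) = m (T u) v + m u (S v)) (u : U) (v : V) :
    expEnd R hR (m u v) = m (expEnd T hT u) (expEnd S hS v) := by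
  obtain ⟨J, hJ⟩ := hT u
  have := expEnd_leibniz hS hR (D := fun j => m ((T ^ j) u)) (J := J) (v := v)
    (fun j v => by rw [h, pow_succ', Module.End.mul_apply])
    (fun j hj m => by rw [pow_apply_eq_zero hJ hj, map_zero, LinearMap.zero_apply])
  rw [pow_zero, Module.End.one_apply] at this
  rw [this, expEnd_apply hT hJ, map_sum, LinearMap.sum_apply]
  simp

/-- `exp T` conjugates `Y` to `Y + [T, Y] + [T, [T, Y]] / 2` if the next bracket vanishes. -/
theorem expEnd_conj {T : Module.End k V} (hT : LocallyNilpotent T) {Y Y₁ Y₂ : Module.End k V}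
    (h₁ : T * Y - Y * T = Y₁) (h₂ : T * Y₁ - Y₁ * T = Y₂) (h₃ : T * Y₂ = Y₂ * T) :
    expEnd T hT * Y = (Y + Y₁ + (2 : k)⁻¹ • Y₂) * expEnd T hT := by
  ext v
  have e : ∀ {a b c : Module.End k V}, a * b - b * a = c → ∀ v, a (b v) = c v + b (a v) := by
    rintro a b c rfl v; simp
  have := expEnd_leibniz hT hT (J := 3) (v := v)
    (D := fun j => match j with | 0 => Y | 1 => Y₁ | 2 => Y₂ | _ => 0)
    (fun j v => by
      match j with
      | 0 => exact e h₁ v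
      | 1 => exact e h₂ v
      | 2 => simpa using LinearMap.congr_fun h₃ v
      | (j + 3) => simp)
    (fun j hj m => by
      match j, hj with
      | (j + 3), _ => rfl)
  simpa [Finset.sum_range_succ, Nat.factorial] using this

theorem expEnd_zero (h : LocallyNilpotent (0 : Module.End k V)) : expEnd 0 h = 1 := by
  ext v
  rw [expEnd_apply (N := 1) h (by simp)]; simp

theorem expEnd_one_of_apply_eq_zero {T : Module.End k V} (hT : LocallyNilpotent T) {v : V}
    (h : T v = 0) : expEnd T hT v = v := by
  rw [expEnd_apply (N := 1) hT (by simpa using h)]; simp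

theorem expEnd_two {T : Module.End k V} (hT : LocallyNilpotent T) {v : V}
    (h : T (T v) = 0) : expEnd T hT v = v + T v := by
  rw [expEnd_apply (N := 2) hT (by simpa [pow_two] using h)]; simp [Finset.sum_range_succ]

theorem expEnd_three {T : Module.End k V} (hT : LocallyNilpotent T) {v : V}
    (h : T (T (T v)) = 0) : expEnd T hT v = v + T v + (2 : k)⁻¹ • T (T v) := by
  rw [expEnd_apply (N := 3) hT (by simpa [pow_succ] using h)]
  simp [Finset.sum_range_succ, Nat.factorial, pow_succ]

theorem expEnd_add {A B : Module.End k V} (hA : LocallyNilpotent A) (hB : LocallyNilpotent B)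
    (hAB : LocallyNilpotent (A + B)) (h : Commute A B) :
    expEnd (A + B) hAB = expEnd A hA * expEnd B hB := by
  ext v
  obtain ⟨J, hJ⟩ := hA v
  have key := expEnd_leibniz hB hAB (D := fun j => A ^ j) (J := J) (v := v)
    (fun j v => by
      rw [LinearMap.add_apply, pow_succ', Module.End.mul_apply, ← Module.End.mul_apply B,
        ← (h.pow_left j).eq, Module.End.mul_apply])
    (fun j hj m => by
      rw [← Module.End.mul_apply, (h.pow_pow j m).eq, Module.End.mul_apply,
        pow_apply_eq_zero hJ hj, map_zero])
  rw [pow_zero, Module.End.one_apply] at key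
  have hJ' : (A ^ J) (expEnd B hB v) = 0 := by
    rw [← expEnd_intertwine hB hB (A ^ J) (fun v => by
      rw [← Module.End.mul_apply, ← (h.pow_left J).eq, Module.End.mul_apply]), hJ, map_zero]
  rw [key, Module.End.mul_apply, expEnd_apply hA hJ']

theorem LocallyNilpotent.add {A B : Module.End k V} (hA : LocallyNilpotent A)
    (hB : LocallyNilpotent B) (h : Commute A B) : LocallyNilpotent (A + B) := fun v => by
  obtain ⟨a, ha⟩ := hA v
  obtain ⟨b, hb⟩ := hB v
  refine ⟨a + b, ?_⟩
  rw [h.add_pow, LinearMap.sum_apply]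
  refine Finset.sum_eq_zero fun j hj => ?_
  rw [← (Nat.cast_commute _ _).eq, Module.End.mul_apply]
  rcases le_or_gt a j with h' | h'
  · rw [(h.pow_pow _ _).eq, Module.End.mul_apply, pow_apply_eq_zero ha h', map_zero, map_zero]
  · rw [Module.End.mul_apply, pow_apply_eq_zero hb (by omega), map_zero, map_zero]

end ExpCalculus

/-! ### Serre relations and integrability of the adjoint representation -/

section SerrePresentation
open CartanMatrix
variable {k : Type u} [Field k] {r : ℕ} {A : Matrix (Fin r) (Fin r) ℤ}

variable (k A) in
/-- The projection from the free Lie algebra on the Chevalley generators. -/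
def ofFree : FreeLieAlgebra k (Generators (Fin r)) →ₗ⁅k⁆ LieAlg k A where
  toFun y := LieSubmodule.Quotient.mk (N := Relations.toIdeal k A) y
  map_add' _ _ := rfl
  map_smul' _ _ := rfl
  map_lie' {y z} := LieSubmodule.Quotient.mk_bracket _ y z

theorem ofFree_eq_zero {x : FreeLieAlgebra k (Generators (Fin r))}
    (hx : x ∈ Relations.toSet k A) : ofFree k A x = 0 :=
  (LieSubmodule.Quotient.mk_eq_zero' (N := Relations.toIdeal k A)).2
    (LieSubmodule.subset_lieSpan hx)

theorem ofFree_surjective : Function.Surjective (ofFree k A) :=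
  LieSubmodule.Quotient.surjective_mk' _

theorem lie_h_h (i j : Fin r) : ⁅h k A i, h k A j⁆ = 0 := by
  have := ofFree_eq_zero (k := k) (A := A) (x := Relations.HH k (i, j))
    (by simp [Relations.toSet])
  exact this

theorem lie_e_f_self (i : Fin r) : ⁅e k A i, f k A i⁆ = h k A i := by
  have := ofFree_eq_zero (k := k) (A := A) (x := Relations.EF k (i, i))
    (by simp [Relations.toSet])
  simp only [Relations.EF, Function.uncurry, if_true, map_sub, LieHom.map_lie] at this
  exact sub_eq_zero.1 this

theorem lie_e_f_ne {i j : Fin r} (hij : i ≠ j) : ⁅e k A i, f k A j⁆ = 0 := by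
  have := ofFree_eq_zero (k := k) (A := A) (x := Relations.EF k (i, j))
    (by simp [Relations.toSet])
  simp only [Relations.EF, Function.uncurry, if_neg hij, LieHom.map_lie] at this
  exact this

theorem lie_h_e (i j : Fin r) : ⁅h k A i, e k A j⁆ = (A i j : k) • e k A j := by
  have := ofFree_eq_zero (k := k) (A := A) (x := Relations.HE k A (i, j))
    (by simp [Relations.toSet])
  simp only [Relations.HE, Function.uncurry, map_sub, LieHom.map_lie, map_zsmul] at this
  rw [Int.cast_smul_eq_zsmul]
  exact sub_eq_zero.1 this

theorem lie_h_f (i j : Fin r) : ⁅h k A i, f k A j⁆ = -(A i j : k) • f k A j := by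
  have := ofFree_eq_zero (k := k) (A := A) (x := Relations.HF k A (i, j))
    (by simp [Relations.toSet])
  simp only [Relations.HF, Function.uncurry, map_add, LieHom.map_lie, map_zsmul] at this
  rw [neg_smul, Int.cast_smul_eq_zsmul]
  exact eq_neg_of_add_eq_zero_left this

theorem ofFree_ad_pow (x y : FreeLieAlgebra k (Generators (Fin r))) (n : ℕ) :
    ofFree k A ((LieAlgebra.ad k _ x ^ n) y)
      = (LieAlgebra.ad k (LieAlg k A) (ofFree k A x) ^ n) (ofFree k A y) := by
  induction n with
  | zero => rfl
  | succ n ih =>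
    rw [pow_succ', pow_succ', Module.End.mul_apply, Module.End.mul_apply, LieAlgebra.ad_apply,
      LieAlgebra.ad_apply, LieHom.map_lie, ih]

theorem serre_e (i j : Fin r) : (LieAlgebra.ad k (LieAlg k A) (e k A i) ^ (-A i j).toNat)
    ⁅e k A i, e k A j⁆ = 0 := by
  have := ofFree_eq_zero (k := k) (A := A) (x := Relations.adE k A (i, j))
    (by simp [Relations.toSet])
  simp only [Relations.adE, Function.uncurry, ofFree_ad_pow, LieHom.map_lie] at this
  exact this

theorem serre_f (i j : Fin r) : (LieAlgebra.ad k (LieAlg k A) (f k A i) ^ (-A i j).toNat)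
    ⁅f k A i, f k A j⁆ = 0 := by
  have := ofFree_eq_zero (k := k) (A := A) (x := Relations.adF k A (i, j))
    (by simp [Relations.toSet])
  simp only [Relations.adF, Function.uncurry, ofFree_ad_pow, LieHom.map_lie] at this
  exact this

/-- The Chevalley generators generate the Kac-Moody algebra. -/
theorem gen_induction (S : LieSubalgebra k (LieAlg k A)) (he : ∀ i, e k A i ∈ S)
    (hf : ∀ i, f k A i ∈ S) (hh : ∀ i, h k A i ∈ S) (y : LieAlg k A) : y ∈ S := by
  obtain ⟨y, rfl⟩ := ofFree_surjective y
  have hS : ∀ g, gen k A g ∈ S := by rintro (i | i | i) <;> [exact hh i; exact he i; exact hf i]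
  have : ofFree k A = S.incl.comp (FreeLieAlgebra.lift k fun g => (⟨gen k A g, hS g⟩ : S)) := by
    refine FreeLieAlgebra.hom_ext fun g => ?_
    rw [LieHom.comp_apply, FreeLieAlgebra.lift_of_apply]
    rfl
  rw [this]
  exact (FreeLieAlgebra.lift k fun g => (⟨gen k A g, hS g⟩ : S)) y |>.2

theorem liftRep_gen {L : Type u} [LieRing L] [LieAlgebra k L]
    (φ : Generators (Fin r) → L)
    (hφ : ∀ x ∈ Relations.toSet k A, FreeLieAlgebra.lift k φ x = 0) (g) :
    liftRep φ hφ (gen k A g) = φ g :=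
  (show liftRep φ hφ (gen k A g) = FreeLieAlgebra.lift k φ (FreeLieAlgebra.of k g) from rfl).trans
    (FreeLieAlgebra.lift_of_apply (R := k) φ g)

variable {V : Type u} [AddCommGroup V] [Module k V]

theorem rep_lie (ρ : LieAlg k A →ₗ⁅k⁆ Module.End k V) (y z : LieAlg k A) :
    ρ ⁅y, z⁆ = ρ y * ρ z - ρ z * ρ y := LieHom.map_lie ρ y z

theorem rep_lie_apply (ρ : LieAlg k A →ₗ⁅k⁆ Module.End k V) (y z : LieAlg k A) (v : V) :
    ρ y (ρ z v) = ρ ⁅y, z⁆ v + ρ z (ρ y v) := by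
  rw [rep_lie]; simp

/-- If `ad y` kills `z` after finitely many steps, then `z` preserves the space of the vectors killed by
some power of `y`. -/
theorem exists_pow_apply_eq_zero [CharZero k] {ρ : LieAlg k A →ₗ⁅k⁆ Module.End k V}
    {y z : LieAlg k A}
    {n m : ℕ} (hz : (LieAlgebra.ad k _ y ^ n) z = 0) {v : V} (hv : (ρ y ^ m) v = 0) :
    (ρ y ^ (n + m)) (ρ z v) = 0 := by
  have := pow_apply_leibniz (S := ρ y) (R := ρ y)
    (D := fun j => ρ ((LieAlgebra.ad k _ y ^ j) z)) (fun j v => by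
      rw [rep_lie_apply, pow_succ', Module.End.mul_apply, LieAlgebra.ad_apply]) (n + m) v
  rw [pow_zero, Module.End.one_apply] at this
  rw [this]
  refine Finset.sum_eq_zero fun j _ => ?_
  rcases le_or_gt n j with h' | h'
  · rw [pow_apply_eq_zero hz h', map_zero, LinearMap.zero_apply, smul_zero]
  · rw [pow_apply_eq_zero hv (show m ≤ n + m - j by omega), map_zero, smul_zero]

theorem locallyNilpotent_ad_of_gen [CharZero k] {y : LieAlg k A}
    (he : ∀ i, ∃ n, (LieAlgebra.ad k _ y ^ n) (e k A i) = 0)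
    (hf : ∀ i, ∃ n, (LieAlgebra.ad k _ y ^ n) (f k A i) = 0)
    (hh : ∀ i, ∃ n, (LieAlgebra.ad k _ y ^ n) (h k A i) = 0) :
    LocallyNilpotent (LieAlgebra.ad k (LieAlg k A) y) := by
  let S : LieSubalgebra k (LieAlg k A) :=
    { carrier := {z | ∃ n, (LieAlgebra.ad k _ y ^ n) z = 0}
      zero_mem' := ⟨0, by simp⟩
      add_mem' := by
        rintro a b ⟨n, hn⟩ ⟨m, hm⟩
        exact ⟨max n m, by rw [map_add, pow_apply_eq_zero hn (le_max_left _ _),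
          pow_apply_eq_zero hm (le_max_right _ _), add_zero]⟩
      smul_mem' := by
        rintro c a ⟨n, hn⟩
        exact ⟨n, by rw [map_smul, hn, smul_zero]⟩
      lie_mem' := by
        rintro a b ⟨n, hn⟩ ⟨m, hm⟩
        exact ⟨n + m, exists_pow_apply_eq_zero (ρ := LieAlgebra.ad k (LieAlg k A)) hn hm⟩ }
  exact fun z => gen_induction S he hf hh z

/-- The Serre relations say that the adjoint representation is integrable. -/
theorem isIntegrable_ad [CharZero k] (hA : ∀ i, A i i = 2) :
    IsIntegrable (LieAlgebra.ad k (LieAlg k A)) := by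
  intro i
  have hA' : ∀ i, (A i i : k) = 2 := fun i => by rw [hA]; norm_num
  constructor
  · refine locallyNilpotent_ad_of_gen (fun j => ⟨(-A i j).toNat + 1, ?_⟩) (fun j => ⟨3, ?_⟩)
      (fun j => ⟨2, ?_⟩)
    · rw [pow_succ, Module.End.mul_apply, LieAlgebra.ad_apply, serre_e]
    · by_cases hij : i = j
      · subst hij
        simp [pow_succ, lie_e_f_self, ← lie_skew (e k A i) (h k A i), lie_h_e]
      · simp [pow_succ, lie_e_f_ne hij]
    · simp [pow_succ, ← lie_skew (e k A i) (h k A j), lie_h_e]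
  · refine locallyNilpotent_ad_of_gen (fun j => ⟨3, ?_⟩) (fun j => ⟨(-A i j).toNat + 1, ?_⟩)
      (fun j => ⟨2, ?_⟩)
    · by_cases hij : j = i
      · subst hij
        simp [pow_succ, ← lie_skew (f k A j) (e k A j), lie_e_f_self,
          ← lie_skew (f k A j) (h k A j), lie_h_f]
      · simp [pow_succ, ← lie_skew (f k A i) (e k A j), lie_e_f_ne hij]
    · rw [pow_succ, Module.End.mul_apply, LieAlgebra.ad_apply, serre_f]
    · simp [pow_succ, ← lie_skew (f k A i) (h k A j), lie_h_f]

end SerrePresentation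

/-! ### The group and its adjoint action -/

section AdjointAction
variable {k : Type u} [Field k] [CharZero k] {r : ℕ} {A : Matrix (Fin r) (Fin r) ℤ}
  {V : Type u} [AddCommGroup V] [Module k V] {ρ : LieAlg k A →ₗ⁅k⁆ Module.End k V}

/-- The one-parameter subgroup elements `x_i(t)` and `x_{\bar i}(t)` at once. -/
def xsym (s : Fin r ⊕ Fin r) (t : k) : Grp k A := QuotientGroup.mk (FreeGroup.of (s, t))

theorem xsym_inl (i : Fin r) (t : k) : xsym (.inl i) t = x k A i t := rfl
theorem xsym_inr (i : Fin r) (t : k) : xsym (.inr i) t = xbar k A i t := rfl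

/-- The action of the group on an integrable representation. It agrees with `act`, but carries the
proof of integrability. -/
def actOn (hρ : IsIntegrable ρ) (g : Grp k A) : V →ₗ[k] V := (action hρ g : Module.End k V)

theorem actOn_mul (hρ : IsIntegrable ρ) (g g' : Grp k A) (v : V) :
    actOn hρ (g * g') v = actOn hρ g (actOn hρ g' v) := by
  rw [actOn, map_mul]; rfl

@[simp] theorem actOn_one (hρ : IsIntegrable ρ) (v : V) : actOn hρ 1 v = v := by
  rw [actOn, map_one]; rfl

@[simp] theorem actOn_inv_actOn (hρ : IsIntegrable ρ) (g : Grp k A) (v : V) :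
    actOn hρ g⁻¹ (actOn hρ g v) = v := by
  rw [← actOn_mul, inv_mul_cancel, actOn_one]

theorem actOn_injective (hρ : IsIntegrable ρ) (g : Grp k A) : Function.Injective (actOn hρ g) :=
  Function.LeftInverse.injective (actOn_inv_actOn hρ g)

theorem act_eq_actOn (hρ : IsIntegrable ρ) (g : Grp k A) : act ρ g = actOn hρ g := by
  rw [act, dif_pos hρ]; rfl

theorem actOn_xsym (hρ : IsIntegrable ρ) (s : Fin r ⊕ Fin r) (t : k) :
    actOn hρ (xsym s t) = expEnd (t • ρ (rootVector s)) ((hρ.locallyNilpotent s).smul t) := by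
  have : action hρ (xsym s t) = expUnit hρ (s, t) := FreeGroup.lift_apply_of
  rw [actOn, this]; rfl

theorem actOn_x (hρ : IsIntegrable ρ) (i : Fin r) (t : k) :
    actOn hρ (x k A i t) = expEnd (t • ρ (e k A i)) ((hρ i).1.smul t) := actOn_xsym hρ (.inl i) t

theorem actOn_xbar (hρ : IsIntegrable ρ) (i : Fin r) (t : k) :
    actOn hρ (xbar k A i t) = expEnd (t • ρ (f k A i)) ((hρ i).2.smul t) := actOn_xsym hρ (.inr i) t

/-- Elements of the group are determined by their action on the integrable representations. -/
theorem grp_ext {g g' : Grp k A} (H : ∀ (V : Type u) [AddCommGroup V] [Module k V]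
    (ρ : LieAlg k A →ₗ⁅k⁆ Module.End k V) (hρ : IsIntegrable ρ) (v : V),
    actOn hρ g v = actOn hρ g' v) : g = g' := by
  induction g using QuotientGroup.induction_on with | _ w
  induction g' using QuotientGroup.induction_on with | _ w'
  refine QuotientGroup.eq.2 fun V _ _ ρ hρ => ?_
  have : wordAction hρ w = wordAction hρ w' := Units.ext (LinearMap.ext fun v => H V ρ hρ v)
  rw [map_mul, map_inv, this, inv_mul_cancel]

theorem xsym_add (s : Fin r ⊕ Fin r) (t t' : k) :
    (xsym s (t + t') : Grp k A) = xsym s t * xsym s t' := by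
  refine grp_ext fun V _ _ ρ hρ v => ?_
  rw [actOn_mul, actOn_xsym, actOn_xsym, actOn_xsym, ← Module.End.mul_apply, ← expEnd_add]
  · congr 2; rw [add_smul]
  · rw [← add_smul]; exact (hρ.locallyNilpotent s).smul _
  · exact ((Commute.refl _).smul_left _).smul_right _

@[simp] theorem xsym_zero (s : Fin r ⊕ Fin r) : (xsym s 0 : Grp k A) = 1 := by
  have := xsym_add (A := A) s (0 : k) 0
  rwa [add_zero, left_eq_mul] at this

theorem xsym_neg (s : Fin r ⊕ Fin r) (t : k) : (xsym s (-t) : Grp k A) = (xsym s t)⁻¹ := by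
  rw [eq_inv_iff_mul_eq_one, ← xsym_add, neg_add_cancel, xsym_zero]

/-- The group is generated by the one-parameter subgroups. -/
theorem grp_induction {P : Grp k A → Prop} (one : P 1)
    (mul : ∀ s t g, P g → P (xsym s t * g)) (g : Grp k A) : P g := by
  have inv : ∀ s t g, P g → P ((xsym s t)⁻¹ * g) := fun s t g hg => by
    rw [← xsym_neg]; exact mul s _ g hg
  induction g using QuotientGroup.induction_on with | _ w
  have : ∀ w : FreeGroup (Symbols k r), ∀ g : Grp k A, P g → P ((w : Grp k A) * g) := by
    intro w
    induction w using FreeGroup.induction_on with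
    | C1 => intro g hg; rwa [QuotientGroup.mk_one, one_mul]
    | of y => exact fun g => mul y.1 y.2 g
    | inv_of y => exact fun g => inv y.1 y.2 g
    | mul a b ha hb => intro g hg; rw [QuotientGroup.mk_mul, mul_assoc]; exact ha _ (hb _ hg)
  simpa using this w 1 one

/-- The adjoint action of the group on the Kac-Moody algebra. -/
def Ad (hA : ∀ i, A i i = 2) (g : Grp k A) : LieAlg k A →ₗ[k] LieAlg k A :=
  actOn (isIntegrable_ad hA) g

theorem actOn_rep (hA : ∀ i, A i i = 2) (hρ : IsIntegrable ρ) (g : Grp k A) (y : LieAlg k A)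
    (v : V) : actOn hρ g (ρ y v) = ρ (Ad hA g y) (actOn hρ g v) := by
  revert y v
  refine grp_induction (P := fun g => ∀ y v, actOn hρ g (ρ y v) = ρ (Ad hA g y) (actOn hρ g v))
    ?_ ?_ g
  · intro y v; rw [Ad, actOn_one, actOn_one, actOn_one]
  · intro s t g hg y v
    have : Ad hA (xsym s t * g) y = actOn (isIntegrable_ad hA) (xsym s t) (Ad hA g y) :=
      actOn_mul _ _ _ _
    rw [actOn_mul, hg, actOn_mul, this, actOn_xsym, actOn_xsym]
    refine expEnd_bilin _ _ _ (ρ : LieAlg k A →ₗ[k] Module.End k V) (fun u v => ?_) _ _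
    simp only [LinearMap.smul_apply, LieHom.coe_toLinearMap, map_smul, LieAlgebra.ad_apply]
    rw [rep_lie_apply, smul_add]

theorem Ad_lie (hA : ∀ i, A i i = 2) (g : Grp k A) (y z : LieAlg k A) :
    Ad hA g ⁅y, z⁆ = ⁅Ad hA g y, Ad hA g z⁆ := actOn_rep hA (isIntegrable_ad hA) g y z

end AdjointAction

/-! ### Representations of `sl₂`: weights and the Weyl group element -/

section Sl2
variable {k V : Type u} [Field k] [CharZero k] [AddCommGroup V] [Module k V]

/-- The operators `E`, `F`, `H` satisfy the relations of `sl₂`. -/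
structure Sl2Rel (E F H : Module.End k V) : Prop where
  ef : E * F - F * E = H
  he : H * E - E * H = (2 : k) • E
  hf : H * F - F * H = -((2 : k) • F)

theorem Sl2Rel.scale {E F H : Module.End k V} (s : Sl2Rel E F H) {t t' : k} (ht : t * t' = 1) :
    Sl2Rel (t • E) (t' • F) H where
  ef := by
    rw [smul_mul_smul_comm, smul_mul_smul_comm, ht, mul_comm t', ht, one_smul, one_smul, s.ef]
  he := by rw [mul_smul_comm, smul_mul_assoc, ← smul_sub, s.he, smul_comm]
  hf := by rw [mul_smul_comm, smul_mul_assoc, ← smul_sub, s.hf, smul_neg, smul_comm]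

theorem LocallyNilpotent.neg {T : Module.End k V} (hT : LocallyNilpotent T) :
    LocallyNilpotent (-T) := by
  simpa using hT.smul (-1)

theorem expEnd_commute {T Y : Module.End k V} (hT : LocallyNilpotent T) (h : T * Y = Y * T) :
    expEnd T hT * Y = Y * expEnd T hT := by
  ext v
  exact expEnd_intertwine hT hT Y (fun v => LinearMap.congr_fun h v) v

/-- The operator by which `(0, 1; -1, 0) = (1, 1; 0, 1) (1, 0; -1, 1) (1, 1; 0, 1)` acts. -/
def weylOp (E F : Module.End k V) (hE : LocallyNilpotent E) (hF : LocallyNilpotent F) :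
    Module.End k V := expEnd E hE * expEnd (-F) hF.neg * expEnd E hE

section
variable {E F H : Module.End k V} (s : Sl2Rel E F H) (hE : LocallyNilpotent E)
  (hF : LocallyNilpotent F)
include s

theorem Sl2Rel.exp_e_mul_h : expEnd E hE * H = (H - (2 : k) • E) * expEnd E hE := by
  have := expEnd_conj hE (Y := H) (Y₁ := -((2 : k) • E)) (Y₂ := 0) (by rw [← s.he]; abel)
    (by simp) (by simp)
  simpa [sub_eq_add_neg] using this

theorem Sl2Rel.exp_neg_f_mul_h :
    expEnd (-F) hF.neg * H = (H - (2 : k) • F) * expEnd (-F) hF.neg := by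
  have := expEnd_conj hF.neg (Y := H) (Y₁ := -((2 : k) • F)) (Y₂ := 0)
    (by rw [← s.hf]; noncomm_ring) (by simp) (by simp)
  simpa [sub_eq_add_neg] using this

theorem Sl2Rel.exp_neg_f_mul_e :
    expEnd (-F) hF.neg * E = (E + H - F) * expEnd (-F) hF.neg := by
  have := expEnd_conj hF.neg (Y := E) (Y₁ := H) (Y₂ := -((2 : k) • F))
    (by rw [← s.ef]; noncomm_ring) (by rw [← s.hf]; noncomm_ring) (by simp)
  rwa [smul_neg, smul_smul, inv_mul_cancel₀ two_ne_zero, one_smul, ← sub_eq_add_neg] at this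

theorem Sl2Rel.weyl_mul_h : weylOp E F hE hF * H = -(H * weylOp E F hE hF) := by
  have h1 := s.exp_e_mul_h hE
  have h2 := s.exp_neg_f_mul_h hF
  have h3 := s.exp_neg_f_mul_e hF
  have h4 := expEnd_commute hE (Y := E) rfl
  unfold weylOp
  generalize expEnd E hE = X at *
  generalize expEnd (-F) hF.neg = Z at *
  calc X * Z * X * H = X * (Z * H - (2 : k) • (Z * E)) * X := by
        rw [mul_assoc, h1]; simp only [mul_assoc, sub_mul, mul_sub, smul_mul_assoc, mul_smul_comm]
    _ = -(X * H + (2 : k) • (X * E)) * Z * X := by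
        rw [h2, h3]
        simp only [two_smul]
        noncomm_ring
    _ = _ := by
        rw [h1, h4]
        simp only [two_smul]
        noncomm_ring

end

section Laurent

/-- The operator `u ^ d ⊗ T` on the Laurent polynomials with coefficients in `V`. -/
def degOp (d : ℤ) (T : Module.End k V) : Module.End k (ℤ →₀ V) :=
  Finsupp.lsum k fun n => Finsupp.lsingle (n + d) ∘ₗ T

/-- The operator `u d/du` on the Laurent polynomials with coefficients in `V`. -/
def eulerOp : Module.End k (ℤ →₀ V) := Finsupp.lsum k fun n => (n : k) • Finsupp.lsingle n

/-- The evaluation at `u = t` of Laurent polynomials with coefficients in `V`. -/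
def evalAt (t : kˣ) : (ℤ →₀ V) →ₗ[k] V :=
  Finsupp.lsum k fun n => ((t ^ n : kˣ) : k) • LinearMap.id

@[simp] theorem degOp_single (d : ℤ) (T : Module.End k V) (n : ℤ) (v : V) :
    degOp d T (Finsupp.single n v) = Finsupp.single (n + d) (T v) := by simp [degOp]

@[simp] theorem eulerOp_single (n : ℤ) (v : V) :
    (eulerOp : Module.End k (ℤ →₀ V)) (Finsupp.single n v) = (n : k) • Finsupp.single n v := by
  simp [eulerOp]

@[simp] theorem evalAt_single (t : kˣ) (n : ℤ) (v : V) :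
    evalAt t (Finsupp.single n v) = ((t ^ n : kˣ) : k) • v := by simp [evalAt]

theorem degOp_zero_apply (T : Module.End k V) (y : ℤ →₀ V) (n : ℤ) :
    degOp 0 T y n = T (y n) := by
  induction y using Finsupp.induction_linear with
  | zero => simp
  | add a b ha hb => simp [ha, hb]
  | single m v => by_cases h : m = n <;> simp [h]

theorem eulerOp_apply (y : ℤ →₀ V) (n : ℤ) :
    (eulerOp : Module.End k (ℤ →₀ V)) y n = (n : k) • y n := by
  induction y using Finsupp.induction_linear with
  | zero => simp
  | add a b ha hb => simp [ha, hb]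
  | single m v => by_cases h : m = n <;> simp [h]

theorem evalAt_apply (t : kˣ) (y : ℤ →₀ V) :
    evalAt t y = ∑ n ∈ y.support, ((t ^ n : kˣ) : k) • y n := by
  simp [evalAt, Finsupp.lsum_apply, Finsupp.sum]

theorem degOp_mul (d d' : ℤ) (T T' : Module.End k V) :
    degOp d T * degOp d' T' = degOp (d' + d) (T * T') := by
  ext n v : 2
  simp [add_assoc]

theorem degOp_locallyNilpotent (d : ℤ) {T : Module.End k V} (hT : LocallyNilpotent T) :
    LocallyNilpotent (degOp d T) := by
  intro y
  induction y using Finsupp.induction_linear with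
  | zero => exact ⟨0, by simp⟩
  | add a b ha hb =>
    obtain ⟨n, hn⟩ := ha
    obtain ⟨m, hm⟩ := hb
    exact ⟨max n m, by rw [map_add, pow_apply_eq_zero hn (le_max_left _ _),
      pow_apply_eq_zero hm (le_max_right _ _), add_zero]⟩
  | single m v =>
    obtain ⟨N, hN⟩ := hT v
    have : ∀ (N : ℕ) m v, (degOp d T ^ N) (Finsupp.single m v)
        = Finsupp.single (m + N * d) ((T ^ N) v) := by
      intro N
      induction N with
      | zero => simp
      | succ N ih =>
        intro m v
        rw [pow_succ, Module.End.mul_apply, degOp_single, ih, pow_succ, Module.End.mul_apply]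
        congr 1; push_cast; ring
    exact ⟨N, by rw [this, hN, Finsupp.single_zero]⟩

theorem evalAt_exp (t : kˣ) (d : ℤ) {T : Module.End k V} (hT : LocallyNilpotent T) (y : ℤ →₀ V) :
    evalAt t (expEnd (degOp d T) (degOp_locallyNilpotent d hT) y)
      = expEnd (((t ^ d : kˣ) : k) • T) (hT.smul _) (evalAt t y) := by
  refine (expEnd_intertwine _ _ (evalAt t) (fun y => ?_) y).symm
  induction y using Finsupp.induction_linear with
  | zero => simp
  | add a b ha hb => rw [map_add, map_add, map_add, map_add, ha, hb]
  | single m v => simp [smul_smul, zpow_add, mul_comm]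

theorem degOp_neg (d : ℤ) (T : Module.End k V) : degOp d (-T) = -degOp d T := by
  ext n v : 2
  simp

theorem degOp_smul (d : ℤ) (c : k) (T : Module.End k V) : degOp d (c • T) = c • degOp d T := by
  ext n v : 2
  simp

theorem degOp_sub (d : ℤ) (S T : Module.End k V) : degOp d (S - T) = degOp d S - degOp d T := by
  ext n v : 2
  simp

theorem Sl2Rel.degOp {E F H : Module.End k V} (s : Sl2Rel E F H) :
    Sl2Rel (degOp 1 E) (degOp (-1) F) (degOp 0 H) where
  ef := by rw [degOp_mul, degOp_mul, ← s.ef, degOp_sub]; rfl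
  he := by rw [degOp_mul, degOp_mul, ← degOp_smul, ← s.he, degOp_sub]; rfl
  hf := by rw [degOp_mul, degOp_mul, ← degOp_smul, ← degOp_neg, ← s.hf, degOp_sub]; rfl

/-- `u d/du - H / 2` commutes with `u E` and `u⁻¹ F`. -/
theorem Sl2Rel.eulerOp_commute {E F H : Module.End k V} (s : Sl2Rel E F H) :
    KacMoody.degOp 1 E * ((2 : k) • eulerOp - KacMoody.degOp 0 H)
        = ((2 : k) • eulerOp - KacMoody.degOp 0 H) * KacMoody.degOp 1 E ∧
      KacMoody.degOp (-1) F * ((2 : k) • eulerOp - KacMoody.degOp 0 H)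
        = ((2 : k) • eulerOp - KacMoody.degOp 0 H) * KacMoody.degOp (-1) F := by
  have he : ∀ v, H (E v) = E (H v) + (2 : k) • E v := fun v => by
    have := LinearMap.congr_fun s.he v
    simp only [LinearMap.sub_apply, Module.End.mul_apply, LinearMap.smul_apply] at this
    rw [← this]; abel
  have hf : ∀ v, H (F v) = F (H v) - (2 : k) • F v := fun v => by
    have := LinearMap.congr_fun s.hf v
    simp only [LinearMap.sub_apply, Module.End.mul_apply, LinearMap.smul_apply,
      LinearMap.neg_apply] at this
    rw [sub_eq_add_neg, ← this]; abel
  constructor <;> ext n v : 2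
  · simp only [LinearMap.comp_apply, Finsupp.lsingle_apply, Module.End.mul_apply,
      LinearMap.sub_apply, LinearMap.smul_apply, eulerOp_single, degOp_single, map_sub, map_smul,
      he, add_zero, Int.cast_add, Int.cast_one, Finsupp.single_add]
    rw [← Finsupp.smul_single]
    module
  · simp only [LinearMap.comp_apply, Finsupp.lsingle_apply, Module.End.mul_apply,
      LinearMap.sub_apply, LinearMap.smul_apply, eulerOp_single, degOp_single, map_sub, map_smul,
      hf, add_zero, Int.cast_add, Int.cast_one, Finsupp.single_sub,
      Int.cast_neg]
    rw [← Finsupp.smul_single]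
    module

/-- The Laurent polynomial whose value at `t` is the image of `v` under the operator of
`(0, t; -t⁻¹, 0)`. -/
def weylCurve {E F : Module.End k V} (hE : LocallyNilpotent E) (hF : LocallyNilpotent F) (v : V) :
    ℤ →₀ V :=
  weylOp (degOp 1 E) (degOp (-1) F) (degOp_locallyNilpotent 1 hE) (degOp_locallyNilpotent (-1) hF)
    (Finsupp.single 0 v)

theorem expEnd_congr {T T' : Module.End k V} (h : T = T') (hT : LocallyNilpotent T)
    (hT' : LocallyNilpotent T') : expEnd T hT = expEnd T' hT' := by subst h; rfl

theorem evalAt_weylCurve {E F : Module.End k V} (hE : LocallyNilpotent E)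
    (hF : LocallyNilpotent F) (v : V) (t : kˣ) :
    evalAt t (weylCurve hE hF v)
      = weylOp ((t : k) • E) (((t⁻¹ : kˣ) : k) • F) (hE.smul _) (hF.smul _) v := by
  have h2 : ∀ y, evalAt t (expEnd (-degOp (-1) F) (degOp_locallyNilpotent (-1) hF).neg y)
      = expEnd (-(((t⁻¹ : kˣ) : k) • F)) (hF.smul _).neg (evalAt t y) := by
    intro y
    have h := evalAt_exp t (-1) hF.neg y
    rw [expEnd_congr (degOp_neg (-1) F) _ (degOp_locallyNilpotent (-1) hF).neg] at h
    rw [h]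
    congr 2
    simp
  have h1 : ∀ y, evalAt t (expEnd (degOp 1 E) (degOp_locallyNilpotent 1 hE) y)
      = expEnd ((t : k) • E) (hE.smul _) (evalAt t y) := by
    intro y
    rw [evalAt_exp t 1 hE]
    congr 2
    simp
  rw [weylCurve, weylOp, Module.End.mul_apply, Module.End.mul_apply, h1, h2, h1]
  simp [weylOp]

/-- The coefficient of `t ^ n` in `weylCurve` has weight `n`: by `Sl2Rel.eulerOp_commute` the operator
of `(0, t; -t⁻¹, 0)` commutes with `2 t d/dt - H`, while it anticommutes with `H`. -/
theorem Sl2Rel.eulerOp_weylCurve {E F H : Module.End k V} (s : Sl2Rel E F H)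
    (hE : LocallyNilpotent E) (hF : LocallyNilpotent F) (v : V) (n : ℤ) :
    H (weylCurve hE hF v n) = (n : k) • weylCurve hE hF v n := by
  obtain ⟨c1, c2⟩ := s.eulerOp_commute
  have hE' := degOp_locallyNilpotent 1 hE
  have hF' := degOp_locallyNilpotent (-1) hF
  have c1 := expEnd_commute hE' c1
  have c2 := expEnd_commute hF'.neg (Y := (2 : k) • eulerOp - KacMoody.degOp 0 H)
    ((neg_mul _ _).trans ((congrArg Neg.neg c2).trans (mul_neg _ _).symm))
  have hw := s.degOp.weyl_mul_h hE' hF'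
  have hc : weylOp _ _ hE' hF' * ((2 : k) • eulerOp - KacMoody.degOp 0 H)
      = ((2 : k) • eulerOp - KacMoody.degOp 0 H) * weylOp _ _ hE' hF' := by
    unfold weylOp
    rw [mul_assoc, c1, ← mul_assoc, mul_assoc _ _ ((2 : k) • eulerOp - KacMoody.degOp 0 H), c2,
      ← mul_assoc, c1]
    simp only [mul_assoc]
  have hc' := LinearMap.congr_fun hc (Finsupp.single 0 v)
  have hw' := LinearMap.congr_fun hw (Finsupp.single 0 v)
  simp only [Module.End.mul_apply, LinearMap.sub_apply, LinearMap.smul_apply, eulerOp_single,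
    Int.cast_zero, zero_smul, smul_zero, zero_sub, map_neg, LinearMap.neg_apply] at hc' hw'
  rw [hw', neg_neg] at hc'
  have := DFunLike.congr_fun hc' n
  rw [Finsupp.sub_apply, Finsupp.smul_apply, eulerOp_apply, degOp_zero_apply,
    show weylOp _ _ hE' hF' (Finsupp.single 0 v) = weylCurve hE hF v from rfl, eq_sub_iff_add_eq, ← two_smul k] at this
  exact smul_right_injective V (two_ne_zero (α := k)) this

theorem Sl2Rel.weylCurve_of_weight {E F H : Module.End k V} (s : Sl2Rel E F H)
    (hE : LocallyNilpotent E) (hF : LocallyNilpotent F) {v : V} {m : ℤ}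
    (hv : H v = -(m : k) • v) (n : ℤ) (hn : n ≠ m) : weylCurve hE hF v n = 0 := by
  have hE' := degOp_locallyNilpotent 1 hE
  have hF' := degOp_locallyNilpotent (-1) hF
  have hw := LinearMap.congr_fun (s.degOp.weyl_mul_h hE' hF') (Finsupp.single 0 v)
  simp only [Module.End.mul_apply, LinearMap.neg_apply, degOp_single, hv, add_zero] at hw
  rw [neg_smul, Finsupp.single_neg, ← Finsupp.smul_single, map_neg, map_smul, neg_inj] at hw
  have := DFunLike.congr_fun hw n
  rw [degOp_zero_apply, show weylOp _ _ hE' hF' (Finsupp.single 0 v) = weylCurve hE hF v from rfl,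
    s.eulerOp_weylCurve, Finsupp.smul_apply] at this
  have h2 : ((n : k) - m) • weylCurve hE hF v n = 0 := by rw [sub_smul, this, sub_self]
  rcases smul_eq_zero.1 h2 with h | h
  · exact absurd (by exact_mod_cast sub_eq_zero.1 h) hn
  · exact h

end Laurent
end Sl2

/-! ### The torus -/

section Torus
variable {k : Type u} [Field k] [CharZero k] {r : ℕ} {A : Matrix (Fin r) (Fin r) ℤ}
  {V : Type u} [AddCommGroup V] [Module k V] {ρ : LieAlg k A →ₗ⁅k⁆ Module.End k V}

theorem sl2Rel (hA : ∀ i, A i i = 2) (ρ : LieAlg k A →ₗ⁅k⁆ Module.End k V) (i : Fin r) :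
    Sl2Rel (ρ (e k A i)) (ρ (f k A i)) (ρ (h k A i)) where
  ef := by rw [← rep_lie, lie_e_f_self]
  he := by
    rw [← rep_lie, lie_h_e, hA, map_smul]; norm_num
  hf := by
    rw [← rep_lie, lie_h_f, hA, map_smul, neg_smul]; norm_num

/-- The image of `(0, t; -t⁻¹, 0)` under the coroot subgroup `φ_i`. -/
def weylElt (i : Fin r) (t : kˣ) : Grp k A :=
  x k A i t * xbar k A i (-(t⁻¹ : kˣ)) * x k A i t

theorem sbar_eq (i : Fin r) : sbar k A i = weylElt i (-1) := by
  simp [weylElt, sbar]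

theorem weylElt_inv (i : Fin r) (t : kˣ) : (weylElt i t : Grp k A)⁻¹ = weylElt i (-t) := by
  simp only [weylElt, mul_inv_rev, ← xsym_inl, ← xsym_inr, ← xsym_neg, mul_assoc, Units.val_neg,
    inv_neg]

theorem corootElt_eq (i : Fin r) (t : kˣ) : corootElt k A i t = weylElt i t * sbar k A i := rfl

theorem corootElt_one (i : Fin r) : corootElt k A i 1 = 1 := by
  rw [corootElt_eq, sbar_eq, ← weylElt_inv, mul_inv_cancel]

theorem sbar_mul_self (i : Fin r) : sbar k A i * sbar k A i = corootElt k A i (-1) := by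
  rw [corootElt_eq, ← sbar_eq]

theorem weylElt_eq (i : Fin r) (t : kˣ) :
    (weylElt i t : Grp k A) = corootElt k A i t * (sbar k A i)⁻¹ := by
  rw [corootElt_eq, mul_inv_cancel_right]

theorem actOn_weylElt (hρ : IsIntegrable ρ) (i : Fin r) (t : kˣ) :
    actOn hρ (weylElt i t) = weylOp ((t : k) • ρ (e k A i)) (((t⁻¹ : kˣ) : k) • ρ (f k A i))
      ((hρ i).1.smul _) ((hρ i).2.smul _) := by
  ext v
  rw [weylElt, actOn_mul, actOn_mul, actOn_x, actOn_xbar, weylOp]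
  simp only [Module.End.mul_apply]
  congr 3
  rw [neg_smul]

/-- The vector valued Laurent polynomial `t ↦ t ^ (α_i^∨) v`. -/
def corootCurve (hρ : IsIntegrable ρ) (i : Fin r) (v : V) : ℤ →₀ V :=
  weylCurve (hρ i).1 (hρ i).2 (actOn hρ (sbar k A i) v)

theorem actOn_corootElt (hρ : IsIntegrable ρ) (i : Fin r) (t : kˣ) (v : V) :
    actOn hρ (corootElt k A i t) v = evalAt t (corootCurve hρ i v) := by
  rw [corootElt_eq, actOn_mul, actOn_weylElt, corootCurve, evalAt_weylCurve]

theorem corootCurve_weight (hA : ∀ i, A i i = 2) (hρ : IsIntegrable ρ) (i : Fin r) (v : V)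
    (n : ℤ) : ρ (h k A i) (corootCurve hρ i v n) = (n : k) • corootCurve hρ i v n :=
  (sl2Rel hA ρ i).eulerOp_weylCurve _ _ _ n

theorem evalAt_corootCurve_one (hρ : IsIntegrable ρ) (i : Fin r) (v : V) :
    evalAt (1 : kˣ) (corootCurve hρ i v) = v := by
  rw [← actOn_corootElt, corootElt_one, actOn_one]

/-- The element `t ^ (α_i^∨)` acts on a vector of weight `m` as multiplication by `t ^ m`. -/
theorem actOn_corootElt_of_weight (hA : ∀ i, A i i = 2) (hρ : IsIntegrable ρ) (i : Fin r)
    (t : kˣ) {v : V} {m : ℤ} (hv : ρ (h k A i) v = (m : k) • v) :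
    actOn hρ (corootElt k A i t) v = ((t ^ m : kˣ) : k) • v := by
  have hs : ρ (h k A i) (actOn hρ (sbar k A i) v) = -(m : k) • actOn hρ (sbar k A i) v := by
    have := LinearMap.congr_fun (((sl2Rel hA ρ i).scale (t := ((-1 : kˣ) : k))
      (t' := (((-1)⁻¹ : kˣ) : k)) (by simp)).weyl_mul_h ((hρ i).1.smul _) ((hρ i).2.smul _)) v
    rw [← actOn_weylElt hρ, ← sbar_eq] at this
    simp only [Module.End.mul_apply, LinearMap.neg_apply, hv, map_smul] at this
    rw [neg_smul, this, neg_neg]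
  have h0 : ∀ n, n ≠ m → corootCurve hρ i v n = 0 := fun n hn =>
    (sl2Rel hA ρ i).weylCurve_of_weight _ _ hs n hn
  have h1 : corootCurve hρ i v = Finsupp.single m (corootCurve hρ i v m) := by
    ext n
    by_cases hn : n = m
    · rw [hn, Finsupp.single_eq_same]
    · rw [h0 n hn, Finsupp.single_eq_of_ne hn]
  have h2 := evalAt_corootCurve_one hρ i v
  rw [h1, evalAt_single, one_zpow, Units.val_one, one_smul] at h2
  rw [actOn_corootElt, h1, evalAt_single, h2]

/-- Every vector is a sum of integral weight vectors for `h i`, on which `t ^ (α_i^∨)` acts by powers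
of `t`. -/
theorem actOn_eq_sum_weights (hA : ∀ i, A i i = 2) (hρ : IsIntegrable ρ) (i : Fin r) (v : V) :
    ∃ y : ℤ →₀ V, (∀ n, ρ (h k A i) (y n) = (n : k) • y n) ∧ v = ∑ n ∈ y.support, y n ∧
      ∀ t, actOn hρ (corootElt k A i t) v = ∑ n ∈ y.support, ((t ^ n : kˣ) : k) • y n := by
  refine ⟨corootCurve hρ i v, corootCurve_weight hA hρ i v, ?_, fun t => ?_⟩
  · have := evalAt_corootCurve_one hρ i v
    rw [evalAt_apply] at this
    simpa using this.symm
  · rw [actOn_corootElt, evalAt_apply]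

theorem corootElt_mul (hA : ∀ i, A i i = 2) (i : Fin r) (s t : kˣ) :
    corootElt k A i (s * t) = corootElt k A i s * corootElt k A i t := by
  refine grp_ext fun V _ _ ρ hρ v => ?_
  obtain ⟨y, hy, -, hv⟩ := actOn_eq_sum_weights hA hρ i v
  rw [actOn_mul, hv, hv, map_sum]
  refine Finset.sum_congr rfl fun n _ => ?_
  rw [map_smul, actOn_corootElt_of_weight hA hρ i s (hy n), smul_smul, mul_zpow, Units.val_mul,
    mul_comm]

theorem corootElt_inv (hA : ∀ i, A i i = 2) (i : Fin r) (t : kˣ) :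
    (corootElt k A i t)⁻¹ = corootElt k A i t⁻¹ := by
  rw [inv_eq_iff_mul_eq_one, ← corootElt_mul hA, mul_inv_cancel, corootElt_one]

/-- Conjugation in the group is governed by the adjoint action. -/
theorem mul_xsym_of_Ad (hA : ∀ i, A i i = 2) {g : Grp k A} {s s' : Fin r ⊕ Fin r} {c : k}
    (hg : Ad hA g (rootVector s) = c • rootVector s') (t : k) :
    g * xsym s t = xsym s' (c * t) * g := by
  refine grp_ext fun V _ _ ρ hρ v => ?_
  rw [actOn_mul, actOn_mul, actOn_xsym, actOn_xsym]
  refine (expEnd_intertwine _ _ (actOn hρ g) (fun v => ?_) v).symm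
  rw [LinearMap.smul_apply, LinearMap.smul_apply, map_smul, actOn_rep hA, hg, map_smul,
    LinearMap.smul_apply, smul_smul, mul_comm]

theorem Ad_sbar_e (hA : ∀ i, A i i = 2) (i : Fin r) :
    Ad hA (sbar k A i) (e k A i) = -f k A i := by
  have hρ := isIntegrable_ad (k := k) hA
  have he : ⁅e k A i, h k A i⁆ = -((2 : k) • e k A i) := by
    rw [← lie_skew, lie_h_e, hA]; norm_num
  have hf : ⁅f k A i, h k A i⁆ = (2 : k) • f k A i := by
    rw [← lie_skew, lie_h_f, hA]; norm_num
  have hfe : ⁅f k A i, e k A i⁆ = -h k A i := by rw [← lie_skew, lie_e_f_self]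
  have h1 : actOn hρ (x k A i (-1)) (e k A i) = e k A i := by
    rw [actOn_x, expEnd_one_of_apply_eq_zero]
    simp
  have h2 : actOn hρ (xbar k A i 1) (e k A i) = e k A i - h k A i - f k A i := by
    have h2 : LieAlgebra.ad k (LieAlg k A) (f k A i) (e k A i) = -h k A i := hfe
    have h3 : LieAlgebra.ad k (LieAlg k A) (f k A i) (-h k A i) = -((2 : k) • f k A i) := by
      rw [LieAlgebra.ad_apply, lie_neg, hf]
    rw [actOn_xbar, expEnd_three]
    · rw [one_smul, h2, h3, smul_neg, smul_smul, inv_mul_cancel₀ two_ne_zero, one_smul]; abel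
    · rw [one_smul, h2, h3]; simp
  have h3 : actOn hρ (x k A i (-1)) (e k A i - h k A i - f k A i) = -f k A i := by
    have h2 : ((-1 : k) • LieAlgebra.ad k (LieAlg k A) (e k A i)) (e k A i - h k A i - f k A i)
        = h k A i - (2 : k) • e k A i := by
      rw [LinearMap.smul_apply, LieAlgebra.ad_apply, lie_sub, lie_sub, lie_self, he, lie_e_f_self]
      module
    have h3 : ((-1 : k) • LieAlgebra.ad k (LieAlg k A) (e k A i)) (h k A i - (2 : k) • e k A i)
        = (2 : k) • e k A i := by
      rw [LinearMap.smul_apply, LieAlgebra.ad_apply, lie_sub, lie_smul, lie_self, he]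
      module
    rw [actOn_x, expEnd_three]
    · rw [h2, h3, smul_smul, inv_mul_cancel₀ two_ne_zero, one_smul]; module
    · rw [h2, h3]; simp
  rw [Ad, sbar, actOn_mul, actOn_mul, h1, h2, h3]

theorem Ad_corootElt_e (hA : ∀ i, A i i = 2) (i j : Fin r) (t : kˣ) :
    Ad hA (corootElt k A i t) (e k A j) = ((t ^ A i j : kˣ) : k) • e k A j :=
  actOn_corootElt_of_weight hA (isIntegrable_ad hA) i t (lie_h_e i j)

theorem Ad_corootElt_f (hA : ∀ i, A i i = 2) (i j : Fin r) (t : kˣ) :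
    Ad hA (corootElt k A i t) (f k A j) = ((t ^ (-A i j) : kˣ) : k) • f k A j :=
  actOn_corootElt_of_weight hA (isIntegrable_ad hA) i t (by
    rw [LieAlgebra.ad_apply, lie_h_f]; push_cast; rfl)

theorem Ad_corootElt_h (hA : ∀ i, A i i = 2) (i j : Fin r) (t : kˣ) :
    Ad hA (corootElt k A i t) (h k A j) = h k A j := by
  have := actOn_corootElt_of_weight hA (isIntegrable_ad hA) i t (v := h k A j) (m := 0) (by
    rw [LieAlgebra.ad_apply, lie_h_h]; simp)
  rwa [zpow_zero, Units.val_one, one_smul] at this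

theorem corootElt_mul_x (hA : ∀ i, A i i = 2) (i j : Fin r) (t : kˣ) (s : k) :
    corootElt k A i t * x k A j s = x k A j ((t ^ A i j : kˣ) * s) * corootElt k A i t :=
  mul_xsym_of_Ad hA (s := .inl j) (s' := .inl j) (Ad_corootElt_e hA i j t) s

theorem corootElt_mul_xbar (hA : ∀ i, A i i = 2) (i j : Fin r) (t : kˣ) (s : k) :
    corootElt k A i t * xbar k A j s
      = xbar k A j ((t ^ (-A i j) : kˣ) * s) * corootElt k A i t :=
  mul_xsym_of_Ad hA (s := .inr j) (s' := .inr j) (Ad_corootElt_f hA i j t) s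

theorem corootElt_comm (hA : ∀ i, A i i = 2) (i j : Fin r) (s t : kˣ) :
    corootElt k A i s * corootElt k A j t = corootElt k A j t * corootElt k A i s := by
  refine grp_ext fun V _ _ ρ hρ v => ?_
  obtain ⟨y, hy, hv0, hv⟩ := actOn_eq_sum_weights hA hρ j v
  rw [actOn_mul, actOn_mul, hv, map_sum]
  conv_rhs => rw [hv0, map_sum, map_sum]
  refine Finset.sum_congr rfl fun n _ => ?_
  rw [map_smul, actOn_corootElt_of_weight hA hρ j t (m := n)]
  have := actOn_rep hA hρ (corootElt k A i s) (h k A j) (y n)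
  rw [Ad_corootElt_h] at this
  rw [← this, hy, map_smul]

theorem sbar_mul_x (hA : ∀ i, A i i = 2) (i : Fin r) (t : k) :
    sbar k A i * x k A i t = xbar k A i (-t) * sbar k A i := by
  have := mul_xsym_of_Ad hA (g := sbar k A i) (s := .inl i) (s' := .inr i) (c := -1)
    (by rw [neg_one_smul]; exact Ad_sbar_e hA i) t
  rwa [neg_one_mul] at this

end Torus

/-! ### Automorphisms from diagram automorphisms and the Chevalley involution -/

section Twist
open CartanMatrix
variable {k : Type u} [Field k] {r : ℕ} {A : Matrix (Fin r) (Fin r) ℤ}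

theorem lieHom_ad_pow {L L' : Type u} [LieRing L] [LieAlgebra k L] [LieRing L'] [LieAlgebra k L']
    (F : L →ₗ⁅k⁆ L') (y z : L) (n : ℕ) :
    F ((LieAlgebra.ad k _ y ^ n) z) = (LieAlgebra.ad k L' (F y) ^ n) (F z) := by
  induction n with
  | zero => rfl
  | succ n ih =>
    rw [pow_succ', pow_succ', Module.End.mul_apply, Module.End.mul_apply, LieAlgebra.ad_apply,
      LieAlgebra.ad_apply, LieHom.map_lie, ih]

variable (k A) in
/-- The images of the Chevalley generators under the Chevalley involution, followed by a
permutation of the nodes. -/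
def twistGen (π : Equiv.Perm (Fin r)) : Generators (Fin r) → LieAlg k A
  | .E i => -f k A (π i)
  | .F i => -e k A (π i)
  | .H i => -h k A (π i)

theorem ad_neg_pow_lie_neg {L : Type u} [LieRing L] [LieAlgebra k L] (y z : L) (n : ℕ)
    (h : (LieAlgebra.ad k L y ^ n) ⁅y, z⁆ = 0) : (LieAlgebra.ad k L (-y) ^ n) ⁅-y, -z⁆ = 0 := by
  rw [map_neg, neg_pow, neg_lie, lie_neg, neg_neg, Module.End.mul_apply, h, map_zero]

theorem twistGen_relations {π : Equiv.Perm (Fin r)} (hπ : ∀ i j, A (π i) (π j) = A i j) :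
    ∀ y ∈ Relations.toSet k A, FreeLieAlgebra.lift k (twistGen k A π) y = 0 := by
  rintro y (((((⟨⟨i, j⟩, rfl⟩ | ⟨⟨i, j⟩, rfl⟩) | ⟨⟨i, j⟩, rfl⟩) | ⟨⟨i, j⟩, rfl⟩) | ⟨⟨i, j⟩, rfl⟩) |
    ⟨⟨i, j⟩, rfl⟩)
  · simp only [Relations.HH, Function.uncurry, Function.comp, LieHom.map_lie,
      FreeLieAlgebra.lift_of_apply, twistGen, neg_lie, lie_neg, neg_neg, lie_h_h]
  · simp only [Relations.EF, Function.uncurry, Function.comp]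
    by_cases hij : i = j
    · subst hij
      rw [if_pos rfl]
      simp only [map_sub, LieHom.map_lie, FreeLieAlgebra.lift_of_apply, twistGen, neg_lie, lie_neg,
        neg_neg, ← lie_skew (f k A (π i)) (e k A (π i)), lie_e_f_self, sub_self]
    · rw [if_neg hij]
      simp only [LieHom.map_lie, FreeLieAlgebra.lift_of_apply, twistGen, neg_lie, lie_neg,
        ← lie_skew (f k A (π i)) (e k A (π j)),
        lie_e_f_ne (fun h => hij (π.injective h.symm)), neg_zero]
  · simp only [Relations.HE, Function.uncurry, Function.comp, LieHom.map_lie,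
      FreeLieAlgebra.lift_of_apply, twistGen, neg_lie, lie_neg, map_sub, map_zsmul, neg_neg,
      lie_h_f, hπ, smul_neg, neg_smul, Int.cast_smul_eq_zsmul, sub_self]
  · simp only [Relations.HF, Function.uncurry, Function.comp, LieHom.map_lie,
      FreeLieAlgebra.lift_of_apply, twistGen, neg_lie, lie_neg, map_add, map_zsmul, neg_neg,
      lie_h_e, hπ, smul_neg, Int.cast_smul_eq_zsmul, add_neg_cancel]
  · simp only [Relations.adE, Function.uncurry, Function.comp, lieHom_ad_pow,
      LieHom.map_lie, FreeLieAlgebra.lift_of_apply, twistGen]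
    exact ad_neg_pow_lie_neg _ _ _ (by rw [← hπ]; exact serre_f _ _)
  · simp only [Relations.adF, Function.uncurry, Function.comp, lieHom_ad_pow,
      LieHom.map_lie, FreeLieAlgebra.lift_of_apply, twistGen]
    exact ad_neg_pow_lie_neg _ _ _ (by rw [← hπ]; exact serre_e _ _)

/-- The automorphism `e_i ↦ -f_{π i}`, `f_i ↦ -e_{π i}` of the Kac-Moody algebra, for a diagram
automorphism `π`. -/
def twistLie (π : Equiv.Perm (Fin r)) (hπ : ∀ i j, A (π i) (π j) = A i j) :
    LieAlg k A →ₗ⁅k⁆ LieAlg k A := liftRep (twistGen k A π) (twistGen_relations hπ)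

/-- The effect of `twistLie` on the real root vectors, up to sign. -/
def twistSym (π : Equiv.Perm (Fin r)) : Fin r ⊕ Fin r → Fin r ⊕ Fin r :=
  Sum.elim (fun i => .inr (π i)) (fun i => .inl (π i))

theorem twistLie_rootVector (π : Equiv.Perm (Fin r)) (hπ : ∀ i j, A (π i) (π j) = A i j)
    (s : Fin r ⊕ Fin r) :
    twistLie (k := k) π hπ (rootVector s) = -rootVector (twistSym π s) := by
  rcases s with i | i <;> exact liftRep_gen _ _ _

variable [CharZero k] {V : Type u} [AddCommGroup V] [Module k V]
  {ρ : LieAlg k A →ₗ⁅k⁆ Module.End k V}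

theorem IsIntegrable.twist (hρ : IsIntegrable ρ) {π : Equiv.Perm (Fin r)}
    (hπ : ∀ i j, A (π i) (π j) = A i j) : IsIntegrable (ρ.comp (twistLie π hπ)) := by
  intro i
  have : ∀ s, LocallyNilpotent ((ρ.comp (twistLie π hπ)) (rootVector s)) := fun s => by
    rw [LieHom.comp_apply, twistLie_rootVector, map_neg]
    exact (hρ.locallyNilpotent _).neg
  exact ⟨this (.inl i), this (.inr i)⟩

theorem wordAction_twist (hρ : IsIntegrable ρ) {π : Equiv.Perm (Fin r)}
    (hπ : ∀ i j, A (π i) (π j) = A i j) (w : FreeGroup (Symbols k r)) :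
    wordAction (hρ.twist hπ) w
      = wordAction hρ (FreeGroup.map (fun y : Symbols k r => (twistSym π y.1, -y.2)) w) := by
  induction w using FreeGroup.induction_on with
  | C1 => rw [map_one, map_one, map_one]
  | of y =>
    rw [FreeGroup.map.of]
    refine (FreeGroup.lift_apply_of).trans (Eq.trans ?_ (FreeGroup.lift_apply_of).symm)
    refine Units.ext (expEnd_congr (V := V) (T := y.2 • (ρ.comp (twistLie π hπ)) (rootVector y.1))
      (T' := (-y.2) • ρ (rootVector (twistSym π y.1))) ?_ ((hρ.twist hπ).locallyNilpotent _ |>.smul _)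
      ((hρ.locallyNilpotent _).smul _))
    rw [LieHom.comp_apply, twistLie_rootVector, map_neg, smul_neg, neg_smul]
  | inv_of y hy => rw [map_inv, map_inv, map_inv, hy]
  | mul a b ha hb => rw [map_mul, map_mul, map_mul, ha, hb]

/-- The automorphism `x_i(t) ↦ x_{\bar{π i}}(-t)`, `x_{\bar i}(t) ↦ x_{π i}(-t)` of the group. -/
def twist (π : Equiv.Perm (Fin r)) (hπ : ∀ i j, A (π i) (π j) = A i j) : Grp k A →* Grp k A :=
  QuotientGroup.map _ _ (FreeGroup.map (fun y : Symbols k r => (twistSym π y.1, -y.2)))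
    (show trivialWords k A ≤ (trivialWords k A).comap _ from
      fun w hw V _ _ ρ hρ => by rw [← wordAction_twist hρ hπ]; exact hw V _ _)

variable {π : Equiv.Perm (Fin r)} (hπ : ∀ i j, A (π i) (π j) = A i j)

theorem twist_xsym (s : Fin r ⊕ Fin r) (t : k) :
    twist π hπ (xsym s t) = xsym (twistSym π s) (-t) :=
  congrArg (QuotientGroup.mk (s := trivialWords k A)) (FreeGroup.map.of (f := fun y : Symbols k r =>
    (twistSym π y.1, -y.2)) (x := (s, t)))

theorem twist_x (i : Fin r) (t : k) : twist π hπ (x k A i t) = xbar k A (π i) (-t) :=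
  twist_xsym hπ (.inl i) t

theorem twist_xbar (i : Fin r) (t : k) : twist π hπ (xbar k A i t) = x k A (π i) (-t) :=
  twist_xsym hπ (.inr i) t

theorem actOn_twist (hρ : IsIntegrable ρ) (g : Grp k A) :
    actOn (hρ.twist hπ) g = actOn hρ (twist π hπ g) := by
  induction g using QuotientGroup.induction_on with | _ w
  exact congrArg Units.val (wordAction_twist hρ hπ w)

theorem twist_twist (hinv : ∀ i, π (π i) = i) (g : Grp k A) :
    twist π hπ (twist π hπ g) = g := by
  refine grp_induction (P := fun g => twist π hπ (twist π hπ g) = g) ?_ ?_ g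
  · rw [map_one, map_one]
  · intro s t g hg
    rw [map_mul, map_mul, hg, twist_xsym, twist_xsym, neg_neg]
    rcases s with i | i <;> simp [twistSym, hinv]

theorem twist_sbar (hA : ∀ i, A i i = 2) (i : Fin r) :
    twist π hπ (sbar k A i) = sbar k A (π i) := by
  have h1 : xbar k A (π i) 1 = sbar k A (π i) * x k A (π i) (-1) * (sbar k A (π i))⁻¹ := by
    rw [sbar_mul_x hA, neg_neg, mul_inv_cancel_right]
  have h2 : xbar k A (π i) 1 * x k A (π i) (-1) = (x k A (π i) (-1))⁻¹ * sbar k A (π i) := by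
    rw [sbar, mul_assoc (x k A (π i) (-1)), inv_mul_cancel_left]
  -- the square of `sbar` is a torus element which commutes with `x (-1)`
  have h3 : sbar k A (π i) * sbar k A (π i) * x k A (π i) (-1)
      = x k A (π i) (-1) * (sbar k A (π i) * sbar k A (π i)) := by
    rw [sbar_mul_self, corootElt_mul_x hA, hA]; simp
  rw [sbar, map_mul, map_mul, twist_x, twist_xbar, neg_neg, h2]
  conv_lhs => rw [h1]
  rw [← mul_assoc, ← mul_assoc, mul_assoc _ (sbar k A (π i)) (sbar k A (π i)),
    mul_assoc _ (sbar k A (π i) * sbar k A (π i)), h3, ← mul_assoc, ← mul_assoc, inv_mul_cancel,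
    one_mul, mul_inv_cancel_right]

theorem Ad_sbar_f (hA : ∀ i, A i i = 2) (i : Fin r) :
    Ad hA (sbar k A i) (f k A i) = -e k A i := by
  have h1 : Ad hA (sbar k A i * sbar k A i) (e k A i) = e k A i := by
    rw [sbar_mul_self, Ad_corootElt_e, hA]
    simp
  rw [Ad, actOn_mul, ← Ad, Ad_sbar_e, map_neg] at h1
  rw [← h1]
  exact (neg_neg _).symm

theorem sbar_mul_xbar (hA : ∀ i, A i i = 2) (i : Fin r) (t : k) :
    sbar k A i * xbar k A i t = x k A i (-t) * sbar k A i := by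
  have := mul_xsym_of_Ad hA (g := sbar k A i) (s := .inr i) (s' := .inl i) (c := -1)
    (by rw [neg_one_smul]; exact Ad_sbar_f hA i) t
  rwa [neg_one_mul] at this

theorem twist_corootElt (hA : ∀ i, A i i = 2) (i : Fin r) (t : kˣ) :
    twist π hπ (corootElt k A i t) = corootElt k A (π i) t⁻¹ := by
  refine grp_ext fun V _ _ ρ hρ v => ?_
  obtain ⟨y, hy, hv0, hv⟩ := actOn_eq_sum_weights hA hρ (π i) v
  rw [← actOn_twist, hv]
  conv_lhs => rw [hv0, map_sum]
  refine Finset.sum_congr rfl fun n _ => ?_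
  rw [actOn_corootElt_of_weight hA (hρ.twist hπ) i t (m := -n), inv_zpow, zpow_neg]
  have : twistLie (k := k) π hπ (h k A i) = -h k A (π i) := liftRep_gen _ _ (.H i)
  rw [LieHom.comp_apply, this, map_neg, LinearMap.neg_apply, hy, Int.cast_neg, neg_smul]

end Twist

/-! ### Small representations of the simple `sl₂` subalgebras -/

section Strings
variable {k : Type u} [Field k] [CharZero k] {r : ℕ} {A : Matrix (Fin r) (Fin r) ℤ}
  {V : Type u} [AddCommGroup V] [Module k V] {ρ : LieAlg k A →ₗ⁅k⁆ Module.End k V}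

/-- `v` spans a trivial representation of the `i`-th `sl₂`. -/
structure Spin0 (ρ : LieAlg k A →ₗ⁅k⁆ Module.End k V) (i : Fin r) (v : V) : Prop where
  e0 : ρ (e k A i) v = 0
  f0 : ρ (f k A i) v = 0

/-- `v`, `w` is the standard basis of a two-dimensional representation of the `i`-th `sl₂`. -/
structure Spin1 (ρ : LieAlg k A →ₗ⁅k⁆ Module.End k V) (i : Fin r) (v w : V) : Prop where
  e0 : ρ (e k A i) v = 0
  e1 : ρ (e k A i) w = v
  f0 : ρ (f k A i) v = w
  f1 : ρ (f k A i) w = 0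

/-- `u₀`, `u₁`, `u₂` is the basis of a three-dimensional representation of the `i`-th `sl₂` formed by
the divided powers of `f i` applied to `u₀`. -/
structure Spin2 (ρ : LieAlg k A →ₗ⁅k⁆ Module.End k V) (i : Fin r) (u₀ u₁ u₂ : V) : Prop where
  e0 : ρ (e k A i) u₀ = 0
  e1 : ρ (e k A i) u₁ = (2 : k) • u₀
  e2 : ρ (e k A i) u₂ = u₁
  f0 : ρ (f k A i) u₀ = u₁
  f1 : ρ (f k A i) u₁ = (2 : k) • u₂
  f2 : ρ (f k A i) u₂ = 0

theorem actOn_x_of_eq_zero (hρ : IsIntegrable ρ) {i : Fin r} {v : V} (hv : ρ (e k A i) v = 0)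
    (t : k) : actOn hρ (x k A i t) v = v := by
  rw [actOn_x, expEnd_one_of_apply_eq_zero _ (by rw [LinearMap.smul_apply, hv, smul_zero])]

theorem actOn_xbar_of_eq_zero (hρ : IsIntegrable ρ) {i : Fin r} {v : V} (hv : ρ (f k A i) v = 0)
    (t : k) : actOn hρ (xbar k A i t) v = v := by
  rw [actOn_xbar, expEnd_one_of_apply_eq_zero _ (by rw [LinearMap.smul_apply, hv, smul_zero])]

theorem actOn_inv_of_eq (hρ : IsIntegrable ρ) {g : Grp k A} {v w : V} (h : actOn hρ g v = w) :
    actOn hρ g⁻¹ w = v := by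
  rw [← h, actOn_inv_actOn]

theorem Spin0.sbar (hρ : IsIntegrable ρ) {i : Fin r} {v : V} (s : Spin0 ρ i v) :
    actOn hρ (sbar k A i) v = v := by
  rw [KacMoody.sbar, actOn_mul, actOn_mul, actOn_x_of_eq_zero hρ s.e0,
    actOn_xbar_of_eq_zero hρ s.f0, actOn_x_of_eq_zero hρ s.e0]

theorem Spin1.x (hρ : IsIntegrable ρ) {i : Fin r} {v w : V} (s : Spin1 ρ i v w) (t : k) :
    actOn hρ (x k A i t) w = w + t • v := by
  rw [actOn_x, expEnd_two]
  · simp [s.e1]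
  · simp [s.e1, s.e0]

theorem Spin1.xbar (hρ : IsIntegrable ρ) {i : Fin r} {v w : V} (s : Spin1 ρ i v w) (t : k) :
    actOn hρ (xbar k A i t) v = v + t • w := by
  rw [actOn_xbar, expEnd_two]
  · simp [s.f0]
  · simp [s.f1, s.f0]

theorem Spin1.sbar_fst (hρ : IsIntegrable ρ) {i : Fin r} {v w : V} (s : Spin1 ρ i v w) :
    actOn hρ (sbar k A i) v = w := by
  rw [KacMoody.sbar, actOn_mul, actOn_mul, actOn_x_of_eq_zero hρ s.e0, s.xbar, map_add, map_smul,
    actOn_x_of_eq_zero hρ s.e0, s.x]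
  module

theorem Spin1.sbar_snd (hρ : IsIntegrable ρ) {i : Fin r} {v w : V} (s : Spin1 ρ i v w) :
    actOn hρ (sbar k A i) w = -v := by
  rw [KacMoody.sbar, actOn_mul, actOn_mul, s.x, map_add, map_smul, s.xbar,
    actOn_xbar_of_eq_zero hρ s.f1, map_add, map_smul, map_add, map_smul,
    actOn_x_of_eq_zero hρ s.e0, s.x]
  module

theorem Spin2.x1 (hρ : IsIntegrable ρ) {i : Fin r} {u₀ u₁ u₂ : V} (s : Spin2 ρ i u₀ u₁ u₂)
    (t : k) : actOn hρ (KacMoody.x k A i t) u₁ = u₁ + (2 * t) • u₀ := by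
  rw [actOn_x, expEnd_two]
  · simp [s.e1, smul_smul, mul_comm]
  · simp [s.e1, s.e0]

theorem Spin2.x2 (hρ : IsIntegrable ρ) {i : Fin r} {u₀ u₁ u₂ : V} (s : Spin2 ρ i u₀ u₁ u₂)
    (t : k) : actOn hρ (KacMoody.x k A i t) u₂ = u₂ + t • u₁ + t ^ 2 • u₀ := by
  rw [actOn_x, expEnd_three]
  · simp only [LinearMap.smul_apply, s.e2, map_smul, s.e1]
    module
  · simp [s.e2, s.e1, s.e0]

theorem Spin2.xbar1 (hρ : IsIntegrable ρ) {i : Fin r} {u₀ u₁ u₂ : V} (s : Spin2 ρ i u₀ u₁ u₂)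
    (t : k) : actOn hρ (xbar k A i t) u₁ = u₁ + (2 * t) • u₂ := by
  rw [actOn_xbar, expEnd_two]
  · simp [s.f1, smul_smul, mul_comm]
  · simp [s.f1, s.f2]

theorem Spin2.xbar0 (hρ : IsIntegrable ρ) {i : Fin r} {u₀ u₁ u₂ : V} (s : Spin2 ρ i u₀ u₁ u₂)
    (t : k) : actOn hρ (xbar k A i t) u₀ = u₀ + t • u₁ + t ^ 2 • u₂ := by
  rw [actOn_xbar, expEnd_three]
  · simp only [LinearMap.smul_apply, s.f0, map_smul, s.f1]
    module
  · simp [s.f0, s.f1, s.f2]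

theorem Spin2.sbar0 (hρ : IsIntegrable ρ) {i : Fin r} {u₀ u₁ u₂ : V} (s : Spin2 ρ i u₀ u₁ u₂) :
    actOn hρ (sbar k A i) u₀ = u₂ := by
  rw [KacMoody.sbar, actOn_mul, actOn_mul, actOn_x_of_eq_zero hρ s.e0, s.xbar0]
  simp only [map_add, map_smul, actOn_x_of_eq_zero hρ s.e0, s.x1, s.x2]
  module

theorem Spin2.sbar1 (hρ : IsIntegrable ρ) {i : Fin r} {u₀ u₁ u₂ : V} (s : Spin2 ρ i u₀ u₁ u₂) :
    actOn hρ (sbar k A i) u₁ = -u₁ := by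
  rw [KacMoody.sbar, actOn_mul, actOn_mul, s.x1]
  simp only [map_add, map_smul, actOn_x_of_eq_zero hρ s.e0, s.x1, s.x2, s.xbar0, s.xbar1]
  module

theorem Spin2.sbar2 (hρ : IsIntegrable ρ) {i : Fin r} {u₀ u₁ u₂ : V} (s : Spin2 ρ i u₀ u₁ u₂) :
    actOn hρ (sbar k A i) u₂ = u₀ := by
  rw [KacMoody.sbar, actOn_mul, actOn_mul, s.x2]
  simp only [map_add, map_smul, actOn_x_of_eq_zero hρ s.e0, s.x1, s.x2, s.xbar0, s.xbar1,
    actOn_xbar_of_eq_zero hρ s.f2]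
  module

end Strings

/-! ### Real root vectors of the affine Lie algebra -/

section AffineLie
variable {k : Type u} [Field k] [CharZero k]

theorem affineA1_self (i : Fin 2) : affineA1 i i = 2 := by fin_cases i <;> rfl

theorem affineA1_rev (i : Fin 2) : affineA1 i i.rev = -2 := by fin_cases i <;> rfl

theorem affineA1_rev' (i : Fin 2) : affineA1 i.rev i = -2 := by fin_cases i <;> rfl

theorem ne_rev (i : Fin 2) : i ≠ i.rev := by fin_cases i <;> decide

theorem eq_or_eq_rev (i j : Fin 2) : j = i ∨ j = i.rev := by
  fin_cases i <;> fin_cases j <;> decide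

theorem isIntegrable_adA1 : IsIntegrable (LieAlgebra.ad k (LieAlg k affineA1)) :=
  isIntegrable_ad affineA1_self

variable (k) in
/-- A vector of the imaginary root `δ`. -/
def imagVec (i : Fin 2) : LieAlg k affineA1 := ⁅e k affineA1 i, e k affineA1 i.rev⁆

theorem imagVec_rev (i : Fin 2) : imagVec k i.rev = -imagVec k i := by
  rw [imagVec, imagVec, Fin.rev_rev, lie_skew]

theorem spin2_ad (i : Fin 2) : Spin2 (LieAlgebra.ad k (LieAlg k affineA1)) i
    ((2 : k)⁻¹ • ⁅e k affineA1 i, imagVec k i⁆) (imagVec k i) (e k affineA1 i.rev) := by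
  have hhe : ⁅h k affineA1 i, e k affineA1 i.rev⁆ = -((2 : k) • e k affineA1 i.rev) := by
    rw [lie_h_e, affineA1_rev]; norm_num
  have hhe' : ⁅h k affineA1 i, e k affineA1 i⁆ = (2 : k) • e k affineA1 i := by
    rw [lie_h_e, affineA1_self]; norm_num
  have hN : ⁅h k affineA1 i, imagVec k i⁆ = 0 := by
    rw [imagVec, leibniz_lie, hhe, hhe', smul_lie, lie_neg, lie_smul, add_neg_cancel]
  have hfe : ⁅f k affineA1 i, e k affineA1 i⁆ = -h k affineA1 i := by
    rw [← lie_skew, lie_e_f_self]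
  have hfe' : ⁅f k affineA1 i, e k affineA1 i.rev⁆ = 0 := by
    rw [← lie_skew, lie_e_f_ne (ne_rev i).symm, neg_zero]
  have hf1 : ⁅f k affineA1 i, imagVec k i⁆ = (2 : k) • e k affineA1 i.rev := by
    rw [imagVec, leibniz_lie, hfe, hfe', lie_zero, neg_lie, hhe, neg_neg, add_zero]
  refine ⟨?_, ?_, rfl, ?_, hf1, hfe'⟩
  · have := serre_e (k := k) (A := affineA1) i i.rev
    rw [affineA1_rev] at this
    rw [map_smul]
    exact (congrArg ((2 : k)⁻¹ • ·) this).trans (smul_zero _)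
  · rw [LieAlgebra.ad_apply, smul_smul, mul_inv_cancel₀ two_ne_zero, one_smul]
  · rw [map_smul, LieAlgebra.ad_apply, leibniz_lie, hfe, hf1, neg_lie, hN, neg_zero, zero_add,
      lie_smul, smul_smul, inv_mul_cancel₀ two_ne_zero, one_smul]
    rfl

variable (k) in
/-- Root vectors for the roots `-α_{j'}`, `α_j`, `α_j + δ`, `α_j + 2δ`, …, where `j'` is the other
node. Thus `rootVec k j (m + 1)` belongs to `α_j + m δ`. -/
def rootVec (j : Fin 2) : ℕ → LieAlg k affineA1
  | 0 => -f k affineA1 j.rev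
  | n + 1 => Ad affineA1_self (sbar k affineA1 j) (rootVec j.rev n)
termination_by n => n

theorem rootVec_succ (j : Fin 2) (n : ℕ) :
    rootVec k j (n + 1) = Ad affineA1_self (sbar k affineA1 j) (rootVec k j.rev n) := by
  rw [rootVec]

theorem rootVec_one (j : Fin 2) : rootVec k j 1 = e k affineA1 j := by
  rw [rootVec_succ, rootVec, Fin.rev_rev, map_neg, Ad_sbar_f, neg_neg]

theorem Ad_sbar_imagVec (i j : Fin 2) :
    Ad affineA1_self (sbar k affineA1 i) (imagVec k j) = -imagVec k j := by
  have h1 : ∀ i, Ad affineA1_self (sbar k affineA1 i) (imagVec k i) = -imagVec k i := fun i =>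
    (spin2_ad i).sbar1 isIntegrable_adA1
  rcases eq_or_eq_rev i j with rfl | rfl
  · exact h1 j
  · rw [imagVec_rev, map_neg, h1]

theorem lie_imagVec_rootVec (i j : Fin 2) (n : ℕ) :
    ∃ c : k, c ≠ 0 ∧ ⁅imagVec k i, rootVec k j n⁆ = c • rootVec k j (n + 1) := by
  induction n generalizing i j with
  | zero =>
    have h : ⁅imagVec k j, rootVec k j 0⁆ = (-2 : k) • rootVec k j 1 := by
      rw [rootVec_one, rootVec, lie_neg, imagVec, lie_lie, lie_e_f_self,
        lie_e_f_ne (ne_rev j), lie_zero, sub_zero, ← lie_skew, lie_h_e, affineA1_rev']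
      simp
    rcases eq_or_eq_rev j i with rfl | rfl
    · exact ⟨-2, by norm_num, h⟩
    · exact ⟨2, by norm_num, by rw [imagVec_rev, neg_lie, h, neg_smul, neg_neg]⟩
  | succ n ih =>
    obtain ⟨c, hc, h⟩ := ih i j.rev
    refine ⟨-c, neg_ne_zero.2 hc, ?_⟩
    have := congrArg (Ad affineA1_self (sbar k affineA1 j)) h
    rw [Ad_lie, Ad_sbar_imagVec, map_smul, ← rootVec_succ, ← rootVec_succ, neg_lie] at this
    rw [neg_smul, ← this, neg_neg]

/-- The root vectors of the roots `α_j + n δ` commute. -/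
theorem lie_rootVec_rootVec (d : ℕ) (j : Fin 2) (n : ℕ) :
    ⁅rootVec k j n, rootVec k j (n + d)⁆ = 0 := by
  induction d using Nat.strong_induction_on generalizing j n with
  | _ d ih =>
    match d with
    | 0 => exact lie_self _
    | 1 =>
      clear ih
      induction n generalizing j with
      | zero =>
        rw [zero_add, rootVec_one, rootVec, neg_lie, ← lie_skew, lie_e_f_ne (ne_rev j), neg_zero,
          neg_zero]
      | succ n ih =>
        rw [rootVec_succ, rootVec_succ, ← Ad_lie, ih, map_zero]
    | d + 2 =>
      -- the bracket with a vector of root `δ` moves both indices up; the term with index distance `d`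
      -- vanishes by induction
      have h1 := congrArg (fun y => ⁅imagVec k 0, y⁆) (ih (d + 1) (by omega) j n)
      obtain ⟨c, hc, hc'⟩ := lie_imagVec_rootVec (k := k) 0 j n
      obtain ⟨c', hc0, hc''⟩ := lie_imagVec_rootVec (k := k) 0 j (n + (d + 1))
      rw [lie_zero, leibniz_lie, hc', hc'', smul_lie, lie_smul,
        show n + (d + 1) = n + 1 + d by ring, ih d (by omega), smul_zero, zero_add] at h1
      rw [show n + (d + 2) = n + 1 + d + 1 by ring]
      exact (smul_eq_zero.1 h1).resolve_left hc0

end AffineLie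

/-! ### Real root subgroups and the positive Borel subgroup -/

section RootGroups
variable {k : Type u} [Field k] [CharZero k]

/-- The real root group elements for the roots `α_j + m δ`. -/
def rootElt : Fin 2 → ℕ → k → Grp k affineA1
  | j, 0, t => x k affineA1 j t
  | j, m + 1, t => sbar k affineA1 j * rootElt j.rev m t * (sbar k affineA1 j)⁻¹
termination_by _ m => m

theorem rootElt_zero (j : Fin 2) (t : k) : rootElt j 0 t = x k affineA1 j t := by rw [rootElt]

theorem rootElt_succ (j : Fin 2) (m : ℕ) (t : k) : rootElt j (m + 1) t
    = sbar k affineA1 j * rootElt j.rev m t * (sbar k affineA1 j)⁻¹ := by rw [rootElt]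

/-- `rootElt j m` is conjugate to a simple root subgroup by an element which carries the simple
root vector to `rootVec k j (m + 1)`. -/
theorem exists_conj_rootElt (j : Fin 2) (m : ℕ) : ∃ (w : Grp k affineA1) (i : Fin 2),
    (∀ t, rootElt j m t = w * x k affineA1 i t * w⁻¹) ∧
      Ad affineA1_self w (e k affineA1 i) = rootVec k j (m + 1) := by
  induction m generalizing j with
  | zero => exact ⟨1, j, fun t => by rw [rootElt_zero]; group, by
      rw [zero_add, rootVec_one]; exact actOn_one _ _⟩
  | succ m ih =>
    obtain ⟨w, i, h1, h2⟩ := ih j.rev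
    refine ⟨sbar k affineA1 j * w, i, fun t => ?_, ?_⟩
    · rw [rootElt_succ, h1]; group
    · rw [rootVec_succ, ← h2]; exact actOn_mul _ _ _ _

theorem mul_rootElt_of_Ad {g : Grp k affineA1} {j j' : Fin 2} {m m' : ℕ} {c : k}
    (hg : Ad affineA1_self g (rootVec k j (m + 1)) = c • rootVec k j' (m' + 1)) (t : k) :
    g * rootElt j m t = rootElt j' m' (c * t) * g := by
  obtain ⟨w, i, h1, h2⟩ := exists_conj_rootElt (k := k) j m
  obtain ⟨w', i', h1', h2'⟩ := exists_conj_rootElt (k := k) j' m'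
  have key : Ad affineA1_self (w'⁻¹ * g * w) (rootVector (.inl i)) = c • rootVector (.inl i') := by
    have hm : ∀ (g g' : Grp k affineA1) y, Ad affineA1_self (g * g') y
        = Ad affineA1_self g (Ad affineA1_self g' y) := fun g g' y => actOn_mul _ _ _ _
    rw [hm, hm]
    change Ad affineA1_self _ (Ad affineA1_self _ (Ad affineA1_self w (e k affineA1 i)))
      = c • e k affineA1 i'
    rw [h2, hg, map_smul, ← h2', ← hm, inv_mul_cancel]
    exact congrArg (c • ·) (actOn_one _ _)
  have := mul_xsym_of_Ad affineA1_self key t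
  rw [xsym_inl, xsym_inl] at this
  rw [h1, h1']
  calc g * (w * x k affineA1 i t * w⁻¹) = w' * (w'⁻¹ * g * w * x k affineA1 i t) * w⁻¹ := by group
    _ = _ := by rw [this]; group

theorem rootElt_comm (j : Fin 2) (m n : ℕ) (s t : k) :
    rootElt j m s * rootElt j n t = rootElt j n t * rootElt j m s := by
  wlog h : m ≤ n generalizing m n s t
  · exact (this n m t s (le_of_not_ge h)).symm
  obtain ⟨d, rfl⟩ := Nat.exists_eq_add_of_le h
  obtain ⟨w, i, h1, h2⟩ := exists_conj_rootElt (k := k) j m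
  have hm : ∀ (g g' : Grp k affineA1) y, Ad affineA1_self (g * g') y
      = Ad affineA1_self g (Ad affineA1_self g' y) := fun g g' y => actOn_mul _ _ _ _
  have hw : ∀ y, Ad affineA1_self w (Ad affineA1_self w⁻¹ y) = y := fun y => by
    rw [← hm, mul_inv_cancel]; exact actOn_one _ _
  have h3 : ⁅e k affineA1 i, Ad affineA1_self w⁻¹ (rootVec k j (m + d + 1))⁆ = 0 := by
    apply actOn_injective isIntegrable_adA1 w
    change Ad affineA1_self w _ = Ad affineA1_self w _
    rw [Ad_lie, hw, h2, map_zero, show m + d + 1 = m + 1 + d by ring, lie_rootVec_rootVec]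
  have h4 : Ad affineA1_self (rootElt j m s) (rootVec k j (m + d + 1))
      = (1 : k) • rootVec k j (m + d + 1) := by
    rw [h1, hm, hm, one_smul]
    have : Ad affineA1_self (x k affineA1 i s) (Ad affineA1_self w⁻¹ (rootVec k j (m + d + 1)))
        = Ad affineA1_self w⁻¹ (rootVec k j (m + d + 1)) :=
      actOn_x_of_eq_zero isIntegrable_adA1 h3 s
    rw [this, hw]
  have := mul_rootElt_of_Ad h4 t
  rwa [one_mul] at this

theorem rootElt_add (j : Fin 2) (m : ℕ) (s t : k) :
    rootElt j m (s + t) = rootElt j m s * rootElt j m t := by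
  obtain ⟨w, i, h1, -⟩ := exists_conj_rootElt (k := k) j m
  rw [h1, h1, h1, ← xsym_inl, xsym_add, xsym_inl, xsym_inl]; group

theorem rootElt_map_zero (j : Fin 2) (m : ℕ) : rootElt j m (0 : k) = 1 := by
  obtain ⟨w, i, h1, -⟩ := exists_conj_rootElt (k := k) j m
  rw [h1, ← xsym_inl, xsym_zero]; group

theorem rootElt_neg (j : Fin 2) (m : ℕ) (t : k) : rootElt j m (-t) = (rootElt j m t)⁻¹ := by
  rw [eq_inv_iff_mul_eq_one, ← rootElt_add, neg_add_cancel, rootElt_map_zero]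

theorem exists_Ad_corootElt_rootVec (i j : Fin 2) (s : kˣ) (m : ℕ) : ∃ c : kˣ,
    Ad affineA1_self (corootElt k affineA1 i s) (rootVec k j (m + 1))
      = (c : k) • rootVec k j (m + 1) := by
  induction m with
  | zero => exact ⟨_, by rw [zero_add, rootVec_one, Ad_corootElt_e]⟩
  | succ m ih =>
    obtain ⟨c, hc⟩ := ih
    obtain ⟨c', hc0, hc'⟩ := lie_imagVec_rootVec (k := k) 0 j (m + 1)
    refine ⟨s ^ affineA1 i 0 * s ^ affineA1 i (Fin.rev 0) * c, ?_⟩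
    have h1 := congrArg (Ad affineA1_self (corootElt k affineA1 i s)) hc'
    rw [Ad_lie, imagVec, Ad_lie, Ad_corootElt_e, Ad_corootElt_e, hc] at h1
    simp only [smul_lie, lie_smul] at h1
    rw [← imagVec, hc', map_smul] at h1
    have h2 := congrArg (c'⁻¹ • ·) h1
    simp only [smul_smul] at h2
    rw [inv_mul_cancel₀ hc0, one_smul] at h2
    rw [← h2]
    congr 1
    field_simp
    push_cast
    ring

theorem exists_corootElt_mul_rootElt (i j : Fin 2) (s : kˣ) (m : ℕ) : ∃ c : kˣ, ∀ t : k,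
    corootElt k affineA1 i s * rootElt j m t
      = rootElt j m (c * t) * corootElt k affineA1 i s := by
  obtain ⟨c, hc⟩ := exists_Ad_corootElt_rootVec (k := k) i j s m
  exact ⟨c, mul_rootElt_of_Ad hc⟩

theorem exists_sbar_mul_rootElt_succ (j : Fin 2) (m : ℕ) : ∃ c : kˣ, ∀ t : k,
    sbar k affineA1 j * rootElt j (m + 1) t
      = rootElt j.rev m (c * t) * sbar k affineA1 j := by
  obtain ⟨c, hc⟩ := exists_corootElt_mul_rootElt (k := k) j j.rev (-1) m
  refine ⟨c, fun t => ?_⟩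
  rw [rootElt_succ, ← mul_assoc, ← mul_assoc, sbar_mul_self, hc, ← sbar_mul_self]
  group

theorem exists_torus_mul_rootElt {g : Grp k affineA1} (hg : g ∈ torus k affineA1) (j : Fin 2)
    (m : ℕ) : ∃ c : kˣ, ∀ t : k, g * rootElt j m t = rootElt j m (c * t) * g := by
  induction hg using Subgroup.closure_induction with
  | mem y hy =>
    obtain ⟨i, s, rfl⟩ := hy
    exact exists_corootElt_mul_rootElt i j s m
  | one => exact ⟨1, fun t => by simp⟩
  | mul a b _ _ iha ihb =>
    obtain ⟨c, hc⟩ := iha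
    obtain ⟨d, hd⟩ := ihb
    exact ⟨c * d, fun t => by rw [mul_assoc, hd, ← mul_assoc, hc, Units.val_mul, mul_assoc,
      mul_assoc (c : k)]⟩
  | inv a _ iha =>
    obtain ⟨c, hc⟩ := iha
    refine ⟨c⁻¹, fun t => ?_⟩
    rw [inv_mul_eq_iff_eq_mul, ← mul_assoc, hc, Units.mul_inv_cancel_left, mul_inv_cancel_right]

theorem corootElt_mem_torus (i : Fin 2) (t : kˣ) : corootElt k affineA1 i t ∈ torus k affineA1 :=
  Subgroup.subset_closure ⟨i, t, rfl⟩

theorem exists_of_mem_torus {g : Grp k affineA1} (hg : g ∈ torus k affineA1) (i : Fin 2) :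
    ∃ s t : kˣ, g = corootElt k affineA1 i s * corootElt k affineA1 i.rev t := by
  have hc := corootElt_comm (k := k) (A := affineA1) affineA1_self
  induction hg using Subgroup.closure_induction with
  | mem y hy =>
    obtain ⟨j, s, rfl⟩ := hy
    rcases eq_or_eq_rev i j with rfl | rfl
    · exact ⟨s, 1, by rw [corootElt_one, mul_one]⟩
    · exact ⟨1, s, by rw [corootElt_one, one_mul]⟩
  | one => exact ⟨1, 1, by simp [corootElt_one]⟩
  | mul a b _ _ iha ihb =>
    obtain ⟨s, t, rfl⟩ := iha
    obtain ⟨s', t', rfl⟩ := ihb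
    refine ⟨s * s', t * t', ?_⟩
    rw [corootElt_mul affineA1_self, corootElt_mul affineA1_self, mul_assoc, mul_assoc,
      ← mul_assoc (corootElt k affineA1 i.rev t), hc i.rev i]
    simp only [mul_assoc]
  | inv a _ iha =>
    obtain ⟨s, t, rfl⟩ := iha
    exact ⟨s⁻¹, t⁻¹, by rw [mul_inv_rev, corootElt_inv affineA1_self, corootElt_inv affineA1_self,
      hc]⟩

theorem torus_comm {g g' : Grp k affineA1} (hg : g ∈ torus k affineA1)
    (hg' : g' ∈ torus k affineA1) : g * g' = g' * g := by
  have hc := corootElt_comm (k := k) (A := affineA1) affineA1_self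
  obtain ⟨s, t, rfl⟩ := exists_of_mem_torus hg 0
  obtain ⟨s', t', rfl⟩ := exists_of_mem_torus hg' 0
  have h1 : ∀ i j s s', Commute (corootElt k affineA1 i s) (corootElt k affineA1 j s') :=
    fun i j s s' => hc i j s s'
  exact (((h1 _ _ _ _).mul_right (h1 _ _ _ _)).mul_left
    ((h1 _ _ _ _).mul_right (h1 _ _ _ _))).eq

theorem sbar_conj_mem_torus (i : Fin 2) {g : Grp k affineA1} (hg : g ∈ torus k affineA1) :
    sbar k affineA1 i * g * (sbar k affineA1 i)⁻¹ ∈ torus k affineA1 := by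
  induction hg using Subgroup.closure_induction with
  | mem y hy =>
    obtain ⟨j, t, rfl⟩ := hy
    -- `h_j(t)⁻¹ s_i h_j(t)` is a Weyl element of the `i`-th coroot subgroup
    have h1 : (corootElt k affineA1 j t⁻¹) * sbar k affineA1 i * corootElt k affineA1 j t
        = weylElt i (-(t⁻¹ ^ affineA1 j i)) := by
      have h3 := corootElt_mul_x (k := k) (A := affineA1) affineA1_self j i t⁻¹
      have h4 := corootElt_mul_xbar (k := k) (A := affineA1) affineA1_self j i t⁻¹
      have h5 : corootElt k affineA1 j t = (corootElt k affineA1 j t⁻¹)⁻¹ := by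
        rw [corootElt_inv affineA1_self, inv_inv]
      rw [h5, mul_inv_eq_iff_eq_mul, sbar, weylElt, ← mul_assoc, ← mul_assoc, h3,
        mul_assoc _ _ (xbar k affineA1 i 1), h4, ← mul_assoc, mul_assoc _ _ (x k affineA1 i (-1)),
        h3, ← mul_assoc]
      simp
    have h2 : sbar k affineA1 i * corootElt k affineA1 j t * (sbar k affineA1 i)⁻¹
        = corootElt k affineA1 j t * (corootElt k affineA1 i (-(t⁻¹ ^ affineA1 j i)) *
          (corootElt k affineA1 i (-1))⁻¹) := by
      rw [← sbar_mul_self, mul_inv_rev, ← mul_assoc _ _ (sbar k affineA1 i)⁻¹, ← weylElt_eq, ← h1,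
        ← corootElt_inv affineA1_self]
      group
    rw [h2]
    exact mul_mem (corootElt_mem_torus _ _) (mul_mem (corootElt_mem_torus _ _)
      (inv_mem (corootElt_mem_torus _ _)))
  | one => simp
  | mul a b _ _ iha ihb =>
    have := mul_mem iha ihb
    rwa [show sbar k affineA1 i * a * (sbar k affineA1 i)⁻¹ *
      (sbar k affineA1 i * b * (sbar k affineA1 i)⁻¹)
      = sbar k affineA1 i * (a * b) * (sbar k affineA1 i)⁻¹ by group] at this
  | inv a _ iha =>
    have := inv_mem iha
    rwa [show (sbar k affineA1 i * a * (sbar k affineA1 i)⁻¹)⁻¹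
      = sbar k affineA1 i * a⁻¹ * (sbar k affineA1 i)⁻¹ by group] at this

theorem sbar_inv_conj_mem_torus (i : Fin 2) {g : Grp k affineA1} (hg : g ∈ torus k affineA1) :
    (sbar k affineA1 i)⁻¹ * g * sbar k affineA1 i ∈ torus k affineA1 := by
  have h1 := torus_comm hg (inv_mem (corootElt_mem_torus i (-1)))
  have h2 : (sbar k affineA1 i)⁻¹ = sbar k affineA1 i * (corootElt k affineA1 i (-1))⁻¹ := by
    rw [← sbar_mul_self]; group
  have h3 : (sbar k affineA1 i)⁻¹ * g * sbar k affineA1 i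
      = sbar k affineA1 i * g * (sbar k affineA1 i)⁻¹ := by
    conv_lhs => rw [h2, mul_assoc _ _ g, ← h1]
    rw [← sbar_mul_self]; group
  rw [h3]
  exact sbar_conj_mem_torus i hg

variable (k) in
/-- The group generated by the positive real root subgroups `rootElt j m`. -/
def posRootGroup : Subgroup (Grp k affineA1) := Subgroup.closure {g | ∃ j m t, g = rootElt j m t}

variable (k) in
/-- The group generated by the torus and the subgroups `rootElt j m`. -/
def posBorel : Subgroup (Grp k affineA1) := torus k affineA1 ⊔ posRootGroup k

theorem torus_le_posBorel : torus k affineA1 ≤ posBorel k := le_sup_left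

theorem rootElt_mem_posRootGroup (j : Fin 2) (m : ℕ) (t : k) : rootElt j m t ∈ posRootGroup k :=
  Subgroup.subset_closure ⟨j, m, t, rfl⟩

theorem rootElt_mem_posBorel (j : Fin 2) (m : ℕ) (t : k) : rootElt j m t ∈ posBorel k :=
  le_sup_right (α := Subgroup _) (rootElt_mem_posRootGroup j m t)

theorem x_mem_posRootGroup (j : Fin 2) (t : k) : x k affineA1 j t ∈ posRootGroup k := by
  rw [← rootElt_zero]; exact rootElt_mem_posRootGroup j 0 t

theorem x_mem_posBorel (j : Fin 2) (t : k) : x k affineA1 j t ∈ posBorel k :=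
  le_sup_right (α := Subgroup _) (x_mem_posRootGroup j t)

/-- Induction over `posBorel` by multiplication with generators from the left. -/
theorem posBorel_induction {P : Grp k affineA1 → Prop} (one : P 1)
    (tor : ∀ h ∈ torus k affineA1, ∀ g, P g → P (h * g))
    (root : ∀ j m t g, P g → P (rootElt j m t * g)) {g : Grp k affineA1} (hg : g ∈ posBorel k) :
    P g := by
  rw [posBorel, posRootGroup, ← Subgroup.closure_eq (torus k affineA1),
    ← Subgroup.closure_union] at hg
  induction hg using Subgroup.closure_induction_left with
  | one => exact one
  | mul_left y hy z _ hz =>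
    rcases hy with hy | ⟨j, m, t, rfl⟩
    · exact tor y hy z hz
    · exact root j m t z hz
  | inv_mul_cancel y hy z _ hz =>
    rcases hy with hy | ⟨j, m, t, rfl⟩
    · exact tor _ (inv_mem hy) z hz
    · rw [← rootElt_neg]; exact root j m _ z hz

/-- `posBorel k` is the product of the torus and the normalized group `posRootGroup k`. -/
theorem exists_torus_mul_posRootGroup {g : Grp k affineA1} (hg : g ∈ posBorel k) :
    ∃ h ∈ torus k affineA1, ∃ u ∈ posRootGroup k, g = h * u := by
  refine posBorel_induction (P := fun g => ∃ h ∈ torus k affineA1, ∃ u ∈ posRootGroup k, g = h * u)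
    ⟨1, one_mem _, 1, one_mem _, (one_mul 1).symm⟩ ?_ ?_ hg
  · rintro h hh _ ⟨h', hh', u, hu, rfl⟩
    exact ⟨h * h', mul_mem hh hh', u, hu, (mul_assoc _ _ _).symm⟩
  · rintro j m t _ ⟨h, hh, u, hu, rfl⟩
    obtain ⟨c, hc⟩ := exists_torus_mul_rootElt (inv_mem hh) j m
    refine ⟨h, hh, rootElt j m (c * t) * u, mul_mem (rootElt_mem_posRootGroup _ _ _) hu, ?_⟩
    have : rootElt j m t * h = h * rootElt j m (c * t) := by
      rw [← inv_mul_eq_iff_eq_mul, ← mul_assoc, hc, inv_mul_cancel_right]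
    rw [← mul_assoc, this, mul_assoc]

/-- The factorization which puts `x_{\bar i}(a)`, `a ≠ 0`, into the double coset of `s_i`. -/
theorem xbar_eq (i : Fin 2) (a : kˣ) : xbar k affineA1 i a
    = x k affineA1 i (a⁻¹ : kˣ) * weylElt i (-a⁻¹) * x k affineA1 i (a⁻¹ : kˣ) := by
  rw [weylElt, Units.val_neg, ← xsym_inl, ← xsym_inl, ← xsym_inr, ← xsym_inr, xsym_neg]
  simp only [inv_neg, Units.val_neg, inv_inv, neg_neg]
  group

/-- Conjugation by `x i a` and then by `sbar i` keeps the root groups of `α_j + m δ`, `j ≠ i`,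
in `posBorel`. -/
theorem sbar_conj_rootElt_rev_mem (i : Fin 2) (a : k) (m : ℕ) (t : k) :
    (sbar k affineA1 i)⁻¹ * ((x k affineA1 i a)⁻¹ * rootElt i.rev m t * x k affineA1 i a) *
      sbar k affineA1 i ∈ posBorel k := by
  obtain ⟨c, hc⟩ := exists_sbar_mul_rootElt_succ (k := k) i m
  have h1 : (sbar k affineA1 i)⁻¹ * rootElt i.rev m t * sbar k affineA1 i
      = rootElt i (m + 1) ((c⁻¹ : kˣ) * t) := by
    rw [mul_assoc, inv_mul_eq_iff_eq_mul, hc, Units.mul_inv_cancel_left]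
  have h2 : x k affineA1 i a * sbar k affineA1 i = sbar k affineA1 i * xbar k affineA1 i (-a) := by
    rw [sbar_mul_xbar affineA1_self, neg_neg]
  have h3 : (sbar k affineA1 i)⁻¹ * ((x k affineA1 i a)⁻¹ * rootElt i.rev m t * x k affineA1 i a) *
      sbar k affineA1 i
      = (xbar k affineA1 i (-a))⁻¹ * rootElt i (m + 1) ((c⁻¹ : kˣ) * t) *
        xbar k affineA1 i (-a) := by
    rw [← h1]
    calc _ = (x k affineA1 i a * sbar k affineA1 i)⁻¹ * rootElt i.rev m t *
        (x k affineA1 i a * sbar k affineA1 i) := by group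
      _ = _ := by rw [h2]; group
  rw [h3]
  by_cases ha : -a = 0
  · rw [ha, ← xsym_inr, xsym_zero, inv_one, one_mul, mul_one]
    exact rootElt_mem_posBorel _ _ _
  · lift -a to kˣ using (isUnit_iff_ne_zero.2 ha) with b
    have h4 : ∀ s s', x k affineA1 i s * rootElt i (m + 1) s'
        = rootElt i (m + 1) s' * x k affineA1 i s := fun s s' => by
      rw [← rootElt_zero, rootElt_comm]
    have h5 : ∀ s, (weylElt i (-b⁻¹))⁻¹ * rootElt i (m + 1) s * weylElt i (-b⁻¹) ∈ posBorel k := by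
      intro s
      rw [weylElt_inv, weylElt_eq, show (weylElt i (-b⁻¹) : Grp k affineA1)
        = (weylElt i (- -b⁻¹))⁻¹ by rw [weylElt_inv, neg_neg], weylElt_eq, rootElt_succ]
      generalize - -b⁻¹ = d
      have : corootElt k affineA1 i d * (sbar k affineA1 i)⁻¹ *
          (sbar k affineA1 i * rootElt i.rev m s * (sbar k affineA1 i)⁻¹) *
          (corootElt k affineA1 i d * (sbar k affineA1 i)⁻¹)⁻¹
          = corootElt k affineA1 i d * rootElt i.rev m s * (corootElt k affineA1 i d)⁻¹ := by group
      rw [this]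
      have := torus_le_posBorel (corootElt_mem_torus i d)
      exact mul_mem (mul_mem this (rootElt_mem_posBorel _ _ _)) (inv_mem this)
    rw [xbar_eq]
    generalize ((c⁻¹ : kˣ) : k) * t = s
    have h6 : ∀ y w : Grp k affineA1, y * rootElt i (m + 1) s = rootElt i (m + 1) s * y →
        (y * w * y)⁻¹ * rootElt i (m + 1) s * (y * w * y)
        = y⁻¹ * (w⁻¹ * rootElt i (m + 1) s * w) * y := by
      intro y w hy
      have : rootElt i (m + 1) s = y⁻¹ * rootElt i (m + 1) s * y := by
        rw [mul_assoc, ← hy]; group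
      conv_rhs => rw [this]
      group
    rw [h6 _ _ (h4 _ _)]
    exact mul_mem (mul_mem (inv_mem (x_mem_posBorel _ _)) (h5 s)) (x_mem_posBorel _ _)

/-- An element of `posBorel` is the product of an element of the `i`-th simple root subgroup and of an
element which stays in `posBorel` under conjugation by `s_i`. -/
theorem exists_x_mul_of_mem_posBorel (i : Fin 2) {g : Grp k affineA1} (hg : g ∈ posBorel k) :
    ∃ a : k, ∃ q ∈ posBorel k, (sbar k affineA1 i)⁻¹ * q * sbar k affineA1 i ∈ posBorel k ∧
      g = x k affineA1 i a * q := by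
  refine posBorel_induction (P := fun g => ∃ a : k, ∃ q ∈ posBorel k,
    (sbar k affineA1 i)⁻¹ * q * sbar k affineA1 i ∈ posBorel k ∧ g = x k affineA1 i a * q)
    ⟨0, 1, one_mem _, by simp, by rw [← xsym_inl, xsym_zero, one_mul]⟩ ?_ ?_ hg
  · rintro h hh _ ⟨a, q, hq, hq', rfl⟩
    obtain ⟨c, hc⟩ := exists_torus_mul_rootElt hh i 0
    have hc' := hc a
    rw [rootElt_zero, rootElt_zero] at hc'
    refine ⟨c * a, h * q, mul_mem (torus_le_posBorel hh) hq, ?_, by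
      rw [← mul_assoc, hc', mul_assoc]⟩
    have := mul_mem (torus_le_posBorel (sbar_inv_conj_mem_torus i hh)) hq'
    rwa [show (sbar k affineA1 i)⁻¹ * h * sbar k affineA1 i *
      ((sbar k affineA1 i)⁻¹ * q * sbar k affineA1 i)
      = (sbar k affineA1 i)⁻¹ * (h * q) * sbar k affineA1 i by group] at this
  · rintro j m t _ ⟨a, q, hq, hq', rfl⟩
    have main : ∀ y ∈ posBorel k,
        (sbar k affineA1 i)⁻¹ * ((x k affineA1 i a)⁻¹ * y * x k affineA1 i a) *
          sbar k affineA1 i ∈ posBorel k →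
        ∃ a' : k, ∃ q' ∈ posBorel k, (sbar k affineA1 i)⁻¹ * q' * sbar k affineA1 i ∈ posBorel k ∧
          y * (x k affineA1 i a * q) = x k affineA1 i a' * q' := by
      intro y hy hy'
      refine ⟨a, (x k affineA1 i a)⁻¹ * y * x k affineA1 i a * q,
        mul_mem (mul_mem (mul_mem (inv_mem (x_mem_posBorel _ _)) hy) (x_mem_posBorel _ _)) hq,
        ?_, by group⟩
      have := mul_mem hy' hq'
      rwa [show (sbar k affineA1 i)⁻¹ * ((x k affineA1 i a)⁻¹ * y * x k affineA1 i a) *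
          sbar k affineA1 i * ((sbar k affineA1 i)⁻¹ * q * sbar k affineA1 i)
        = (sbar k affineA1 i)⁻¹ * ((x k affineA1 i a)⁻¹ * y * x k affineA1 i a * q) *
          sbar k affineA1 i by group] at this
    rcases eq_or_eq_rev i j with rfl | rfl
    · cases m with
      | zero =>
        refine ⟨t + a, q, hq, hq', ?_⟩
        rw [rootElt_zero, ← mul_assoc, ← xsym_inl, ← xsym_inl, ← xsym_inl, xsym_add]
      | succ m =>
        refine main _ (rootElt_mem_posBorel _ _ _) ?_
        have h4 : rootElt j (m + 1) t * x k affineA1 j a = x k affineA1 j a * rootElt j (m + 1) t := by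
          rw [← rootElt_zero, rootElt_comm]
        rw [mul_assoc _ (rootElt j (m + 1) t), h4, inv_mul_cancel_left, rootElt_succ]
        have := rootElt_mem_posBorel j.rev m t
        rwa [show rootElt j.rev m t = (sbar k affineA1 j)⁻¹ *
          (sbar k affineA1 j * rootElt j.rev m t * (sbar k affineA1 j)⁻¹) * sbar k affineA1 j by
          group] at this
    · exact main _ (rootElt_mem_posBorel _ _ _) (sbar_conj_rootElt_rev_mem i a m t)

end RootGroups

/-! ### Exponentials on the representation `V(a)` -/

section EvaluationAction
open scoped Matrix
open LaurentPolynomial (C T)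

variable {k : Type u} [Field k] {n : ℕ}

/-- The canonical map from pure tensors of vectors over `k[u^{±1}]` to `k[u^{±1}] ⊗ V^{⊗ n}`. -/
def loopTensor (w : Fin n → Fin 2 → k[T;T⁻¹]) : EvalSpace k n :=
  ∑ ε : Fin n → Fin 2, (∏ l, w l (ε l)) ⊗ₜ[k] PiTensorProduct.tprod k fun l => Pi.single (ε l) 1

/-- The coordinate `⨂ e_{b_l}` of a vector of `k[u^{±1}] ⊗ V^{⊗ n}`, for constant `b`. -/
def evalCoord (b : Fin 2) : EvalSpace k n →ₗ[k] k[T;T⁻¹] :=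
  (TensorProduct.rid k k[T;T⁻¹]).toLinearMap ∘ₗ TensorProduct.map LinearMap.id
    (PiTensorProduct.lift ((MultilinearMap.mkPiAlgebra k (Fin n) k).compLinearMap
      fun _ => LinearMap.proj b))

theorem evalCoord_loopTensor (b : Fin 2) (w : Fin n → Fin 2 → k[T;T⁻¹]) :
    evalCoord b (loopTensor w) = ∏ l, w l b := by
  rw [loopTensor, map_sum, Finset.sum_eq_single fun _ => b]
  · simp [evalCoord]
  · intro ε _ hε
    obtain ⟨l, hl⟩ := Function.ne_iff.1 hε
    simp only [evalCoord, LinearMap.comp_apply, TensorProduct.map_tmul, PiTensorProduct.lift.tprod,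
      MultilinearMap.compLinearMap_apply, MultilinearMap.mkPiAlgebra_apply, LinearMap.proj_apply]
    have h0 : (∏ i, (Pi.single (ε i) 1 : Fin 2 → k) b) = 0 :=
      Finset.prod_eq_zero (Finset.mem_univ l) (by rw [Pi.single_apply, if_neg (Ne.symm hl)])
    simp [h0]
  · simp

theorem evalProj_eq (y : EvalSpace k n) : evalProj k n y = (evalCoord 0 y).coeff 0 := by
  induction y using TensorProduct.induction_on with
  | zero => simp
  | tmul p q => 
    simp only [evalProj, evalCoord, LinearMap.comp_apply, TensorProduct.map_tmul,
      LinearMap.mul'_apply, LinearEquiv.coe_coe, TensorProduct.rid_tmul, LinearMap.id_apply]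
    rw [mul_comm]; rfl
  | add p q hp hq => rw [map_add, map_add, hp, hq]; rfl

theorem evalVector_eq : evalVector k n = loopTensor fun _ => Pi.single 0 1 := by
  rw [loopTensor, Finset.sum_eq_single fun _ => 0]
  · simp [evalVector]
  · intro ε _ hε
    obtain ⟨l, hl⟩ := Function.ne_iff.1 hε
    have h0 : (∏ i, (Pi.single 0 1 : Fin 2 → k[T;T⁻¹]) (ε i)) = 0 :=
      Finset.prod_eq_zero (Finset.mem_univ l) (by rw [Pi.single_apply, if_neg hl])
    rw [h0, TensorProduct.zero_tmul]
  · simp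

/-- The summand of `evalOp` for one tensor factor. -/
def slotOp (p : ℤ) (X : Matrix (Fin 2) (Fin 2) k) (l : Fin n) : Module.End k (EvalSpace k n) :=
  TensorProduct.map (LinearMap.mulLeft k (T p : k[T;T⁻¹]))
    (slot l (Matrix.toLin' X))

theorem evalOp_eq_sum (p : ℤ) (X : Fin n → Matrix (Fin 2) (Fin 2) k) :
    evalOp p X = ∑ l, slotOp p (X l) l := by
  simp only [evalOp, slotSum, slotOp]
  exact map_sum (TensorProduct.mapBilinear (RingHom.id k) k[T;T⁻¹] (TensorPower k n) k[T;T⁻¹]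
    (TensorPower k n) (LinearMap.mulLeft k (T p : k[T;T⁻¹]))) _ _

/-- The matrix `u ^ p X`. -/
def loopMatrix (p : ℤ) (X : Matrix (Fin 2) (Fin 2) k) : Matrix (Fin 2) (Fin 2) k[T;T⁻¹] :=
  Matrix.of fun i j => C (X i j) * T p

theorem slot_tprod (l : Fin n) (X : Matrix (Fin 2) (Fin 2) k) (ε : Fin n → Fin 2) :
    slot l (Matrix.toLin' X) (PiTensorProduct.tprod k fun l => Pi.single (ε l) 1)
      = ∑ b, X b (ε l) • PiTensorProduct.tprod k fun l' => Pi.single (Function.update ε l b l') 1 := by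
  rw [slot, PiTensorProduct.map_tprod]
  have h1 : (fun i => (Pi.mulSingle (M := fun _ : Fin n => Module.End k (Fin 2 → k)) l
      (Matrix.toLin' X) i) (Pi.single (ε i) 1))
      = Function.update (fun i => (Pi.single (ε i) 1 : Fin 2 → k)) l
        (∑ b, X b (ε l) • Pi.single b 1) := by
    funext i
    by_cases hi : i = l
    · subst hi
      rw [Pi.mulSingle_eq_same, Function.update_self, Matrix.toLin'_apply, Matrix.mulVec_single_one]
      funext b
      simp [Pi.single_apply]
    · rw [Pi.mulSingle_eq_of_ne hi, Function.update_of_ne hi]; rfl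
  rw [h1, MultilinearMap.map_update_sum]
  refine Finset.sum_congr rfl fun b _ => ?_
  rw [MultilinearMap.map_update_smul]
  congr 2
  funext i
  by_cases hi : i = l
  · subst hi; simp
  · simp [Function.update_of_ne hi]

theorem slotOp_loopTensor (p : ℤ) (X : Matrix (Fin 2) (Fin 2) k) (l : Fin n)
    (w : Fin n → Fin 2 → k[T;T⁻¹]) : slotOp p X l (loopTensor w)
      = loopTensor (Function.update w l (loopMatrix p X *ᵥ w l)) := by
  have hprod : ∀ (v : Fin 2 → k[T;T⁻¹]) (ε : Fin n → Fin 2),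
      ∏ i, Function.update w l v i (ε i) = v (ε l) * ∏ i ∈ Finset.univ.erase l, w i (ε i) := by
    intro v ε
    rw [← Finset.mul_prod_erase _ _ (Finset.mem_univ l), Function.update_self]
    congr 1
    exact Finset.prod_congr rfl fun i hi => by rw [Function.update_of_ne (Finset.ne_of_mem_erase hi)]
  rw [loopTensor, loopTensor, map_sum]
  have hL : ∀ ε : Fin n → Fin 2, slotOp p X l ((∏ i, w i (ε i)) ⊗ₜ[k]
      PiTensorProduct.tprod k fun i => Pi.single (ε i) 1)
      = ∑ b, (C (X b (ε l)) * T p * w l (ε l) *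
        ∏ i ∈ Finset.univ.erase l, w i (ε i)) ⊗ₜ[k]
        PiTensorProduct.tprod k fun i => Pi.single (Function.update ε l b i) 1 := by
    intro ε
    rw [slotOp, TensorProduct.map_tmul, slot_tprod, TensorProduct.tmul_sum]
    refine Finset.sum_congr rfl fun b _ => ?_
    rw [TensorProduct.tmul_smul, TensorProduct.smul_tmul', LinearMap.mulLeft_apply,
      ← Finset.mul_prod_erase _ _ (Finset.mem_univ l), LaurentPolynomial.smul_eq_C_mul]
    congr 1; ring
  have hR : ∀ ε : Fin n → Fin 2, (∏ i, Function.update w l (loopMatrix p X *ᵥ w l) i (ε i)) ⊗ₜ[k]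
      (PiTensorProduct.tprod k fun i => (Pi.single (ε i) 1 : Fin 2 → k))
      = ∑ b, (C (X (ε l) b) * T p * w l b *
        ∏ i ∈ Finset.univ.erase l, w i (ε i)) ⊗ₜ[k]
        PiTensorProduct.tprod k fun i => Pi.single (ε i) 1 := by
    intro ε
    rw [hprod, Matrix.mulVec, dotProduct, Finset.sum_mul, TensorProduct.sum_tmul]
    rfl
  rw [Finset.sum_congr rfl fun ε _ => hL ε, Finset.sum_congr rfl fun ε _ => hR ε,
    ← Finset.sum_product', ← Finset.sum_product']
  -- exchange the new and the old value at `l`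
  refine Finset.sum_nbij' (fun q => (Function.update q.1 l q.2, q.1 l))
    (fun q => (Function.update q.1 l q.2, q.1 l)) (by simp) (by simp) (by simp) (by simp) ?_
  rintro ⟨ε, b⟩ -
  simp only [Function.update_self]
  congr 2
  exact Finset.prod_congr rfl fun i hi => by rw [Function.update_of_ne (Finset.ne_of_mem_erase hi)]

theorem loopTensor_update_add (w : Fin n → Fin 2 → k[T;T⁻¹]) (l : Fin n)
    (u v : Fin 2 → k[T;T⁻¹]) : loopTensor (Function.update w l (u + v))
      = loopTensor (Function.update w l u) + loopTensor (Function.update w l v) := by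
  simp only [loopTensor, ← Finset.sum_add_distrib, ← TensorProduct.add_tmul]
  refine Finset.sum_congr rfl fun ε _ => ?_
  congr 1
  simp only [← Finset.mul_prod_erase _ _ (Finset.mem_univ l), Function.update_self, Pi.add_apply]
  have h : ∀ v : Fin 2 → k[T;T⁻¹], ∏ i ∈ Finset.univ.erase l, Function.update w l v i (ε i)
      = ∏ i ∈ Finset.univ.erase l, w i (ε i) := fun v =>
    Finset.prod_congr rfl fun i hi => by rw [Function.update_of_ne (Finset.ne_of_mem_erase hi)]
  rw [h, h, h, add_mul]

theorem slotOp_mul_self (p : ℤ) {X : Matrix (Fin 2) (Fin 2) k} (hX : X * X = 0) (l : Fin n) :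
    slotOp p X l * slotOp p X l = 0 := by
  rw [slotOp, ← TensorProduct.map_mul, ← slot_mul, Module.End.mul_eq_comp _ (Matrix.toLin' X),
    ← Matrix.toLin'_mul, hX, map_zero]
  have h0 : slot l (0 : Module.End k (Fin 2 → k)) = 0 := by
    simpa using slot_smul l (0 : k) 0
  rw [h0, TensorProduct.map_zero_right]

theorem slotOp_commute (p q : ℤ) (X Y : Matrix (Fin 2) (Fin 2) k) {l m : Fin n} (h : l ≠ m) :
    Commute (slotOp p X l) (slotOp q Y m) := by
  have hT : LinearMap.mulLeft k (T p : k[T;T⁻¹]) *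
      LinearMap.mulLeft k (T q : k[T;T⁻¹])
      = LinearMap.mulLeft k (T q : k[T;T⁻¹]) *
        LinearMap.mulLeft k (T p : k[T;T⁻¹]) := by
    exact LinearMap.ext fun y => mul_left_comm _ _ _
  rw [Commute, SemiconjBy, slotOp, slotOp, ← TensorProduct.map_mul, ← TensorProduct.map_mul, hT,
    (slot_commute h _ _).eq]

theorem locallyNilpotent_of_mul_self {V : Type u} [AddCommGroup V] [Module k V]
    {S : Module.End k V} (h : S * S = 0) : LocallyNilpotent S :=
  fun v => ⟨2, by rw [pow_two, h]; rfl⟩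

variable [CharZero k]

/-- The exponential of `evalOp p X`, for square-zero `X l`, acts factor by factor. -/
theorem expEnd_evalOp (p : ℤ) {X : Fin n → Matrix (Fin 2) (Fin 2) k} (hX : ∀ l, X l * X l = 0)
    (t : k) : ∃ h : LocallyNilpotent (t • evalOp p X), ∀ w : Fin n → Fin 2 → k[T;T⁻¹],
      expEnd (t • evalOp p X) h (loopTensor w)
        = loopTensor fun l => (1 + loopMatrix p (t • X l)) *ᵥ w l := by
  have hs : ∀ l, t • slotOp p (X l) l = slotOp p (t • X l) l := fun l => by
    rw [slotOp, slotOp, map_smul, slot_smul, TensorProduct.map_smul_right]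
  have hX' : ∀ l, (t • X l) * (t • X l) = 0 := fun l => by simp [hX]
  have key : ∀ S : Finset (Fin n), ∃ h : LocallyNilpotent (∑ l ∈ S, slotOp p (t • X l) l),
      ∀ w : Fin n → Fin 2 → k[T;T⁻¹], expEnd _ h (loopTensor w)
        = loopTensor fun l => if l ∈ S then (1 + loopMatrix p (t • X l)) *ᵥ w l else w l := by
    intro S
    induction S using Finset.induction_on with
    | empty =>
      have h0 : LocallyNilpotent (0 : Module.End k (EvalSpace k n)) := fun v => ⟨1, by simp⟩
      refine ⟨by rw [Finset.sum_empty]; exact h0, fun w => ?_⟩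
      rw [expEnd_congr Finset.sum_empty _ h0, expEnd_zero]
      simp
    | insert m S hm ih =>
      obtain ⟨h, ih⟩ := ih
      have hm' := locallyNilpotent_of_mul_self (slotOp_mul_self p (hX' m) m)
      have hc : Commute (slotOp p (t • X m) m) (∑ l ∈ S, slotOp p (t • X l) l) :=
        Commute.sum_right _ _ _ fun l hl => slotOp_commute _ _ _ _ (by rintro rfl; exact hm hl)
      have hadd := hm'.add h hc
      refine ⟨by rw [Finset.sum_insert hm]; exact hadd, fun w => ?_⟩
      rw [expEnd_congr (Finset.sum_insert hm) _ hadd, expEnd_add hm' h hadd hc,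
        Module.End.mul_apply, ih, expEnd_two hm' (by
          rw [← Module.End.mul_apply, slotOp_mul_self p (hX' m)]; rfl), slotOp_loopTensor]
      set w' : Fin n → Fin 2 → k[T;T⁻¹] :=
        fun l => if l ∈ S then (1 + loopMatrix p (t • X l)) *ᵥ w l else w l with hw'
      have hwm : w' m = w m := by simp [hw', hm]
      conv_lhs => rw [← Function.update_eq_self m w']
      rw [Function.update_idem, if_neg hm, ← loopTensor_update_add]
      congr 1
      funext l
      by_cases hl : l = m
      · subst hl
        rw [Function.update_self, if_pos (Finset.mem_insert_self _ _), Matrix.add_mulVec,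
          Matrix.one_mulVec, hwm]
      · rw [Function.update_of_ne hl]
        simp [hw', hl]
  obtain ⟨h, H⟩ := key Finset.univ
  have h1 : t • evalOp p X = ∑ l, slotOp p (t • X l) l := by
    rw [evalOp_eq_sum, Finset.smul_sum]; exact Finset.sum_congr rfl fun l _ => hs l
  refine ⟨by rw [h1]; exact h, fun w => ?_⟩
  rw [expEnd_congr h1 _ h, H]
  simp

end EvaluationAction

/-! ### The homomorphism to the loop group of `SL₂` -/

section LoopMatrices
open scoped Matrix
open LaurentPolynomial (C T)

variable {k : Type u} [Field k] {n : ℕ}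

/-- The matrices by which `x_i(t)` and `x_{\bar i}(t)` act on the tensor factor of `V(a)` with
parameter `a`. -/
def loopSym (a : kˣ) : Fin 2 ⊕ Fin 2 → k → Matrix (Fin 2) (Fin 2) k[T;T⁻¹]
  | .inl 0, t => !![1, 0; C (a * t) * T 1, 1]
  | .inl 1, t => !![1, C t; 0, 1]
  | .inr 0, t => !![1, C ((a⁻¹ : kˣ) * t) * T (-1); 0, 1]
  | .inr 1, t => !![1, 0; C t, 1]

variable [CharZero k]

theorem loopSym_spec (a : Fin n → kˣ) (s : Fin 2 ⊕ Fin 2) : ∃ (p : ℤ)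
    (X : Fin n → Matrix (Fin 2) (Fin 2) k), evalRep a (rootVector s) = evalOp p X ∧
      (∀ l, X l * X l = 0) ∧ ∀ l t, loopSym (a l) s t = 1 + loopMatrix p (t • X l) := by
  have hg : ∀ g, evalRep a (gen k affineA1 g) = evalGen a g := liftRep_gen _ _
  rcases s with i | i <;> fin_cases i
  · refine ⟨1, _, hg (.E 0), fun l => ?_, fun l t => ?_⟩
    · ext i j; fin_cases i <;> fin_cases j <;> simp
    · ext1 i j; fin_cases i <;> fin_cases j <;> simp [loopSym, loopMatrix, mul_comm t]
  · refine ⟨0, _, hg (.E 1), fun l => ?_, fun l t => ?_⟩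
    · ext i j; fin_cases i <;> fin_cases j <;> simp
    · ext i j; fin_cases i <;> fin_cases j <;> simp [loopSym, loopMatrix]
  · refine ⟨-1, _, hg (.F 0), fun l => ?_, fun l t => ?_⟩
    · ext i j; fin_cases i <;> fin_cases j <;> simp
    · ext1 i j; fin_cases i <;> fin_cases j <;> simp [loopSym, loopMatrix, mul_comm t]
  · refine ⟨0, _, hg (.F 1), fun l => ?_, fun l t => ?_⟩
    · ext i j; fin_cases i <;> fin_cases j <;> simp
    · ext i j; fin_cases i <;> fin_cases j <;> simp [loopSym, loopMatrix]

theorem isIntegrable_evalRep (a : Fin n → kˣ) : IsIntegrable (evalRep a) := by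
  have : ∀ s, LocallyNilpotent (evalRep a (rootVector s)) := fun s => by
    obtain ⟨p, X, h1, h2, -⟩ := loopSym_spec a s
    obtain ⟨h, -⟩ := expEnd_evalOp p h2 (1 : k)
    rw [h1]; rwa [one_smul] at h
  exact fun i => ⟨this (.inl i), this (.inr i)⟩

theorem actOn_xsym_loopTensor (a : Fin n → kˣ) (s : Fin 2 ⊕ Fin 2) (t : k)
    (w : Fin n → Fin 2 → k[T;T⁻¹]) :
    actOn (isIntegrable_evalRep a) (xsym s t) (loopTensor w)
      = loopTensor fun l => loopSym (a l) s t *ᵥ w l := by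
  obtain ⟨p, X, h1, h2, h3⟩ := loopSym_spec a s
  obtain ⟨h, H⟩ := expEnd_evalOp p h2 t
  rw [actOn_xsym, expEnd_congr (by rw [h1]) _ h, H]
  simp only [h3]

theorem loopSym_mul_neg (a : kˣ) (s : Fin 2 ⊕ Fin 2) (t : k) :
    loopSym a s t * loopSym a s (-t) = 1 := by
  rcases s with i | i <;> fin_cases i <;> ext i j <;> fin_cases i <;> fin_cases j <;>
    simp [loopSym, Matrix.mul_apply, Fin.sum_univ_two]

/-- `loopSym a s t` as a unit. -/
def loopUnit (a : kˣ) (s : Symbols k 2) : (Matrix (Fin 2) (Fin 2) k[T;T⁻¹])ˣ where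
  val := loopSym a s.1 s.2
  inv := loopSym a s.1 (-s.2)
  val_inv := loopSym_mul_neg a s.1 s.2
  inv_val := by simpa using loopSym_mul_neg a s.1 (-s.2)

theorem actOn_word_loopTensor (a : Fin n → kˣ) (q : FreeGroup (Symbols k 2))
    (w : Fin n → Fin 2 → k[T;T⁻¹]) :
    actOn (isIntegrable_evalRep a) (QuotientGroup.mk q) (loopTensor w)
      = loopTensor fun l =>
        (FreeGroup.lift (loopUnit (a l)) q : Matrix (Fin 2) (Fin 2) k[T;T⁻¹]) *ᵥ w l := by
  induction q using FreeGroup.induction_on generalizing w with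
  | C1 =>
    simp only [map_one, Units.val_one, Matrix.one_mulVec]
    exact actOn_one _ _
  | of s =>
    simp only [FreeGroup.lift_apply_of]
    exact actOn_xsym_loopTensor a s.1 s.2 w
  | inv_of s _ =>
    simp only [map_inv, FreeGroup.lift_apply_of]
    have h1 : (QuotientGroup.mk (FreeGroup.of s)⁻¹ : Grp k affineA1) = xsym s.1 (-s.2) :=
      (xsym_neg s.1 s.2).symm
    rw [h1]
    exact actOn_xsym_loopTensor a s.1 (-s.2) w
  | mul p q hp hq =>
    rw [QuotientGroup.mk_mul, actOn_mul, hq, hp]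
    simp only [map_mul, Units.val_mul, Matrix.mulVec_mulVec]

theorem loopTensor_injective : Function.Injective fun w : Fin 2 → k[T;T⁻¹] =>
    (loopTensor fun _ => w : EvalSpace k 1) := by
  intro v w h
  funext b
  have := congrArg (evalCoord b) h
  simpa [evalCoord_loopTensor] using this

/-- The homomorphism from the Kac-Moody group to matrices over `k[u^{±1}]` (the loop group of
`SL₂`), rescaled by the parameter `a`. -/
def loopHom (a : kˣ) : Grp k affineA1 →* (Matrix (Fin 2) (Fin 2) k[T;T⁻¹])ˣ :=
  QuotientGroup.lift (trivialWords k affineA1) (FreeGroup.lift (loopUnit a)) fun q hq => by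
    have h1 := actOn_word_loopTensor (fun _ : Fin 1 => a) q
    rw [(QuotientGroup.eq_one_iff q).2 hq] at h1
    ext1
    rw [Units.val_one, Matrix.ext_iff_mulVec]
    intro v
    refine loopTensor_injective (k := k) ?_
    refine (h1 fun _ => v).symm.trans ?_
    rw [Matrix.one_mulVec]
    exact actOn_one _ _

theorem loopHom_xsym (a : kˣ) (s : Fin 2 ⊕ Fin 2) (t : k) :
    (loopHom a (xsym s t) : Matrix (Fin 2) (Fin 2) k[T;T⁻¹]) = loopSym a s t := by
  have : loopHom a (xsym s t) = loopUnit a (s, t) := FreeGroup.lift_apply_of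
  rw [this]; rfl

theorem actOn_loopTensor (a : Fin n → kˣ) (g : Grp k affineA1) (w : Fin n → Fin 2 → k[T;T⁻¹]) :
    actOn (isIntegrable_evalRep a) g (loopTensor w)
      = loopTensor fun l => (loopHom (a l) g : Matrix (Fin 2) (Fin 2) k[T;T⁻¹]) *ᵥ w l := by
  obtain ⟨q, rfl⟩ := QuotientGroup.mk_surjective g
  exact actOn_word_loopTensor a q w

/-- The minor of `V(a)` is the constant term of the product of the upper left entries of the loop
matrices. -/
theorem evalMinor_eq (a : Fin n → kˣ) (g : Grp k affineA1) : evalMinor a g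
    = (∏ l, (loopHom (a l) g : Matrix (Fin 2) (Fin 2) k[T;T⁻¹]) 0 0).coeff 0 := by
  rw [evalMinor, act_eq_actOn (isIntegrable_evalRep a), evalVector_eq, actOn_loopTensor,
    evalProj_eq, evalCoord_loopTensor]
  simp

theorem loopHom_sbar_zero (a : kˣ) : (loopHom a (sbar k affineA1 0) : Matrix (Fin 2) (Fin 2) _)
    = !![0, C ((a⁻¹ : kˣ) : k) * T (-1);
      -(C (a : k) * T 1), 0] := by
  simp only [sbar, map_mul, Units.val_mul, ← xsym_inl, ← xsym_inr, loopHom_xsym]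
  have h1 : C ((a : k)⁻¹) * T (-1) *
      (C (a : k) * T 1) = 1 := by
    rw [mul_mul_mul_comm, ← map_mul, ← LaurentPolynomial.T_add]; simp
  ext1 i j
  fin_cases i <;> fin_cases j <;> simp [loopSym, Matrix.mul_apply, Fin.sum_univ_two]
  · linear_combination -h1
  · left; linear_combination -h1
  · linear_combination -h1

theorem loopHom_sbar_one (a : kˣ) : (loopHom a (sbar k affineA1 1) : Matrix (Fin 2) (Fin 2) _)
    = (!![0, -1; 1, 0] : Matrix (Fin 2) (Fin 2) k[T;T⁻¹]) := by
  simp only [sbar, map_mul, Units.val_mul, ← xsym_inl, ← xsym_inr, loopHom_xsym]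
  ext1 i j
  fin_cases i <;> fin_cases j <;> simp [loopSym, Matrix.mul_apply, Fin.sum_univ_two]

theorem loopHom_corootElt_zero (a t : kˣ) :
    (loopHom a (corootElt k affineA1 0 t) : Matrix (Fin 2) (Fin 2) _)
    = !![C ((t⁻¹ : kˣ) : k), 0; 0, C (t : k)] := by
  simp only [corootElt, map_mul, Units.val_mul, ← xsym_inl, ← xsym_inr, loopHom_xsym,
    loopHom_sbar_zero]
  have h1 : C ((a : k)⁻¹) * T (-1) *
      (C (a : k) * T 1) = 1 := by
    rw [mul_mul_mul_comm, ← map_mul, ← LaurentPolynomial.T_add]; simp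
  have h2 : C (t : k) * C ((t : k)⁻¹) = 1 := by
    rw [← map_mul]; simp
  ext1 i j
  fin_cases i <;> fin_cases j <;> simp [loopSym, Matrix.mul_apply, Fin.sum_univ_two]
  · linear_combination C ((t : k)⁻¹) * h1
  · left
    linear_combination -h1 - C ((a : k)⁻¹) * T (-1) *
      (C (a : k) * T 1) * h2
  · left
    linear_combination -h1 - C ((a : k)⁻¹) * T (-1) *
      (C (a : k) * T 1) * h2
  · have h3 : C (a : k) * C (t : k) * T 1 *
        (C ((a : k)⁻¹) * C ((t : k)⁻¹) *
          T (-1)) = 1 := by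
      linear_combination h1 + C ((a : k)⁻¹) * T (-1) *
        (C (a : k) * T 1) * h2
    rw [h3]
    linear_combination C (t : k) * h1

theorem loopHom_corootElt_one (a t : kˣ) :
    (loopHom a (corootElt k affineA1 1 t) : Matrix (Fin 2) (Fin 2) _)
    = !![C (t : k), 0; 0, C ((t⁻¹ : kˣ) : k)] := by
  simp only [corootElt, map_mul, Units.val_mul, ← xsym_inl, ← xsym_inr, loopHom_xsym,
    loopHom_sbar_one]
  have h1 : C (t : k) * C ((t : k)⁻¹) = 1 := by
    rw [← map_mul]; simp
  ext1 i j
  fin_cases i <;> fin_cases j <;> simp [loopSym, Matrix.mul_apply, Fin.sum_univ_two]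
  · linear_combination -h1
  · linear_combination h1
  · linear_combination -h1

/-- The upper left entry of the loop matrix of a product of the shape considered in the evaluation
formula. -/
theorem loopHom_factored (a : kˣ) (t₁' t₂' h₁ h₂ t₂ t₁ : kˣ) :
    (loopHom a (xbar k affineA1 0 t₁' * xbar k affineA1 1 t₂' * corootElt k affineA1 0 h₁ *
        corootElt k affineA1 1 h₂ * x k affineA1 1 t₂ * x k affineA1 0 t₁) :
        Matrix (Fin 2) (Fin 2) k[T;T⁻¹]) 0 0
      = C ((h₂ / h₁ : k) + t₁ * t₁' * (h₂ / h₁ : k)⁻¹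
          + (h₂ / h₁ : k) * (t₁ * t₁') * (t₂ * t₂'))
        + (C ((h₂ / h₁ : k) * t₁ * t₂ * a) * T 1
        + C ((h₂ / h₁ : k) * t₁' * t₂' * (a : k)⁻¹) *
          T (-1)) := by
  simp only [map_mul, Units.val_mul, ← xsym_inl, ← xsym_inr, loopHom_xsym, loopHom_corootElt_zero,
    loopHom_corootElt_one]
  have h1 : T (-1) * T 1 = (1 : k[T;T⁻¹]) := by
    rw [← LaurentPolynomial.T_add]; simp
  have h2 : C (a : k) * C ((a : k)⁻¹) = 1 := by
    rw [← map_mul]; simp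
  have h3 : C (h₁ : k) * C ((h₁ : k)⁻¹) = 1 := by
    rw [← map_mul]; simp
  have h4 : C (h₂ : k) * C ((h₂ : k)⁻¹) = 1 := by
    rw [← map_mul]; simp
  simp [loopSym, Matrix.mul_apply, Fin.sum_univ_two, div_eq_mul_inv]
  generalize C (a : k) = α at *
  generalize C ((a : k)⁻¹) = α' at *
  generalize C (h₁ : k) = β at *
  generalize C ((h₁ : k)⁻¹) = β' at *
  generalize C (h₂ : k) = γ at *
  generalize C ((h₂ : k)⁻¹) = γ' at *
  generalize T (R := k) (1 : ℤ) = y at *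
  generalize T (R := k) (-1 : ℤ) = y' at *
  generalize C (t₁ : k) = s₁ at *
  generalize C (t₂ : k) = s₂ at *
  generalize C (t₁' : k) = s₁' at *
  generalize C (t₂' : k) = s₂' at *
  linear_combination (s₁ * s₁' * (β * γ') + γ * β' * (s₁ * s₁') * (s₂ * s₂')) * (α * α') * h1 +
    (s₁ * s₁' * (β * γ') + γ * β' * (s₁ * s₁') * (s₂ * s₂')) * h2

end LoopMatrices

/-! ### The evaluation formula on factored elements -/

section EvaluationFormula
open LaurentPolynomial (C T)
variable {k : Type u} [Field k] {n : ℕ}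

/-- The constant term of a product of Laurent trinomials. -/
theorem coeff_prod_trinomial (a : Fin n → kˣ) (α β γ : k) :
    (∏ l, (C α + (C (β * a l) * T 1
      + C (γ * (a l : k)⁻¹) * T (-1)))).coeff 0
      = ∑ r ∈ Finset.range (n + 1), α ^ (n - 2 * r) * (β * γ) ^ r * sCoeff a r := by
  have h1 : ∀ I : Finset (Fin n), ∏ l ∈ I, C (β * a l) * T 1
      = C (β ^ I.card * ∏ l ∈ I, (a l : k)) * T (I.card : ℤ) := by
    intro I
    rw [Finset.prod_mul_distrib, ← map_prod, Finset.prod_mul_distrib, Finset.prod_const,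
      Finset.prod_const, LaurentPolynomial.T_pow, mul_one]
  have h2 : ∀ I : Finset (Fin n),
      ∏ l ∈ I, C (γ * (a l : k)⁻¹) * T (-1)
      = C (γ ^ I.card * (∏ l ∈ I, (a l : k))⁻¹) *
        T (-(I.card : ℤ)) := by
    intro I
    rw [Finset.prod_mul_distrib, ← map_prod, Finset.prod_mul_distrib, Finset.prod_const,
      Finset.prod_const, LaurentPolynomial.T_pow, Finset.prod_inv_distrib]
    simp
  have h3 : ∀ I J : Finset (Fin n), Disjoint I J → ((Finset.univ \ I) \ J).card
      = n - (I.card + J.card) := fun I J h => by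
    rw [sdiff_sdiff_left, Finset.sup_eq_union, Finset.card_sdiff_of_subset (Finset.subset_univ _),
      Finset.card_union_of_disjoint h, Finset.card_univ, Fintype.card_fin]
  have key : ∏ l, (C α + (C (β * a l) * T 1
      + C (γ * (a l : k)⁻¹) * T (-1)))
      = ∑ p : Finset (Fin n) × Finset (Fin n) with Disjoint p.1 p.2,
        C (α ^ (n - (p.1.card + p.2.card)) * (β ^ p.1.card * γ ^ p.2.card) *
          ((∏ l ∈ p.1, (a l : k)) / ∏ l ∈ p.2, (a l : k))) *
        T ((p.1.card : ℤ) - p.2.card) := by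
    -- `I` and `J` are the sets of factors from which the terms with `u` and `u⁻¹` are chosen
    rw [Finset.sum_filter, Fintype.sum_prod_type]
    simp only [add_left_comm (C α)]
    rw [Finset.prod_add, Finset.powerset_univ]
    refine Finset.sum_congr rfl fun I _ => ?_
    simp only [add_comm (C α)]
    rw [Finset.prod_add, ← Finset.sum_filter, Finset.mul_sum]
    refine Finset.sum_congr ?_ fun J hJ => ?_
    · ext J
      simp [Finset.subset_sdiff, disjoint_comm]
    · have hJ' : Disjoint I J := (Finset.mem_filter.1 hJ).2
      rw [h1, h2, Finset.prod_const, h3 I J hJ', sub_eq_add_neg, LaurentPolynomial.T_add,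
        div_eq_mul_inv]
      simp only [map_mul, map_pow]
      ring
  have hc : ∀ (c : k) (m : ℤ), (C c * T m).coeff 0
      = if m = 0 then c else 0 := fun c m => by
    rw [← LaurentPolynomial.single_eq_C_mul_T]
    exact Finsupp.single_apply
  rw [key, AddMonoidAlgebra.coeff_sum, Finset.sum_apply']
  simp only [hc, sCoeff, Finset.mul_sum]
  rw [← Finset.sum_filter, Finset.filter_filter]
  -- only pairs with `|I| = |J|` contribute to the constant term
  rw [← Finset.sum_fiberwise_of_maps_to (g := fun p => p.1.card) (t := Finset.range (n + 1))]
  · refine Finset.sum_congr rfl fun r _ => ?_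
    rw [Finset.filter_filter]
    refine Finset.sum_congr ?_ fun p hp => ?_
    · ext p
      simp only [Finset.mem_filter, Finset.mem_univ, true_and]
      constructor
      · rintro ⟨⟨h1, h2⟩, h3⟩
        exact ⟨h3, by omega, h1⟩
      · rintro ⟨h1, h2, h3⟩
        exact ⟨⟨h3, by omega⟩, h1⟩
    · obtain ⟨-, hp1, hp2, -⟩ := Finset.mem_filter.1 hp
      rw [hp1, hp2, mul_pow, two_mul]
  · intro p _
    have := Finset.card_le_univ p.1
    rw [Fintype.card_fin] at this
    exact Finset.mem_range.2 (by omega)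

theorem sCoeff_eq_zero (a : Fin n → kˣ) {r : ℕ} (h : n < 2 * r) : sCoeff a r = 0 := by
  refine Finset.sum_eq_zero fun p hp => ?_
  obtain ⟨h1, h2, h3⟩ := (Finset.mem_filter.1 hp).2
  have := Finset.card_le_univ (p.1 ∪ p.2)
  rw [Finset.card_union_of_disjoint h3, Fintype.card_fin] at this
  omega

theorem trinomial_pow {q : k} (hq : q ≠ 0) (X Y : k) (N : ℕ) :
    (q + X * q⁻¹ + q * X * Y) ^ N = ∑ m ∈ Finset.range (N + 1), ∑ l ∈ Finset.range (m + 1),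
      (m.choose l : k) * (N.choose m : k) * X ^ m * Y ^ (m - l) * q ^ ((N : ℤ) - 2 * l) := by
  have h1 : q + X * q⁻¹ + q * X * Y = X * q⁻¹ * (1 + q ^ 2 * Y) + q := by field_simp; ring
  rw [h1, add_pow]
  refine Finset.sum_congr rfl fun m hm => ?_
  have hm' : m ≤ N := Nat.lt_succ_iff.1 (Finset.mem_range.1 hm)
  rw [mul_pow, add_pow, Finset.mul_sum, Finset.sum_mul, Finset.sum_mul]
  refine Finset.sum_congr rfl fun l hl => ?_
  have hl' : l ≤ m := Nat.lt_succ_iff.1 (Finset.mem_range.1 hl)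
  have h2 : q ^ ((N : ℤ) - 2 * l) = (q⁻¹) ^ m * (q ^ 2) ^ (m - l) * q ^ (N - m) := by
    rw [← pow_mul, ← zpow_natCast q (2 * (m - l)), ← zpow_natCast q (N - m), ← zpow_natCast q⁻¹ m,
      inv_zpow', ← zpow_add₀ hq, ← zpow_add₀ hq]
    congr 1
    push_cast [hm', hl']
    ring
  rw [h2, one_pow, mul_pow, mul_pow]
  ring

/-- The resummation behind the definition of `dCoeff`. -/
theorem sum_sCoeff_eq_sum_dCoeff (a : Fin n → kˣ) {q : k} (hq : q ≠ 0) (X Y : k) :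
    ∑ r ∈ Finset.range (n + 1), (q + X * q⁻¹ + q * X * Y) ^ (n - 2 * r) * (q ^ 2 * X * Y) ^ r *
        sCoeff a r
      = ∑ m ∈ Finset.range (n + 1), ∑ l ∈ Finset.range (m + 1),
        dCoeff a m l * X ^ m * Y ^ (m - l) * q ^ ((n : ℤ) - 2 * l) := by
  have h1 : ∀ r ∈ Finset.range (n + 1), (q + X * q⁻¹ + q * X * Y) ^ (n - 2 * r) *
      (q ^ 2 * X * Y) ^ r * sCoeff a r = ∑ m ∈ Finset.range (n + 1), ∑ l ∈ Finset.range (m + 1),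
        if r ≤ m then ((m - r).choose l : k) * ((n - 2 * r).choose (m - r) : k) * sCoeff a r *
          X ^ m * Y ^ (m - l) * q ^ ((n : ℤ) - 2 * l) else 0 := by
    intro r hr
    rcases lt_or_ge n (2 * r) with hn | hn
    · simp [sCoeff_eq_zero a hn]
    obtain ⟨N, rfl⟩ := Nat.exists_eq_add_of_le hn
    rw [Nat.add_sub_cancel_left, trinomial_pow hq, Finset.sum_mul, Finset.sum_mul,
      show 2 * r + N + 1 = r + (N + 1 + r) by ring, Finset.sum_range_add _ r,
      Finset.sum_range_add _ (N + 1)]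
    rw [Finset.sum_eq_zero (s := Finset.range r), Finset.sum_eq_zero (s := Finset.range r),
      add_zero, zero_add]
    · refine Finset.sum_congr rfl fun m _ => ?_
      rw [show r + m + 1 = m + 1 + r by ring, Finset.sum_range_add _ (m + 1) r,
        Finset.sum_eq_zero (s := Finset.range r), add_zero, Finset.sum_mul, Finset.sum_mul]
      · refine Finset.sum_congr rfl fun l hl => ?_
        have hl' : l ≤ m := Nat.lt_succ_iff.1 (Finset.mem_range.1 hl)
        have hq2 : q ^ (((2 * r + N : ℕ) : ℤ) - 2 * l) = q ^ (2 * r) * q ^ ((N : ℤ) - 2 * l) := by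
          rw [← zpow_natCast, ← zpow_add₀ hq]
          congr 1
          push_cast
          ring
        rw [if_pos (Nat.le_add_right r m), Nat.add_sub_cancel_left, hq2,
          show r + m - l = r + (m - l) by omega, mul_pow, mul_pow, ← pow_mul]
        ring
      · intro l _
        rw [Nat.add_sub_cancel_left, Nat.choose_eq_zero_of_lt (by omega : m < m + 1 + l)]
        simp
    · intro m _
      refine Finset.sum_eq_zero fun l _ => ?_
      rw [Nat.add_sub_cancel_left, Nat.choose_eq_zero_of_lt (by omega : N < N + 1 + m)]
      simp
    · intro m hm
      exact Finset.sum_eq_zero fun l _ => if_neg (by have := Finset.mem_range.1 hm; omega)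
  rw [Finset.sum_congr rfl h1, Finset.sum_comm]
  refine Finset.sum_congr rfl fun m hm => ?_
  rw [Finset.sum_comm]
  refine Finset.sum_congr rfl fun l hl => ?_
  rw [dCoeff, Finset.sum_mul, Finset.sum_mul, Finset.sum_mul, ← Finset.sum_filter]
  refine Finset.sum_congr ?_ fun _ _ => rfl
  ext r
  have := Finset.mem_range.1 hm
  simp only [Finset.mem_filter, Finset.mem_range]
  omega

variable [CharZero k]

/-- The evaluation formula for the minor of `V(a)` on the product of a torus element with
one-parameter subgroup elements. -/
theorem evalMinor_factored (a : Fin n → kˣ) (t₁' t₂' h₁ h₂ t₂ t₁ : kˣ) :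
    evalMinor a (xbar k affineA1 0 t₁' * xbar k affineA1 1 t₂' * corootElt k affineA1 0 h₁ *
        corootElt k affineA1 1 h₂ * x k affineA1 1 t₂ * x k affineA1 0 t₁)
      = ∑ m ∈ Finset.range (n + 1), ∑ l ∈ Finset.range (m + 1),
        dCoeff a m l * (t₁ * t₁' : k) ^ m * (t₂ * t₂' : k) ^ (m - l) *
          (h₂ / h₁ : k) ^ ((n : ℤ) - 2 * l) := by
  have hq : (h₂ / h₁ : k) ≠ 0 := div_ne_zero h₂.ne_zero h₁.ne_zero
  rw [evalMinor_eq, ← sum_sCoeff_eq_sum_dCoeff a hq, Finset.prod_congr rfl fun l _ =>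
    loopHom_factored (a l) t₁' t₂' h₁ h₂ t₂ t₁, coeff_prod_trinomial]
  refine Finset.sum_congr rfl fun r _ => ?_
  congr 2
  · ring

end EvaluationFormula

/-! ### The positive unipotent group embeds into the loop group -/

section PingPong
open scoped Matrix
open Polynomial (toLaurent)

variable {k : Type u} [Field k]

/-- The elementary matrices over `k[u]` in the root groups of the loop group: for `j = 0` the
lower unitriangular matrices with entry divisible by `u`, for `j = 1` the upper unitriangular
ones. -/
def loopElem : Fin 2 → Polynomial k → Matrix (Fin 2) (Fin 2) k[T;T⁻¹]
  | 0, p => !![1, 0; toLaurent (Polynomial.X * p), 1]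
  | 1, p => !![1, toLaurent p; 0, 1]

theorem loopElem_add (j : Fin 2) (p q : Polynomial k) :
    loopElem j (p + q) = loopElem j p * loopElem j q := by
  fin_cases j <;> ext1 i j <;> fin_cases i <;> fin_cases j <;>
    simp [loopElem, Matrix.mul_apply, Fin.sum_univ_two, mul_add, add_comm]

variable [CharZero k]

theorem loopHom_one_sbar_zero : (loopHom 1 (sbar k affineA1 0) : Matrix (Fin 2) (Fin 2) k[T;T⁻¹])
    = !![0, LaurentPolynomial.T (-1); -LaurentPolynomial.T 1, 0] := by
  rw [loopHom_sbar_zero]; simp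

theorem loopHom_rootElt (j : Fin 2) (m : ℕ) (t : k) :
    (loopHom 1 (rootElt j m t) : Matrix (Fin 2) (Fin 2) k[T;T⁻¹])
      = loopElem j (Polynomial.monomial m ((-1) ^ m * t)) := by
  have hT : (LaurentPolynomial.T (-1) : k[T;T⁻¹]) * LaurentPolynomial.T 1 = 1 := by
    rw [← LaurentPolynomial.T_add]; simp
  induction m generalizing j t with
  | zero =>
    rw [rootElt_zero, ← xsym_inl, loopHom_xsym]
    fin_cases j <;> ext1 i j <;> fin_cases i <;> fin_cases j <;>
      simp [loopSym, loopElem, Polynomial.monomial_zero_left]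
  | succ m ih =>
    have h1 : loopHom 1 (rootElt j (m + 1) t) * loopHom 1 (sbar k affineA1 j)
        = loopHom 1 (sbar k affineA1 j) * loopHom 1 (rootElt j.rev m t) := by
      rw [← map_mul, ← map_mul, rootElt_succ, inv_mul_cancel_right]
    have h2 := congrArg Units.val h1
    rw [Units.val_mul, Units.val_mul, ih] at h2
    rw [← Units.mul_left_inj (loopHom 1 (sbar k affineA1 j)), h2]
    have h3 : Polynomial.monomial (m + 1) ((-1) ^ (m + 1) * t)
        = -(Polynomial.X * Polynomial.monomial m ((-1) ^ m * t)) := by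
      rw [Polynomial.X_mul_monomial, ← map_neg, pow_succ]; ring_nf
    rw [h3]
    generalize Polynomial.monomial m ((-1) ^ m * t) = p
    fin_cases j
    · simp only [Fin.zero_eta, loopHom_one_sbar_zero, show Fin.rev (0 : Fin 2) = 1 from rfl]
      ext1 i j
      fin_cases i <;> fin_cases j <;> simp [loopElem, Matrix.mul_apply, Fin.sum_univ_two]
    · simp only [Fin.mk_one, loopHom_sbar_one, show Fin.rev (1 : Fin 2) = 0 from rfl]
      ext1 i j
      fin_cases i <;> fin_cases j <;> simp [loopElem, Matrix.mul_apply, Fin.sum_univ_two]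

/-- The homomorphism from polynomials to the abelian group generated by the `rootElt j m`. -/
theorem exists_rootHom (j : Fin 2) : ∃ θ : Multiplicative (Polynomial k) →* Grp k affineA1,
    (∀ m t, ∃ p, θ p = rootElt j m t) ∧
      ∀ p, (loopHom 1 (θ p) : Matrix (Fin 2) (Fin 2) k[T;T⁻¹]) = loopElem j p.toAdd := by
  set S : Set (Grp k affineA1) := {g | ∃ m t, g = rootElt j m t} with hS
  have hcomm : ∀ x ∈ S, ∀ y ∈ S, x * y = y * x := by
    rintro _ ⟨m, s, rfl⟩ _ ⟨n, t, rfl⟩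
    exact rootElt_comm j m n s t
  have hcomm' := Subgroup.isMulCommutative_closure hcomm
  let _ : CommGroup (Subgroup.closure S) :=
    { (inferInstance : Group (Subgroup.closure S)) with
      mul_comm := fun a b => hcomm'.is_comm.comm a b }
  let r : ℕ → k →+ Additive (Subgroup.closure S) := fun m =>
    { toFun := fun t => Additive.ofMul ⟨rootElt j m ((-1) ^ m * t),
        Subgroup.subset_closure ⟨m, _, rfl⟩⟩
      map_zero' := by
        apply Additive.toMul.injective; ext1
        change rootElt j m ((-1) ^ m * 0) = 1
        rw [mul_zero, rootElt_map_zero]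
      map_add' := fun s t => by
        apply Additive.toMul.injective; ext1
        change rootElt j m ((-1) ^ m * (s + t)) = rootElt j m _ * rootElt j m _
        rw [mul_add, rootElt_add] }
  let E : Polynomial k →+ (ℕ →₀ k) :=
    { toFun := fun p => p.toFinsupp.coeff
      map_zero' := rfl
      map_add' := fun p q => by rw [Polynomial.toFinsupp_add]; rfl }
  let Ψ : Polynomial k →+ Additive (Subgroup.closure S) := (Finsupp.liftAddHom r).comp E
  have hΨ : ∀ m t, Ψ (Polynomial.monomial m t) = r m t := fun m t => by
    have hE : E (Polynomial.monomial m t) = Finsupp.single m t := by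
      change (Polynomial.toFinsupp _).coeff = _
      rw [Polynomial.toFinsupp_monomial]; rfl
    rw [AddMonoidHom.comp_apply, hE, Finsupp.liftAddHom_apply_single]
  let θ : Multiplicative (Polynomial k) →* Grp k affineA1 :=
    (Subgroup.closure S).subtype.comp (AddMonoidHom.toMultiplicativeLeft Ψ)
  have hθ : ∀ m t, θ (Multiplicative.ofAdd (Polynomial.monomial m t))
      = rootElt j m ((-1) ^ m * t) := fun m t => by
    change ((Additive.toMul (Ψ (Polynomial.monomial m t)) : Subgroup.closure S) : Grp k affineA1) = _
    rw [hΨ]; rfl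
  have hsq : ∀ m : ℕ, ((-1 : k) ^ m) * (-1) ^ m = 1 := fun m => by
    rw [← mul_pow, neg_one_mul, neg_neg, one_pow]
  refine ⟨θ, fun m t => ⟨Multiplicative.ofAdd (Polynomial.monomial m ((-1) ^ m * t)), ?_⟩,
    fun p => ?_⟩
  · rw [hθ, ← mul_assoc, hsq, one_mul]
  · induction p using Multiplicative.rec with | ofAdd p => ?_
    change _ = loopElem j p
    induction p using Polynomial.induction_on' with
    | add p q hp hq => rw [ofAdd_add, map_mul, map_mul, Units.val_mul, hp, hq, loopElem_add]
    | monomial m t => rw [hθ, loopHom_rootElt, ← mul_assoc, hsq, one_mul]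

/-- The group generated by the positive real root groups is the free product of the two abelian
groups of the roots `α_j + m δ`, `j = 0, 1`, and embeds into the loop group. The ping-pong is
played on pairs of polynomials by comparing degrees. -/
theorem eq_one_of_loopHom_eq_one {g : Grp k affineA1} (hg : g ∈ posRootGroup k)
    (h : loopHom 1 g = 1) : g = 1 := by
  choose θ hθ hθ' using exists_rootHom (k := k)
  let act : MulAction (Matrix (Fin 2) (Fin 2) k[T;T⁻¹])ˣ (Fin 2 → k[T;T⁻¹]) :=
    { smul := fun M v => M.val *ᵥ v
      one_smul := fun v => Matrix.one_mulVec v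
      mul_smul := fun M N v => (Matrix.mulVec_mulVec v M.val N.val).symm }
  have hsmul : ∀ (M : (Matrix (Fin 2) (Fin 2) k[T;T⁻¹])ˣ) (v : Fin 2 → k[T;T⁻¹]),
      M • v = M.val *ᵥ v := fun _ _ => rfl
  -- an upper triangular element makes the degree of the first entry dominate, a lower triangular one
  -- that of the second entry
  let X : Fin 2 → Set (Fin 2 → k[T;T⁻¹]) := ![
    {v | ∃ p q : Polynomial k, v = ![toLaurent p, toLaurent q] ∧ p.degree < q.degree},
    {v | ∃ p q : Polynomial k, v = ![toLaurent p, toLaurent q] ∧ p ≠ 0 ∧ q.degree ≤ p.degree}]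
  have hinj : Function.Injective (Monoid.CoprodI.lift fun j => (loopHom 1).comp (θ j)) := by
    refine Monoid.CoprodI.lift_injective_of_ping_pong _ (Or.inr ⟨0, ?_⟩) X ?_ ?_ ?_
    · have : Infinite (Multiplicative (Polynomial k)) :=
        inferInstanceAs (Infinite (Polynomial k))
      -- ping-pong for two groups needs one of them to have at least three elements
      exact (Cardinal.natCast_lt_aleph0 (n := 3)).le.trans (Cardinal.aleph0_le_mk _)
    · intro i
      fin_cases i
      · exact ⟨_, 0, 1, rfl, by simp⟩
      · exact ⟨_, 1, 0, rfl, one_ne_zero, by simp⟩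
    · have h01 : Disjoint (X 0) (X 1) := by
        rw [Set.disjoint_left]
        rintro v ⟨p, q, rfl, h⟩ ⟨p', q', h', -, h''⟩
        have hp := Polynomial.toLaurent_injective (by simpa using congrFun h' 0 : toLaurent p = toLaurent p')
        have hq := Polynomial.toLaurent_injective (by simpa using congrFun h' 1 : toLaurent q = toLaurent q')
        subst hp hq
        exact absurd h (not_lt_of_ge h'')
      intro i j hij
      fin_cases i <;> fin_cases j
      · exact absurd rfl hij
      · exact h01
      · exact h01.symm
      · exact absurd rfl hij
    · intro i j hij r hr
      have hr' : r.toAdd ≠ 0 := fun h0 => hr (Multiplicative.toAdd.injective h0)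
      rintro _ ⟨v, hv, rfl⟩
      change ((loopHom 1).comp (θ i) r) • v ∈ X i
      rw [hsmul, MonoidHom.comp_apply, hθ']
      generalize r.toAdd = f at hr'
      fin_cases i <;> fin_cases j
      · exact absurd rfl hij
      · obtain ⟨p, q, rfl, hp, hpq⟩ := hv
        refine ⟨p, q + Polynomial.X * f * p, ?_, ?_⟩
        · funext i
          fin_cases i <;> simp [loopElem, Matrix.mulVec, dotProduct, Fin.sum_univ_two, add_comm]
        · have h1 : p.degree < (Polynomial.X * f * p).degree := by
            rw [Polynomial.degree_eq_natDegree hp,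
              Polynomial.degree_eq_natDegree (mul_ne_zero (mul_ne_zero Polynomial.X_ne_zero hr') hp),
              Polynomial.natDegree_mul (mul_ne_zero Polynomial.X_ne_zero hr') hp,
              Polynomial.natDegree_mul Polynomial.X_ne_zero hr', Polynomial.natDegree_X]
            exact_mod_cast (by omega : p.natDegree < 1 + f.natDegree + p.natDegree)
          rw [Polynomial.degree_add_eq_right_of_degree_lt (hpq.trans_lt h1)]
          exact h1
      · obtain ⟨p, q, rfl, hpq⟩ := hv
        have hq : q ≠ 0 := by rintro rfl; simp at hpq
        have h1 : q.degree ≤ (f * q).degree := by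
          rw [mul_comm]; exact Polynomial.degree_le_mul_left q hr'
        have h2 : (p + f * q).degree = (f * q).degree :=
          Polynomial.degree_add_eq_right_of_degree_lt (hpq.trans_le h1)
        refine ⟨p + f * q, q, ?_, ?_, ?_⟩
        · funext i
          fin_cases i <;> simp [loopElem, Matrix.mulVec, dotProduct, Fin.sum_univ_two]
        · intro h0
          rw [h0, Polynomial.degree_zero] at h2
          exact mul_ne_zero hr' hq (Polynomial.degree_eq_bot.1 h2.symm)
        · rw [h2]; exact h1
      · exact absurd rfl hij
  have hsurj : posRootGroup k ≤ (Monoid.CoprodI.lift θ).range := by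
    rw [posRootGroup, Subgroup.closure_le]
    rintro _ ⟨j, m, t, rfl⟩
    obtain ⟨p, hp⟩ := hθ j m t
    exact ⟨Monoid.CoprodI.of p, by rw [Monoid.CoprodI.lift_of, hp]⟩
  obtain ⟨w, rfl⟩ := hsurj hg
  have hw : Monoid.CoprodI.lift (fun j => (loopHom 1).comp (θ j)) w = 1 := by
    rw [← h]
    have : Monoid.CoprodI.lift (fun j => (loopHom 1).comp (θ j))
        = (loopHom 1).comp (Monoid.CoprodI.lift θ) := by
      ext1 j; rw [MonoidHom.comp_assoc]; simp
    rw [this]; rfl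
  rw [hinj (hw.trans (map_one _).symm), map_one]

end PingPong

/-! ### Intersections of opposite parabolic subgroups -/

section Levi
open scoped Matrix
open LaurentPolynomial (C T)
open Polynomial (toLaurent)

variable {k : Type u} [Field k] [CharZero k]

/-- On the group of positive real root elements the loop matrices are polynomial in `u` and
upper unitriangular at `u = 0`. -/
theorem exists_loopHom_eq_toLaurent {g : Grp k affineA1} (hg : g ∈ posRootGroup k) :
    ∃ (N : Matrix (Fin 2) (Fin 2) (Polynomial k)) (c : k),
      (loopHom 1 g : Matrix (Fin 2) (Fin 2) k[T;T⁻¹]) = N.map toLaurent ∧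
        N.map (Polynomial.eval 0) = !![1, c; 0, 1] := by
  have hgen : ∀ (j : Fin 2) (m : ℕ) (t : k), ∃ (N : Matrix (Fin 2) (Fin 2) (Polynomial k)) (c : k),
      (loopHom 1 (rootElt j m t) : Matrix (Fin 2) (Fin 2) k[T;T⁻¹]) = N.map toLaurent ∧
        N.map (Polynomial.eval 0) = !![1, c; 0, 1] := by
    intro j m t
    rw [loopHom_rootElt]
    generalize Polynomial.monomial m ((-1) ^ m * t) = p
    fin_cases j
    · refine ⟨!![1, 0; Polynomial.X * p, 1], 0, ?_, ?_⟩ <;> ext1 i j <;> fin_cases i <;>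
        fin_cases j <;> simp [loopElem]
    · refine ⟨!![1, p; 0, 1], p.eval 0, ?_, ?_⟩ <;> ext1 i j <;> fin_cases i <;>
        fin_cases j <;> simp [loopElem]
  have hmul : ∀ a b : Grp k affineA1, (∃ (N : Matrix (Fin 2) (Fin 2) (Polynomial k)) (c : k),
      (loopHom 1 a : Matrix (Fin 2) (Fin 2) k[T;T⁻¹]) = N.map toLaurent ∧
        N.map (Polynomial.eval 0) = !![1, c; 0, 1]) →
      (∃ (N : Matrix (Fin 2) (Fin 2) (Polynomial k)) (c : k),
      (loopHom 1 b : Matrix (Fin 2) (Fin 2) k[T;T⁻¹]) = N.map toLaurent ∧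
        N.map (Polynomial.eval 0) = !![1, c; 0, 1]) →
      ∃ (N : Matrix (Fin 2) (Fin 2) (Polynomial k)) (c : k),
      (loopHom 1 (a * b) : Matrix (Fin 2) (Fin 2) k[T;T⁻¹]) = N.map toLaurent ∧
        N.map (Polynomial.eval 0) = !![1, c; 0, 1] := by
    rintro a b ⟨N, c, h1, h2⟩ ⟨N', c', h1', h2'⟩
    refine ⟨N * N', c + c', ?_, ?_⟩
    · rw [map_mul, Units.val_mul, h1, h1', Matrix.map_mul]
    · have := Matrix.map_mul (L := N) (M := N') (f := Polynomial.evalRingHom (0 : k))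
      simp only [Polynomial.coe_evalRingHom] at this
      rw [this, h2, h2']
      ext1 i j
      fin_cases i <;> fin_cases j <;> simp [Matrix.mul_apply, Fin.sum_univ_two, add_comm]
  refine Subgroup.closure_induction_left (p := fun g _ => ∃ (N : Matrix (Fin 2) (Fin 2) (Polynomial k)) (c : k),
      (loopHom 1 g : Matrix (Fin 2) (Fin 2) k[T;T⁻¹]) = N.map toLaurent ∧
        N.map (Polynomial.eval 0) = !![1, c; 0, 1]) ?_ ?_ ?_ hg
  · exact ⟨1, 0, by simp, by ext1 i j; fin_cases i <;> fin_cases j <;> simp⟩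
  · rintro _ ⟨j, m, t, rfl⟩ y _ hy
    exact hmul _ _ (hgen j m t) hy
  · rintro _ ⟨j, m, t, rfl⟩ y _ hy
    rw [← rootElt_neg]
    exact hmul _ _ (hgen j m _) hy

variable (k) in
/-- The elements with constant loop matrices. -/
def constLoops : Subgroup (Grp k affineA1) :=
  (Units.map (C.mapMatrix :
    Matrix (Fin 2) (Fin 2) k →+* Matrix (Fin 2) (Fin 2) k[T;T⁻¹]).toMonoidHom).range.comap (loopHom 1)

theorem mem_constLoops_of_eq {g : Grp k affineA1} (M N : Matrix (Fin 2) (Fin 2) k)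
    (hMN : M * N = 1) (h : (loopHom 1 g : Matrix (Fin 2) (Fin 2) k[T;T⁻¹])
      = M.map C) : g ∈ constLoops k :=
  ⟨⟨M, N, hMN, mul_eq_one_comm.1 hMN⟩, Units.ext h.symm⟩

theorem x_one_mem_constLoops (t : k) : x k affineA1 1 t ∈ constLoops k := by
  refine mem_constLoops_of_eq !![1, t; 0, 1] !![1, -t; 0, 1] ?_ ?_
  · ext1 i j; fin_cases i <;> fin_cases j <;> simp [Matrix.mul_apply, Fin.sum_univ_two]
  · rw [← xsym_inl, loopHom_xsym]
    ext1 i j; fin_cases i <;> fin_cases j <;> simp [loopSym]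

theorem xbar_one_mem_constLoops (t : k) : xbar k affineA1 1 t ∈ constLoops k := by
  refine mem_constLoops_of_eq !![1, 0; t, 1] !![1, 0; -t, 1] ?_ ?_
  · ext1 i j; fin_cases i <;> fin_cases j <;> simp [Matrix.mul_apply, Fin.sum_univ_two]
  · rw [← xsym_inr, loopHom_xsym]
    ext1 i j; fin_cases i <;> fin_cases j <;> simp [loopSym]

theorem sbar_one_mem_constLoops : sbar k affineA1 1 ∈ constLoops k :=
  mul_mem (mul_mem (x_one_mem_constLoops _) (xbar_one_mem_constLoops _)) (x_one_mem_constLoops _)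

theorem torus_le_constLoops : torus k affineA1 ≤ constLoops k := by
  rw [torus, Subgroup.closure_le]
  rintro _ ⟨i, t, rfl⟩
  fin_cases i
  · refine mem_constLoops_of_eq !![((t⁻¹ : kˣ) : k), 0; 0, t] !![(t : k), 0; 0, (t⁻¹ : kˣ)] ?_ ?_
    · ext1 i j; fin_cases i <;> fin_cases j <;> simp [Matrix.mul_apply, Fin.sum_univ_two]
    · refine (loopHom_corootElt_zero 1 t).trans ?_
      ext1 i j; fin_cases i <;> fin_cases j <;> simp
  · exact mul_mem (mul_mem (mul_mem (x_one_mem_constLoops _) (xbar_one_mem_constLoops _))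
      (x_one_mem_constLoops _)) sbar_one_mem_constLoops

variable (k) in
/-- The Chevalley involution. -/
def chevalley : Grp k affineA1 →* Grp k affineA1 := twist 1 fun _ _ => rfl

theorem chevalley_x (i : Fin 2) (t : k) :
    chevalley k (x k affineA1 i t) = xbar k affineA1 i (-t) := twist_x _ _ _

theorem chevalley_xbar (i : Fin 2) (t : k) :
    chevalley k (xbar k affineA1 i t) = x k affineA1 i (-t) := twist_xbar _ _ _

theorem chevalley_chevalley (g : Grp k affineA1) : chevalley k (chevalley k g) = g :=
  twist_twist _ (fun _ => rfl) g

theorem chevalley_sbar (i : Fin 2) : chevalley k (sbar k affineA1 i) = sbar k affineA1 i :=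
  twist_sbar _ affineA1_self i

theorem chevalley_corootElt (i : Fin 2) (t : kˣ) :
    chevalley k (corootElt k affineA1 i t) = corootElt k affineA1 i t⁻¹ :=
  twist_corootElt _ affineA1_self i t

theorem chevalley_of_mem_torus {g : Grp k affineA1} (hg : g ∈ torus k affineA1) :
    chevalley k g = g⁻¹ := by
  obtain ⟨s, t, rfl⟩ := exists_of_mem_torus hg 0
  rw [map_mul, chevalley_corootElt, chevalley_corootElt, mul_inv_rev,
    corootElt_inv affineA1_self, corootElt_inv affineA1_self, corootElt_comm affineA1_self]

/-- The Chevalley involution of the loop group is the inverse transpose together with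
`u ↦ u⁻¹`. -/
theorem loopHom_chevalley_inv (g : Grp k affineA1) :
    (loopHom 1 (chevalley k g)⁻¹ : Matrix (Fin 2) (Fin 2) k[T;T⁻¹])
      = ((loopHom 1 g : Matrix (Fin 2) (Fin 2) k[T;T⁻¹])ᵀ).map LaurentPolynomial.invert := by
  refine grp_induction (P := fun g => (loopHom 1 (chevalley k g)⁻¹ : Matrix (Fin 2) (Fin 2) k[T;T⁻¹])
      = ((loopHom 1 g : Matrix (Fin 2) (Fin 2) k[T;T⁻¹])ᵀ).map LaurentPolynomial.invert) ?_ ?_ g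
  · simp
  · intro s t g hg
    have h1 : (chevalley k (xsym s t))⁻¹ = xsym (twistSym 1 s) t := by
      have := twist_xsym (k := k) (A := affineA1) (π := 1) (fun _ _ => rfl) s t
      rw [chevalley, this, ← xsym_neg, neg_neg]
    have h2 : loopSym (1 : kˣ) (twistSym 1 s) t
        = ((loopSym (1 : kˣ) s t)ᵀ).map LaurentPolynomial.invert := by
      rcases s with i | i <;> fin_cases i <;> ext1 i j <;> fin_cases i <;> fin_cases j <;>
        simp [twistSym, loopSym]
    rw [map_mul, mul_inv_rev, map_mul, Units.val_mul, hg, h1, loopHom_xsym, map_mul, Units.val_mul,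
      loopHom_xsym, Matrix.transpose_mul, h2]
    exact (Matrix.map_mul (f := (LaurentPolynomial.invert : k[T;T⁻¹] ≃ₐ[k] k[T;T⁻¹]).toRingEquiv.toRingHom)).symm

/-- The intersection of a parabolic with an opposite one: if `l₀ y = τ(y') l₀'` with `l₀`, `l₀'` in
the Levi subgroup of node `1`, `y`, `y'` in `posBorel` and `τ` the transposition, then `y` lies in
the Levi subgroup. Indeed the part of `y` in the unipotent radical has a loop matrix which is
polynomial in `u` as well as in `u⁻¹`. -/
theorem exists_eq_torus_mul_x {y y' l₀ l₀' : Grp k affineA1} (hy : y ∈ posBorel k)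
    (hy' : y' ∈ posBorel k) (hl : l₀ ∈ constLoops k) (hl' : l₀' ∈ constLoops k)
    (h : l₀ * y = (chevalley k y')⁻¹ * l₀') :
    ∃ h ∈ torus k affineA1, ∃ c, y = h * x k affineA1 1 c := by
  obtain ⟨a, ha, u, hu, rfl⟩ := exists_torus_mul_posRootGroup hy
  obtain ⟨a', ha', u', hu', rfl⟩ := exists_torus_mul_posRootGroup hy'
  obtain ⟨N, c, h1, h2⟩ := exists_loopHom_eq_toLaurent hu
  obtain ⟨N', c', h1', -⟩ := exists_loopHom_eq_toLaurent hu'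
  refine ⟨a, ha, c, ?_⟩
  -- the part of `u` in the unipotent radical
  set u₀ := (x k affineA1 1 c)⁻¹ * u with hu₀
  have hu₀' : u = x k affineA1 1 c * u₀ := by rw [hu₀]; group
  suffices u₀ = 1 by rw [hu₀', this, mul_one]
  refine eq_one_of_loopHom_eq_one (mul_mem (inv_mem (x_mem_posRootGroup _ _)) hu) ?_
  obtain ⟨P, hP⟩ : (l₀ * a * x k affineA1 1 c)⁻¹ ∈ constLoops k := inv_mem (mul_mem (mul_mem hl
    (torus_le_constLoops ha)) (x_one_mem_constLoops _))
  obtain ⟨Q, hQ⟩ : (chevalley k a')⁻¹ * l₀' ∈ constLoops k := by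
    rw [chevalley_of_mem_torus ha', inv_inv]
    exact mul_mem (torus_le_constLoops ha') hl'
  -- this equates a loop polynomial in `u` with one polynomial in `u⁻¹`
  have h3 : u₀ = (l₀ * a * x k affineA1 1 c)⁻¹ * ((chevalley k u')⁻¹ *
      ((chevalley k a')⁻¹ * l₀')) := by
    rw [eq_inv_mul_iff_mul_eq, ← mul_assoc (chevalley k u')⁻¹, ← mul_inv_rev, ← map_mul, ← h, hu₀]
    group
  have h4 := congrArg (fun g => (loopHom 1 g : Matrix (Fin 2) (Fin 2) k[T;T⁻¹])) h3
  have hc : ∀ (r : k) (f : k[T;T⁻¹]) (m : ℤ), (C r * f).coeff m = r * f.coeff m := by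
    intro r f m
    rw [← LaurentPolynomial.smul_eq_C_mul]; rfl
  have hneg : ∀ (p : Polynomial k) (m : ℤ), m < 0 → (toLaurent p).coeff m = 0 := by
    intro p m hm
    by_contra h0
    have := Finsupp.mem_support_iff.2 h0
    rw [LaurentPolynomial.support_coeff_toLaurent, Finset.mem_map] at this
    obtain ⟨n, -, rfl⟩ := this
    exact absurd hm (by simp)
  have hpos : ∀ (p : Polynomial k) (m : ℕ), (toLaurent p).coeff (m : ℤ) = p.coeff m := by
    intro p m
    induction p using Polynomial.induction_on' with
    | add p q hp hq => rw [map_add, Polynomial.coeff_add, ← hp, ← hq]; rfl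
    | monomial n r =>
      rw [← Polynomial.C_mul_X_pow_eq_monomial, Polynomial.toLaurent_C_mul_X_pow, hc,
        LaurentPolynomial.T_apply, Polynomial.coeff_C_mul, Polynomial.coeff_X_pow]
      simp [eq_comm]
  have hx : (loopHom 1 u₀ : Matrix (Fin 2) (Fin 2) k[T;T⁻¹])
      = (!![1, -Polynomial.C c; 0, 1] * N).map toLaurent := by
    rw [hu₀, map_mul, Units.val_mul, ← xsym_inl, ← xsym_neg, loopHom_xsym, h1, Matrix.map_mul]
    congr 1
    ext1 i j; fin_cases i <;> fin_cases j <;> simp [loopSym]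
  have hM0 : (!![1, -Polynomial.C c; 0, 1] * N).map (Polynomial.eval 0) = 1 := by
    have := Matrix.map_mul (L := !![1, -Polynomial.C c; 0, 1]) (M := N)
      (f := Polynomial.evalRingHom (0 : k))
    simp only [Polynomial.coe_evalRingHom] at this
    rw [this, h2]
    ext1 i j; fin_cases i <;> fin_cases j <;> simp [Matrix.mul_apply, Fin.sum_univ_two]
  generalize !![1, -Polynomial.C c; 0, 1] * N = M at hx hM0
  -- the coefficients of positive degree vanish, as the right hand side is polynomial in `u⁻¹`
  have h5 : ∀ i j (m : ℕ), 0 < m → (M i j).coeff m = 0 := by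
    intro i j m hm
    have h6 := congrArg (fun f : k[T;T⁻¹] => f.coeff (m : ℤ)) (congrFun (congrFun h4 i) j)
    simp only [hx, map_mul, Units.val_mul, ← hP, ← hQ, loopHom_chevalley_inv, h1'] at h6
    have hc' : ∀ (r : k) (f : k[T;T⁻¹]) (m : ℤ),
        (f * C r).coeff m = r * f.coeff m := fun r f m => by rw [mul_comm, hc]
    have hinv : ∀ p : Polynomial k, (LaurentPolynomial.invert (toLaurent p)).coeff (m : ℤ) = 0 :=
      fun p => by rw [LaurentPolynomial.invert_apply, hneg _ _ (by omega)]
    have hP' : ∀ (P : (Matrix (Fin 2) (Fin 2) k)ˣ) i j, (Units.map (C.mapMatrix :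
        Matrix (Fin 2) (Fin 2) k →+* Matrix (Fin 2) (Fin 2) k[T;T⁻¹]).toMonoidHom P).val i j
        = C (P.val i j) := fun P i j => rfl
    have hadd : ∀ f g : k[T;T⁻¹], (f + g).coeff (m : ℤ) = f.coeff (m : ℤ) + g.coeff (m : ℤ) :=
      fun _ _ => rfl
    rw [Matrix.map_apply, hpos] at h6
    rw [h6]
    simp only [Matrix.mul_apply, Fin.sum_univ_two]
    erw [hP', hP', hP', hP']
    simp only [hadd, hc, hc', Matrix.map_apply, Matrix.transpose_apply, hinv, mul_zero, add_zero]
  ext1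
  rw [hx]
  ext1 i j
  have h7 : M i j = Polynomial.C ((1 : Matrix (Fin 2) (Fin 2) k) i j) := by
    ext m
    rcases Nat.eq_zero_or_pos m with rfl | hm
    · rw [Polynomial.coeff_C_zero, ← hM0, Matrix.map_apply, Polynomial.coeff_zero_eq_eval_zero]
    · rw [h5 i j m hm, Polynomial.coeff_C_of_ne_zero hm.ne']
  rw [Matrix.map_apply, h7, Polynomial.toLaurent_C]
  by_cases hij : i = j <;> simp [Matrix.one_apply, hij]

end Levi

/-! ### Borel subgroups, Bruhat cells and the involution of the double Bruhat cell -/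

section Borel
variable {k : Type u} [Field k] [CharZero k]

/-- The real root `α_j + m δ`, where `δ = α_0 + α_1`. -/
def posRoot (j : Fin 2) (m : ℕ) : Fin 2 → ℤ := fun i => (if i = j then 1 else 0) + m

theorem reflect_posRoot_rev (j : Fin 2) (m : ℕ) :
    reflect affineA1 j (posRoot j.rev m) = posRoot j (m + 1) := by
  funext i
  fin_cases j <;> fin_cases i <;> simp [reflect, posRoot, Fin.sum_univ_two, affineA1, Fin.rev] <;>
    ring

theorem reflect_posRoot_succ (j : Fin 2) (m : ℕ) :
    reflect affineA1 j (posRoot j (m + 1)) = posRoot j.rev m := by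
  funext i
  fin_cases j <;> fin_cases i <;> simp [reflect, posRoot, Fin.sum_univ_two, affineA1, Fin.rev] <;>
    ring

theorem reflect_posRoot_zero (j : Fin 2) : reflect affineA1 j (posRoot j 0) = -posRoot j 0 := by
  funext i
  fin_cases j <;> fin_cases i <;> simp [reflect, posRoot, affineA1]

theorem reflect_neg (j : Fin 2) (β : Fin 2 → ℤ) :
    reflect affineA1 j (-β) = -reflect affineA1 j β := by
  funext i
  simp only [reflect, Pi.sub_apply, Pi.neg_apply, mul_neg, Finset.sum_neg_distrib, Pi.single_neg]
  ring

theorem single_eq_posRoot (i : Fin 2) : (Pi.single i 1 : Fin 2 → ℤ) = posRoot i 0 := by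
  funext j; simp [posRoot, Pi.single_apply]

theorem posRoot_not_nonpos (j : Fin 2) (m : ℕ) : ¬ posRoot j m ≤ 0 := fun h => by
  have := h j
  simp [posRoot] at this
  omega

theorem posRoot_nonneg (j : Fin 2) (m : ℕ) : 0 ≤ posRoot j m := fun i => by
  simp only [posRoot, Pi.zero_apply]; split_ifs <;> omega

/-- The conjugates of simple root subgroups by lifts of Weyl group elements are formed by the elements
`rootElt j m t` and their images under the Chevalley involution. -/
theorem wordLift_conj (w : List (Fin 2)) (i : Fin 2) (t : k) : ∃ (j : Fin 2) (m : ℕ) (s : k),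
    (realRoot affineA1 w i = posRoot j m ∧
      wordLift k affineA1 w * x k affineA1 i t * (wordLift k affineA1 w)⁻¹ = rootElt j m s) ∨
    (realRoot affineA1 w i = -posRoot j m ∧
      wordLift k affineA1 w * x k affineA1 i t * (wordLift k affineA1 w)⁻¹
        = chevalley k (rootElt j m s)) := by
  induction w with
  | nil => exact ⟨i, 0, t, Or.inl ⟨single_eq_posRoot i, by simp [wordLift, rootElt_zero]⟩⟩
  | cons l w ih =>
    obtain ⟨j, m, s, ih⟩ := ih
    have h1 : realRoot affineA1 (l :: w) i = reflect affineA1 l (realRoot affineA1 w i) := rfl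
    have h2 : wordLift k affineA1 (l :: w) = sbar k affineA1 l * wordLift k affineA1 w := by
      simp [wordLift]
    have h3 : wordLift k affineA1 (l :: w) * x k affineA1 i t * (wordLift k affineA1 (l :: w))⁻¹
        = sbar k affineA1 l * (wordLift k affineA1 w * x k affineA1 i t *
          (wordLift k affineA1 w)⁻¹) * (sbar k affineA1 l)⁻¹ := by rw [h2]; group
    rw [h1, h3]
    have h4 : ∀ g : Grp k affineA1, sbar k affineA1 l * chevalley k g * (sbar k affineA1 l)⁻¹
        = chevalley k (sbar k affineA1 l * g * (sbar k affineA1 l)⁻¹) := fun g => by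
      rw [map_mul, map_mul, map_inv, chevalley_sbar]
    have key : (∃ m' s', reflect affineA1 l (posRoot j m) = posRoot l m' ∧
          sbar k affineA1 l * rootElt j m s * (sbar k affineA1 l)⁻¹ = rootElt l m' s') ∨
        (∃ m' s', reflect affineA1 l (posRoot j m) = posRoot l.rev m' ∧
          sbar k affineA1 l * rootElt j m s * (sbar k affineA1 l)⁻¹ = rootElt l.rev m' s') ∨
        (∃ s', reflect affineA1 l (posRoot j m) = -posRoot l 0 ∧
          sbar k affineA1 l * rootElt j m s * (sbar k affineA1 l)⁻¹
            = chevalley k (rootElt l 0 s')) := by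
      rcases eq_or_eq_rev l j with rfl | rfl
      · cases m with
        | zero =>
          refine Or.inr (Or.inr ⟨s, reflect_posRoot_zero j, ?_⟩)
          rw [rootElt_zero, sbar_mul_x affineA1_self, chevalley_x,
            mul_inv_cancel_right]
        | succ m =>
          obtain ⟨c, hc⟩ := exists_sbar_mul_rootElt_succ (k := k) j m
          exact Or.inr (Or.inl ⟨m, c * s, reflect_posRoot_succ j m, by
            rw [hc, mul_inv_cancel_right]⟩)
      · exact Or.inl ⟨m + 1, s, reflect_posRoot_rev l m, by rw [rootElt_succ]⟩
    rcases ih with ⟨ih1, ih2⟩ | ⟨ih1, ih2⟩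
    · rw [ih1, ih2]
      rcases key with ⟨m', s', e1, e2⟩ | ⟨m', s', e1, e2⟩ | ⟨s', e1, e2⟩
      · exact ⟨_, _, _, Or.inl ⟨e1, e2⟩⟩
      · exact ⟨_, _, _, Or.inl ⟨e1, e2⟩⟩
      · exact ⟨_, _, _, Or.inr ⟨e1, e2⟩⟩
    · rw [ih1, ih2, reflect_neg, h4]
      rcases key with ⟨m', s', e1, e2⟩ | ⟨m', s', e1, e2⟩ | ⟨s', e1, e2⟩
      · exact ⟨_, _, _, Or.inr ⟨by rw [e1], by rw [e2]⟩⟩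
      · exact ⟨_, _, _, Or.inr ⟨by rw [e1], by rw [e2]⟩⟩
      · exact ⟨_, _, _, Or.inl ⟨by rw [e1, neg_neg], by rw [e2, chevalley_chevalley]⟩⟩

theorem exists_wordLift_conj (j : Fin 2) (m : ℕ) : ∃ (w : List (Fin 2)) (i : Fin 2),
    realRoot affineA1 w i = posRoot j m ∧ ∀ t : k, rootElt j m t
      = wordLift k affineA1 w * x k affineA1 i t * (wordLift k affineA1 w)⁻¹ := by
  induction m generalizing j with
  | zero => exact ⟨[], j, single_eq_posRoot j, fun t => by simp [wordLift, rootElt_zero]⟩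
  | succ m ih =>
    obtain ⟨w, i, h1, h2⟩ := ih j.rev
    refine ⟨j :: w, i, ?_, fun t => ?_⟩
    · rw [← reflect_posRoot_rev, ← h1]; rfl
    · rw [rootElt_succ, h2, show wordLift k affineA1 (j :: w)
        = sbar k affineA1 j * wordLift k affineA1 w by simp [wordLift]]
      group

theorem borelPos_eq : borelPos k affineA1 = posBorel k := by
  rw [borelPos, posBorel]
  congr 1
  apply le_antisymm
  · rw [unipotentPos, Subgroup.closure_le]
    rintro _ ⟨w, i, t, hw, rfl⟩
    obtain ⟨j, m, s, ⟨-, h⟩ | ⟨h, -⟩⟩ := wordLift_conj (k := k) w i t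
    · rw [h]; exact rootElt_mem_posRootGroup j m s
    · rw [h] at hw
      exact absurd (by simpa using hw) (posRoot_not_nonpos j m)
  · rw [posRootGroup, Subgroup.closure_le]
    rintro _ ⟨j, m, t, rfl⟩
    obtain ⟨w, i, h1, h2⟩ := exists_wordLift_conj (k := k) j m
    exact Subgroup.subset_closure ⟨w, i, t, by rw [h1]; exact posRoot_nonneg j m, h2 t⟩

theorem realRoot_append_self (w : List (Fin 2)) (i : Fin 2) :
    realRoot affineA1 (w ++ [i]) i = -realRoot affineA1 w i := by
  induction w with
  | nil =>
    change reflect affineA1 i (Pi.single i 1) = -Pi.single i 1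
    rw [single_eq_posRoot, reflect_posRoot_zero]
  | cons l w ih =>
    change reflect affineA1 l (realRoot affineA1 (w ++ [i]) i) = -reflect affineA1 l _
    rw [ih, reflect_neg]; rfl

theorem map_chevalley_torus : (torus k affineA1).map (chevalley k) = torus k affineA1 := by
  ext g
  constructor
  · rintro ⟨g, hg, rfl⟩
    rw [chevalley_of_mem_torus hg]; exact inv_mem hg
  · intro hg
    exact ⟨g⁻¹, inv_mem hg, by rw [chevalley_of_mem_torus (inv_mem hg), inv_inv]⟩

theorem borelNeg_eq : borelNeg k affineA1 = (posBorel k).map (chevalley k) := by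
  rw [borelNeg, posBorel, Subgroup.map_sup, map_chevalley_torus]
  congr 1
  apply le_antisymm
  · rw [unipotentNeg, Subgroup.closure_le]
    rintro _ ⟨w, i, t, hw, rfl⟩
    obtain ⟨j, m, s, ⟨h, -⟩ | ⟨-, h⟩⟩ := wordLift_conj (k := k) w i t
    · rw [h] at hw
      exact absurd hw (posRoot_not_nonpos j m)
    · rw [h]; exact ⟨_, rootElt_mem_posRootGroup j m s, rfl⟩
  · rw [posRootGroup, MonoidHom.map_closure, Subgroup.closure_le]
    rintro _ ⟨_, ⟨j, m, t, rfl⟩, rfl⟩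
    obtain ⟨w, i, h1, h2⟩ := exists_wordLift_conj (k := k) j m
    refine Subgroup.subset_closure ⟨w ++ [i], i, t, ?_, ?_⟩
    · rw [realRoot_append_self, h1]
      simpa using posRoot_nonneg j m
    · have h3 : ∀ w, chevalley k (wordLift k affineA1 w) = wordLift k affineA1 w := by
        intro w
        rw [wordLift, map_list_prod, List.map_map]
        congr 2
        funext i
        exact chevalley_sbar i
      rw [h2, map_mul, map_mul, map_inv, h3, chevalley_x,
        show wordLift k affineA1 (w ++ [i]) = wordLift k affineA1 w * sbar k affineA1 i by
          simp [wordLift], mul_inv_rev]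
      have h4 := sbar_mul_x (k := k) (A := affineA1) affineA1_self i t
      calc wordLift k affineA1 w * xbar k affineA1 i (-t) * (wordLift k affineA1 w)⁻¹
          = wordLift k affineA1 w * (xbar k affineA1 i (-t) * sbar k affineA1 i) *
            (sbar k affineA1 i)⁻¹ * (wordLift k affineA1 w)⁻¹ := by group
        _ = _ := by rw [← h4]; group

theorem coxeterLift_eq : coxeterLift k affineA1 = sbar k affineA1 0 * sbar k affineA1 1 := by
  simp [coxeterLift, wordLift, List.finRange_succ]

variable (k) in
/-- The Bruhat double coset `B_+ c B_+`. -/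
def posCell : Set (Grp k affineA1) :=
  {g | ∃ b ∈ posBorel k, ∃ b' ∈ posBorel k, g = b * sbar k affineA1 0 * sbar k affineA1 1 * b'}

/-- Both Bruhat conditions concern `posCell`, since `g ↦ (chevalley k g)⁻¹` exchanges
`B_- c⁻¹ B_-` and `B_+ c B_+`. -/
theorem mem_coxeterCell_iff (g : Grp k affineA1) :
    g ∈ coxeterCell k affineA1 ↔ g ∈ posCell k ∧ (chevalley k g)⁻¹ ∈ posCell k := by
  have hc : chevalley k (coxeterLift k affineA1) = sbar k affineA1 0 * sbar k affineA1 1 := by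
    rw [coxeterLift_eq, map_mul, chevalley_sbar, chevalley_sbar]
  rw [coxeterCell, Set.mem_inter_iff, DoubleCoset.mem_doubleCoset, DoubleCoset.mem_doubleCoset,
    borelPos_eq, borelNeg_eq]
  refine and_congr ?_ ?_
  · constructor
    · rintro ⟨b, hb, b', hb', rfl⟩
      exact ⟨b, hb, b', hb', by rw [coxeterLift_eq, ← mul_assoc b]⟩
    · rintro ⟨b, hb, b', hb', rfl⟩
      exact ⟨b, hb, b', hb', by rw [coxeterLift_eq, ← mul_assoc b]⟩
  · constructor
    · rintro ⟨_, ⟨b, hb, rfl⟩, _, ⟨b', hb', rfl⟩, rfl⟩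
      refine ⟨b'⁻¹, inv_mem hb', b⁻¹, inv_mem hb, ?_⟩
      rw [map_mul, map_mul, map_inv, hc, chevalley_chevalley, chevalley_chevalley]
      group
    · rintro ⟨b, hb, b', hb', h⟩
      refine ⟨_, ⟨b'⁻¹, inv_mem hb', rfl⟩, _, ⟨b⁻¹, inv_mem hb, rfl⟩, ?_⟩
      rw [← chevalley_chevalley g, ← inv_inv (chevalley k g), h, map_inv,
        coxeterLift_eq]
      simp only [map_mul, map_inv, chevalley_sbar]
      group

variable (k) in
/-- The Chevalley involution followed by the exchange of the two nodes. -/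
def swapTwist : Grp k affineA1 →* Grp k affineA1 :=
  twist Fin.revPerm fun i j => by fin_cases i <;> fin_cases j <;> rfl

theorem swapTwist_x (i : Fin 2) (t : k) :
    swapTwist k (x k affineA1 i t) = xbar k affineA1 i.rev (-t) := twist_x _ _ _

theorem swapTwist_xbar (i : Fin 2) (t : k) :
    swapTwist k (xbar k affineA1 i t) = x k affineA1 i.rev (-t) := twist_xbar _ _ _

theorem swapTwist_swapTwist (g : Grp k affineA1) : swapTwist k (swapTwist k g) = g :=
  twist_twist _ (fun i => Fin.rev_rev i) g

theorem swapTwist_sbar (i : Fin 2) : swapTwist k (sbar k affineA1 i) = sbar k affineA1 i.rev :=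
  twist_sbar _ affineA1_self i

theorem swapTwist_corootElt (i : Fin 2) (t : kˣ) :
    swapTwist k (corootElt k affineA1 i t) = corootElt k affineA1 i.rev t⁻¹ :=
  twist_corootElt _ affineA1_self i t

theorem chevalley_swapTwist (g : Grp k affineA1) :
    chevalley k (swapTwist k g) = swapTwist k (chevalley k g) := by
  refine grp_induction (P := fun g => chevalley k (swapTwist k g) = swapTwist k (chevalley k g))
    ?_ ?_ g
  · simp
  · intro s t g hg
    simp only [map_mul, hg]
    congr 1
    rcases s with i | i
    · rw [xsym_inl, swapTwist_x, chevalley_x, chevalley_xbar, swapTwist_xbar]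
    · rw [xsym_inr, swapTwist_xbar, chevalley_x, chevalley_xbar, swapTwist_x]

theorem chevalley_swapTwist_rootElt (j : Fin 2) (m : ℕ) (t : k) :
    chevalley k (swapTwist k (rootElt j m t)) = rootElt j.rev m t := by
  induction m generalizing j with
  | zero => rw [rootElt_zero, rootElt_zero, swapTwist_x, chevalley_xbar, neg_neg]
  | succ m ih =>
    rw [rootElt_succ, rootElt_succ, map_mul, map_mul, map_mul, map_mul, ih, map_inv, map_inv,
      swapTwist_sbar, chevalley_sbar]

theorem chevalley_swapTwist_mem_torus {g : Grp k affineA1} (hg : g ∈ torus k affineA1) :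
    chevalley k (swapTwist k g) ∈ torus k affineA1 := by
  obtain ⟨s, t, rfl⟩ := exists_of_mem_torus hg 0
  simp only [map_mul, swapTwist_corootElt, chevalley_corootElt]
  exact mul_mem (corootElt_mem_torus _ _) (corootElt_mem_torus _ _)

theorem chevalley_swapTwist_mem_posBorel {g : Grp k affineA1} (hg : g ∈ posBorel k) :
    chevalley k (swapTwist k g) ∈ posBorel k := by
  refine posBorel_induction (P := fun g => chevalley k (swapTwist k g) ∈ posBorel k)
    (by simp) ?_ ?_ hg
  · intro h hh g hg
    rw [map_mul, map_mul]
    exact mul_mem (torus_le_posBorel (chevalley_swapTwist_mem_torus hh)) hg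
  · intro j m t g hg
    rw [map_mul, map_mul, chevalley_swapTwist_rootElt]
    exact mul_mem (rootElt_mem_posBorel _ _ _) hg

theorem sbar_inv_eq (i : Fin 2) : (sbar k affineA1 i)⁻¹
    = corootElt k affineA1 i (-1) * sbar k affineA1 i := by
  refine inv_eq_of_mul_eq_one_left ?_
  rw [mul_assoc, sbar_mul_self, ← corootElt_mul affineA1_self, neg_one_mul, neg_neg, corootElt_one]

theorem swapTwist_inv_mem_posCell {g : Grp k affineA1} (hg : g ∈ posCell k) :
    (chevalley k (swapTwist k g))⁻¹ ∈ posCell k := by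
  obtain ⟨b, hb, b', hb', rfl⟩ := hg
  have h1 := corootElt_mem_torus (k := k) 0 (-1)
  have h2 := sbar_conj_mem_torus 0 (corootElt_mem_torus (k := k) 1 (-1))
  refine ⟨(chevalley k (swapTwist k b'))⁻¹ * corootElt k affineA1 0 (-1) *
    (sbar k affineA1 0 * corootElt k affineA1 1 (-1) * (sbar k affineA1 0)⁻¹),
    mul_mem (mul_mem (inv_mem (chevalley_swapTwist_mem_posBorel hb')) (torus_le_posBorel h1))
      (torus_le_posBorel h2), (chevalley k (swapTwist k b))⁻¹,
    inv_mem (chevalley_swapTwist_mem_posBorel hb), ?_⟩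
  have h3 := sbar_inv_eq (k := k) 0
  have h4 := sbar_inv_eq (k := k) 1
  simp only [map_mul, swapTwist_sbar, chevalley_sbar, mul_inv_rev]
  rw [show Fin.rev (0 : Fin 2) = 1 from rfl, show Fin.rev (1 : Fin 2) = 0 from rfl]
  conv_lhs => rw [h3, h4]
  group

theorem swapTwist_mem_coxeterCell {g : Grp k affineA1} (hg : g ∈ coxeterCell k affineA1) :
    swapTwist k g ∈ coxeterCell k affineA1 := by
  rw [mem_coxeterCell_iff] at hg ⊢
  refine ⟨?_, swapTwist_inv_mem_posCell hg.1⟩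
  have := swapTwist_inv_mem_posCell hg.2
  rwa [map_inv, map_inv, inv_inv, chevalley_swapTwist, chevalley_chevalley] at this

theorem exists_of_mem_posCell {g : Grp k affineA1} (hg : g ∈ posCell k) :
    ∃ (a b : k), ∃ y ∈ posBorel k, g = x k affineA1 0 a * sbar k affineA1 0 * x k affineA1 1 b *
      sbar k affineA1 1 * y := by
  obtain ⟨b, hb, b', hb', rfl⟩ := hg
  obtain ⟨a, q, -, hq, rfl⟩ := exists_x_mul_of_mem_posBorel 0 hb
  obtain ⟨c, r, -, hr, hqr⟩ := exists_x_mul_of_mem_posBorel 1 hq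
  refine ⟨a, c, (sbar k affineA1 1)⁻¹ * r * sbar k affineA1 1 * b', mul_mem hr hb', ?_⟩
  have : x k affineA1 0 a * sbar k affineA1 0 * x k affineA1 1 c * sbar k affineA1 1 *
      ((sbar k affineA1 1)⁻¹ * r * sbar k affineA1 1 * b')
      = x k affineA1 0 a * sbar k affineA1 0 * (x k affineA1 1 c * r) * sbar k affineA1 1 * b' := by
    group
  rw [this, ← hqr]
  group

/-- For `a ≠ 0` the element `x_i(a) s_i` lies in the opposite big cell. -/
theorem x_mul_sbar (i : Fin 2) (a : kˣ) : x k affineA1 i a * sbar k affineA1 i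
    = xbar k affineA1 i (a⁻¹ : kˣ) * corootElt k affineA1 i a * x k affineA1 i (-(a⁻¹ : kˣ)) := by
  have h1 : corootElt k affineA1 i a * x k affineA1 i (-(a⁻¹ : kˣ))
      = x k affineA1 i (-a) * corootElt k affineA1 i a := by
    rw [corootElt_mul_x affineA1_self, affineA1_self]
    congr 2
    simp only [zpow_ofNat, Units.val_pow_eq_pow_val, Units.val_inv_eq_inv_val]
    field_simp
  rw [mul_assoc, h1, corootElt, ← xsym_inl, ← xsym_inl, ← xsym_inr, ← xsym_inr, xsym_neg, xsym_neg]
  group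

theorem torus_mul_x {h : Grp k affineA1} (hh : h ∈ torus k affineA1) (i : Fin 2) :
    ∃ c : kˣ, ∀ t : k, h * x k affineA1 i t = x k affineA1 i (c * t) * h := by
  obtain ⟨c, hc⟩ := exists_torus_mul_rootElt hh i 0
  exact ⟨c, fun t => by simpa only [rootElt_zero] using hc t⟩

theorem exists_sbar_mul_of_mem_torus (i : Fin 2) {h : Grp k affineA1} (hh : h ∈ torus k affineA1) :
    ∃ h' ∈ torus k affineA1, h * sbar k affineA1 i = sbar k affineA1 i * h' :=
  ⟨_, sbar_inv_conj_mem_torus i hh, by group⟩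

/-- The elements of `B_+ c B_+` whose first coordinate `a` does not vanish. -/
theorem exists_xbar_form (a : kˣ) (b : k) {y : Grp k affineA1} (hy : y ∈ posBorel k) :
    ∃ b' : k, ∃ y' ∈ posBorel k, x k affineA1 0 a * sbar k affineA1 0 * x k affineA1 1 b *
      sbar k affineA1 1 * y
      = xbar k affineA1 0 (a⁻¹ : kˣ) * x k affineA1 1 b' * sbar k affineA1 1 * y' := by
  have h1 := sbar_conj_rootElt_rev_mem (k := k) 1 b 0 (-(a⁻¹ : kˣ))
  rw [rootElt_zero, show Fin.rev (1 : Fin 2) = 0 from rfl] at h1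
  have hh := corootElt_mem_torus (k := k) 0 a
  obtain ⟨c, hc⟩ := torus_mul_x hh 1
  obtain ⟨h', hh', hs⟩ := exists_sbar_mul_of_mem_torus 1 hh
  refine ⟨c * b, _, mul_mem (mul_mem (torus_le_posBorel hh') h1) hy, ?_⟩
  rw [x_mul_sbar]
  calc xbar k affineA1 0 (a⁻¹ : kˣ) * corootElt k affineA1 0 a * x k affineA1 0 (-(a⁻¹ : kˣ)) *
        x k affineA1 1 b * sbar k affineA1 1 * y
      = xbar k affineA1 0 (a⁻¹ : kˣ) * (corootElt k affineA1 0 a * x k affineA1 1 b) *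
        sbar k affineA1 1 * ((sbar k affineA1 1)⁻¹ * ((x k affineA1 1 b)⁻¹ *
          x k affineA1 0 (-(a⁻¹ : kˣ)) * x k affineA1 1 b) * sbar k affineA1 1) * y := by group
    _ = xbar k affineA1 0 (a⁻¹ : kˣ) * x k affineA1 1 (c * b) *
        (corootElt k affineA1 0 a * sbar k affineA1 1) * ((sbar k affineA1 1)⁻¹ *
          ((x k affineA1 1 b)⁻¹ * x k affineA1 0 (-(a⁻¹ : kˣ)) * x k affineA1 1 b) *
          sbar k affineA1 1) * y := by rw [hc]; group
    _ = _ := by rw [hs]; group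

/-- The converse of `exists_xbar_form`. -/
theorem xbar_mul_mem_posCell (t : kˣ) (b : k) {y : Grp k affineA1} (hy : y ∈ posBorel k) :
    xbar k affineA1 0 t * x k affineA1 1 b * sbar k affineA1 1 * y ∈ posCell k := by
  have h1 := sbar_conj_rootElt_rev_mem (k := k) 1 b 0 ((t⁻¹ : kˣ) : k)
  rw [rootElt_zero, show Fin.rev (1 : Fin 2) = 0 from rfl] at h1
  have h2 : rootElt 0 1 b = sbar k affineA1 0 * x k affineA1 1 b * (sbar k affineA1 0)⁻¹ := by
    rw [rootElt_succ, rootElt_zero]; rfl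
  have hr := rootElt_mem_posBorel (k := k) 0 1 b
  rw [h2] at hr
  refine ⟨x k affineA1 0 (t⁻¹ : kˣ) * (corootElt k affineA1 0 (-t⁻¹) * corootElt k affineA1 0 (-1)) *
    (sbar k affineA1 0 * x k affineA1 1 b * (sbar k affineA1 0)⁻¹),
    mul_mem (mul_mem (x_mem_posBorel _ _) (torus_le_posBorel (mul_mem (corootElt_mem_torus _ _)
      (corootElt_mem_torus _ _)))) hr, _, mul_mem h1 hy, ?_⟩
  have hw : (weylElt 0 (-t⁻¹) : Grp k affineA1) = corootElt k affineA1 0 (-t⁻¹) *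
      corootElt k affineA1 0 (-1) * sbar k affineA1 0 := by
    rw [weylElt_eq, sbar_inv_eq, mul_assoc]
  rw [xbar_eq, hw]
  group

end Borel

/-! ### Charts of the double Bruhat cell -/

section Chart
variable {k : Type u} [Field k] [CharZero k]

/-- The chart of the double Bruhat cell on which `Δ_{ω_0}` does not vanish. Its points lie in the cell
if and only if `b ^ 2 * y' * y ≠ 1`. -/
def chartPt (s t p b : kˣ) (y' y : k) : Grp k affineA1 :=
  xbar k affineA1 0 s * corootElt k affineA1 0 p * xbar k affineA1 1 y' * corootElt k affineA1 1 b *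
    (sbar k affineA1 1)⁻¹ * xbar k affineA1 1 y * x k affineA1 0 t

theorem x_add (i : Fin 2) (s t : k) :
    x k affineA1 i (s + t) = x k affineA1 i s * x k affineA1 i t := xsym_add (.inl i) s t

theorem xbar_add (i : Fin 2) (s t : k) :
    xbar k affineA1 i (s + t) = xbar k affineA1 i s * xbar k affineA1 i t := xsym_add (.inr i) s t

theorem x_neg (i : Fin 2) (t : k) : x k affineA1 i (-t) = (x k affineA1 i t)⁻¹ :=
  xsym_neg (.inl i) t

theorem xbar_neg (i : Fin 2) (t : k) : xbar k affineA1 i (-t) = (xbar k affineA1 i t)⁻¹ :=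
  xsym_neg (.inr i) t

theorem sbar_inv_mul_xbar (i : Fin 2) (t : k) : (sbar k affineA1 i)⁻¹ * xbar k affineA1 i t
    = x k affineA1 i (-t) * (sbar k affineA1 i)⁻¹ := by
  rw [inv_mul_eq_iff_eq_mul, ← mul_assoc, sbar_mul_x affineA1_self, neg_neg, mul_inv_cancel_right]

theorem x_eq (i : Fin 2) (a : kˣ) : x k affineA1 i a
    = xbar k affineA1 i (a⁻¹ : kˣ) * corootElt k affineA1 i a * (sbar k affineA1 i)⁻¹ *
      xbar k affineA1 i (a⁻¹ : kˣ) := by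
  rw [mul_assoc _ _ (xbar k affineA1 i (a⁻¹ : kˣ)), sbar_inv_mul_xbar, ← mul_assoc, ← x_mul_sbar,
    mul_inv_cancel_right]

theorem x_mul_sbar_mul_x_of_eq_one (i : Fin 2) {b c : k} (h : b * c = 1) : ∃ (d : k) (B : kˣ),
    x k affineA1 i b * sbar k affineA1 i * x k affineA1 i c
      = xbar k affineA1 i d * corootElt k affineA1 i B := by
  lift b to kˣ using isUnit_iff_ne_zero.2 (left_ne_zero_of_mul_eq_one h)
  have hc : c = (b⁻¹ : kˣ) := by
    rw [Units.val_inv_eq_inv_val]; exact eq_inv_of_mul_eq_one_right h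
  refine ⟨(b⁻¹ : kˣ), b, ?_⟩
  rw [x_mul_sbar, hc, x_neg, inv_mul_cancel_right]

theorem x_mul_sbar_mul_x_of_ne_one (i : Fin 2) {b c : k} (h : b * c ≠ 1) :
    ∃ (y' : k) (B : kˣ) (y : k), x k affineA1 i b * sbar k affineA1 i * x k affineA1 i c
      = xbar k affineA1 i y' * corootElt k affineA1 i B * (sbar k affineA1 i)⁻¹ *
        xbar k affineA1 i y := by
  rcases eq_or_ne b 0 with rfl | hb
  · refine ⟨-c, -1, 0, ?_⟩
    have h0 : x k affineA1 i (0 : k) = 1 := xsym_zero (.inl i)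
    have h1 : xbar k affineA1 i (0 : k) = 1 := xsym_zero (.inr i)
    rw [h0, h1, one_mul, mul_one, sbar_mul_x affineA1_self, ← sbar_mul_self]
    group
  · lift b to kˣ using isUnit_iff_ne_zero.2 hb
    have he : c - (b⁻¹ : kˣ) ≠ 0 := fun h0 => h (by rw [sub_eq_zero.1 h0, Units.mul_inv])
    have h1 : x k affineA1 i b * sbar k affineA1 i * x k affineA1 i c
        = xbar k affineA1 i (b⁻¹ : kˣ) * corootElt k affineA1 i b *
          x k affineA1 i (c - (b⁻¹ : kˣ)) := by
      rw [x_mul_sbar, mul_assoc _ _ (x k affineA1 i c), ← x_add, neg_add_eq_sub]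
    rw [h1]
    lift c - (b⁻¹ : kˣ) to kˣ using isUnit_iff_ne_zero.2 he with e
    rw [x_eq i e]
    refine ⟨(b⁻¹ : kˣ) + (b ^ (-affineA1 i i) : kˣ) * (e⁻¹ : kˣ), b * e, (e⁻¹ : kˣ), ?_⟩
    have h2 := corootElt_mul_xbar (k := k) (A := affineA1) affineA1_self i i b ((e⁻¹ : kˣ) : k)
    rw [xbar_add, corootElt_mul affineA1_self]
    simp only [← mul_assoc]
    rw [mul_assoc _ (corootElt k affineA1 i b) (xbar k affineA1 i _), h2]
    group

theorem chevalley_chartPt_inv (s t p b : kˣ) (y' y : k) :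
    (chevalley k (chartPt s t p b y' y))⁻¹ = xbar k affineA1 0 t * x k affineA1 1 y *
      sbar k affineA1 1 * (corootElt k affineA1 1 b * x k affineA1 1 y' * corootElt k affineA1 0 p *
        x k affineA1 0 s) := by
  have h1 : ∀ i t, (corootElt k affineA1 i t⁻¹)⁻¹ = corootElt k affineA1 i t := fun i t => by
    rw [corootElt_inv affineA1_self, inv_inv]
  simp only [chartPt, map_mul, map_inv, chevalley_x, chevalley_xbar, chevalley_corootElt,
    chevalley_sbar, mul_inv_rev, h1, inv_inv, x_neg, xbar_neg, mul_assoc]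

theorem chartPt_mem_coxeterCell {s t p b : kˣ} {y' y : k} (h : (b : k) ^ 2 * y' * y ≠ 1) :
    chartPt s t p b y' y ∈ coxeterCell k affineA1 := by
  have hX := fun i (t : k) => x_mem_posBorel i t
  have hT : ∀ i (t : kˣ), corootElt k affineA1 i t ∈ posBorel k := fun i t =>
    torus_le_posBorel (corootElt_mem_torus i t)
  rw [mem_coxeterCell_iff, chevalley_chartPt_inv]
  refine ⟨?_, xbar_mul_mem_posCell t y
    (mul_mem (mul_mem (mul_mem (hT _ _) (hX _ _)) (hT _ _)) (hX _ _))⟩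
  have h1 := corootElt_mul_xbar (k := k) (A := affineA1) affineA1_self 1 1 b ((b : k) ^ 2 * y')
  have h2 : ((b ^ (-affineA1 1 1) : kˣ) : k) * ((b : k) ^ 2 * y') = y' := by
    rw [affineA1_self, ← mul_assoc, Units.val_zpow_eq_zpow_val, ← zpow_natCast,
      ← zpow_add₀ b.ne_zero]
    simp
  rw [h2] at h1
  obtain ⟨z', B, z, hz⟩ := x_mul_sbar_mul_x_of_ne_one (k := k) 1
    (b := -((b : k) ^ 2 * y')) (c := -y) (by rwa [neg_mul_neg])
  have h3 := congrArg (chevalley k) hz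
  simp only [map_mul, map_inv, chevalley_x, chevalley_xbar, chevalley_corootElt, chevalley_sbar,
    neg_neg] at h3
  have h4 : chartPt s t p b y' y = xbar k affineA1 0 s * ((corootElt k affineA1 0 p *
      corootElt k affineA1 1 b * corootElt k affineA1 1 (-1)) * x k affineA1 1 (-z')) *
      corootElt k affineA1 1 B⁻¹ * (sbar k affineA1 1)⁻¹ * x k affineA1 1 (-z) *
      x k affineA1 0 t := by
    have h5 : xbar k affineA1 1 ((b : k) ^ 2 * y') * corootElt k affineA1 1 (-1)
        = corootElt k affineA1 1 (-1) * xbar k affineA1 1 ((b : k) ^ 2 * y') := by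
      rw [corootElt_mul_xbar affineA1_self, affineA1_self]; simp
    have h6 : (sbar k affineA1 1)⁻¹ = corootElt k affineA1 1 (-1) * sbar k affineA1 1 :=
      sbar_inv_eq 1
    calc chartPt s t p b y' y = xbar k affineA1 0 s * corootElt k affineA1 0 p *
          (xbar k affineA1 1 y' * corootElt k affineA1 1 b) * (sbar k affineA1 1)⁻¹ *
          xbar k affineA1 1 y * x k affineA1 0 t := by rw [chartPt]; group
      _ = xbar k affineA1 0 s * corootElt k affineA1 0 p * (corootElt k affineA1 1 b *
          (xbar k affineA1 1 ((b : k) ^ 2 * y') * corootElt k affineA1 1 (-1))) *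
          sbar k affineA1 1 * xbar k affineA1 1 y * x k affineA1 0 t := by
        rw [← h1, h6]; group
      _ = xbar k affineA1 0 s * corootElt k affineA1 0 p * corootElt k affineA1 1 b *
          corootElt k affineA1 1 (-1) * (xbar k affineA1 1 ((b : k) ^ 2 * y') *
          sbar k affineA1 1 * xbar k affineA1 1 y) * x k affineA1 0 t := by rw [h5]; group
      _ = _ := by rw [h3]; group
  obtain ⟨c, hc⟩ := torus_mul_x (mul_mem (mul_mem (corootElt_mem_torus (k := k) 0 p)
    (corootElt_mem_torus 1 b)) (corootElt_mem_torus 1 (-1))) 1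
  set T := corootElt k affineA1 0 p * corootElt k affineA1 1 b * corootElt k affineA1 1 (-1) with hT'
  obtain ⟨h', hh', hs⟩ := exists_sbar_mul_of_mem_torus 1 (h := T * corootElt k affineA1 1 B⁻¹ *
    corootElt k affineA1 1 (-1)) (mul_mem (mul_mem (mul_mem (mul_mem (corootElt_mem_torus _ _)
    (corootElt_mem_torus _ _)) (corootElt_mem_torus _ _)) (corootElt_mem_torus _ _))
    (corootElt_mem_torus _ _))
  have h7 : chartPt s t p b y' y = xbar k affineA1 0 s * x k affineA1 1 (c * -z') *
      sbar k affineA1 1 * (h' * x k affineA1 1 (-z) * x k affineA1 0 t) := by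
    have h8 := sbar_inv_eq (k := k) 1
    rw [h4, hc, h8]
    calc _ = xbar k affineA1 0 s * x k affineA1 1 (c * -z') * (T * corootElt k affineA1 1 B⁻¹ *
          corootElt k affineA1 1 (-1) * sbar k affineA1 1) * x k affineA1 1 (-z) *
          x k affineA1 0 t := by group
      _ = _ := by rw [hs]; group
  rw [h7]
  exact xbar_mul_mem_posCell s _ (mul_mem (mul_mem (torus_le_posBorel hh') (hX _ _)) (hX _ _))

/-- Elements with two opposite Bruhat forms lie in the chart, or in a degenerate stratum. -/
theorem exists_chartPt {s t : kˣ} {c d : k} {y y' : Grp k affineA1} (hy : y ∈ posBorel k)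
    (hy' : y' ∈ posBorel k) {g : Grp k affineA1}
    (h1 : g = xbar k affineA1 0 s * x k affineA1 1 c * sbar k affineA1 1 * y)
    (h2 : (chevalley k g)⁻¹ = xbar k affineA1 0 t * x k affineA1 1 d * sbar k affineA1 1 * y') :
    (∃ (p b : kˣ) (z' z : k), g = chartPt s t p b z' z) ∨
    ∃ (p q : kˣ) (z : k), g = xbar k affineA1 0 s * corootElt k affineA1 0 p *
      xbar k affineA1 1 z * corootElt k affineA1 1 q * x k affineA1 0 t := by
  have h3 : g = (chevalley k y')⁻¹ * (sbar k affineA1 1)⁻¹ * xbar k affineA1 1 d *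
      x k affineA1 0 t := by
    have := congrArg (fun g => (chevalley k g)⁻¹) h2
    simp only [map_inv, inv_inv, chevalley_chevalley, map_mul, chevalley_x, chevalley_xbar,
      chevalley_sbar, mul_inv_rev, x_neg, xbar_neg] at this
    rw [this]; simp only [mul_assoc]
  obtain ⟨h, hh, c', hc'⟩ := exists_eq_torus_mul_x (l₀ := x k affineA1 1 c * sbar k affineA1 1)
    (l₀' := (sbar k affineA1 1)⁻¹ * xbar k affineA1 1 d)
    (mul_mem hy (x_mem_posBorel 0 (-(t : k)))) (mul_mem hy' (x_mem_posBorel 0 (-(s : k))))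
    (mul_mem (x_one_mem_constLoops _) sbar_one_mem_constLoops)
    (mul_mem (inv_mem sbar_one_mem_constLoops) (xbar_one_mem_constLoops _)) (by
      rw [map_mul, chevalley_x, neg_neg, mul_inv_rev, x_neg]
      have h4 : x k affineA1 1 c * sbar k affineA1 1 * y = (xbar k affineA1 0 s)⁻¹ * g := by
        rw [h1]; group
      have h5 : (chevalley k y')⁻¹ * ((sbar k affineA1 1)⁻¹ * xbar k affineA1 1 d)
          = g * (x k affineA1 0 t)⁻¹ := by rw [h3]; group
      rw [← mul_assoc, h4, mul_assoc _ (chevalley k y')⁻¹, h5, mul_assoc])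
  have h4 : y = h * x k affineA1 1 c' * x k affineA1 0 t := by
    rw [← hc', x_neg, inv_mul_cancel_right]
  have h5 := sbar_conj_mem_torus 1 hh
  obtain ⟨p, q, hpq⟩ := exists_of_mem_torus h5 0
  rw [show Fin.rev (0 : Fin 2) = 1 from rfl] at hpq
  obtain ⟨e, he⟩ := torus_mul_x h5 1
  have h6 : g = xbar k affineA1 0 s * corootElt k affineA1 0 p * corootElt k affineA1 1 q *
      (x k affineA1 1 ((e⁻¹ : kˣ) * c) * sbar k affineA1 1 * x k affineA1 1 c') *
      x k affineA1 0 t := by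
    have h7 := he ((e⁻¹ : kˣ) * c)
    rw [Units.mul_inv_cancel_left] at h7
    calc g = xbar k affineA1 0 s * (x k affineA1 1 c * (sbar k affineA1 1 * h *
          (sbar k affineA1 1)⁻¹)) * sbar k affineA1 1 * x k affineA1 1 c' * x k affineA1 0 t := by rw [h1, h4]; group
      _ = _ := by rw [← h7, hpq]; group
  have h7 : ∀ z, corootElt k affineA1 1 q * xbar k affineA1 1 z
      = xbar k affineA1 1 ((q ^ (-affineA1 1 1) : kˣ) * z) * corootElt k affineA1 1 q :=
    fun z => corootElt_mul_xbar affineA1_self 1 1 q z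
  -- an identity in `SL₂`: the middle factor is lower triangular or lies in the big cell
  by_cases hbc : ((e⁻¹ : kˣ) : k) * c * c' = 1
  · obtain ⟨z, B, hz⟩ := x_mul_sbar_mul_x_of_eq_one (k := k) 1 hbc
    refine Or.inr ⟨p, q * B, ((q ^ (-affineA1 1 1) : kˣ) : k) * z, ?_⟩
    rw [h6, hz, corootElt_mul affineA1_self, ← mul_assoc, mul_assoc _ (corootElt k affineA1 1 q),
      h7]
    group
  · obtain ⟨z', B, z, hz⟩ := x_mul_sbar_mul_x_of_ne_one (k := k) 1 hbc
    refine Or.inl ⟨p, q * B, ((q ^ (-affineA1 1 1) : kˣ) : k) * z', z, ?_⟩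
    rw [h6, hz, chartPt, corootElt_mul affineA1_self, ← mul_assoc, ← mul_assoc, ← mul_assoc,
      mul_assoc _ (corootElt k affineA1 1 q), h7]
    group

end Chart

/-! ### Verma modules on words and the Serre relations -/

section Verma
open CartanMatrix
variable {k : Type u} [Field k] (lam : Fin 2 → ℤ)

variable (k) in
/-- The underlying space of the Verma module of the Lie algebra of type `A_1^(1)` without the Serre
relations; its basis consists of the words in the `f i` applied to the highest weight vector. -/
abbrev Verma : Type u := List (Fin 2) →₀ k

/-- The weight of a word in the `f i` applied to a vector of weight `lam`. -/
def wordWeight (w : List (Fin 2)) (i : Fin 2) : ℤ := lam i - (w.map (affineA1 i)).sum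

/-- The action of `h i` on the Verma module. -/
def vermaH (i : Fin 2) : Module.End k (Verma k) :=
  Finsupp.lsum k fun w => (wordWeight lam w i : k) • Finsupp.lsingle w

/-- The action of `f i` on the Verma module. -/
def vermaF (i : Fin 2) : Module.End k (Verma k) := Finsupp.lsum k fun w => Finsupp.lsingle (i :: w)

variable (k) in
/-- The action of `e i` on a basis vector of the Verma module. -/
def vermaEWord (i : Fin 2) : List (Fin 2) → Verma k
  | [] => 0
  | j :: w => (if i = j then vermaH lam i (Finsupp.single w 1) else 0) + vermaF j (vermaEWord i w)

/-- The action of `e i` on the Verma module. -/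
def vermaE (i : Fin 2) : Module.End k (Verma k) :=
  Finsupp.lsum k fun w => LinearMap.toSpanSingleton k _ (vermaEWord k lam i w)

/-- The action of the generators on the Verma module. -/
def vermaGen : Generators (Fin 2) → Module.End k (Verma k)
  | .E i => vermaE lam i
  | .F i => vermaF i
  | .H i => vermaH lam i

@[simp] theorem vermaH_single (i : Fin 2) (w : List (Fin 2)) (c : k) :
    vermaH lam i (Finsupp.single w c) = Finsupp.single w ((wordWeight lam w i : k) * c) := by
  simp [vermaH]

@[simp] theorem vermaF_single (i : Fin 2) (w : List (Fin 2)) (c : k) :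
    vermaF i (Finsupp.single w c) = Finsupp.single (i :: w) c := by
  simp [vermaF]

@[simp] theorem vermaE_single (i : Fin 2) (w : List (Fin 2)) :
    vermaE lam i (Finsupp.single w (1 : k)) = vermaEWord k lam i w := by
  simp [vermaE]

theorem verma_hh (i j : Fin 2) (y : Verma k) :
    vermaH lam i (vermaH lam j y) = vermaH lam j (vermaH lam i y) := by
  induction y using Finsupp.induction_linear with
  | zero => simp
  | add a b ha hb => simp only [map_add, ha, hb]
  | single w c => simp only [vermaH_single]; congr 1; ring

theorem verma_hf (i j : Fin 2) (y : Verma k) : vermaH lam i (vermaF j y)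
    = vermaF j (vermaH lam i y) - (affineA1 i j : k) • vermaF j y := by
  induction y using Finsupp.induction_linear with
  | zero => simp
  | add a b ha hb => simp only [map_add, ha, hb]; module
  | single w c =>
    simp only [vermaF_single, vermaH_single, wordWeight, ← Finsupp.single_sub, Finsupp.smul_single,
      smul_eq_mul]
    congr 1
    push_cast [List.map_cons, List.sum_cons]
    ring

theorem verma_ef (i j : Fin 2) (y : Verma k) : vermaE lam i (vermaF j y)
    = vermaF j (vermaE lam i y) + if i = j then vermaH lam i y else 0 := by
  induction y using Finsupp.induction_linear with
  | zero => simp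
  | add a b ha hb => simp only [map_add, ha, hb]; split_ifs <;> module
  | single w c =>
    rw [← mul_one c, ← smul_eq_mul, ← Finsupp.smul_single]
    simp only [map_smul, vermaF_single, vermaE_single, vermaEWord]
    split_ifs <;> module

theorem verma_he (i j : Fin 2) (y : Verma k) : vermaH lam i (vermaE lam j y)
    = vermaE lam j (vermaH lam i y) + (affineA1 i j : k) • vermaE lam j y := by
  have key : ∀ w, vermaH lam i (vermaEWord k lam j w)
      = ((wordWeight lam w i + affineA1 i j : ℤ) : k) • vermaEWord k lam j w := by
    intro w
    induction w with
    | nil => simp [vermaEWord]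
    | cons l w ih =>
      rw [vermaEWord, map_add, verma_hf, ih, map_smul, smul_add]
      have h2 : wordWeight lam (l :: w) i = wordWeight lam w i - affineA1 i l := by
        simp [wordWeight]; ring
      rw [h2]
      congr 1
      · split_ifs with hjl
        · subst hjl; simp
        · simp
      · push_cast; module
  induction y using Finsupp.induction_linear with
  | zero => simp
  | add a b ha hb => simp only [map_add, ha, hb]; module
  | single w c =>
    have hs : ∀ c : k, (Finsupp.single w c : Verma k) = c • Finsupp.single w (1 : k) := fun c => by simp
    rw [vermaH_single, hs c, hs (_ * _), map_smul, map_smul, map_smul, vermaE_single, key]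
    push_cast
    module

theorem end_lie_apply {V : Type u} [AddCommGroup V] [Module k V] (S T : Module.End k V) (v : V) :
    ⁅S, T⁆ v = S (T v) - T (S v) := rfl

/-- The Serre element commutes with the opposite generators. -/
theorem lie_serre_eq_zero {L : Type u} [LieRing L] [LieAlgebra k L] {e f h e' f' h' : L}
    (ef : ⁅e, f⁆ = h) (ef' : ⁅e, f'⁆ = 0) (hf : ⁅h, f⁆ = -((2 : k) • f))
    (hf' : ⁅h, f'⁆ = (2 : k) • f') (e'f : ⁅e', f⁆ = 0) (e'f' : ⁅e', f'⁆ = h')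
    (h'f : ⁅h', f⁆ = (2 : k) • f) :
    ⁅e, ⁅f, ⁅f, ⁅f, f'⁆⁆⁆⁆ = 0 ∧ ⁅e', ⁅f, ⁅f, ⁅f, f'⁆⁆⁆⁆ = 0 := by
  have h1 : ⁅h, ⁅f, f'⁆⁆ = 0 := by
    rw [leibniz_lie, hf, hf', neg_lie, smul_lie, lie_smul, neg_add_cancel]
  have h2 : ⁅h, ⁅f, ⁅f, f'⁆⁆⁆ = -((2 : k) • ⁅f, ⁅f, f'⁆⁆) := by
    rw [leibniz_lie, hf, h1, neg_lie, smul_lie, lie_zero, add_zero]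
  have e1 : ⁅e, ⁅f, f'⁆⁆ = (2 : k) • f' := by
    rw [leibniz_lie, ef, ef', lie_zero, add_zero, hf']
  have e2 : ⁅e, ⁅f, ⁅f, f'⁆⁆⁆ = (2 : k) • ⁅f, f'⁆ := by
    rw [leibniz_lie, ef, h1, e1, zero_add, lie_smul]
  have g1 : ⁅e', ⁅f, f'⁆⁆ = -((2 : k) • f) := by
    rw [leibniz_lie, e'f, e'f', zero_lie, zero_add, ← lie_skew, h'f]
  have g2 : ⁅e', ⁅f, ⁅f, f'⁆⁆⁆ = 0 := by
    rw [leibniz_lie, e'f, g1, zero_lie, zero_add, lie_neg, lie_smul, lie_self, smul_zero, neg_zero]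
  constructor
  · rw [leibniz_lie, ef, h2, e2, lie_smul, neg_add_cancel]
  · rw [leibniz_lie, e'f, g2, zero_lie, lie_zero, add_zero]

variable (k) in
/-- The Serre element `(ad f i)³ (f j)` for the two different nodes `i` and `j`. -/
def vermaSerreF (i : Fin 2) : Module.End k (Verma k) :=
  ⁅(vermaF i : Module.End k (Verma k)), ⁅(vermaF i : Module.End k (Verma k)),
    ⁅(vermaF i : Module.End k (Verma k)), (vermaF i.rev : Module.End k (Verma k))⁆⁆⁆

variable (k) in
/-- The Serre element `(ad e i)³ (e j)` for the two different nodes `i` and `j`. -/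
def vermaSerreE (i : Fin 2) : Module.End k (Verma k) :=
  ⁅(vermaE lam i : Module.End k (Verma k)), ⁅(vermaE lam i : Module.End k (Verma k)),
    ⁅(vermaE lam i : Module.End k (Verma k)), (vermaE lam i.rev : Module.End k (Verma k))⁆⁆⁆

theorem vermaE_serreF (i j : Fin 2) (y : Verma k) :
    vermaE lam j (vermaSerreF k i y) = vermaSerreF k i (vermaE lam j y) := by
  have hr := affineA1_rev i
  have hr' := affineA1_rev' i
  have hne := ne_rev i
  have hs := affineA1_self i
  have hS := lie_serre_eq_zero (k := k) (L := Module.End k (Verma k))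
    (e := vermaE lam i) (f := vermaF i) (h := vermaH lam i) (e' := vermaE lam i.rev)
    (f' := vermaF i.rev) (h' := vermaH lam i.rev)
    (LinearMap.ext fun y => by rw [end_lie_apply, verma_ef, if_pos rfl]; abel)
    (LinearMap.ext fun y => by rw [end_lie_apply, verma_ef, if_neg hne]; simp)
    (LinearMap.ext fun y => by rw [end_lie_apply, verma_hf, hs]; simp)
    (LinearMap.ext fun y => by rw [end_lie_apply, verma_hf, hr]; simp)
    (LinearMap.ext fun y => by rw [end_lie_apply, verma_ef, if_neg hne.symm]; simp)
    (LinearMap.ext fun y => by rw [end_lie_apply, verma_ef, if_pos rfl]; abel)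
    (LinearMap.ext fun y => by rw [end_lie_apply, verma_hf, hr']; simp)
  rcases eq_or_eq_rev i j with rfl | rfl
  · exact sub_eq_zero.1 (LinearMap.congr_fun hS.1 y)
  · exact sub_eq_zero.1 (LinearMap.congr_fun hS.2 y)

theorem vermaF_serreE (i j : Fin 2) (y : Verma k) :
    vermaF j (vermaSerreE k lam i y) = vermaSerreE k lam i (vermaF j y) := by
  have hr := affineA1_rev i
  have hr' := affineA1_rev' i
  have hne := ne_rev i
  have hs := affineA1_self i
  have hS := lie_serre_eq_zero (k := k) (L := Module.End k (Verma k))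
    (e := vermaF i) (f := vermaE lam i) (h := -(vermaH lam i : Module.End k (Verma k))) (e' := vermaF i.rev)
    (f' := vermaE lam i.rev) (h' := -(vermaH lam i.rev : Module.End k (Verma k)))
    (LinearMap.ext fun y => by rw [end_lie_apply, verma_ef, if_pos rfl]; simp)
    (LinearMap.ext fun y => by rw [end_lie_apply, verma_ef, if_neg hne.symm]; simp)
    (LinearMap.ext fun y => by
      rw [end_lie_apply, LinearMap.neg_apply, LinearMap.neg_apply, verma_he, hs]; simp)
    (LinearMap.ext fun y => by
      rw [end_lie_apply, LinearMap.neg_apply, LinearMap.neg_apply, verma_he, hr]; simp)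
    (LinearMap.ext fun y => by rw [end_lie_apply, verma_ef, if_neg hne]; simp)
    (LinearMap.ext fun y => by rw [end_lie_apply, verma_ef, if_pos rfl]; simp)
    (LinearMap.ext fun y => by
      rw [end_lie_apply, LinearMap.neg_apply, LinearMap.neg_apply, verma_he, hr']; simp)
  rcases eq_or_eq_rev i j with rfl | rfl
  · exact sub_eq_zero.1 (LinearMap.congr_fun hS.1 y)
  · exact sub_eq_zero.1 (LinearMap.congr_fun hS.2 y)

theorem vermaSerreE_eq_zero (i : Fin 2) : vermaSerreE k lam i = 0 := by
  ext w : 2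
  rw [LinearMap.comp_apply, Finsupp.lsingle_apply, LinearMap.zero_comp, LinearMap.zero_apply]
  induction w with
  | nil => simp [vermaSerreE, vermaEWord]
  | cons j w ih => rw [← vermaF_single, ← vermaF_serreE, ih, map_zero]

theorem vermaH_serreF (i j : Fin 2) : ∃ c : k, ∀ y,
    vermaH lam j (vermaSerreF k i y) = vermaSerreF k i (vermaH lam j y) + c • vermaSerreF k i y := by
  refine ⟨3 * -(affineA1 j i : k) + -(affineA1 j i.rev : k), fun y => ?_⟩
  simp only [vermaSerreF, end_lie_apply, map_sub, verma_hf, map_smul]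
  module

variable (k) in
/-- The submodule of the Verma module generated by the Serre relations, generated by words in the
`f i` alone. -/
def vermaRel : Submodule k (Verma k) :=
  sInf {R | (∀ i y, vermaSerreF k i y ∈ R) ∧ ∀ i, ∀ y ∈ R, vermaF i y ∈ R}

theorem serreF_mem_vermaRel (i : Fin 2) (y : Verma k) : vermaSerreF k i y ∈ vermaRel k :=
  Submodule.mem_sInf.2 fun _ hR => hR.1 i y

theorem vermaF_mem_vermaRel (i : Fin 2) {y : Verma k} (hy : y ∈ vermaRel k) :
    vermaF i y ∈ vermaRel k :=
  Submodule.mem_sInf.2 fun R hR => hR.2 i y (Submodule.mem_sInf.1 hy R hR)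

theorem vermaRel_induction {P : Submodule k (Verma k)} (h₁ : ∀ i y, vermaSerreF k i y ∈ P)
    (h₂ : ∀ i, ∀ y ∈ vermaRel k, y ∈ P → vermaF i y ∈ P) {y : Verma k} (hy : y ∈ vermaRel k) :
    y ∈ P := by
  have := Submodule.mem_sInf.1 hy (P ⊓ vermaRel k)
    ⟨fun i y => ⟨h₁ i y, serreF_mem_vermaRel i y⟩,
      fun i y hy => ⟨h₂ i y hy.2 hy.1, vermaF_mem_vermaRel i hy.2⟩⟩
  exact this.1

theorem vermaH_mem_vermaRel (j : Fin 2) {y : Verma k} (hy : y ∈ vermaRel k) :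
    vermaH lam j y ∈ vermaRel k := by
  refine vermaRel_induction (P := (vermaRel k).comap (vermaH lam j)) (fun i y => ?_)
    (fun i y hy hy' => ?_) hy
  · obtain ⟨c, hc⟩ := vermaH_serreF (k := k) lam i j
    rw [Submodule.mem_comap, hc]
    exact add_mem (serreF_mem_vermaRel _ _) (Submodule.smul_mem _ _ (serreF_mem_vermaRel _ _))
  · rw [Submodule.mem_comap, verma_hf]
    exact sub_mem (vermaF_mem_vermaRel i hy') (Submodule.smul_mem _ _ (vermaF_mem_vermaRel i hy))

theorem vermaE_mem_vermaRel (j : Fin 2) {y : Verma k} (hy : y ∈ vermaRel k) :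
    vermaE lam j y ∈ vermaRel k := by
  refine vermaRel_induction (P := (vermaRel k).comap (vermaE lam j)) (fun i y => ?_)
    (fun i y hy hy' => ?_) hy
  · rw [Submodule.mem_comap, vermaE_serreF]
    exact serreF_mem_vermaRel _ _
  · rw [Submodule.mem_comap, verma_ef]
    refine add_mem (vermaF_mem_vermaRel i hy') ?_
    split_ifs
    · exact vermaH_mem_vermaRel lam j hy
    · exact zero_mem _

theorem vermaGen_mem_vermaRel (g) : vermaRel k ≤ (vermaRel k).comap (vermaGen lam g) := by
  rcases g with j | j | j
  · exact fun y hy => vermaH_mem_vermaRel lam j hy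
  · exact fun y hy => vermaE_mem_vermaRel lam j hy
  · exact fun y hy => vermaF_mem_vermaRel j hy

theorem vermaF_apply_nil (i : Fin 2) (y : Verma k) : vermaF i y [] = 0 := by
  induction y using Finsupp.induction_linear with
  | zero => simp
  | add a b ha hb => simp [ha, hb]
  | single w c => simp

theorem vermaRel_apply_nil {y : Verma k} (hy : y ∈ vermaRel k) : y [] = 0 := by
  refine vermaRel_induction (P := LinearMap.ker (Finsupp.lapply [])) (fun i y => ?_)
    (fun i y _ _ => vermaF_apply_nil i y) hy
  simp [vermaSerreF, vermaF_apply_nil]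

/-- The action of the generators on the quotient of the Verma module by the Serre relations. -/
def vermaQuotGen (g : Generators (Fin 2)) :
    Module.End k (Verma k ⧸ vermaRel k) :=
  (vermaRel k).mapQ (vermaRel k) (vermaGen lam g) (vermaGen_mem_vermaRel lam g)

theorem lift_vermaQuotGen (y : FreeLieAlgebra k (Generators (Fin 2))) (m : Verma k) :
    FreeLieAlgebra.lift k (vermaQuotGen lam) y (Submodule.Quotient.mk m)
      = Submodule.Quotient.mk (FreeLieAlgebra.lift k (vermaGen lam) y m) := by
  let S : LieSubalgebra k (FreeLieAlgebra k (Generators (Fin 2))) :=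
    { carrier := {y | ∀ m : Verma k,
        FreeLieAlgebra.lift k (vermaQuotGen lam) y (Submodule.Quotient.mk m)
          = Submodule.Quotient.mk (FreeLieAlgebra.lift k (vermaGen lam) y m)}
      add_mem' := fun ha hb m => by simp [ha m, hb m]
      zero_mem' := fun m => by simp
      smul_mem' := fun c y hy m => by simp [hy m]
      lie_mem' := fun {a b} ha hb m => by
        have h1 : ∀ {V : Type u} [AddCommGroup V] [Module k V]
            (φ : Generators (Fin 2) → Module.End k V) (v : V),
            FreeLieAlgebra.lift k φ ⁅a, b⁆ v
              = FreeLieAlgebra.lift k φ a (FreeLieAlgebra.lift k φ b v)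
                - FreeLieAlgebra.lift k φ b (FreeLieAlgebra.lift k φ a v) :=
          fun φ v => LinearMap.congr_fun (LieHom.map_lie _ _ _) v
        rw [h1, h1, ha, hb, ha, hb, Submodule.Quotient.mk_sub] }
  have h : LieHom.id = S.incl.comp (FreeLieAlgebra.lift k fun g =>
      (⟨FreeLieAlgebra.of k g, fun m => by
        rw [FreeLieAlgebra.lift_of_apply, FreeLieAlgebra.lift_of_apply]; rfl⟩ : S)) := by
    refine FreeLieAlgebra.hom_ext fun g => ?_
    rw [LieHom.comp_apply, FreeLieAlgebra.lift_of_apply]; rfl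
  have h2 := LieHom.congr_fun h y
  rw [LieHom.id_apply] at h2
  rw [h2]
  exact SetLike.coe_mem (FreeLieAlgebra.lift k _ y : S) m

theorem vermaQuotGen_relations : ∀ y ∈ Relations.toSet k affineA1,
    FreeLieAlgebra.lift k (vermaQuotGen (k := k) lam) y = 0 := by
  suffices H : ∀ y ∈ Relations.toSet k affineA1, ∀ m,
      FreeLieAlgebra.lift k (vermaGen (k := k) lam) y m ∈ vermaRel k by
    intro y hy
    refine LinearMap.ext fun m => ?_
    obtain ⟨m, rfl⟩ := Submodule.Quotient.mk_surjective _ m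
    rw [lift_vermaQuotGen, LinearMap.zero_apply]
    exact (Submodule.Quotient.mk_eq_zero _).2 (H y hy m)
  have hm : ∀ x y m, FreeLieAlgebra.lift k (vermaGen (k := k) lam) ⁅x, y⁆ m
      = FreeLieAlgebra.lift k (vermaGen lam) x (FreeLieAlgebra.lift k (vermaGen lam) y m)
        - FreeLieAlgebra.lift k (vermaGen lam) y (FreeLieAlgebra.lift k (vermaGen lam) x m) :=
    fun x y m => LinearMap.congr_fun (LieHom.map_lie _ _ _) m
  have hzm : ∀ (c : ℤ) x, FreeLieAlgebra.lift k (vermaGen (k := k) lam) (c • x)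
      = (c : k) • FreeLieAlgebra.lift k (vermaGen (k := k) lam) x := fun c x => by
    rw [← Int.cast_smul_eq_zsmul k c x, map_smul]
  have hE : ∀ i, vermaGen (k := k) lam (.E i) = vermaE lam i := fun _ => rfl
  have hF : ∀ i, vermaGen (k := k) lam (.F i) = vermaF i := fun _ => rfl
  have hH : ∀ i, vermaGen (k := k) lam (.H i) = vermaH lam i := fun _ => rfl
  have n0 : ∀ i, (-affineA1 i i).toNat = 0 := fun i => by rw [affineA1_self]; rfl
  have n2 : ∀ i, (-affineA1 i i.rev).toNat = 2 := fun i => by rw [affineA1_rev]; rfl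
  have h0 : ∀ {y m}, FreeLieAlgebra.lift k (vermaGen (k := k) lam) y m = 0 →
      FreeLieAlgebra.lift k (vermaGen (k := k) lam) y m ∈ vermaRel k := fun {y m} h => by
    rw [h]; exact zero_mem _
  rintro y (((((⟨⟨i, j⟩, rfl⟩ | ⟨⟨i, j⟩, rfl⟩) | ⟨⟨i, j⟩, rfl⟩) | ⟨⟨i, j⟩, rfl⟩) | ⟨⟨i, j⟩, rfl⟩) |
    ⟨⟨i, j⟩, rfl⟩) m
  · refine h0 ?_
    simp only [Relations.HH, Function.uncurry, Function.comp, hm,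
      FreeLieAlgebra.lift_of_apply, hH]
    rw [verma_hh, sub_self]
  · refine h0 ?_
    simp only [Relations.EF, Function.uncurry, Function.comp]
    split_ifs with hij
    · subst hij
      simp only [map_sub, LinearMap.sub_apply, hm, FreeLieAlgebra.lift_of_apply, hH, hE, hF]
      rw [verma_ef, if_pos rfl]; abel
    · simp only [hm, FreeLieAlgebra.lift_of_apply, hE, hF]
      rw [verma_ef, if_neg hij]; abel
  · refine h0 ?_
    simp only [Relations.HE, Function.uncurry, Function.comp, map_sub,
      LinearMap.sub_apply, hm, hzm, LinearMap.smul_apply, FreeLieAlgebra.lift_of_apply, hH, hE]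
    rw [verma_he]; abel
  · refine h0 ?_
    simp only [Relations.HF, Function.uncurry, Function.comp, map_add,
      LinearMap.add_apply, hm, hzm, LinearMap.smul_apply, FreeLieAlgebra.lift_of_apply, hH, hF]
    rw [verma_hf]; abel
  · refine h0 ?_
    simp only [Relations.adE, Function.uncurry, Function.comp]
    rcases eq_or_eq_rev i j with rfl | rfl
    · rw [n0, pow_zero, Module.End.one_apply, lie_self, map_zero, LinearMap.zero_apply]
    · rw [n2, pow_two, Module.End.mul_apply, LieAlgebra.ad_apply, LieAlgebra.ad_apply]
      have := LinearMap.congr_fun (vermaSerreE_eq_zero (k := k) lam i) m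
      simp only [vermaSerreE, end_lie_apply, LinearMap.zero_apply] at this
      simpa only [hm, FreeLieAlgebra.lift_of_apply, hE] using this
  · simp only [Relations.adF, Function.uncurry, Function.comp]
    rcases eq_or_eq_rev i j with rfl | rfl
    · rw [n0, pow_zero, Module.End.one_apply, lie_self, map_zero]; exact zero_mem _
    · rw [n2, pow_two, Module.End.mul_apply, LieAlgebra.ad_apply, LieAlgebra.ad_apply]
      have := serreF_mem_vermaRel i m
      simp only [vermaSerreF, end_lie_apply] at this
      simpa only [hm, FreeLieAlgebra.lift_of_apply, hF] using this

/-- The quotient of the Verma module by the Serre relations as a representation. -/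
def vermaRep : LieAlg k affineA1 →ₗ⁅k⁆ Module.End k (Verma k ⧸ vermaRel k) :=
  liftRep (vermaQuotGen lam) (vermaQuotGen_relations lam)

/-- The vacuum coefficient in the Verma module separates `1` from `lowerPart`. This is what makes the
projection to the highest weight line nonzero. -/
theorem exists_lowerPart_functional : ∃ θ : Env k affineA1 →ₗ[k] k,
    θ 1 = 1 ∧ ∀ y ∈ lowerPart k affineA1 lam, θ y = 0 := by
  let π : Verma k ⧸ vermaRel k →ₗ[k] k := (vermaRel k).liftQ (Finsupp.lapply [])
    fun y hy => vermaRel_apply_nil hy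
  let v : Verma k ⧸ vermaRel k := Submodule.Quotient.mk (Finsupp.single [] 1)
  let α := UniversalEnvelopingAlgebra.lift k (vermaRep (k := k) lam)
  have hα : ∀ y, α (UniversalEnvelopingAlgebra.ι k y) = vermaRep lam y := fun y => by
    simp [α]
  have hgen : ∀ g, vermaRep (k := k) lam (gen k affineA1 g) = vermaQuotGen lam g :=
    fun g => liftRep_gen _ _ g
  refine ⟨π ∘ₗ (LinearMap.applyₗ v) ∘ₗ α.toLinearMap, ?_, fun y hy => ?_⟩
  · simp only [LinearMap.comp_apply, AlgHom.toLinearMap_apply, map_one, LinearMap.applyₗ_apply_apply,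
      Module.End.one_apply]
    show (Finsupp.single [] 1 : Verma k) [] = 1
    simp
  · refine Submodule.span_induction ?_ (map_zero _) (fun a b _ _ ha hb => by rw [map_add, ha, hb,
      add_zero]) (fun c a _ ha => by rw [map_smul, ha, smul_zero]) hy
    rintro _ ⟨i, z, rfl | rfl | rfl⟩ <;>
      simp only [LinearMap.comp_apply, AlgHom.toLinearMap_apply, map_mul, map_sub, hα,
        LinearMap.applyₗ_apply_apply, Module.End.mul_apply, AlgHom.commutes, LinearMap.sub_apply]
    · obtain ⟨m, hm⟩ := Submodule.Quotient.mk_surjective _ (α z v)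
      rw [← hm, show vermaRep lam (f k affineA1 i) = _ from hgen (.F i)]
      exact vermaF_apply_nil i m
    · have : vermaRep (k := k) lam (e k affineA1 i) v = 0 := by
        rw [show vermaRep (k := k) lam (e k affineA1 i) = _ from hgen (.E i)]
        show Submodule.Quotient.mk (vermaE lam i (Finsupp.single [] 1)) = _
        rw [vermaE_single]; rfl
      rw [this, map_zero, map_zero]
    · have : vermaRep (k := k) lam (h k affineA1 i) v = (lam i : k) • v := by
        rw [show vermaRep (k := k) lam (h k affineA1 i) = _ from hgen (.H i)]
        show Submodule.Quotient.mk (vermaH lam i (Finsupp.single [] 1)) = _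
        rw [vermaH_single, ← smul_eq_mul, ← Finsupp.smul_single, Submodule.Quotient.mk_smul]
        simp [wordWeight, v]
      rw [this, Module.algebraMap_end_apply, sub_self]

end Verma

/-! ### Highest weight modules -/

section HighestWeightModule
variable {k : Type u} [Field k]

open UniversalEnvelopingAlgebra in
theorem env_closure_induction {r : ℕ} {A : Matrix (Fin r) (Fin r) ℤ} {S : Submodule k (Env k A)}
    (one : 1 ∈ S) (e_mul : ∀ i, ∀ y ∈ S, y * ι k (e k A i) ∈ S)
    (f_mul : ∀ i, ∀ y ∈ S, y * ι k (f k A i) ∈ S) (h_mul : ∀ i, ∀ y ∈ S, y * ι k (h k A i) ∈ S)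
    (y : Env k A) : y ∈ S := by
  -- the elements of the Lie algebra by which right multiplication preserves `S`
  let T : LieSubalgebra k (LieAlg k A) :=
    { carrier := {x | ∀ y ∈ S, y * ι k x ∈ S}
      add_mem' := fun ha hb y hy => by
        rw [map_add, mul_add]; exact add_mem (ha y hy) (hb y hy)
      zero_mem' := fun y hy => by simp
      smul_mem' := fun c x hx y hy => by
        rw [map_smul, mul_smul_comm]; exact S.smul_mem c (hx y hy)
      lie_mem' := fun {a b} ha hb y hy => by
        have : ι k ⁅a, b⁆ = ι k a * ι k b - ι k b * ι k a := LieHom.map_lie _ _ _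
        rw [this, mul_sub, ← mul_assoc, ← mul_assoc]
        exact sub_mem (hb _ (ha y hy)) (ha _ (hb y hy)) }
  have hT : ∀ x, ∀ y ∈ S, y * ι k x ∈ S := gen_induction T e_mul f_mul h_mul
  -- the elements of the enveloping algebra by which right multiplication preserves `S`
  let U : Subalgebra k (Env k A) :=
    { carrier := {z | ∀ y ∈ S, y * z ∈ S}
      mul_mem' := fun ha hb y hy => by rw [← mul_assoc]; exact hb _ (ha y hy)
      add_mem' := fun ha hb y hy => by rw [mul_add]; exact add_mem (ha y hy) (hb y hy)
      algebraMap_mem' := fun c y hy => by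
        rw [← Algebra.commutes, ← Algebra.smul_def]; exact S.smul_mem c hy }
  have hU : ∀ z, z ∈ U := fun z => by
    let φ : LieAlg k A →ₗ⁅k⁆ U :=
      { toFun := fun x => ⟨ι k x, hT x⟩
        map_add' := fun _ _ => Subtype.ext (map_add _ _ _)
        map_smul' := fun _ _ => Subtype.ext (map_smul _ _ _)
        map_lie' := Subtype.ext (LieHom.map_lie _ _ _) }
    have h : AlgHom.id k (Env k A) = U.val.comp (lift k φ) := by
      refine UniversalEnvelopingAlgebra.hom_ext k (LieHom.ext fun x => ?_)
      simp only [LieHom.comp_apply, AlgHom.coe_toLieHom, AlgHom.id_apply, AlgHom.comp_apply,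
        lift_ι_apply]
      rfl
    rw [← AlgHom.id_apply (R := k) z, h]
    exact SetLike.coe_mem (lift k φ z)
  simpa using hU y 1 one

open UniversalEnvelopingAlgebra in
/-- The words which span the enveloping algebra by the triangular decomposition. -/
inductive TriangularWord {r : ℕ} (A : Matrix (Fin r) (Fin r) ℤ) : Env k A → Prop
  | one : TriangularWord A 1
  | f_mul (i) {y} : TriangularWord A y → TriangularWord A (ι k (f k A i) * y)
  | mul_e (i) {y} : TriangularWord A y → TriangularWord A (y * ι k (e k A i))
  | mul_h (i) {y} : TriangularWord A y → TriangularWord A (y * ι k (h k A i))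

open UniversalEnvelopingAlgebra in
/-- The triangular decomposition of the enveloping algebra, as an induction principle. -/
theorem env_induction {r : ℕ} {A : Matrix (Fin r) (Fin r) ℤ} {S : Submodule k (Env k A)}
    (one : 1 ∈ S) (f_mul : ∀ i, ∀ y ∈ S, ι k (f k A i) * y ∈ S)
    (mul_e : ∀ i, ∀ y ∈ S, y * ι k (e k A i) ∈ S) (mul_h : ∀ i, ∀ y ∈ S, y * ι k (h k A i) ∈ S)
    (y : Env k A) : y ∈ S := by
  have hW : Submodule.span k {y | TriangularWord A y} ≤ S := by
    refine Submodule.span_le.2 fun y hy => ?_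
    induction hy with
    | one => exact one
    | f_mul i _ ih => exact f_mul i _ ih
    | mul_e i _ ih => exact mul_e i _ ih
    | mul_h i _ ih => exact mul_h i _ ih
  refine hW ?_
  set W := Submodule.span k {y : Env k A | TriangularWord A y} with hWdef
  have span_ind : ∀ (φ : Env k A →ₗ[k] Env k A), (∀ y, TriangularWord A y → φ y ∈ W) →
      ∀ y ∈ W, φ y ∈ W := fun φ h y hy =>
    (Submodule.span_le (p := W.comap φ)).2 h hy
  have he : ∀ i, ∀ y ∈ W, y * ι k (e k A i) ∈ W := fun i =>
    span_ind (LinearMap.mulRight k _) fun y hy => Submodule.subset_span (hy.mul_e i)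
  have hh : ∀ i, ∀ y ∈ W, y * ι k (h k A i) ∈ W := fun i =>
    span_ind (LinearMap.mulRight k _) fun y hy => Submodule.subset_span (hy.mul_h i)
  have hf : ∀ i, ∀ y ∈ W, ι k (f k A i) * y ∈ W := fun i =>
    span_ind (LinearMap.mulLeft k _) fun y hy => Submodule.subset_span (hy.f_mul i)
  have hlie : ∀ a b : LieAlg k A, ι k a * ι k b = ι k ⁅a, b⁆ + ι k b * ι k a := fun a b => by
    have : ι k ⁅a, b⁆ = ι k a * ι k b - ι k b * ι k a := LieHom.map_lie _ _ _
    rw [this, sub_add_cancel]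
  -- right multiplication by `f i` is moved to the left past the letters of the word
  refine env_closure_induction (Submodule.subset_span .one) he (fun i => ?_) hh y
  refine span_ind (LinearMap.mulRight k _) fun y hy => ?_
  rw [LinearMap.mulRight_apply]
  induction hy with
  | one =>
    have := (TriangularWord.one (k := k) (A := A)).f_mul i
    rw [mul_one] at this
    rw [one_mul]; exact Submodule.subset_span this
  | f_mul j _ ih => rw [mul_assoc]; exact hf j _ ih
  | mul_e j hy ih =>
    rw [mul_assoc, hlie, mul_add, ← mul_assoc]
    refine add_mem ?_ (he j _ ih)
    by_cases hij : j = i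
    · subst hij; rw [lie_e_f_self]; exact Submodule.subset_span (hy.mul_h j)
    · rw [lie_e_f_ne hij, map_zero, mul_zero]; exact zero_mem _
  | mul_h j hy ih =>
    rw [mul_assoc, hlie, mul_add, ← mul_assoc]
    refine add_mem ?_ (hh j _ ih)
    rw [lie_h_f, map_smul, mul_smul_comm]
    exact W.smul_mem _ ih

variable (lam : Fin 2 → ℤ)

local notation "ρV" => highestWeightRep k affineA1
local notation "vV" => highestWeightVector k affineA1
local notation "πV" => highestWeightProj k affineA1

theorem highestWeightRep_mk (x : LieAlg k affineA1) (y : Env k affineA1) :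
    ρV lam x (Submodule.Quotient.mk y)
      = Submodule.Quotient.mk (UniversalEnvelopingAlgebra.ι k x * y) := rfl

theorem mem_highestWeightIdeal_of_e (i : Fin 2) (z : Env k affineA1) :
    z * UniversalEnvelopingAlgebra.ι k (e k affineA1 i) ∈ highestWeightIdeal k affineA1 lam :=
  fun w => Submodule.subset_span ⟨i, w * z, Or.inr (Or.inl (mul_assoc _ _ _).symm)⟩

theorem mem_highestWeightIdeal_of_h (i : Fin 2) (z : Env k affineA1) :
    z * (UniversalEnvelopingAlgebra.ι k (h k affineA1 i) - algebraMap k _ (lam i : k))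
      ∈ highestWeightIdeal k affineA1 lam :=
  fun w => Submodule.subset_span ⟨i, w * z, Or.inr (Or.inr (mul_assoc _ _ _).symm)⟩

theorem e_highestWeightVector (i : Fin 2) : ρV lam (e k affineA1 i) (vV lam) = 0 := by
  rw [highestWeightVector, highestWeightRep_mk, mul_one]
  exact (Submodule.Quotient.mk_eq_zero _).2 (by simpa using mem_highestWeightIdeal_of_e lam i 1)

theorem mk_mul_h (i : Fin 2) (z : Env k affineA1) :
    (Submodule.Quotient.mk (z * UniversalEnvelopingAlgebra.ι k (h k affineA1 i)) :
      HighestWeightModule k affineA1 lam) = (lam i : k) • Submodule.Quotient.mk z := by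
  have := (Submodule.Quotient.mk_eq_zero _).2 (mem_highestWeightIdeal_of_h (k := k) lam i z)
  rw [mul_sub, Submodule.Quotient.mk_sub, sub_eq_zero] at this
  rw [this, ← Algebra.commutes, ← Algebra.smul_def]
  rfl

theorem h_highestWeightVector (i : Fin 2) :
    ρV lam (h k affineA1 i) (vV lam) = (lam i : k) • vV lam := by
  rw [highestWeightVector, highestWeightRep_mk, mul_one]
  simpa using mk_mul_h (k := k) lam i 1

/-- The highest weight module is spanned by the words in the `f i` applied to the highest weight
vector. -/
theorem highestWeightModule_induction {S : Submodule k (HighestWeightModule k affineA1 lam)}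
    (hv : vV lam ∈ S) (hf : ∀ i, ∀ w ∈ S, ρV lam (f k affineA1 i) w ∈ S)
    (w : HighestWeightModule k affineA1 lam) : w ∈ S := by
  obtain ⟨y, rfl⟩ := Submodule.Quotient.mk_surjective _ w
  let q : Env k affineA1 →ₗ[k] HighestWeightModule k affineA1 lam :=
    (Submodule.mkQ (highestWeightIdeal k affineA1 lam)).restrictScalars k
  refine env_induction (S := S.comap q) hv (fun i y hy => hf i _ hy) (fun i y _ => ?_)
    (fun i y hy => ?_) y
  · have : q (y * UniversalEnvelopingAlgebra.ι k (e k affineA1 i)) = 0 :=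
      (Submodule.Quotient.mk_eq_zero _).2 (mem_highestWeightIdeal_of_e lam i y)
    rw [Submodule.mem_comap, this]; exact zero_mem _
  · have : q (y * UniversalEnvelopingAlgebra.ι k (h k affineA1 i)) = (lam i : k) • q y :=
      mk_mul_h lam i y
    rw [Submodule.mem_comap, this]; exact S.smul_mem _ hy

theorem highestWeightProj_spec : πV lam (vV lam) = 1 ∧
    ∀ i v, πV lam (ρV lam (f k affineA1 i) v) = 0 := by
  obtain ⟨θ, h1, h2⟩ := exists_lowerPart_functional (k := k) lam
  refine Classical.epsilon_spec (p := fun π : HighestWeightModule k affineA1 lam →ₗ[k] k =>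
    π (vV lam) = 1 ∧ ∀ i v, π (ρV lam (f k affineA1 i) v) = 0) ?_
  have hN : (highestWeightIdeal k affineA1 lam).restrictScalars k ≤ LinearMap.ker θ := fun y hy => by
    have := hy 1
    rw [one_mul] at this
    exact h2 y this
  refine ⟨(Submodule.liftQ _ θ hN : (Env k affineA1 ⧸
    (highestWeightIdeal k affineA1 lam).restrictScalars k) →ₗ[k] k) ∘ₗ
      (Submodule.Quotient.restrictScalarsEquiv k (highestWeightIdeal k affineA1 lam)).symm.toLinearMap,
      h1, fun i v => ?_⟩
  obtain ⟨y, rfl⟩ := Submodule.Quotient.mk_surjective _ v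
  exact h2 _ (Submodule.subset_span ⟨i, y, Or.inl rfl⟩)

section Envelope
open UniversalEnvelopingAlgebra

theorem ι_mul_ι {r : ℕ} {A : Matrix (Fin r) (Fin r) ℤ} (a b : LieAlg k A) :
    ι k a * ι k b = ι k b * ι k a + ι k ⁅a, b⁆ := by
  have : ι k ⁅a, b⁆ = ι k a * ι k b - ι k b * ι k a := LieHom.map_lie _ _ _
  rw [this, add_sub_cancel]

theorem ι_e_mul_pow (j : Fin 2) (n : ℕ) :
    ι k (e k affineA1 j) * ι k (f k affineA1 j) ^ (n + 1)
      = ι k (f k affineA1 j) ^ (n + 1) * ι k (e k affineA1 j)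
        + (n + 1 : k) • (ι k (f k affineA1 j) ^ n *
          (ι k (h k affineA1 j) - algebraMap k (Env k affineA1) n)) := by
  have hef := ι_mul_ι (e k affineA1 j) (f k affineA1 j)
  have hhf := ι_mul_ι (h k affineA1 j) (f k affineA1 j)
  rw [lie_e_f_self] at hef
  rw [lie_h_f, affineA1_self, map_smul] at hhf
  set E := ι k (e k affineA1 j)
  set F := ι k (f k affineA1 j)
  set H := ι k (h k affineA1 j)
  induction n with
  | zero => simp [hef]
  | succ n ih =>
    have h1 : (H - algebraMap k (Env k affineA1) n) * F
        = F * (H - algebraMap k (Env k affineA1) (n + 2)) := by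
      rw [sub_mul, hhf, mul_sub, ← Algebra.commutes ((n : k) + 2), ← Algebra.smul_def,
        ← Algebra.smul_def]
      push_cast
      module
    rw [pow_succ F (n + 1), ← mul_assoc, ih, add_mul, mul_assoc _ E F, hef, smul_mul_assoc,
      mul_assoc (F ^ n), h1, ← mul_assoc (F ^ n), ← pow_succ, mul_add, ← mul_assoc, mul_sub,
      mul_sub, ← Algebra.commutes ((n : k) + 2), ← Algebra.commutes (((n + 1 : ℕ) : k)),
      ← Algebra.smul_def, ← Algebra.smul_def]
    push_cast
    module

theorem f_pow_mem_highestWeightIdeal {j : Fin 2} {m : ℕ} (hm : lam j = m) :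
    ι k (f k affineA1 j) ^ (m + 1) ∈ highestWeightIdeal k affineA1 lam := by
  intro z
  have L1 : ∀ i (z : Env k affineA1), ι k (f k affineA1 i) * z ∈ lowerPart k affineA1 lam :=
    fun i z => Submodule.subset_span ⟨i, z, Or.inl rfl⟩
  have L2 : ∀ i (z : Env k affineA1), z * ι k (e k affineA1 i) ∈ lowerPart k affineA1 lam :=
    fun i z => Submodule.subset_span ⟨i, z, Or.inr (Or.inl rfl)⟩
  have L3 : ∀ i (z : Env k affineA1), z * (ι k (h k affineA1 i) - algebraMap k _ (lam i : k))
      ∈ lowerPart k affineA1 lam := fun i z => Submodule.subset_span ⟨i, z, Or.inr (Or.inr rfl)⟩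
  refine env_induction (S := (lowerPart k affineA1 lam).comap
    (LinearMap.mulRight k (ι k (f k affineA1 j) ^ (m + 1)))) ?_ (fun i y _ => ?_)
    (fun i y _ => ?_) (fun i y hy => ?_) z
  · rw [Submodule.mem_comap, LinearMap.mulRight_apply, one_mul, pow_succ']
    exact L1 _ _
  · rw [Submodule.mem_comap, LinearMap.mulRight_apply, mul_assoc]
    exact L1 _ _
  · rw [Submodule.mem_comap, LinearMap.mulRight_apply, mul_assoc]
    by_cases hij : i = j
    · subst hij
      rw [ι_e_mul_pow, mul_add, ← mul_assoc, mul_smul_comm, ← mul_assoc]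
      have := L3 i (y * ι k (f k affineA1 i) ^ m)
      rw [hm, Int.cast_natCast] at this
      exact add_mem (L2 _ _) (Submodule.smul_mem _ _ this)
    · have hc : Commute (ι k (e k affineA1 i)) (ι k (f k affineA1 j)) := by
        rw [commute_iff_eq, ι_mul_ι, lie_e_f_ne hij, map_zero, add_zero]
      rw [(hc.pow_right _).eq, ← mul_assoc]
      exact L2 _ _
  · have hc : ∀ n : ℕ, ι k (h k affineA1 i) * ι k (f k affineA1 j) ^ n
        = ι k (f k affineA1 j) ^ n * (ι k (h k affineA1 i) - algebraMap k _ (lam i : k))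
          + (lam i - n * affineA1 i j : k) • ι k (f k affineA1 j) ^ n := by
      intro n
      induction n with
      | zero => simp [Algebra.smul_def]
      | succ n ih =>
        have hhf := ι_mul_ι (h k affineA1 i) (f k affineA1 j)
        rw [lie_h_f, map_smul] at hhf
        rw [mul_sub, ← Algebra.commutes, ← Algebra.smul_def] at ih ⊢
        rw [pow_succ, ← mul_assoc, ih, add_mul, sub_mul, mul_assoc, hhf, mul_add]
        simp only [smul_mul_assoc, mul_smul_comm, mul_assoc]
        push_cast
        module
    rw [Submodule.mem_comap, LinearMap.mulRight_apply, mul_assoc, hc, mul_add, ← mul_assoc,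
      mul_smul_comm]
    exact add_mem (L3 _ _) (Submodule.smul_mem _ _ hy)

end Envelope

theorem f_pow_highestWeightVector {j : Fin 2} {m : ℕ} (hm : lam j = m) :
    (ρV lam (f k affineA1 j) ^ (m + 1)) (vV lam) = 0 := by
  have : ∀ n : ℕ, (ρV lam (f k affineA1 j) ^ n) (vV lam) = Submodule.Quotient.mk
      (UniversalEnvelopingAlgebra.ι k (f k affineA1 j) ^ n) := by
    intro n
    induction n with
    | zero => rw [pow_zero, pow_zero]; rfl
    | succ n ih => rw [pow_succ', Module.End.mul_apply, ih, highestWeightRep_mk, pow_succ']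
  rw [this]
  exact (Submodule.Quotient.mk_eq_zero _).2 (f_pow_mem_highestWeightIdeal lam hm)

/-- The vectors killed by a power of an endomorphism. -/
def nilSubmodule {V : Type u} [AddCommGroup V] [Module k V] (T : Module.End k V) :
    Submodule k V where
  carrier := {v | ∃ n : ℕ, (T ^ n) v = 0}
  zero_mem' := ⟨0, map_zero _⟩
  add_mem' := fun ⟨n, hn⟩ ⟨m, hm⟩ => ⟨max n m, by
    rw [map_add, pow_apply_eq_zero hn (le_max_left _ _), pow_apply_eq_zero hm (le_max_right _ _),
      add_zero]⟩
  smul_mem' := fun c _ ⟨n, hn⟩ => ⟨n, by rw [map_smul, hn, smul_zero]⟩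

theorem isIntegrable_highestWeightRep [CharZero k] (hlam : ∀ i, 0 ≤ lam i) :
    IsIntegrable (ρV lam : LieAlg k affineA1 →ₗ⁅k⁆ _) := by
  have key : ∀ s, vV lam ∈ nilSubmodule (ρV lam (rootVector s)) →
      LocallyNilpotent (ρV lam (rootVector s)) := fun s hs =>
    highestWeightModule_induction lam (S := nilSubmodule (ρV lam (rootVector s))) hs
      fun j w ⟨n, hn⟩ => by
        obtain ⟨m, hm⟩ := (isIntegrable_ad (k := k) affineA1_self).locallyNilpotent s
          (f k affineA1 j)
        exact ⟨m + n, exists_pow_apply_eq_zero hm hn⟩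
  intro i
  refine ⟨key (.inl i) ⟨1, ?_⟩, key (.inr i) ⟨(lam i).toNat + 1, ?_⟩⟩
  · rw [pow_one]; exact e_highestWeightVector lam i
  · exact f_pow_highestWeightVector lam (Int.toNat_of_nonneg (hlam i)).symm

theorem highestWeightProj_vector : πV lam (vV lam) = (1 : k) := (highestWeightProj_spec lam).1

theorem highestWeightProj_f (i : Fin 2) (w : HighestWeightModule k affineA1 lam) :
    πV lam (ρV lam (f k affineA1 i) w) = 0 := (highestWeightProj_spec lam).2 i w

theorem highestWeightProj_h (i : Fin 2) (w : HighestWeightModule k affineA1 lam) :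
    πV lam (ρV lam (h k affineA1 i) w) = lam i * πV lam w := by
  suffices H : w ∈ LinearMap.ker (πV lam ∘ₗ ρV lam (h k affineA1 i) - (lam i : k) • πV lam) by
    simpa [sub_eq_zero] using H
  refine highestWeightModule_induction lam ?_ (fun j w _ => ?_) w
  · simp [h_highestWeightVector]
  · rw [LinearMap.mem_ker, LinearMap.sub_apply, LinearMap.comp_apply, rep_lie_apply, lie_h_f]
    simp [highestWeightProj_f]

theorem highestWeightProj_e {i : Fin 2} (hi : lam i = 0) (w : HighestWeightModule k affineA1 lam) :
    πV lam (ρV lam (e k affineA1 i) w) = 0 := by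
  suffices H : w ∈ LinearMap.ker (πV lam ∘ₗ ρV lam (e k affineA1 i)) by simpa using H
  refine highestWeightModule_induction lam ?_ (fun j w _ => ?_) w
  · simp [e_highestWeightVector]
  · rw [LinearMap.mem_ker, LinearMap.comp_apply, rep_lie_apply, map_add, highestWeightProj_f,
      add_zero]
    by_cases hij : i = j
    · subst hij; rw [lie_e_f_self, highestWeightProj_h, hi]; simp
    · rw [lie_e_f_ne hij]; simp

theorem highestWeightProj_e_e {i : Fin 2} (hi : lam i = 1)
    (w : HighestWeightModule k affineA1 lam) :
    πV lam (ρV lam (e k affineA1 i) (ρV lam (e k affineA1 i) w)) = 0 := by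
  suffices H : w ∈ LinearMap.ker (πV lam ∘ₗ ρV lam (e k affineA1 i) ∘ₗ ρV lam (e k affineA1 i)) by
    simpa using H
  refine highestWeightModule_induction lam ?_ (fun j w _ => ?_) w
  · simp [e_highestWeightVector]
  · rw [LinearMap.mem_ker, LinearMap.comp_apply, LinearMap.comp_apply,
      rep_lie_apply _ _ (f k affineA1 j), map_add, rep_lie_apply _ _ (f k affineA1 j), map_add,
      map_add, highestWeightProj_f]
    by_cases hij : i = j
    · subst hij
      have h1 := rep_lie_apply (ρV lam) (h k affineA1 i) (e k affineA1 i) w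
      rw [lie_h_e, affineA1_self, map_smul, LinearMap.smul_apply] at h1
      rw [lie_e_f_self, eq_sub_of_add_eq' h1.symm, map_sub, map_smul, highestWeightProj_h, hi]
      simp; ring
    · rw [lie_e_f_ne hij]; simp

end HighestWeightModule

/-! ### Small representations of the simple `sl₂` subalgebras in the dual space -/

section DualStrings
variable {k : Type u} [Field k] [CharZero k] {r : ℕ} {A : Matrix (Fin r) (Fin r) ℤ}
variable {V : Type u} [AddCommGroup V] [Module k V] {ρ : LieAlg k A →ₗ⁅k⁆ Module.End k V}

theorem apply_expEnd {T : Module.End k V} (hT : LocallyNilpotent T) {φ : V →ₗ[k] k} {N : ℕ}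
    (h : ∀ w, φ ((T ^ N) w) = 0) (t : k) (w : V) :
    φ (expEnd (t • T) (hT.smul t) w)
      = ∑ n ∈ Finset.range N, (n.factorial : k)⁻¹ * (t ^ n * φ ((T ^ n) w)) := by
  obtain ⟨M, hM⟩ := hT w
  have hM' : ((t • T) ^ (N + M)) w = 0 := by
    rw [smul_pow, LinearMap.smul_apply, pow_apply_eq_zero hM (Nat.le_add_left _ _), smul_zero]
  rw [expEnd_apply _ hM', map_sum, Finset.sum_range_add]
  simp only [smul_pow, LinearMap.smul_apply, map_smul, smul_eq_mul]
  rw [add_eq_left]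
  refine Finset.sum_eq_zero fun m _ => ?_
  rw [pow_add T, Module.End.mul_apply, h]
  simp

/-- A linear form which spans a trivial representation of the `i`-th `sl₂` in the dual space. -/
structure DualSpin0 (ρ : LieAlg k A →ₗ⁅k⁆ Module.End k V) (i : Fin r) (φ : V →ₗ[k] k) : Prop where
  e0 : ∀ w, φ (ρ (e k A i) w) = 0
  f0 : ∀ w, φ (ρ (f k A i) w) = 0

/-- Linear forms which form the standard basis of a two-dimensional representation of the `i`-th
`sl₂` in the dual space. -/
structure DualSpin1 (ρ : LieAlg k A →ₗ⁅k⁆ Module.End k V) (i : Fin r) (φ ψ : V →ₗ[k] k) : Prop where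
  e0 : ∀ w, φ (ρ (e k A i) w) = ψ w
  e1 : ∀ w, ψ (ρ (e k A i) w) = 0
  f0 : ∀ w, φ (ρ (f k A i) w) = 0
  f1 : ∀ w, ψ (ρ (f k A i) w) = φ w

/-- Linear forms which form a basis of divided powers in a three-dimensional representation of the
`i`-th `sl₂` in the dual space. -/
structure DualSpin2 (ρ : LieAlg k A →ₗ⁅k⁆ Module.End k V) (i : Fin r) (ξ₀ ξ₁ ξ₂ : V →ₗ[k] k) :
    Prop where
  e0 : ∀ w, ξ₀ (ρ (e k A i) w) = ξ₁ w
  e1 : ∀ w, ξ₁ (ρ (e k A i) w) = 2 * ξ₂ w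
  e2 : ∀ w, ξ₂ (ρ (e k A i) w) = 0
  f0 : ∀ w, ξ₀ (ρ (f k A i) w) = 0
  f1 : ∀ w, ξ₁ (ρ (f k A i) w) = 2 * ξ₀ w
  f2 : ∀ w, ξ₂ (ρ (f k A i) w) = ξ₁ w

theorem apply_actOn_x_of_eq_zero (hρ : IsIntegrable ρ) {i : Fin r} {φ : V →ₗ[k] k}
    (h : ∀ w, φ (ρ (e k A i) w) = 0) (t : k) (w : V) : φ (actOn hρ (x k A i t) w) = φ w := by
  rw [actOn_x, apply_expEnd (hρ i).1 (N := 1) (by simpa using h)]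
  simp

theorem apply_actOn_xbar_of_eq_zero (hρ : IsIntegrable ρ) {i : Fin r} {φ : V →ₗ[k] k}
    (h : ∀ w, φ (ρ (f k A i) w) = 0) (t : k) (w : V) : φ (actOn hρ (xbar k A i t) w) = φ w := by
  rw [actOn_xbar, apply_expEnd (hρ i).2 (N := 1) (by simpa using h)]
  simp

theorem sbar_inv (i : Fin r) : (sbar k A i)⁻¹ = x k A i 1 * xbar k A i (-1) * x k A i 1 := by
  simp only [KacMoody.sbar, mul_inv_rev, ← xsym_inl, ← xsym_inr, ← xsym_neg, neg_neg, mul_assoc]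

theorem DualSpin0.sbar_inv (hρ : IsIntegrable ρ) {i : Fin r} {φ : V →ₗ[k] k}
    (s : DualSpin0 ρ i φ) (w : V) : φ (actOn hρ (sbar k A i)⁻¹ w) = φ w := by
  rw [KacMoody.sbar_inv, actOn_mul, actOn_mul, apply_actOn_x_of_eq_zero hρ s.e0,
    apply_actOn_xbar_of_eq_zero hρ s.f0, apply_actOn_x_of_eq_zero hρ s.e0]

section
variable (hρ : IsIntegrable ρ) {i : Fin r} {φ ψ : V →ₗ[k] k} (s : DualSpin1 ρ i φ ψ)
include s

theorem DualSpin1.x (t : k) (w : V) : φ (actOn hρ (KacMoody.x k A i t) w) = φ w + t * ψ w := by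
  rw [actOn_x, apply_expEnd (hρ i).1 (N := 2) (by simp [pow_two, s.e0, s.e1])]
  simp [Finset.sum_range_succ, s.e0]

theorem DualSpin1.xbar (t : k) (w : V) :
    ψ (actOn hρ (KacMoody.xbar k A i t) w) = ψ w + t * φ w := by
  rw [actOn_xbar, apply_expEnd (hρ i).2 (N := 2) (by simp [pow_two, s.f0, s.f1])]
  simp [Finset.sum_range_succ, s.f1]

theorem DualSpin1.sbar_inv_fst (w : V) : φ (actOn hρ (sbar k A i)⁻¹ w) = ψ w := by
  rw [KacMoody.sbar_inv, actOn_mul, actOn_mul, s.x hρ, apply_actOn_xbar_of_eq_zero hρ s.f0,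
    s.xbar hρ, s.x hρ, apply_actOn_x_of_eq_zero hρ s.e1]
  ring

theorem DualSpin1.sbar_inv_snd (w : V) : ψ (actOn hρ (sbar k A i)⁻¹ w) = -φ w := by
  rw [KacMoody.sbar_inv, actOn_mul, actOn_mul, apply_actOn_x_of_eq_zero hρ s.e1, s.xbar hρ,
    s.x hρ, apply_actOn_x_of_eq_zero hρ s.e1]
  ring

end

section
variable (hρ : IsIntegrable ρ) {i : Fin r} {ξ₀ ξ₁ ξ₂ : V →ₗ[k] k} (s : DualSpin2 ρ i ξ₀ ξ₁ ξ₂)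
include s

theorem DualSpin2.x0 (t : k) (w : V) :
    ξ₀ (actOn hρ (KacMoody.x k A i t) w) = ξ₀ w + t * ξ₁ w + t ^ 2 * ξ₂ w := by
  rw [actOn_x, apply_expEnd (hρ i).1 (N := 3) (by simp [pow_succ, s.e0, s.e1, s.e2])]
  simp [Finset.sum_range_succ, pow_succ, s.e0, s.e1, Nat.factorial]
  ring

theorem DualSpin2.x1 (t : k) (w : V) :
    ξ₁ (actOn hρ (KacMoody.x k A i t) w) = ξ₁ w + 2 * t * ξ₂ w := by
  rw [actOn_x, apply_expEnd (hρ i).1 (N := 2) (by simp [pow_succ, s.e1, s.e2])]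
  simp [Finset.sum_range_succ, s.e1]
  ring

theorem DualSpin2.xbar1 (t : k) (w : V) :
    ξ₁ (actOn hρ (KacMoody.xbar k A i t) w) = ξ₁ w + 2 * t * ξ₀ w := by
  rw [actOn_xbar, apply_expEnd (hρ i).2 (N := 2) (by simp [pow_succ, s.f0, s.f1])]
  simp [Finset.sum_range_succ, s.f1]
  ring

theorem DualSpin2.xbar2 (t : k) (w : V) :
    ξ₂ (actOn hρ (KacMoody.xbar k A i t) w) = ξ₂ w + t * ξ₁ w + t ^ 2 * ξ₀ w := by
  rw [actOn_xbar, apply_expEnd (hρ i).2 (N := 3) (by simp [pow_succ, s.f0, s.f1, s.f2])]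
  simp [Finset.sum_range_succ, pow_succ, s.f2, s.f1, Nat.factorial]
  ring

theorem DualSpin2.sbar_inv0 (w : V) : ξ₀ (actOn hρ (sbar k A i)⁻¹ w) = ξ₂ w := by
  rw [KacMoody.sbar_inv, actOn_mul, actOn_mul, s.x0 hρ, apply_actOn_xbar_of_eq_zero hρ s.f0,
    s.xbar1 hρ, s.xbar2 hρ, s.x0 hρ, s.x1 hρ, apply_actOn_x_of_eq_zero hρ s.e2]
  ring

theorem DualSpin2.sbar_inv1 (w : V) : ξ₁ (actOn hρ (sbar k A i)⁻¹ w) = -ξ₁ w := by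
  rw [KacMoody.sbar_inv, actOn_mul, actOn_mul, s.x1 hρ, s.xbar1 hρ, s.xbar2 hρ, s.x0 hρ, s.x1 hρ,
    apply_actOn_x_of_eq_zero hρ s.e2]
  ring

theorem DualSpin2.sbar_inv2 (w : V) : ξ₂ (actOn hρ (sbar k A i)⁻¹ w) = ξ₀ w := by
  rw [KacMoody.sbar_inv, actOn_mul, actOn_mul, apply_actOn_x_of_eq_zero hρ s.e2, s.xbar2 hρ,
    s.x0 hρ, s.x1 hρ, apply_actOn_x_of_eq_zero hρ s.e2]
  ring

end

theorem apply_actOn_corootElt (hA : ∀ i, A i i = 2) (hρ : IsIntegrable ρ) {i : Fin r}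
    {φ : V →ₗ[k] k} {m : ℤ} (h : ∀ w, φ (ρ (KacMoody.h k A i) w) = m * φ w) (t : kˣ) (w : V) :
    φ (actOn hρ (corootElt k A i t) w) = (t : k) ^ m * φ w := by
  obtain ⟨y, hy, hw, ht⟩ := actOn_eq_sum_weights hA hρ i w
  rw [ht, hw, map_sum, map_sum, Finset.mul_sum]
  refine Finset.sum_congr rfl fun n _ => ?_
  rw [map_smul, smul_eq_mul, Units.val_zpow_eq_zpow_val]
  by_cases hn : n = m
  · rw [hn]
  · have h1 := h (y n)
    rw [hy, map_smul, smul_eq_mul, ← sub_eq_zero, ← sub_mul] at h1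
    have h2 : (n : k) - m ≠ 0 := sub_ne_zero.2 fun h => hn (by exact_mod_cast h)
    rw [(mul_eq_zero.1 h1).resolve_left h2, mul_zero, mul_zero]

theorem apply_h_comp_e {i j : Fin r} {φ : V →ₗ[k] k} {m : ℤ}
    (h : ∀ w, φ (ρ (KacMoody.h k A i) w) = m * φ w) (w : V) :
    φ (ρ (e k A j) (ρ (KacMoody.h k A i) w)) = (m - A i j : ℤ) * φ (ρ (e k A j) w) := by
  have h1 := rep_lie_apply ρ (KacMoody.h k A i) (e k A j) w
  rw [lie_h_e, map_smul, LinearMap.smul_apply] at h1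
  rw [eq_sub_of_add_eq' h1.symm, map_sub, map_smul, h, smul_eq_mul]
  push_cast; ring

end DualStrings

/-! ### Fundamental representations -/

section Fundamental
variable (k : Type u) [Field k]

/-- The fundamental representation of highest weight `ω_i`. -/
abbrev fundRep (i : Fin 2) : LieAlg k affineA1 →ₗ⁅k⁆
    Module.End k (HighestWeightModule k affineA1 (Pi.single i 1)) :=
  highestWeightRep k affineA1 (Pi.single i 1)

/-- The highest weight vector of the fundamental representation. -/
abbrev fundVec (i : Fin 2) : HighestWeightModule k affineA1 (Pi.single i 1) :=
  highestWeightVector k affineA1 (Pi.single i 1)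

/-- The projection to the highest weight line of the fundamental representation. -/
abbrev fundProj (i : Fin 2) : HighestWeightModule k affineA1 (Pi.single i 1) →ₗ[k] k :=
  highestWeightProj k affineA1 (Pi.single i 1)

variable {k} [CharZero k]

theorem isIntegrable_fundRep (i : Fin 2) : IsIntegrable (fundRep k i) :=
  isIntegrable_highestWeightRep _ fun j => by rw [Pi.single_apply]; split_ifs <;> norm_num

theorem fundMinor_eq (i : Fin 2) (g : Grp k affineA1) :
    fundMinor k affineA1 i g = fundProj k i (actOn (isIntegrable_fundRep i) g (fundVec k i)) := by
  rw [fundMinor, act_eq_actOn (isIntegrable_fundRep i)]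

theorem single_self (i : Fin 2) : (Pi.single i 1 : Fin 2 → ℤ) i = 1 := Pi.single_eq_same i _

theorem single_rev (i : Fin 2) : (Pi.single i 1 : Fin 2 → ℤ) i.rev = 0 :=
  Pi.single_eq_of_ne (ne_rev i).symm _

theorem spin1_fundVec (i : Fin 2) :
    Spin1 (fundRep k i) i (fundVec k i) (fundRep k i (f k affineA1 i) (fundVec k i)) where
  e0 := e_highestWeightVector _ i
  e1 := by
    rw [rep_lie_apply, e_highestWeightVector, lie_e_f_self, h_highestWeightVector, single_self]
    simp
  f0 := rfl
  f1 := by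
    have := f_pow_highestWeightVector (k := k) (Pi.single i 1) (m := 1) (single_self i)
    rwa [pow_two] at this

theorem spin0_fundVec (i : Fin 2) : Spin0 (fundRep k i) i.rev (fundVec k i) where
  e0 := e_highestWeightVector _ _
  f0 := by
    have := f_pow_highestWeightVector (k := k) (Pi.single i 1) (m := 0) (single_rev i)
    rwa [zero_add, pow_one] at this

theorem spin2_fundRep (i : Fin 2) :
    Spin2 (fundRep k i) i.rev (fundRep k i (f k affineA1 i) (fundVec k i))
      (fundRep k i (f k affineA1 i.rev) (fundRep k i (f k affineA1 i) (fundVec k i)))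
      ((2 : k)⁻¹ • fundRep k i (f k affineA1 i.rev) (fundRep k i (f k affineA1 i.rev)
        (fundRep k i (f k affineA1 i) (fundVec k i)))) := by
  set ρ := fundRep k i
  set v := fundVec k i
  have he : ∀ j, ρ (e k affineA1 j) v = 0 := e_highestWeightVector _
  have e0 : ρ (e k affineA1 i.rev) (ρ (f k affineA1 i) v) = 0 := by
    rw [rep_lie_apply, lie_e_f_ne (ne_rev i).symm, he]; simp
  have h0 : ρ (h k affineA1 i.rev) (ρ (f k affineA1 i) v) = (2 : k) • ρ (f k affineA1 i) v := by
    have h1 : ρ (h k affineA1 i.rev) v = 0 := by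
      rw [show ρ (h k affineA1 i.rev) v = _ from h_highestWeightVector _ _, single_rev]; simp
    rw [rep_lie_apply, lie_h_f, affineA1_rev', h1]; simp
  have h1 : ρ (h k affineA1 i.rev) (ρ (f k affineA1 i.rev) (ρ (f k affineA1 i) v)) = 0 := by
    rw [rep_lie_apply, h0, lie_h_f, affineA1_self]; simp
  have e1 : ρ (e k affineA1 i.rev) (ρ (f k affineA1 i.rev) (ρ (f k affineA1 i) v))
      = (2 : k) • ρ (f k affineA1 i) v := by
    rw [rep_lie_apply, lie_e_f_self, h0, e0]; simp
  refine ⟨e0, e1, ?_, rfl, ?_, ?_⟩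
  · rw [map_smul, rep_lie_apply, lie_e_f_self, h1, e1, map_smul, zero_add, smul_smul,
      inv_mul_cancel₀ two_ne_zero, one_smul]
  · rw [smul_smul, mul_inv_cancel₀ two_ne_zero, one_smul]
  · have hv : ρ (f k affineA1 i.rev) v = 0 := (spin0_fundVec i).f0
    have hs := serre_f (k := k) (A := affineA1) i.rev i
    rw [affineA1_rev'] at hs
    have hs' : ⁅f k affineA1 i.rev, ⁅f k affineA1 i.rev, ⁅f k affineA1 i.rev, f k affineA1 i⁆⁆⁆
        = 0 := hs
    have hc : ∀ y, ρ (f k affineA1 i.rev) (ρ y v) = ρ ⁅f k affineA1 i.rev, y⁆ v := fun y => by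
      rw [rep_lie_apply, hv, map_zero, add_zero]
    rw [map_smul, hc, hc, hc, hs', map_zero, LinearMap.zero_apply, smul_zero]

theorem dualSpin0_fundProj (i : Fin 2) : DualSpin0 (fundRep k i) i.rev (fundProj k i) where
  e0 := highestWeightProj_e _ (single_rev i)
  f0 := highestWeightProj_f _ _

theorem dualSpin1_fundProj (i : Fin 2) : DualSpin1 (fundRep k i) i (fundProj k i)
    (fundProj k i ∘ₗ fundRep k i (e k affineA1 i)) where
  e0 _ := rfl
  e1 := highestWeightProj_e_e _ (single_self i)
  f0 := highestWeightProj_f _ _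
  f1 w := by
    rw [LinearMap.comp_apply, rep_lie_apply, lie_e_f_self, map_add, highestWeightProj_f,
      highestWeightProj_h, single_self]
    simp

theorem fundProj_h_self (i : Fin 2) (w) :
    fundProj k i (fundRep k i (h k affineA1 i) w) = (1 : ℤ) * fundProj k i w := by
  rw [highestWeightProj_h, single_self]

theorem fundProj_h_rev (i : Fin 2) (w) :
    fundProj k i (fundRep k i (h k affineA1 i.rev) w) = (0 : ℤ) * fundProj k i w := by
  rw [highestWeightProj_h, single_rev]

theorem fundProj_e_h (i j : Fin 2) (w) :
    fundProj k i (fundRep k i (e k affineA1 i) (fundRep k i (h k affineA1 j) w))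
      = ((Pi.single i 1 : Fin 2 → ℤ) j - affineA1 j i : ℤ)
        * fundProj k i (fundRep k i (e k affineA1 i) w) :=
  apply_h_comp_e (fun w => highestWeightProj_h (Pi.single i 1) j w) w

theorem dualSpin2_fundProj (i : Fin 2) : DualSpin2 (fundRep k i) i.rev
    (fundProj k i ∘ₗ fundRep k i (e k affineA1 i))
    (fundProj k i ∘ₗ fundRep k i (e k affineA1 i) ∘ₗ fundRep k i (e k affineA1 i.rev))
    ((2 : k)⁻¹ • (fundProj k i ∘ₗ fundRep k i (e k affineA1 i) ∘ₗ
      fundRep k i (e k affineA1 i.rev) ∘ₗ fundRep k i (e k affineA1 i.rev))) := by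
  set ρ := fundRep k i
  set π := fundProj k i
  have he : ∀ w, π (ρ (e k affineA1 i.rev) w) = 0 := (dualSpin0_fundProj i).e0
  have hf : ∀ j w, π (ρ (f k affineA1 j) w) = 0 := highestWeightProj_f _
  have f0 : ∀ w, π (ρ (e k affineA1 i) (ρ (f k affineA1 i.rev) w)) = 0 := fun w => by
    rw [rep_lie_apply, lie_e_f_ne (ne_rev i), map_add, hf]; simp
  have h0 : ∀ w, π (ρ (e k affineA1 i) (ρ (h k affineA1 i.rev) w)) = 2 * π (ρ (e k affineA1 i) w) :=
    fun w => by
      rw [show π (ρ (e k affineA1 i) (ρ (h k affineA1 i.rev) w)) = _ from fundProj_e_h i i.rev w,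
        single_rev, affineA1_rev']
      norm_num
      rfl
  have f1 : ∀ w, π (ρ (e k affineA1 i) (ρ (e k affineA1 i.rev) (ρ (f k affineA1 i.rev) w)))
      = 2 * π (ρ (e k affineA1 i) w) := fun w => by
    rw [rep_lie_apply _ (e k affineA1 i.rev), lie_e_f_self, map_add, map_add, h0, f0, add_zero]
  have h1 : ∀ w, π (ρ (e k affineA1 i) (ρ (e k affineA1 i.rev) (ρ (h k affineA1 i.rev) w))) = 0 :=
    fun w => by
      have := apply_h_comp_e (ρ := ρ) (φ := π ∘ₗ ρ (e k affineA1 i)) (i := i.rev) (j := i.rev)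
        (m := 2) (fun w => by simpa using h0 w) w
      rw [affineA1_self] at this
      simpa using this
  refine ⟨fun _ => rfl, fun w => ?_, fun w => ?_, f0, f1, fun w => ?_⟩
  · simp
  · have hs := serre_e (k := k) (A := affineA1) i.rev i
    rw [affineA1_rev'] at hs
    have hs' : ⁅e k affineA1 i.rev, ⁅e k affineA1 i.rev, ⁅e k affineA1 i.rev, e k affineA1 i⁆⁆⁆
        = 0 := hs
    have hc : ∀ y w, π (ρ y (ρ (e k affineA1 i.rev) w)) = -π (ρ ⁅e k affineA1 i.rev, y⁆ w) :=
      fun y w => by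
        have := congrArg π (rep_lie_apply ρ (e k affineA1 i.rev) y w)
        rw [he, map_add] at this
        exact eq_neg_of_add_eq_zero_right this.symm
    simp only [LinearMap.smul_apply, LinearMap.comp_apply, hc, hs', map_zero, LinearMap.zero_apply,
      neg_zero, smul_zero]
  · simp only [LinearMap.smul_apply, LinearMap.comp_apply, smul_eq_mul]
    rw [rep_lie_apply ρ (e k affineA1 i.rev) (f k affineA1 i.rev) w, lie_e_f_self, map_add,
      map_add, map_add, h1, f1, zero_add, inv_mul_cancel_left₀ two_ne_zero]

/-- The positive Borel subgroup acts on the highest weight vector by nonzero scalars. -/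
theorem exists_actOn_fundVec (i : Fin 2) {b : Grp k affineA1} (hb : b ∈ posBorel k) :
    ∃ c : kˣ, actOn (isIntegrable_fundRep i) b (fundVec k i) = (c : k) • fundVec k i := by
  have he : ∀ j m, fundRep k i (rootVec k j (m + 1)) (fundVec k i) = 0 := by
    intro j m
    induction m with
    | zero => rw [zero_add, rootVec_one]; exact e_highestWeightVector _ j
    | succ m ih =>
      obtain ⟨c, hc, h⟩ := lie_imagVec_rootVec (k := k) 0 j (m + 1)
      have h2 : fundRep k i ⁅imagVec k 0, rootVec k j (m + 1)⁆ (fundVec k i) = 0 := by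
        have h3 : fundRep k i (imagVec k 0) (fundVec k i) = 0 := by
          rw [imagVec, rep_lie, LinearMap.sub_apply, Module.End.mul_apply, Module.End.mul_apply,
            e_highestWeightVector, e_highestWeightVector, map_zero, map_zero, sub_zero]
        rw [rep_lie, LinearMap.sub_apply, Module.End.mul_apply, Module.End.mul_apply, ih, h3,
          map_zero, map_zero, sub_zero]
      rw [h, map_smul, LinearMap.smul_apply] at h2
      exact (smul_eq_zero.1 h2).resolve_left hc
  refine posBorel_induction (P := fun b => ∃ c : kˣ,
    actOn (isIntegrable_fundRep i) b (fundVec k i) = (c : k) • fundVec k i) ?_ ?_ ?_ hb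
  · exact ⟨1, by rw [actOn_one, Units.val_one, one_smul]⟩
  · rintro h hh g ⟨c, hc⟩
    obtain ⟨s, t, rfl⟩ := exists_of_mem_torus hh 0
    refine ⟨c * (s ^ (Pi.single i 1 : Fin 2 → ℤ) 0 * t ^ (Pi.single i 1 : Fin 2 → ℤ) 1), ?_⟩
    rw [actOn_mul, hc, map_smul, actOn_mul, show Fin.rev (0 : Fin 2) = 1 from rfl,
      actOn_corootElt_of_weight affineA1_self _ 1 t (h_highestWeightVector _ 1), map_smul,
      actOn_corootElt_of_weight affineA1_self _ 0 s (h_highestWeightVector _ 0), smul_smul,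
      smul_smul]
    congr 1
    push_cast; ring
  · rintro j m t g ⟨c, hc⟩
    refine ⟨c, ?_⟩
    obtain ⟨w, l, h1, h2⟩ := exists_conj_rootElt (k := k) j m
    have h3 : fundRep k i (e k affineA1 l)
        (actOn (isIntegrable_fundRep i) w⁻¹ (fundVec k i)) = 0 := by
      refine actOn_injective (isIntegrable_fundRep i) w ?_
      rw [actOn_rep affineA1_self, h2, ← actOn_mul, mul_inv_cancel, actOn_one, map_zero]
      exact he j m
    rw [actOn_mul, hc, map_smul, h1, actOn_mul, actOn_mul, actOn_x_of_eq_zero _ h3, ← actOn_mul,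
      mul_inv_cancel, actOn_one]

/-- The negative Borel subgroup acts on the projection to the highest weight line by nonzero
scalars. -/
theorem exists_fundProj_actOn (i : Fin 2) {b : Grp k affineA1} (hb : b ∈ posBorel k) :
    ∃ c : kˣ, ∀ w, fundProj k i (actOn (isIntegrable_fundRep i) (chevalley k b) w)
      = c * fundProj k i w := by
  -- the twisted representation, in which `b` acts as its image under the Chevalley involution
  have hπ : ∀ i j : Fin 2, affineA1 ((1 : Equiv.Perm (Fin 2)) i) ((1 : Equiv.Perm (Fin 2)) j)
    = affineA1 i j := fun _ _ => rfl
  set ρ := (fundRep k i).comp (twistLie 1 hπ) with hρdef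
  have hρ : IsIntegrable ρ := (isIntegrable_fundRep i).twist hπ
  have hact : ∀ b, actOn hρ b = actOn (isIntegrable_fundRep i) (chevalley k b) := fun b =>
    actOn_twist hπ (isIntegrable_fundRep i) b
  have he0 : ∀ j w, fundProj k i (ρ (e k affineA1 j) w) = 0 := fun j w => by
    have : twistLie (k := k) 1 hπ (e k affineA1 j) = -f k affineA1 j :=
      twistLie_rootVector (k := k) 1 hπ (.inl j)
    rw [hρdef, LieHom.comp_apply, this, map_neg, LinearMap.neg_apply, map_neg,
      highestWeightProj_f, neg_zero]
  have he : ∀ j m w, fundProj k i (ρ (rootVec k j (m + 1)) w) = 0 := by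
    intro j m
    induction m with
    | zero => rw [zero_add, rootVec_one]; exact he0 j
    | succ m ih =>
      intro w
      obtain ⟨c, hc, h⟩ := lie_imagVec_rootVec (k := k) 0 j (m + 1)
      have h2 : fundProj k i (ρ ⁅imagVec k 0, rootVec k j (m + 1)⁆ w) = 0 := by
        have h3 : ∀ w, fundProj k i (ρ (imagVec k 0) w) = 0 := fun w => by
          rw [imagVec, rep_lie, LinearMap.sub_apply, Module.End.mul_apply, Module.End.mul_apply,
            map_sub, he0, he0, sub_zero]
        rw [rep_lie, LinearMap.sub_apply, Module.End.mul_apply, Module.End.mul_apply, map_sub, ih,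
          h3, sub_zero]
      rw [h, map_smul, LinearMap.smul_apply, map_smul] at h2
      exact (smul_eq_zero.1 h2).resolve_left hc
  refine posBorel_induction (P := fun b => ∃ c : kˣ, ∀ w,
    fundProj k i (actOn (isIntegrable_fundRep i) (chevalley k b) w) = c * fundProj k i w)
    ?_ ?_ ?_ hb
  · exact ⟨1, fun w => by rw [map_one, actOn_one, Units.val_one, one_mul]⟩
  · rintro h hh g ⟨c, hc⟩
    obtain ⟨s, t, rfl⟩ := exists_of_mem_torus hh 0
    refine ⟨s⁻¹ ^ (Pi.single i 1 : Fin 2 → ℤ) 0 * t⁻¹ ^ (Pi.single i 1 : Fin 2 → ℤ) 1 * c,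
      fun w => ?_⟩
    rw [show Fin.rev (0 : Fin 2) = 1 from rfl, map_mul, map_mul, chevalley_corootElt,
      chevalley_corootElt, actOn_mul, actOn_mul,
      apply_actOn_corootElt affineA1_self _ (fun w => highestWeightProj_h _ 0 w),
      apply_actOn_corootElt affineA1_self _ (fun w => highestWeightProj_h _ 1 w), hc]
    push_cast; ring
  · rintro j m t g ⟨c, hc⟩
    refine ⟨c, fun w => ?_⟩
    obtain ⟨u, l, h1, h2⟩ := exists_conj_rootElt (k := k) j m
    rw [map_mul, actOn_mul, ← hact, h1, actOn_mul, actOn_mul]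
    have h3 : ∀ w, (fundProj k i ∘ₗ actOn hρ u) (ρ (e k affineA1 l) w) = 0 := fun w => by
      rw [LinearMap.comp_apply, actOn_rep affineA1_self, h2, he]
    have h4 := apply_actOn_x_of_eq_zero hρ h3 t
    rw [← LinearMap.comp_apply, h4, LinearMap.comp_apply, ← actOn_mul, mul_inv_cancel, actOn_one,
      hc]

end Fundamental

/-! ### The extremal vectors `v` and `f_i v` -/

section FundamentalZero
variable {k : Type u} [Field k] [CharZero k]

variable (k) in
/-- The representation of the group with highest weight `ω_i`. -/
abbrev fundAct (i : Fin 2) (g : Grp k affineA1) :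
    HighestWeightModule k affineA1 (Pi.single i 1) →ₗ[k]
      HighestWeightModule k affineA1 (Pi.single i 1) := actOn (isIntegrable_fundRep i) g

variable (k) in
/-- The vector `f_i v` of the fundamental representation. -/
def fundLow (i : Fin 2) : HighestWeightModule k affineA1 (Pi.single i 1) :=
  fundRep k i (f k affineA1 i) (fundVec k i)

variable (k) in
/-- The linear form which is dual to `f_i v` on the extremal weight line of `f_i v`. -/
def fundCoproj (i : Fin 2) : HighestWeightModule k affineA1 (Pi.single i 1) →ₗ[k] k :=
  fundProj k i ∘ₗ fundRep k i (e k affineA1 i)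

theorem corootElt_apply_of_weight (i j : Fin 2) (t : kˣ) {m : ℤ}
    {w : HighestWeightModule k affineA1 (Pi.single i 1)}
    (hw : fundRep k i (h k affineA1 j) w = (m : k) • w) :
    fundAct k i (corootElt k affineA1 j t) w = (t : k) ^ m • w := by
  rw [actOn_corootElt_of_weight affineA1_self _ _ _ hw, Units.val_zpow_eq_zpow_val]

theorem h_f_of_weight {i j l : Fin 2} {m : ℤ} {w : HighestWeightModule k affineA1 (Pi.single i 1)}
    (hw : fundRep k i (h k affineA1 j) w = (m : k) • w) :
    fundRep k i (h k affineA1 j) (fundRep k i (f k affineA1 l) w)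
      = ((m - affineA1 j l : ℤ) : k) • fundRep k i (f k affineA1 l) w := by
  rw [rep_lie_apply, lie_h_f, hw, map_smul, map_smul, LinearMap.smul_apply]
  push_cast; module

theorem fundProj_fundVec (i : Fin 2) : fundProj k i (fundVec k i) = 1 := highestWeightProj_vector _

theorem fundProj_fundLow (i : Fin 2) : fundProj k i (fundLow k i) = 0 := highestWeightProj_f _ _ _

theorem fundCoproj_fundVec (i : Fin 2) : fundCoproj k i (fundVec k i) = 0 := by
  rw [fundCoproj, LinearMap.comp_apply, e_highestWeightVector, map_zero]

theorem fundCoproj_fundLow (i : Fin 2) : fundCoproj k i (fundLow k i) = 1 := by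
  rw [fundCoproj, LinearMap.comp_apply, fundLow, (spin1_fundVec i).e1, fundProj_fundVec]

section Common
variable (i : Fin 2) (t : k) (p : kˣ) (w : HighestWeightModule k affineA1 (Pi.single i 1))

theorem fundVec_x (j : Fin 2) : fundAct k i (x k affineA1 j t) (fundVec k i) = fundVec k i :=
  actOn_x_of_eq_zero _ (e_highestWeightVector _ j) t

theorem fundVec_xbar_rev :
    fundAct k i (xbar k affineA1 i.rev t) (fundVec k i) = fundVec k i :=
  actOn_xbar_of_eq_zero _ (spin0_fundVec i).f0 t

theorem fundVec_xbar :
    fundAct k i (xbar k affineA1 i t) (fundVec k i) = fundVec k i + t • fundLow k i :=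
  (spin1_fundVec i).xbar _ t

theorem fundVec_sbar_rev : fundAct k i (sbar k affineA1 i.rev) (fundVec k i) = fundVec k i :=
  (spin0_fundVec i).sbar _

theorem fundVec_sbar_inv_rev :
    fundAct k i (sbar k affineA1 i.rev)⁻¹ (fundVec k i) = fundVec k i :=
  actOn_inv_of_eq _ (fundVec_sbar_rev i)

theorem fundVec_sbar : fundAct k i (sbar k affineA1 i) (fundVec k i) = fundLow k i :=
  (spin1_fundVec i).sbar_fst _

theorem fundLow_sbar_inv : fundAct k i (sbar k affineA1 i)⁻¹ (fundLow k i) = fundVec k i :=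
  actOn_inv_of_eq _ (fundVec_sbar i)

theorem fundVec_sbar_inv : fundAct k i (sbar k affineA1 i)⁻¹ (fundVec k i) = -fundLow k i := by
  refine actOn_inv_of_eq _ ?_
  have h1 := (spin1_fundVec (k := k) i).sbar_snd (isIntegrable_fundRep i)
  rw [map_neg]
  exact (congrArg Neg.neg h1).trans (neg_neg _)

theorem fundVec_coroot :
    fundAct k i (corootElt k affineA1 i p) (fundVec k i) = (p : k) • fundVec k i := by
  rw [corootElt_apply_of_weight i i p (m := 1)
    (by rw [h_highestWeightVector, single_self]), zpow_one]

theorem fundVec_coroot_rev :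
    fundAct k i (corootElt k affineA1 i.rev p) (fundVec k i) = fundVec k i := by
  rw [corootElt_apply_of_weight i i.rev p (m := 0)
    (by rw [h_highestWeightVector, single_rev]), zpow_zero, one_smul]

theorem h_fundLow : fundRep k i (h k affineA1 i) (fundLow k i) = ((-1 : ℤ) : k) • fundLow k i := by
  have := h_f_of_weight (k := k) (i := i) (j := i) (l := i) (m := 1) (w := fundVec k i)
    (by rw [h_highestWeightVector, single_self])
  rw [affineA1_self] at this
  exact this

theorem h_rev_fundLow :
    fundRep k i (h k affineA1 i.rev) (fundLow k i) = ((2 : ℤ) : k) • fundLow k i := by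
  have := h_f_of_weight (k := k) (i := i) (j := i.rev) (l := i) (m := 0) (w := fundVec k i)
    (by rw [h_highestWeightVector, single_rev])
  rw [affineA1_rev'] at this
  exact this

theorem fundLow_coroot :
    fundAct k i (corootElt k affineA1 i p) (fundLow k i) = (p : k)⁻¹ • fundLow k i := by
  rw [corootElt_apply_of_weight i i p (h_fundLow i), zpow_neg_one]

theorem fundLow_coroot_rev :
    fundAct k i (corootElt k affineA1 i.rev p) (fundLow k i) = (p : k) ^ 2 • fundLow k i := by
  rw [corootElt_apply_of_weight i i.rev p (h_rev_fundLow i)]; norm_cast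

theorem fundLow_x : fundAct k i (x k affineA1 i t) (fundLow k i) = fundLow k i + t • fundVec k i :=
  (spin1_fundVec i).x _ t

theorem fundLow_x_rev : fundAct k i (x k affineA1 i.rev t) (fundLow k i) = fundLow k i :=
  actOn_x_of_eq_zero _ (spin2_fundRep i).e0 t

theorem fundLow_xbar : fundAct k i (xbar k affineA1 i t) (fundLow k i) = fundLow k i :=
  actOn_xbar_of_eq_zero _ (spin1_fundVec i).f1 t

theorem fundProj_xbar (j : Fin 2) :
    fundProj k i (fundAct k i (xbar k affineA1 j t) w) = fundProj k i w :=
  apply_actOn_xbar_of_eq_zero _ (highestWeightProj_f _ j) t w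

theorem fundProj_x_rev :
    fundProj k i (fundAct k i (x k affineA1 i.rev t) w) = fundProj k i w :=
  apply_actOn_x_of_eq_zero _ (dualSpin0_fundProj i).e0 t w

theorem fundProj_x :
    fundProj k i (fundAct k i (x k affineA1 i t) w) = fundProj k i w + t * fundCoproj k i w :=
  (dualSpin1_fundProj i).x _ t w

theorem fundProj_sbar_inv_rev :
    fundProj k i (fundAct k i (sbar k affineA1 i.rev)⁻¹ w) = fundProj k i w :=
  (dualSpin0_fundProj i).sbar_inv _ w

theorem fundProj_sbar_inv :
    fundProj k i (fundAct k i (sbar k affineA1 i)⁻¹ w) = fundCoproj k i w :=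
  (dualSpin1_fundProj i).sbar_inv_fst _ w

theorem fundProj_coroot :
    fundProj k i (fundAct k i (corootElt k affineA1 i p) w) = p * fundProj k i w := by
  rw [apply_actOn_corootElt affineA1_self _ (fundProj_h_self i), zpow_one]

theorem fundProj_coroot_rev :
    fundProj k i (fundAct k i (corootElt k affineA1 i.rev p) w) = fundProj k i w := by
  rw [apply_actOn_corootElt affineA1_self _ (fundProj_h_rev i), zpow_zero, one_mul]

theorem fundCoproj_x :
    fundCoproj k i (fundAct k i (x k affineA1 i t) w) = fundCoproj k i w :=
  apply_actOn_x_of_eq_zero _ (dualSpin1_fundProj i).e1 t w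

theorem fundCoproj_xbar :
    fundCoproj k i (fundAct k i (xbar k affineA1 i t) w) = fundCoproj k i w + t * fundProj k i w :=
  (dualSpin1_fundProj i).xbar _ t w

theorem fundCoproj_xbar_rev :
    fundCoproj k i (fundAct k i (xbar k affineA1 i.rev t) w) = fundCoproj k i w :=
  apply_actOn_xbar_of_eq_zero _ (dualSpin2_fundProj i).f0 t w

theorem fundCoproj_sbar_inv :
    fundCoproj k i (fundAct k i (sbar k affineA1 i)⁻¹ w) = -fundProj k i w :=
  (dualSpin1_fundProj i).sbar_inv_snd _ w

theorem fundCoproj_coroot :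
    fundCoproj k i (fundAct k i (corootElt k affineA1 i p) w) = (p : k)⁻¹ * fundCoproj k i w := by
  rw [apply_actOn_corootElt affineA1_self _ (m := -1) (fun w => ?_), zpow_neg_one]
  have := fundProj_e_h (k := k) i i w
  rwa [single_self, affineA1_self] at this

theorem fundCoproj_h_rev (w) : fundCoproj k i (fundRep k i (h k affineA1 i.rev) w)
    = (2 : ℤ) * fundCoproj k i w := by
  have := fundProj_e_h (k := k) i i.rev w
  rwa [single_rev, affineA1_rev'] at this

theorem fundCoproj_coroot_rev :
    fundCoproj k i (fundAct k i (corootElt k affineA1 i.rev p) w) = (p : k) ^ 2 * fundCoproj k i w := by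
  rw [apply_actOn_corootElt affineA1_self _ (m := 2) (fundCoproj_h_rev i)]
  norm_cast

end Common

end FundamentalZero

/-! ### The extremal vector of weight `s_j s_i ω_i` -/

section FundamentalOne
variable {k : Type u} [Field k] [CharZero k]

variable (k) in
/-- The vector `f_j f_i v` of the fundamental representation, for the other node `j`. -/
def fundLow₁ (i : Fin 2) : HighestWeightModule k affineA1 (Pi.single i 1) :=
  fundRep k i (f k affineA1 i.rev) (fundLow k i)

variable (k) in
/-- The vector `f_j² f_i v / 2` of the fundamental representation, for the other node `j`. -/
def fundLow₂ (i : Fin 2) : HighestWeightModule k affineA1 (Pi.single i 1) :=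
  (2 : k)⁻¹ • fundRep k i (f k affineA1 i.rev) (fundRep k i (f k affineA1 i.rev) (fundLow k i))

theorem spin2_fundLow (i : Fin 2) :
    Spin2 (fundRep k i) i.rev (fundLow k i) (fundLow₁ k i) (fundLow₂ k i) := spin2_fundRep i

variable (k) in
/-- The linear form `w ↦ π (e_i e_j w)`, where `π` is the projection to the highest weight line and
`j` is the other node. -/
def fundCoproj₁ (i : Fin 2) : HighestWeightModule k affineA1 (Pi.single i 1) →ₗ[k] k :=
  fundProj k i ∘ₗ fundRep k i (e k affineA1 i) ∘ₗ fundRep k i (e k affineA1 i.rev)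

variable (k) in
/-- The linear form `w ↦ π (e_i e_j² w) / 2`, where `π` is the projection to the highest weight line
and `j` is the other node. -/
def fundCoproj₂ (i : Fin 2) : HighestWeightModule k affineA1 (Pi.single i 1) →ₗ[k] k :=
  (2 : k)⁻¹ • (fundProj k i ∘ₗ fundRep k i (e k affineA1 i) ∘ₗ
      fundRep k i (e k affineA1 i.rev) ∘ₗ fundRep k i (e k affineA1 i.rev))

theorem dualSpin2_fundCoproj (i : Fin 2) :
    DualSpin2 (fundRep k i) i.rev (fundCoproj k i) (fundCoproj₁ k i) (fundCoproj₂ k i) :=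
  dualSpin2_fundProj i

variable (i : Fin 2) (t : k) (p : kˣ) (w : HighestWeightModule k affineA1 (Pi.single i 1))

theorem fundCoproj_fundLow₁ : fundCoproj k i (fundLow₁ k i) = 0 :=
  (dualSpin2_fundCoproj i).f0 _

theorem fundCoproj_fundLow₂ : fundCoproj k i (fundLow₂ k i) = 0 := by
  rw [fundLow₂, map_smul, (dualSpin2_fundCoproj i).f0, smul_zero]

theorem fundCoproj₁_fundLow₂ : fundCoproj₁ k i (fundLow₂ k i) = 0 := by
  rw [← (dualSpin2_fundCoproj i).e0, (spin2_fundLow i).e2, fundCoproj_fundLow₁]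

theorem fundCoproj₂_fundLow₂ : fundCoproj₂ k i (fundLow₂ k i) = 1 := by
  have h := (dualSpin2_fundCoproj (k := k) i).e1 (fundLow₂ k i)
  rw [(spin2_fundLow i).e2, ← (dualSpin2_fundCoproj i).e0, (spin2_fundLow i).e1, map_smul,
    fundCoproj_fundLow, smul_eq_mul] at h
  exact (mul_left_cancel₀ two_ne_zero h).symm

theorem fundProj_fundLow₁ : fundProj k i (fundLow₁ k i) = 0 := highestWeightProj_f _ _ _

theorem fundProj_fundLow₂ : fundProj k i (fundLow₂ k i) = 0 := by
  rw [fundLow₂, map_smul, highestWeightProj_f, smul_zero]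

theorem fundLow₂_x_rev : fundAct k i (x k affineA1 i.rev t) (fundLow₂ k i)
    = fundLow₂ k i + t • fundLow₁ k i + t ^ 2 • fundLow k i := (spin2_fundLow i).x2 _ t

theorem fundLow_sbar_rev : fundAct k i (sbar k affineA1 i.rev) (fundLow k i) = fundLow₂ k i :=
  (spin2_fundLow i).sbar0 _

theorem fundLow₂_sbar_inv_rev :
    fundAct k i (sbar k affineA1 i.rev)⁻¹ (fundLow₂ k i) = fundLow k i :=
  actOn_inv_of_eq _ (fundLow_sbar_rev i)

theorem fundLow_sbar_inv_rev :
    fundAct k i (sbar k affineA1 i.rev)⁻¹ (fundLow k i) = fundLow₂ k i :=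
  actOn_inv_of_eq _ ((spin2_fundLow i).sbar2 _)

theorem h_fundLow₁ :
    fundRep k i (h k affineA1 i) (fundLow₁ k i) = ((1 : ℤ) : k) • fundLow₁ k i := by
  have := h_f_of_weight (l := i.rev) (h_fundLow (k := k) i)
  rw [affineA1_rev] at this
  exact this

theorem h_fundLow₂ :
    fundRep k i (h k affineA1 i) (fundLow₂ k i) = ((3 : ℤ) : k) • fundLow₂ k i := by
  have := h_f_of_weight (l := i.rev) (h_fundLow₁ (k := k) i)
  rw [affineA1_rev] at this
  rw [fundLow₂, map_smul, smul_comm]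
  exact congrArg _ this

theorem h_rev_fundLow₂ :
    fundRep k i (h k affineA1 i.rev) (fundLow₂ k i) = ((-2 : ℤ) : k) • fundLow₂ k i := by
  have := h_f_of_weight (l := i.rev) (h_f_of_weight (l := i.rev) (h_rev_fundLow (k := k) i))
  rw [affineA1_self] at this
  rw [fundLow₂, map_smul, smul_comm]
  exact congrArg _ this

theorem fundLow₁_coroot :
    fundAct k i (corootElt k affineA1 i p) (fundLow₁ k i) = (p : k) • fundLow₁ k i := by
  rw [corootElt_apply_of_weight i i p (h_fundLow₁ i), zpow_one]

theorem fundLow₂_coroot :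
    fundAct k i (corootElt k affineA1 i p) (fundLow₂ k i) = (p : k) ^ 3 • fundLow₂ k i := by
  rw [corootElt_apply_of_weight i i p (h_fundLow₂ i)]; norm_cast

theorem fundLow₂_coroot_rev : fundAct k i (corootElt k affineA1 i.rev p) (fundLow₂ k i)
    = ((p : k) ^ 2)⁻¹ • fundLow₂ k i := by
  rw [corootElt_apply_of_weight i i.rev p (h_rev_fundLow₂ i), zpow_neg]; norm_cast

theorem e_fundLow₁ : fundRep k i (e k affineA1 i) (fundLow₁ k i) = 0 := by
  rw [fundLow₁, rep_lie_apply, lie_e_f_ne (ne_rev i), fundLow, (spin1_fundVec i).e1,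
    (spin0_fundVec i).f0]
  simp

theorem e_fundLow₂ : fundRep k i (e k affineA1 i) (fundLow₂ k i) = 0 := by
  have := e_fundLow₁ (k := k) i
  rw [fundLow₁] at this
  rw [fundLow₂, map_smul, rep_lie_apply, lie_e_f_ne (ne_rev i), this]
  simp

theorem fundLow₁_x : fundAct k i (x k affineA1 i t) (fundLow₁ k i) = fundLow₁ k i :=
  actOn_x_of_eq_zero _ (e_fundLow₁ i) t

theorem fundLow₂_x : fundAct k i (x k affineA1 i t) (fundLow₂ k i) = fundLow₂ k i :=
  actOn_x_of_eq_zero _ (e_fundLow₂ i) t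

theorem fundCoproj_x_rev : fundCoproj k i (fundAct k i (x k affineA1 i.rev t) w)
    = fundCoproj k i w + t * fundCoproj₁ k i w + t ^ 2 * fundCoproj₂ k i w :=
  (dualSpin2_fundCoproj i).x0 _ t w

theorem fundCoproj₁_x_rev : fundCoproj₁ k i (fundAct k i (x k affineA1 i.rev t) w)
    = fundCoproj₁ k i w + 2 * t * fundCoproj₂ k i w := (dualSpin2_fundCoproj i).x1 _ t w

theorem fundCoproj₂_x_rev : fundCoproj₂ k i (fundAct k i (x k affineA1 i.rev t) w)
    = fundCoproj₂ k i w := apply_actOn_x_of_eq_zero _ (dualSpin2_fundCoproj i).e2 t w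

theorem fundCoproj_sbar_inv_rev : fundCoproj k i (fundAct k i (sbar k affineA1 i.rev)⁻¹ w)
    = fundCoproj₂ k i w := (dualSpin2_fundCoproj i).sbar_inv0 _ w

theorem fundCoproj₁_sbar_inv_rev : fundCoproj₁ k i (fundAct k i (sbar k affineA1 i.rev)⁻¹ w)
    = -fundCoproj₁ k i w := (dualSpin2_fundCoproj i).sbar_inv1 _ w

theorem fundCoproj₂_sbar_inv_rev : fundCoproj₂ k i (fundAct k i (sbar k affineA1 i.rev)⁻¹ w)
    = fundCoproj k i w := (dualSpin2_fundCoproj i).sbar_inv2 _ w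

theorem fundCoproj₁_h_rev (w) : fundCoproj₁ k i (fundRep k i (h k affineA1 i.rev) w)
    = (0 : ℤ) * fundCoproj₁ k i w := by
  have := apply_h_comp_e (j := i.rev) (fundCoproj_h_rev (k := k) i) w
  rwa [affineA1_self] at this

theorem fundCoproj₂_h_rev (w) : fundCoproj₂ k i (fundRep k i (h k affineA1 i.rev) w)
    = (-2 : ℤ) * fundCoproj₂ k i w := by
  have := apply_h_comp_e (j := i.rev) (fundCoproj₁_h_rev (k := k) i) w
  rw [affineA1_self] at this
  rw [fundCoproj₂, LinearMap.smul_apply, LinearMap.smul_apply, smul_eq_mul, smul_eq_mul,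
    mul_left_comm]
  exact congrArg _ this

theorem fundCoproj₁_coroot_rev : fundCoproj₁ k i (fundAct k i (corootElt k affineA1 i.rev p) w)
    = fundCoproj₁ k i w := by
  rw [apply_actOn_corootElt affineA1_self _ (fundCoproj₁_h_rev i), zpow_zero, one_mul]

theorem fundCoproj₂_coroot_rev : fundCoproj₂ k i (fundAct k i (corootElt k affineA1 i.rev p) w)
    = ((p : k) ^ 2)⁻¹ * fundCoproj₂ k i w := by
  rw [apply_actOn_corootElt affineA1_self _ (fundCoproj₂_h_rev i), zpow_neg]; norm_cast

theorem fundCoproj₁_f (w) : fundCoproj₁ k i (fundRep k i (f k affineA1 i) w) = 0 := by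
  have h1 : ∀ w, fundProj k i (fundRep k i (e k affineA1 i) (fundRep k i (f k affineA1 i) w))
    = fundProj k i w := (dualSpin1_fundProj i).f1
  rw [fundCoproj₁, LinearMap.comp_apply, LinearMap.comp_apply,
    rep_lie_apply _ (e k affineA1 i.rev), lie_e_f_ne (ne_rev i).symm, map_zero, LinearMap.zero_apply,
    zero_add, h1]
  exact (dualSpin0_fundProj i).e0 _

theorem fundCoproj₂_f (w) : fundCoproj₂ k i (fundRep k i (f k affineA1 i) w) = 0 := by
  have h1 := fundCoproj₁_f (k := k) i (fundRep k i (e k affineA1 i.rev) w)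
  have h2 : fundRep k i (e k affineA1 i.rev) (fundRep k i (f k affineA1 i) w)
      = fundRep k i (f k affineA1 i) (fundRep k i (e k affineA1 i.rev) w) := by
    rw [rep_lie_apply, lie_e_f_ne (ne_rev i).symm]; simp
  rw [← h2] at h1
  exact (congrArg ((2 : k)⁻¹ * ·) h1).trans (mul_zero _)

theorem fundCoproj₁_xbar : fundCoproj₁ k i (fundAct k i (xbar k affineA1 i t) w)
    = fundCoproj₁ k i w := apply_actOn_xbar_of_eq_zero _ (fundCoproj₁_f i) t w

theorem fundCoproj₂_xbar : fundCoproj₂ k i (fundAct k i (xbar k affineA1 i t) w)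
    = fundCoproj₂ k i w := apply_actOn_xbar_of_eq_zero _ (fundCoproj₂_f i) t w

end FundamentalOne

/-! ### Values of the minors on the chart -/

section ChartValues
variable {k : Type u} [Field k] [CharZero k] (s t p b : kˣ) (y' y : k)

theorem chartPt_eq_zero : chartPt s t p b y' y = xbar k affineA1 0 s * corootElt k affineA1 0 p *
    xbar k affineA1 (Fin.rev 0) y' * corootElt k affineA1 (Fin.rev 0) b *
    (sbar k affineA1 (Fin.rev 0))⁻¹ * xbar k affineA1 (Fin.rev 0) y * x k affineA1 0 t := rfl

theorem chartPt_eq_one : chartPt s t p b y' y = xbar k affineA1 (Fin.rev 1) s *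
    corootElt k affineA1 (Fin.rev 1) p * xbar k affineA1 1 y' * corootElt k affineA1 1 b *
    (sbar k affineA1 1)⁻¹ * xbar k affineA1 1 y * x k affineA1 (Fin.rev 1) t := rfl

theorem swapTwist_chartPt : swapTwist k (chartPt s t p b y' y) = x k affineA1 1 (-(s : k)) *
    corootElt k affineA1 1 p⁻¹ * x k affineA1 0 (-y') * corootElt k affineA1 0 b⁻¹ *
    (sbar k affineA1 0)⁻¹ * x k affineA1 0 (-y) * xbar k affineA1 1 (-(t : k)) := by
  simp only [chartPt, map_mul, map_inv, swapTwist_x, swapTwist_xbar, swapTwist_sbar,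
    swapTwist_corootElt, show Fin.rev (0 : Fin 2) = 1 from rfl, show Fin.rev (1 : Fin 2) = 0 from rfl]

theorem swapTwist_chartPt_zero : swapTwist k (chartPt s t p b y' y) =
    x k affineA1 (Fin.rev 0) (-(s : k)) *
    corootElt k affineA1 (Fin.rev 0) p⁻¹ * x k affineA1 0 (-y') * corootElt k affineA1 0 b⁻¹ *
    (sbar k affineA1 0)⁻¹ * x k affineA1 0 (-y) * xbar k affineA1 (Fin.rev 0) (-(t : k)) :=
  swapTwist_chartPt s t p b y' y

theorem swapTwist_chartPt_one : swapTwist k (chartPt s t p b y' y) = x k affineA1 1 (-(s : k)) *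
    corootElt k affineA1 1 p⁻¹ * x k affineA1 (Fin.rev 1) (-y') *
    corootElt k affineA1 (Fin.rev 1) b⁻¹ * (sbar k affineA1 (Fin.rev 1))⁻¹ *
    x k affineA1 (Fin.rev 1) (-y) * xbar k affineA1 1 (-(t : k)) :=
  swapTwist_chartPt s t p b y' y

theorem minorRight_zero_eq (g : Grp k affineA1) : minorRight k affineA1 0 g
    = fundProj k 0 (fundAct k 0 g (fundLow k 0)) := by
  rw [minorRight, fundMinor_eq, coxeterLift_eq, actOn_mul, actOn_mul]
  congr 2
  exact (congrArg _ (fundVec_sbar_rev (k := k) 0)).trans (fundVec_sbar 0)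

theorem minorRight_one_eq (g : Grp k affineA1) : minorRight k affineA1 1 g
    = fundProj k 1 (fundAct k 1 g (fundLow₂ k 1)) := by
  rw [minorRight, fundMinor_eq, coxeterLift_eq, actOn_mul, actOn_mul]
  congr 2
  exact (congrArg _ (fundVec_sbar (k := k) 1)).trans (fundLow_sbar_rev 1)

theorem minorLeft_zero_eq (g : Grp k affineA1) : minorLeft k affineA1 0 g
    = fundCoproj k 0 (fundAct k 0 g (fundVec k 0)) := by
  rw [minorLeft, fundMinor_eq, coxeterLift_eq, mul_inv_rev, actOn_mul, actOn_mul]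
  exact (fundProj_sbar_inv_rev 0 _).trans (fundProj_sbar_inv 0 _)

theorem minorLeft_one_eq (g : Grp k affineA1) : minorLeft k affineA1 1 g
    = fundCoproj₂ k 1 (fundAct k 1 g (fundVec k 1)) := by
  rw [minorLeft, fundMinor_eq, coxeterLift_eq, mul_inv_rev, actOn_mul, actOn_mul]
  exact (fundProj_sbar_inv 1 _).trans (fundCoproj_sbar_inv_rev 1 _)

theorem fundMinor_zero_chartPt : fundMinor k affineA1 0 (chartPt s t p b y' y) = p := by
  rw [chartPt_eq_zero, fundMinor_eq]
  simp only [actOn_mul, fundVec_x, fundVec_xbar_rev, fundVec_sbar_inv_rev, fundVec_coroot_rev,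
    fundVec_coroot, fundProj_xbar, fundProj_fundVec, map_smul, smul_eq_mul, mul_one, -Fin.reduceRev]

theorem fundMinor_one_chartPt : fundMinor k affineA1 1 (chartPt s t p b y' y) = b * y := by
  rw [chartPt_eq_one, fundMinor_eq]
  simp only [actOn_mul, fundVec_x, fundVec_xbar, fundProj_xbar, fundProj_coroot_rev,
    fundProj_coroot, fundProj_sbar_inv, map_add, map_smul, smul_eq_mul, fundCoproj_fundVec,
    fundCoproj_fundLow, -Fin.reduceRev]
  ring

theorem minorRight_zero_chartPt : minorRight k affineA1 0 (chartPt s t p b y' y) = p * t := by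
  rw [chartPt_eq_zero, minorRight_zero_eq]
  simp only [actOn_mul, fundProj_xbar, fundProj_coroot, fundProj_coroot_rev, fundProj_x,
    fundProj_sbar_inv_rev, fundProj_fundLow, fundCoproj_fundLow, mul_one, zero_add, -Fin.reduceRev]

theorem minorLeft_zero_chartPt : minorLeft k affineA1 0 (chartPt s t p b y' y) = p * s := by
  rw [chartPt_eq_zero, minorLeft_zero_eq]
  simp only [actOn_mul, fundVec_x, fundVec_xbar_rev, fundVec_sbar_inv_rev, fundVec_coroot_rev,
    fundVec_coroot, fundCoproj_xbar, fundCoproj_fundVec, fundProj_fundVec, map_smul, smul_eq_mul,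
    mul_one, zero_add, -Fin.reduceRev]

theorem minorRight_one_chartPt : minorRight k affineA1 1 (chartPt s t p b y' y) = b * t ^ 2 := by
  rw [chartPt_eq_one, minorRight_one_eq]
  simp only [actOn_mul, fundProj_xbar, fundProj_coroot_rev, fundProj_coroot, fundProj_sbar_inv,
    fundCoproj_xbar, fundLow₂_x_rev, map_add, map_smul, smul_eq_mul, fundCoproj_fundLow,
    fundCoproj_fundLow₁, fundCoproj_fundLow₂, fundProj_fundLow, fundProj_fundLow₁,
    fundProj_fundLow₂, -Fin.reduceRev]
  ring

theorem minorLeft_one_chartPt : minorLeft k affineA1 1 (chartPt s t p b y' y)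
    = (-(b : k)⁻¹ + b * y' * y) * (p * s) ^ 2 := by
  have h1 : fundCoproj₁ k 1 (fundVec k 1) = 0 := by
    rw [fundCoproj₁, LinearMap.comp_apply, LinearMap.comp_apply, e_highestWeightVector, map_zero,
      map_zero]
  have h2 : fundCoproj₂ k 1 (fundVec k 1) = 0 := by
    rw [← fundCoproj_sbar_inv_rev, fundVec_sbar_inv_rev, fundCoproj_fundVec]
  have h3 : fundCoproj₁ k 1 (fundLow k 1) = 0 := by
    rw [fundCoproj₁, LinearMap.comp_apply, LinearMap.comp_apply, (spin2_fundLow 1).e0, map_zero,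
      map_zero]
  have h4 : fundCoproj₂ k 1 (fundLow k 1) = 0 := by
    rw [← fundCoproj_sbar_inv_rev, fundLow_sbar_inv_rev, fundCoproj_fundLow₂]
  have h5 : ∀ t w, fundCoproj₂ k 1 (fundAct k 1 (xbar k affineA1 (Fin.rev 1) t) w)
      = fundCoproj₂ k 1 w + t * fundCoproj₁ k 1 w + t ^ 2 * fundCoproj k 1 w :=
    (dualSpin2_fundCoproj 1).xbar2 _
  have h6 : fundAct k 1 (sbar k affineA1 1)⁻¹ (fundVec k 1 + y • fundLow k 1)
      = -fundLow k 1 + y • fundVec k 1 := by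
    rw [map_add, map_smul, fundVec_sbar_inv, fundLow_sbar_inv]
  rw [chartPt_eq_one, minorLeft_one_eq]
  simp only [actOn_mul, fundVec_x, fundVec_xbar, h5, h6, fundCoproj_coroot_rev,
    fundCoproj₁_coroot_rev, fundCoproj₂_coroot_rev, fundCoproj_xbar, fundCoproj₁_xbar,
    fundCoproj₂_xbar, fundCoproj_coroot, fundProj_coroot, -Fin.reduceRev]
  simp only [map_add, map_neg, map_smul, smul_eq_mul, actOn_mul, fundVec_coroot, fundLow_coroot,
    h1, h2, h3, h4, fundCoproj_fundVec, fundCoproj_fundLow, fundProj_fundVec, fundProj_fundLow]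
  ring

theorem fundMinor_zero_swapTwist_chartPt :
    fundMinor k affineA1 0 (swapTwist k (chartPt s t p b y' y)) = b * y' := by
  rw [swapTwist_chartPt_zero, fundMinor_eq]
  simp only [actOn_mul, fundVec_xbar_rev, fundVec_x, fundVec_sbar_inv, fundProj_x_rev,
    fundProj_coroot_rev, fundProj_x, fundProj_coroot, fundCoproj_coroot, map_neg,
    fundProj_fundLow, fundCoproj_fundLow, Units.val_inv_eq_inv_val, inv_inv, -Fin.reduceRev]
  ring

theorem fundMinor_one_swapTwist_chartPt :
    fundMinor k affineA1 1 (swapTwist k (chartPt s t p b y' y))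
      = (p : k)⁻¹ + s * t * p * (b * y') ^ 2 := by
  have h1 : fundAct k 1 (sbar k affineA1 (Fin.rev 1))⁻¹ (fundVec k 1 + (-(t : k)) • fundLow k 1)
      = fundVec k 1 + (-(t : k)) • fundLow₂ k 1 := by
    rw [map_add, map_smul, fundVec_sbar_inv_rev, fundLow_sbar_inv_rev]
  have h0 : fundAct k 1 (x k affineA1 (Fin.rev 1) (-y)) (fundVec k 1 + (-(t : k)) • fundLow k 1)
      = fundVec k 1 + (-(t : k)) • fundLow k 1 := by
    rw [map_add, map_smul, fundVec_x, fundLow_x_rev]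
  rw [swapTwist_chartPt_one, fundMinor_eq]
  simp only [actOn_mul, fundVec_xbar, h0, h1, fundProj_x, -Fin.reduceRev]
  simp only [map_add, map_smul, smul_eq_mul, fundVec_coroot_rev, fundLow₂_coroot_rev,
    fundProj_coroot, fundCoproj_coroot, fundVec_x, fundLow₂_x_rev, fundProj_fundVec,
    fundProj_fundLow, fundProj_fundLow₁, fundProj_fundLow₂, fundCoproj_fundVec,
    fundCoproj_fundLow, fundCoproj_fundLow₁, fundCoproj_fundLow₂, Units.val_inv_eq_inv_val,
    inv_inv, inv_pow, -Fin.reduceRev]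
  ring

theorem minorRight_zero_swapTwist_chartPt :
    minorRight k affineA1 0 (swapTwist k (chartPt s t p b y' y)) = (b : k)⁻¹ - b * y' * y := by
  rw [swapTwist_chartPt_zero, minorRight_zero_eq]
  simp only [actOn_mul, fundProj_x_rev, fundProj_coroot_rev, fundProj_x, fundProj_coroot,
    fundCoproj_coroot, fundProj_sbar_inv, fundCoproj_sbar_inv, fundCoproj_x, fundProj_xbar,
    fundCoproj_xbar_rev, fundProj_fundLow, fundCoproj_fundLow, Units.val_inv_eq_inv_val, inv_inv,
    -Fin.reduceRev]
  ring

theorem minorLeft_zero_swapTwist_chartPt :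
    minorLeft k affineA1 0 (swapTwist k (chartPt s t p b y' y)) = -(b / (p : k) ^ 2) := by
  rw [swapTwist_chartPt_zero, minorLeft_zero_eq]
  simp only [actOn_mul, fundVec_xbar_rev, fundVec_x, fundVec_sbar_inv, map_neg, fundLow_coroot,
    map_smul, fundLow_x, map_add, fundLow_coroot_rev, fundVec_coroot_rev, fundLow_x_rev,
    smul_eq_mul, fundCoproj_fundLow, fundCoproj_fundVec, Units.val_inv_eq_inv_val, inv_inv,
    inv_pow, -Fin.reduceRev]
  rw [div_eq_mul_inv]; ring

theorem minorRight_one_swapTwist_chartPt :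
    minorRight k affineA1 1 (swapTwist k (chartPt s t p b y' y))
      = -(s * p * ((b : k)⁻¹ - b * y' * y) ^ 2) := by
  rw [swapTwist_chartPt_one, minorRight_one_eq]
  simp only [actOn_mul, fundProj_x, fundProj_coroot, fundCoproj_coroot, fundProj_x_rev,
    fundProj_coroot_rev, fundProj_sbar_inv_rev, fundProj_xbar, fundCoproj_x_rev,
    fundCoproj_coroot_rev, fundCoproj₁_coroot_rev, fundCoproj₂_coroot_rev, fundCoproj_sbar_inv_rev,
    fundCoproj₁_sbar_inv_rev, fundCoproj₂_sbar_inv_rev, fundCoproj₁_x_rev, fundCoproj₂_x_rev,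
    fundCoproj_xbar, fundCoproj₁_xbar, fundCoproj₂_xbar, fundProj_fundLow₂, fundCoproj_fundLow₂,
    fundCoproj₁_fundLow₂, fundCoproj₂_fundLow₂, Units.val_inv_eq_inv_val, inv_inv, -Fin.reduceRev]
  field_simp
  ring

theorem minorLeft_one_swapTwist_chartPt :
    minorLeft k affineA1 1 (swapTwist k (chartPt s t p b y' y)) = -(t * b ^ 2 / (p : k) ^ 3) := by
  have h1 : fundAct k 1 (sbar k affineA1 (Fin.rev 1))⁻¹ (fundVec k 1 + (-(t : k)) • fundLow k 1)
      = fundVec k 1 + (-(t : k)) • fundLow₂ k 1 := by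
    rw [map_add, map_smul, fundVec_sbar_inv_rev, fundLow_sbar_inv_rev]
  have h0 : fundAct k 1 (x k affineA1 (Fin.rev 1) (-y)) (fundVec k 1 + (-(t : k)) • fundLow k 1)
      = fundVec k 1 + (-(t : k)) • fundLow k 1 := by
    rw [map_add, map_smul, fundVec_x, fundLow_x_rev]
  have h2 : fundCoproj₂ k 1 (fundVec k 1) = 0 := by
    rw [← fundCoproj_sbar_inv_rev, fundVec_sbar_inv_rev, fundCoproj_fundVec]
  have h4 : fundCoproj₂ k 1 (fundLow k 1) = 0 := by
    rw [← fundCoproj_sbar_inv_rev, fundLow_sbar_inv_rev, fundCoproj_fundLow₂]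
  have h5 : fundCoproj₂ k 1 (fundLow₁ k 1) = 0 := by
    have := (dualSpin2_fundCoproj (k := k) 1).f2 (fundLow k 1)
    rw [fundLow₁, this, fundCoproj₁, LinearMap.comp_apply, LinearMap.comp_apply,
      (spin2_fundLow 1).e0, map_zero, map_zero]
  rw [swapTwist_chartPt_one, minorLeft_one_eq]
  simp only [actOn_mul, fundVec_xbar, h0, h1, -Fin.reduceRev]
  simp only [map_add, map_smul, smul_eq_mul, fundVec_coroot_rev, fundLow₂_coroot_rev,
    fundVec_coroot, fundLow_coroot, fundLow₁_coroot, fundLow₂_coroot, fundLow_x, fundLow₁_x,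
    fundLow₂_x, fundVec_x, fundLow₂_x_rev, h2, h4, h5, fundCoproj₂_fundLow₂,
    Units.val_inv_eq_inv_val, inv_inv, inv_pow, -Fin.reduceRev]
  rw [div_eq_mul_inv]; ring

end ChartValues

/-! ### The chart and its twist cover the cell -/

section CellPoints
variable {k : Type u} [Field k] [CharZero k]

theorem fundCoproj₂_fundVec (i : Fin 2) : fundCoproj₂ k i (fundVec k i) = 0 := by
  rw [fundCoproj₂, LinearMap.smul_apply, LinearMap.comp_apply, LinearMap.comp_apply,
    LinearMap.comp_apply, e_highestWeightVector, map_zero, map_zero, map_zero, smul_zero]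

theorem fundLow₂_xbar_rev (i : Fin 2) (t : k) :
    fundAct k i (xbar k affineA1 i.rev t) (fundLow₂ k i) = fundLow₂ k i :=
  actOn_xbar_of_eq_zero _ (spin2_fundLow i).f2 t

variable {g : Grp k affineA1}

theorem fundAct_zero_posCell {a b : k} {y : Grp k affineA1} (hy : y ∈ posBorel k)
    (h : g = x k affineA1 0 a * sbar k affineA1 0 * x k affineA1 1 b * sbar k affineA1 1 * y) :
    ∃ c : kˣ, fundAct k 0 g (fundVec k 0) = (c : k) • (fundLow k 0 + a • fundVec k 0) := by
  obtain ⟨c, hc⟩ := exists_actOn_fundVec 0 hy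
  refine ⟨c, ?_⟩
  have h1 : fundAct k 0 (sbar k affineA1 1) (fundVec k 0) = fundVec k 0 := fundVec_sbar_rev 0
  rw [h, actOn_mul, hc, map_smul, actOn_mul, h1, actOn_mul, fundVec_x, actOn_mul, fundVec_sbar,
    fundLow_x]

theorem minorLeft_one_ne_zero (hg : g ∈ posCell k) : minorLeft k affineA1 1 g ≠ 0 := by
  obtain ⟨a, b, y, hy, rfl⟩ := exists_of_mem_posCell hg
  obtain ⟨c, hc⟩ := exists_actOn_fundVec 1 hy
  have h1 : fundAct k 1 (sbar k affineA1 0) (fundLow k 1) = fundLow₂ k 1 := fundLow_sbar_rev 1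
  have h2 : fundAct k 1 (sbar k affineA1 0) (fundVec k 1) = fundVec k 1 := fundVec_sbar_rev 1
  have h3 : ∀ w, fundCoproj₂ k 1 (fundAct k 1 (x k affineA1 0 a) w) = fundCoproj₂ k 1 w :=
    fundCoproj₂_x_rev 1 a
  rw [minorLeft_one_eq, actOn_mul, hc, map_smul, actOn_mul, fundVec_sbar, actOn_mul, fundLow_x,
    actOn_mul, map_add, map_smul, map_smul, h1, h2, h3, map_add, map_smul, fundCoproj₂_fundLow₂,
    fundCoproj₂_fundVec, smul_zero, add_zero, smul_eq_mul, mul_one]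
  exact c.ne_zero

theorem eq_of_chevalley_inv_eq {a b : k} {y : Grp k affineA1}
    (h : (chevalley k g)⁻¹
      = x k affineA1 0 a * sbar k affineA1 0 * x k affineA1 1 b * sbar k affineA1 1 * y) :
    g = chevalley k y⁻¹ * (sbar k affineA1 1)⁻¹ * xbar k affineA1 1 b * (sbar k affineA1 0)⁻¹ *
      xbar k affineA1 0 a := by
  have h1 : g = (chevalley k (chevalley k g)⁻¹)⁻¹ := by rw [map_inv, inv_inv, chevalley_chevalley]
  rw [h1, h]
  simp only [map_mul, mul_inv_rev, chevalley_x, chevalley_sbar, xbar_neg, inv_inv, map_inv,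
    mul_assoc]

theorem fundProj_zero_posCell {a b : k} {y : Grp k affineA1} (hy : y ∈ posBorel k)
    (h : (chevalley k g)⁻¹
      = x k affineA1 0 a * sbar k affineA1 0 * x k affineA1 1 b * sbar k affineA1 1 * y) :
    ∃ c : kˣ, ∀ w, fundProj k 0 (fundAct k 0 g w)
      = c * (fundCoproj k 0 w + a * fundProj k 0 w) := by
  obtain ⟨c, hc⟩ := exists_fundProj_actOn 0 (inv_mem hy)
  refine ⟨c, fun w => ?_⟩
  have h1 : ∀ w, fundProj k 0 (fundAct k 0 (sbar k affineA1 1)⁻¹ w) = fundProj k 0 w :=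
    fundProj_sbar_inv_rev 0
  rw [eq_of_chevalley_inv_eq h, actOn_mul, actOn_mul, actOn_mul, actOn_mul, hc, h1, fundProj_xbar,
    fundProj_sbar_inv, fundCoproj_xbar]

theorem minorRight_one_ne_zero (hg : (chevalley k g)⁻¹ ∈ posCell k) :
    minorRight k affineA1 1 g ≠ 0 := by
  obtain ⟨a, b, y, hy, h⟩ := exists_of_mem_posCell hg
  obtain ⟨c, hc⟩ := exists_fundProj_actOn 1 (inv_mem hy)
  have h1 : fundAct k 1 (xbar k affineA1 0 a) (fundLow₂ k 1) = fundLow₂ k 1 :=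
    fundLow₂_xbar_rev 1 a
  have h2 : fundAct k 1 (sbar k affineA1 0)⁻¹ (fundLow₂ k 1) = fundLow k 1 :=
    fundLow₂_sbar_inv_rev 1
  rw [minorRight_one_eq, eq_of_chevalley_inv_eq h, actOn_mul, h1, actOn_mul, h2, actOn_mul,
    fundLow_xbar, actOn_mul, fundLow_sbar_inv, hc, fundProj_fundVec, mul_one]
  exact c.ne_zero

/-- The points of the Coxeter double Bruhat cell at which `Δ_{ω_0}` does not vanish. -/
theorem exists_chartPt_of_mem (hg : g ∈ coxeterCell k affineA1)
    (h0 : fundMinor k affineA1 0 g ≠ 0) : ∃ (s t p b : kˣ) (y' y : k),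
      g = chartPt s t p b y' y ∧ (b : k) ^ 2 * y' * y ≠ 1 := by
  rw [mem_coxeterCell_iff] at hg
  obtain ⟨a, b, y, hy, h⟩ := exists_of_mem_posCell hg.1
  obtain ⟨a', b', y', hy', h'⟩ := exists_of_mem_posCell hg.2
  obtain ⟨c, hc⟩ := fundAct_zero_posCell hy h
  obtain ⟨c', hc'⟩ := fundProj_zero_posCell hy' h'
  have ha : a ≠ 0 := by
    rintro rfl
    rw [fundMinor_eq, hc, zero_smul, add_zero, map_smul, fundProj_fundLow, smul_zero] at h0
    exact h0 rfl
  have ha' : a' ≠ 0 := by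
    rintro rfl
    rw [fundMinor_eq, hc', zero_mul, add_zero, fundCoproj_fundVec, mul_zero] at h0
    exact h0 rfl
  lift a to kˣ using isUnit_iff_ne_zero.2 ha
  lift a' to kˣ using isUnit_iff_ne_zero.2 ha'
  obtain ⟨d, z, hz, e1⟩ := exists_xbar_form a b hy
  obtain ⟨d', z', hz', e2⟩ := exists_xbar_form a' b' hy'
  obtain ⟨p, q, u, w, rfl⟩ | ⟨p, q, z, rfl⟩ := exists_chartPt hz hz' (h.trans e1) (h'.trans e2)
  · refine ⟨_, _, p, q, u, w, rfl, fun h1 => minorLeft_one_ne_zero hg.1 ?_⟩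
    rw [minorLeft_one_chartPt]
    have h2 : -(q : k)⁻¹ + q * u * w = (q : k)⁻¹ * ((q : k) ^ 2 * u * w - 1) := by
      field_simp; ring
    rw [h2, h1, sub_self, mul_zero, zero_mul]
  · -- in the remaining case the element lies in a smaller Bruhat double coset
    refine absurd ?_ (minorRight_one_ne_zero hg.2)
    have h1 : ∀ t w, fundProj k 1 (fundAct k 1 (x k affineA1 0 t) w) = fundProj k 1 w :=
      fundProj_x_rev 1
    have h2 : ∀ p w, fundProj k 1 (fundAct k 1 (corootElt k affineA1 0 p) w) = fundProj k 1 w :=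
      fundProj_coroot_rev 1
    rw [minorRight_one_eq, actOn_mul, actOn_mul, actOn_mul, actOn_mul, fundProj_xbar, h2,
      fundProj_xbar, fundProj_coroot, h1, fundProj_fundLow₂, mul_zero]

/-- The two charts cover the Coxeter double Bruhat cell. If both functions vanish at `g`, then `g v` is
a multiple of `f_0 v`, and `g⁻¹` maps `f_0 v` to a vector without component along `v`. -/
theorem fundMinor_zero_ne_zero_or (hg : g ∈ coxeterCell k affineA1) :
    fundMinor k affineA1 0 g ≠ 0 ∨ fundMinor k affineA1 0 (swapTwist k g) ≠ 0 := by
  by_contra! hcon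
  obtain ⟨h0, h0'⟩ := hcon
  have hg' := swapTwist_mem_coxeterCell hg
  rw [mem_coxeterCell_iff] at hg hg'
  obtain ⟨a, b, y, hy, h⟩ := exists_of_mem_posCell hg.1
  obtain ⟨a', b', y', hy', h'⟩ := exists_of_mem_posCell hg'.1
  obtain ⟨c, hc⟩ := fundAct_zero_posCell hy h
  obtain ⟨c', hc'⟩ := fundAct_zero_posCell hy' h'
  have key : ∀ (c a : k), c ≠ 0 →
      fundProj k 0 (c • (fundLow k 0 + a • fundVec k 0)) = 0 → a = 0 := fun c a hc h => by
    rw [map_smul, map_add, map_smul, fundProj_fundLow, fundProj_fundVec, zero_add, smul_eq_mul,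
      smul_eq_mul, mul_one] at h
    exact (mul_eq_zero.1 h).resolve_left hc
  rw [fundMinor_eq, hc] at h0
  rw [fundMinor_eq, hc'] at h0'
  obtain rfl := key _ _ c.ne_zero h0
  obtain rfl := key _ _ c'.ne_zero h0'
  have hy3 := inv_mem (chevalley_swapTwist_mem_posBorel hy')
  obtain ⟨d, hd⟩ := exists_fundProj_actOn 0 hy3
  -- the inverse of `g` in the Bruhat form of its twist
  have hinv : g⁻¹ = chevalley k (chevalley k (swapTwist k y'))⁻¹ * (sbar k affineA1 0)⁻¹ *
      xbar k affineA1 0 b' * (sbar k affineA1 1)⁻¹ := by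
    rw [← swapTwist_swapTwist g, h']
    have hz : x k affineA1 0 0 = 1 := by
      have := x_add (k := k) 0 0 0
      rw [add_zero] at this
      exact (mul_eq_left.1 this.symm)
    simp only [hz, one_mul, map_mul, mul_inv_rev, map_inv, chevalley_chevalley, swapTwist_x,
      swapTwist_sbar, xbar_neg, inv_inv, mul_assoc, show Fin.rev (0 : Fin 2) = 1 from rfl,
      show Fin.rev (1 : Fin 2) = 0 from rfl]
  have h1 : fundAct k 0 (sbar k affineA1 1)⁻¹ (fundLow k 0) = fundLow₂ k 0 :=
    fundLow_sbar_inv_rev 0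
  have h2 : fundProj k 0 (fundAct k 0 g⁻¹ (fundAct k 0 g (fundVec k 0))) = 0 := by
    rw [hc, zero_smul, add_zero, map_smul, map_smul, hinv, actOn_mul, h1, actOn_mul, actOn_mul, hd,
      fundProj_sbar_inv, fundCoproj_xbar, fundCoproj_fundLow₂, fundProj_fundLow₂]
    simp
  rw [← actOn_mul, inv_mul_cancel, actOn_one, fundProj_fundVec] at h2
  exact one_ne_zero h2

end CellPoints

/-! ### Families of group elements with regular matrix coefficients -/

section RegularFamily
variable {k : Type u} [Field k] [CharZero k] {r : ℕ} {A : Matrix (Fin r) (Fin r) ℤ} {P : Type*}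

/-- The `V`-valued functions on `P` which are combinations of vectors of `V` with coefficients in
the algebra `R` of functions on `P`. -/
def vectorFunctions (R : Subalgebra k (P → k)) (V : Type u) [AddCommGroup V] [Module k V] :
    Submodule k (P → V) :=
  Submodule.span k {F | ∃ a ∈ R, ∃ w : V, F = fun p => a p • w}

variable {R : Subalgebra k (P → k)} {V : Type u} [AddCommGroup V] [Module k V]

theorem smul_mem_vectorFunctions {a : P → k} (ha : a ∈ R) {F : P → V}
    (hF : F ∈ vectorFunctions R V) : (fun p => a p • F p) ∈ vectorFunctions R V := by
  induction hF using Submodule.span_induction with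
  | mem F hF =>
    obtain ⟨b, hb, w, rfl⟩ := hF
    exact Submodule.subset_span ⟨a * b, mul_mem ha hb, w, by simp [smul_smul]⟩
  | zero => convert zero_mem (vectorFunctions R V) using 1; funext p; simp
  | add F G _ _ h1 h2 => convert add_mem h1 h2 using 1; funext p; simp
  | smul c F _ h =>
    convert Submodule.smul_mem _ c h using 1
    funext p; exact smul_comm _ _ _

variable (R) in
/-- A family of group elements whose matrix coefficients lie in the algebra `R` of functions of the
parameter. -/
def IsRegularFamily (g : P → Grp k A) : Prop :=
  ∀ (V : Type u) [AddCommGroup V] [Module k V] (ρ : LieAlg k A →ₗ⁅k⁆ Module.End k V)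
    (hρ : IsIntegrable ρ) (v : V), (fun p => actOn hρ (g p) v) ∈ vectorFunctions R V

theorem IsRegularFamily.mul {g g' : P → Grp k A} (hg : IsRegularFamily R g)
    (hg' : IsRegularFamily R g') : IsRegularFamily R fun p => g p * g' p := by
  intro V _ _ ρ hρ v
  have key : ∀ F ∈ vectorFunctions R V,
      (fun p => actOn hρ (g p) (F p)) ∈ vectorFunctions R V := by
    intro F hF
    induction hF using Submodule.span_induction with
    | mem F hF =>
      obtain ⟨b, hb, w, rfl⟩ := hF
      simpa using smul_mem_vectorFunctions hb (hg V ρ hρ w)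
    | zero => convert zero_mem (vectorFunctions R V) using 1; funext p; simp
    | add F G _ _ h1 h2 => convert add_mem h1 h2 using 1; funext p; simp
    | smul c F _ h => convert Submodule.smul_mem _ c h using 1; funext p; simp
  simpa only [actOn_mul] using key _ (hg' V ρ hρ v)

theorem isRegularFamily_xsym (s : Fin r ⊕ Fin r) {a : P → k} (ha : a ∈ R) :
    IsRegularFamily R fun p => (xsym s (a p) : Grp k A) := by
  intro V _ _ ρ hρ v
  obtain ⟨N, hN⟩ := hρ.locallyNilpotent s v
  have : (fun p => actOn hρ (xsym s (a p)) v) = ∑ n ∈ Finset.range N,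
      fun p => (a ^ n) p • ((n.factorial : k)⁻¹ • (ρ (rootVector s) ^ n) v) := by
    funext p
    rw [actOn_xsym, expEnd_apply (N := N) _ (by rw [smul_pow, LinearMap.smul_apply, hN, smul_zero]),
      Finset.sum_apply]
    exact Finset.sum_congr rfl fun n _ => by
      rw [smul_pow, LinearMap.smul_apply, smul_comm, Pi.pow_apply]
  rw [this]
  exact sum_mem fun n _ => Submodule.subset_span ⟨_, pow_mem ha n, _, rfl⟩

theorem isRegularFamily_x (i : Fin r) {a : P → k} (ha : a ∈ R) :
    IsRegularFamily R fun p => x k A i (a p) := isRegularFamily_xsym (.inl i) ha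

theorem isRegularFamily_xbar (i : Fin r) {a : P → k} (ha : a ∈ R) :
    IsRegularFamily R fun p => xbar k A i (a p) := isRegularFamily_xsym (.inr i) ha

theorem isRegularFamily_const (g : Grp k A) : IsRegularFamily R fun _ : P => g :=
  fun _ _ _ _ hρ v => Submodule.subset_span ⟨1, one_mem _, actOn hρ g v, by simp⟩

theorem isRegularFamily_corootElt (i : Fin r) {t : P → kˣ} (ht : (fun p => (t p : k)) ∈ R)
    (ht' : (fun p => (t p : k)⁻¹) ∈ R) : IsRegularFamily R fun p => corootElt k A i (t p) := by
  refine (((isRegularFamily_x i ht).mul (isRegularFamily_xbar i (a := fun p => -(((t p)⁻¹ : kˣ) : k))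
    ?_)).mul (isRegularFamily_x i ht)).mul (isRegularFamily_const _)
  convert neg_mem ht' using 1
  funext p; simp

/-- Composed with a regular family, a polynomial function gives an element of the algebra. -/
theorem IsRegularFamily.comp_mem {g : P → Grp k A} (hg : IsRegularFamily R g) {F : Grp k A → k}
    (hF : F ∈ polynomialFunctions k A) : (fun p => F (g p)) ∈ R := by
  induction hF using Algebra.adjoin_induction with
  | mem F hF =>
    obtain ⟨V, _, _, ρ, hρ, v, ξ, rfl⟩ := hF
    have key : ∀ G ∈ vectorFunctions R V, (fun p => ξ (G p)) ∈ R := by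
      intro G hG
      induction hG using Submodule.span_induction with
      | mem F hF =>
        obtain ⟨b, hb, w, rfl⟩ := hF
        have := R.smul_mem hb (ξ w)
        convert this using 1
        funext p; simp [mul_comm]
      | zero => convert zero_mem R using 1; funext p; simp
      | add F G _ _ h1 h2 => convert add_mem h1 h2 using 1; funext p; simp
      | smul c F _ h => convert R.smul_mem h c using 1; funext p; simp
    exact key _ (hg V ρ hρ v)
  | algebraMap c => exact R.algebraMap_mem c
  | add F G _ _ h1 h2 => exact add_mem h1 h2
  | mul F G _ _ h1 h2 => exact mul_mem h1 h2

theorem matrixCoeff_mem_polynomialFunctions {ρ : LieAlg k A →ₗ⁅k⁆ Module.End k V}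
    (hρ : IsIntegrable ρ) (v : V) (ξ : V →ₗ[k] k) :
    (fun g => ξ (actOn hρ g v)) ∈ polynomialFunctions k A :=
  Algebra.subset_adjoin ⟨V, _, _, ρ, hρ, v, ξ, rfl⟩

theorem comp_twist_mem_polynomialFunctions {π : Equiv.Perm (Fin r)}
    (hπ : ∀ i j, A (π i) (π j) = A i j) {F : Grp k A → k} (hF : F ∈ polynomialFunctions k A) :
    (fun g => F (twist π hπ g)) ∈ polynomialFunctions k A := by
  induction hF using Algebra.adjoin_induction with
  | mem F hF =>
    obtain ⟨V, _, _, ρ, hρ, v, ξ, rfl⟩ := hF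
    convert matrixCoeff_mem_polynomialFunctions (hρ.twist hπ) v ξ using 1
    funext g
    rw [actOn_twist]
    rfl
  | algebraMap c => exact Subalgebra.algebraMap_mem _ c
  | add F G _ _ h1 h2 => exact add_mem h1 h2
  | mul F G _ _ h1 h2 => exact mul_mem h1 h2

end RegularFamily

/-! ### Regularity of the minors -/

section RegularFunctions
variable {k : Type u} [Field k] [CharZero k]

theorem coordinateRing_of_polynomialFunctions {r : ℕ} {A : Matrix (Fin r) (Fin r) ℤ}
    {X : Set (Grp k A)} {F : Grp k A → k} (hF : F ∈ polynomialFunctions k A) :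
    (fun g : X => F g) ∈ coordinateRing k A X :=
  fun _ => ⟨F, hF, 1, one_mem _, one_ne_zero, fun _ _ => by simp⟩

theorem inv_mem_coordinateRing {r : ℕ} {A : Matrix (Fin r) (Fin r) ℤ}
    {X : Set (Grp k A)} {F : X → k} (hF : F ∈ coordinateRing k A X) (h0 : ∀ g, F g ≠ 0) :
    F⁻¹ ∈ coordinateRing k A X := fun p => by
  obtain ⟨a, ha, b, hb, hp, H⟩ := hF p
  have hap : a p ≠ 0 := fun h => h0 p (by rw [H p hp, h, zero_div])
  refine ⟨b * b, mul_mem hb hb, a * b, mul_mem ha hb, mul_ne_zero hap hp, fun g hg => ?_⟩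
  have h1 : a g ≠ 0 ∧ b g ≠ 0 := mul_ne_zero_iff.1 hg
  rw [Pi.inv_apply, H g h1.2, inv_div, Pi.mul_apply, Pi.mul_apply, mul_div_mul_right _ _ h1.2]

theorem fundMinor_mem_polynomialFunctions (i : Fin 2) :
    fundMinor k affineA1 i ∈ polynomialFunctions k affineA1 := by
  have := matrixCoeff_mem_polynomialFunctions (isIntegrable_fundRep (k := k) i) (fundVec k i)
    (fundProj k i)
  simpa only [← fundMinor_eq] using this

theorem minorRight_mem_polynomialFunctions (i : Fin 2) :
    minorRight k affineA1 i ∈ polynomialFunctions k affineA1 := by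
  have := matrixCoeff_mem_polynomialFunctions (isIntegrable_fundRep (k := k) i)
    (fundAct k i (coxeterLift k affineA1) (fundVec k i)) (fundProj k i)
  simp only [← actOn_mul, ← fundMinor_eq] at this
  exact this

theorem minorLeft_mem_polynomialFunctions (i : Fin 2) :
    minorLeft k affineA1 i ∈ polynomialFunctions k affineA1 := by
  have := matrixCoeff_mem_polynomialFunctions (isIntegrable_fundRep (k := k) i) (fundVec k i)
    (fundProj k i ∘ₗ fundAct k i (coxeterLift k affineA1)⁻¹)
  simp only [LinearMap.comp_apply, ← actOn_mul, ← fundMinor_eq] at this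
  exact this

theorem evalMinor_mem_polynomialFunctions {n : ℕ} (a : Fin n → kˣ) :
    evalMinor a ∈ polynomialFunctions k affineA1 := by
  have := matrixCoeff_mem_polynomialFunctions (isIntegrable_evalRep a) (evalVector k n)
    (evalProj k n)
  simp only [← act_eq_actOn] at this
  exact this

end RegularFunctions

/-! ### Coordinates on the cell and exchange relations -/

section CellCoordinates
variable {k : Type u} [Field k] [CharZero k]

/-- The involution of the Coxeter double Bruhat cell induced by the diagram automorphism composed
with the Chevalley involution. -/
def cellTwist (g : coxeterCell k affineA1) : coxeterCell k affineA1 :=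
  ⟨swapTwist k g, swapTwist_mem_coxeterCell g.2⟩

theorem cellTwist_cellTwist (g : coxeterCell k affineA1) : cellTwist (cellTwist g) = g :=
  Subtype.ext (swapTwist_swapTwist _)

/-- The function `Δ_{ω_i}` on the cell. -/
def cellX (i : Fin 2) (g : coxeterCell k affineA1) : k := fundMinor k affineA1 i g

/-- The function `Δ_{ω_i}` on the cell, precomposed with `cellTwist`. These functions correspond to
further cluster variables. -/
def cellX' (i : Fin 2) (g : coxeterCell k affineA1) : k := cellX i (cellTwist g)

/-- The function on the cell which corresponds to the frozen variable `z_i`. -/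
def cellZ (i : Fin 2) (g : coxeterCell k affineA1) : k :=
  minorRight k affineA1 i g * ∏ j ∈ Finset.Iio i, minorRight k affineA1 j g ^ affineA1 j i

/-- The function on the cell which corresponds to the frozen variable `z_{\bar i}`. -/
def cellZbar (i : Fin 2) (g : coxeterCell k affineA1) : k :=
  minorLeft k affineA1 i g * ∏ j ∈ Finset.Iio i, minorLeft k affineA1 j g ^ affineA1 j i

theorem cellZ_zero (g : coxeterCell k affineA1) : cellZ 0 g = minorRight k affineA1 0 g := by
  have : Finset.Iio (0 : Fin 2) = ∅ := rfl
  rw [cellZ, this, Finset.prod_empty, mul_one]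

theorem cellZbar_zero (g : coxeterCell k affineA1) : cellZbar 0 g = minorLeft k affineA1 0 g := by
  have : Finset.Iio (0 : Fin 2) = ∅ := rfl
  rw [cellZbar, this, Finset.prod_empty, mul_one]

theorem cellZ_one (g : coxeterCell k affineA1) : cellZ 1 g
    = minorRight k affineA1 1 g * (minorRight k affineA1 0 g ^ 2)⁻¹ := by
  have : Finset.Iio (1 : Fin 2) = {0} := rfl
  rw [cellZ, this, Finset.prod_singleton, show affineA1 0 1 = -2 from rfl, zpow_neg]
  norm_cast

theorem cellZbar_one (g : coxeterCell k affineA1) : cellZbar 1 g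
    = minorLeft k affineA1 1 g * (minorLeft k affineA1 0 g ^ 2)⁻¹ := by
  have : Finset.Iio (1 : Fin 2) = {0} := rfl
  rw [cellZbar, this, Finset.prod_singleton, show affineA1 0 1 = -2 from rfl, zpow_neg]
  norm_cast

section Chart
variable {s t p b : kˣ} {y' y : k} (h : (b : k) ^ 2 * y' * y ≠ 1)

/-- The points of the chart `Δ_{ω_0} ≠ 0` of the cell. -/
def chartCell (s t p b : kˣ) (y' y : k) (h : (b : k) ^ 2 * y' * y ≠ 1) : coxeterCell k affineA1 :=
  ⟨chartPt s t p b y' y, chartPt_mem_coxeterCell h⟩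

theorem chart_ne_zero {b : kˣ} {y' y : k} (h : (b : k) ^ 2 * y' * y ≠ 1) : -(b : k)⁻¹ + b * y' * y ≠ 0 := fun h0 => h (by
  have : (b : k) ^ 2 * y' * y = b * (-(b : k)⁻¹ + b * y' * y) + 1 := by
    have := b.ne_zero
    field_simp; ring
  rw [this, h0]; ring)

theorem cellX_zero_chart : cellX 0 (chartCell s t p b y' y h) = p := fundMinor_zero_chartPt ..

theorem cellX_one_chart : cellX 1 (chartCell s t p b y' y h) = b * y := fundMinor_one_chartPt ..

theorem cellX'_zero_chart : cellX' 0 (chartCell s t p b y' y h) = b * y' :=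
  fundMinor_zero_swapTwist_chartPt ..

theorem cellX'_one_chart : cellX' 1 (chartCell s t p b y' y h)
    = (p : k)⁻¹ + s * t * p * (b * y') ^ 2 := fundMinor_one_swapTwist_chartPt ..

theorem cellZ_zero_chart : cellZ 0 (chartCell s t p b y' y h) = p * t := by
  rw [cellZ_zero]; exact minorRight_zero_chartPt ..

theorem cellZbar_zero_chart : cellZbar 0 (chartCell s t p b y' y h) = p * s := by
  rw [cellZbar_zero]; exact minorLeft_zero_chartPt ..

theorem cellZ_one_chart : cellZ 1 (chartCell s t p b y' y h) = b / (p : k) ^ 2 := by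
  rw [cellZ_one, chartCell, minorRight_zero_chartPt, minorRight_one_chartPt]
  have := p.ne_zero
  have := t.ne_zero
  field_simp

theorem cellZbar_one_chart :
    cellZbar 1 (chartCell s t p b y' y h) = -(b : k)⁻¹ + b * y' * y := by
  rw [cellZbar_one, chartCell, minorLeft_zero_chartPt, minorLeft_one_chartPt]
  have := p.ne_zero
  have := s.ne_zero
  rw [mul_inv_cancel_right₀ (by positivity)]

theorem cellZ_twist_chart (i : Fin 2) : cellZ i (cellTwist (chartCell s t p b y' y h))
    = -cellZbar i.rev (chartCell s t p b y' y h) := by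
  have h0 := chart_ne_zero h
  have hb := b.ne_zero
  have h1 : (b : k)⁻¹ - b * y' * y ≠ 0 := fun h => h0 (by rw [neg_add_eq_sub, ← neg_sub, h, neg_zero])
  rcases eq_or_eq_rev 0 i with rfl | rfl
  · rw [cellZ_zero, show Fin.rev (0 : Fin 2) = 1 from rfl, cellZbar_one_chart]
    exact (minorRight_zero_swapTwist_chartPt ..).trans (by ring)
  · rw [show Fin.rev (0 : Fin 2) = 1 from rfl, cellZ_one, show Fin.rev (1 : Fin 2) = 0 from rfl,
      cellZbar_zero_chart, cellTwist, chartCell, minorRight_zero_swapTwist_chartPt,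
      minorRight_one_swapTwist_chartPt, ← neg_mul, mul_inv_cancel_right₀ (pow_ne_zero 2 h1)]
    ring

theorem cellZbar_twist_chart (i : Fin 2) : cellZbar i (cellTwist (chartCell s t p b y' y h))
    = -cellZ i.rev (chartCell s t p b y' y h) := by
  have hb := b.ne_zero
  have hp := p.ne_zero
  rcases eq_or_eq_rev 0 i with rfl | rfl
  · rw [cellZbar_zero, show Fin.rev (0 : Fin 2) = 1 from rfl, cellZ_one_chart]
    exact minorLeft_zero_swapTwist_chartPt ..
  · rw [show Fin.rev (0 : Fin 2) = 1 from rfl, cellZbar_one, show Fin.rev (1 : Fin 2) = 0 from rfl,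
      cellZ_zero_chart, cellTwist, chartCell, minorLeft_zero_swapTwist_chartPt,
      minorLeft_one_swapTwist_chartPt]
    field_simp

end Chart

theorem exists_chartCell {g : coxeterCell k affineA1} (h0 : cellX 0 g ≠ 0) :
    ∃ (s t p b : kˣ) (y' y : k) (h : (b : k) ^ 2 * y' * y ≠ 1), g = chartCell s t p b y' y h := by
  obtain ⟨s, t, p, b, y', y, h1, h2⟩ := exists_chartPt_of_mem g.2 h0
  exact ⟨s, t, p, b, y', y, h2, Subtype.ext h1⟩

/-- The cell is covered by the chart `Δ_{ω_0} ≠ 0` and its image under `cellTwist`. -/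
theorem cell_cases {C : coxeterCell k affineA1 → Prop}
    (h1 : ∀ (s t p b : kˣ) (y' y : k) (h : (b : k) ^ 2 * y' * y ≠ 1), C (chartCell s t p b y' y h))
    (h2 : ∀ (s t p b : kˣ) (y' y : k) (h : (b : k) ^ 2 * y' * y ≠ 1),
      C (cellTwist (chartCell s t p b y' y h))) (g : coxeterCell k affineA1) : C g := by
  rcases fundMinor_zero_ne_zero_or g.2 with h | h
  · obtain ⟨s, t, p, b, y', y, h', rfl⟩ := exists_chartCell h
    exact h1 ..
  · obtain ⟨s, t, p, b, y', y, h', e⟩ := exists_chartCell (g := cellTwist g) h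
    rw [← cellTwist_cellTwist g, e]
    exact h2 ..

theorem cellZ_twist (i : Fin 2) (g : coxeterCell k affineA1) :
    cellZ i (cellTwist g) = -cellZbar i.rev g := by
  refine cell_cases (C := fun g => cellZ i (cellTwist g) = -cellZbar i.rev g)
    (fun _ _ _ _ _ _ h => cellZ_twist_chart h i) (fun _ _ _ _ _ _ h => ?_) g
  rw [cellTwist_cellTwist, cellZbar_twist_chart, Fin.rev_rev, neg_neg]

theorem cellZbar_twist (i : Fin 2) (g : coxeterCell k affineA1) :
    cellZbar i (cellTwist g) = -cellZ i.rev g := by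
  rw [← cellTwist_cellTwist g, cellZ_twist, cellTwist_cellTwist, Fin.rev_rev, neg_neg]

theorem cellX_twist (i : Fin 2) (g : coxeterCell k affineA1) :
    cellX i (cellTwist g) = cellX' i g := rfl

theorem cellX'_twist (i : Fin 2) (g : coxeterCell k affineA1) :
    cellX' i (cellTwist g) = cellX i g := congrArg _ (cellTwist_cellTwist g)

theorem cellZ_chart_ne_zero {s t p b : kˣ} {y' y : k} (h : (b : k) ^ 2 * y' * y ≠ 1) (i : Fin 2) :
    cellZ i (chartCell s t p b y' y h) ≠ 0 ∧ cellZbar i (chartCell s t p b y' y h) ≠ 0 := by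
  rcases eq_or_eq_rev 0 i with rfl | rfl
  · rw [cellZ_zero_chart, cellZbar_zero_chart]
    exact ⟨mul_ne_zero p.ne_zero t.ne_zero, mul_ne_zero p.ne_zero s.ne_zero⟩
  · rw [show Fin.rev (0 : Fin 2) = 1 from rfl, cellZ_one_chart, cellZbar_one_chart]
    exact ⟨div_ne_zero b.ne_zero (pow_ne_zero 2 p.ne_zero), chart_ne_zero h⟩

theorem cellZ_ne_zero_and (i : Fin 2) (g : coxeterCell k affineA1) :
    cellZ i g ≠ 0 ∧ cellZbar i g ≠ 0 := by
  refine cell_cases (C := fun g => cellZ i g ≠ 0 ∧ cellZbar i g ≠ 0)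
    (fun _ _ _ _ _ _ h => cellZ_chart_ne_zero h i) (fun _ _ _ _ _ _ h => ?_) g
  rw [cellZ_twist, cellZbar_twist]
  exact ⟨neg_ne_zero.2 (cellZ_chart_ne_zero h i.rev).2, neg_ne_zero.2 (cellZ_chart_ne_zero h i.rev).1⟩

theorem cellZ_ne_zero (i : Fin 2) (g : coxeterCell k affineA1) : cellZ i g ≠ 0 :=
  (cellZ_ne_zero_and i g).1

theorem cellZbar_ne_zero (i : Fin 2) (g : coxeterCell k affineA1) : cellZbar i g ≠ 0 :=
  (cellZ_ne_zero_and i g).2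

theorem cell_relations_chart {s t p b : kˣ} {y' y : k} (h : (b : k) ^ 2 * y' * y ≠ 1)
    {g : coxeterCell k affineA1} (hg : g = chartCell s t p b y' y h) :
    cellX 1 g * cellX' 0 g = cellX 0 g ^ 2 * (cellZ 1 g * cellZbar 1 g) + 1 ∧
    cellX 0 g * cellX' 1 g = cellX' 0 g ^ 2 * (cellZ 0 g * cellZbar 0 g) + 1 := by
  have hb := b.ne_zero
  have hp := p.ne_zero
  rw [hg, cellX_zero_chart, cellX_one_chart, cellX'_zero_chart, cellX'_one_chart, cellZ_zero_chart,
    cellZ_one_chart, cellZbar_zero_chart, cellZbar_one_chart]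
  constructor
  · field_simp; ring
  · field_simp; ring

/-- The exchange relations. -/
theorem cell_relations (g : coxeterCell k affineA1) :
    cellX 1 g * cellX' 0 g = cellX 0 g ^ 2 * (cellZ 1 g * cellZbar 1 g) + 1 ∧
    cellX 0 g * cellX' 1 g = cellX' 0 g ^ 2 * (cellZ 0 g * cellZbar 0 g) + 1 := by
  refine cell_cases (C := fun g =>
    cellX 1 g * cellX' 0 g = cellX 0 g ^ 2 * (cellZ 1 g * cellZbar 1 g) + 1 ∧
    cellX 0 g * cellX' 1 g = cellX' 0 g ^ 2 * (cellZ 0 g * cellZbar 0 g) + 1)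
    (fun _ _ _ _ _ _ h => cell_relations_chart h rfl) (fun _ _ _ _ _ _ h => ?_) g
  obtain ⟨h1, h2⟩ := cell_relations_chart h rfl
  rw [cellX_twist, cellX_twist, cellX'_twist, cellX'_twist, cellZ_twist, cellZ_twist,
    cellZbar_twist, cellZbar_twist, show Fin.rev (0 : Fin 2) = 1 from rfl,
    show Fin.rev (1 : Fin 2) = 0 from rfl, mul_comm (cellX' 1 _), h2, mul_comm (cellX' 0 _), h1]
  exact ⟨by ring, by ring⟩

/-- The chart parameters of a point are recovered from its coordinates. -/
theorem exists_cell_of_ne_zero {X X' Z W : Fin 2 → k} (hZ : ∀ i, Z i ≠ 0) (hW : ∀ i, W i ≠ 0)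
    (h1 : X 1 * X' 0 = X 0 ^ 2 * (Z 1 * W 1) + 1) (h2 : X 0 * X' 1 = X' 0 ^ 2 * (Z 0 * W 0) + 1)
    (h0 : X 0 ≠ 0) : ∃ g : coxeterCell k affineA1, ∀ i, cellX i g = X i ∧ cellX' i g = X' i ∧
      cellZ i g = Z i ∧ cellZbar i g = W i := by
  have hz0 := hZ 0
  have hz1 := hZ 1
  have hw0 := hW 0
  have hw1 := hW 1
  set b : kˣ := Units.mk0 (Z 1 * X 0 ^ 2) (by positivity) with hb
  have hbv : (b : k) = Z 1 * X 0 ^ 2 := rfl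
  have hyy : (b : k) ^ 2 * (X' 0 / b) * (X 1 / b) = X 0 ^ 2 * (Z 1 * W 1) + 1 := by
    rw [← h1]
    have := b.ne_zero
    field_simp
  have h : (b : k) ^ 2 * (X' 0 / b) * (X 1 / b) ≠ 1 := by
    rw [hyy]
    intro h
    have : X 0 ^ 2 * (Z 1 * W 1) ≠ 0 := by positivity
    exact this (by simpa using h)
  refine ⟨chartCell (Units.mk0 (W 0 / X 0) (div_ne_zero hw0 h0))
    (Units.mk0 (Z 0 / X 0) (div_ne_zero hz0 h0)) (Units.mk0 (X 0) h0) b (X' 0 / b) (X 1 / b) h,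
    Fin.forall_fin_two.2 ⟨⟨?_, ?_, ?_, ?_⟩, ?_, ?_, ?_, ?_⟩⟩
  · exact cellX_zero_chart _
  · rw [cellX'_zero_chart, mul_div_cancel₀ _ b.ne_zero]
  · rw [cellZ_zero_chart, Units.val_mk0, Units.val_mk0, mul_div_cancel₀ _ h0]
  · rw [cellZbar_zero_chart, Units.val_mk0, Units.val_mk0, mul_div_cancel₀ _ h0]
  · rw [cellX_one_chart, mul_div_cancel₀ _ b.ne_zero]
  · rw [cellX'_one_chart, mul_div_cancel₀ _ b.ne_zero]
    refine mul_left_cancel₀ h0 ?_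
    rw [h2]
    simp only [Units.val_mk0]
    field_simp; ring
  · rw [cellZ_one_chart, hbv, Units.val_mk0, mul_div_cancel_right₀ _ (pow_ne_zero 2 h0)]
  · rw [cellZbar_one_chart]
    refine mul_left_cancel₀ b.ne_zero ?_
    rw [mul_add, show (b : k) * (b * (X' 0 / b) * (X 1 / b)) = (b : k) ^ 2 * (X' 0 / b) * (X 1 / b)
      by ring, hyy, mul_neg, mul_inv_cancel₀ b.ne_zero, hbv]
    ring

/-- The coordinates identify the cell with the affine variety given by the exchange relations. -/
theorem exists_cell {X X' Z W : Fin 2 → k} (hZ : ∀ i, Z i ≠ 0) (hW : ∀ i, W i ≠ 0)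
    (h1 : X 1 * X' 0 = X 0 ^ 2 * (Z 1 * W 1) + 1)
    (h2 : X 0 * X' 1 = X' 0 ^ 2 * (Z 0 * W 0) + 1) :
    ∃ g : coxeterCell k affineA1, ∀ i, cellX i g = X i ∧ cellX' i g = X' i ∧
      cellZ i g = Z i ∧ cellZbar i g = W i := by
  by_cases h0 : X 0 = 0
  · have h0' : X' 0 ≠ 0 := by
      intro h
      rw [h0, h] at h1
      simp at h1
    obtain ⟨g, hg⟩ := exists_cell_of_ne_zero (X := X') (X' := X) (Z := fun i => -W i.rev)
      (W := fun i => -Z i.rev) (fun i => neg_ne_zero.2 (hW _)) (fun i => neg_ne_zero.2 (hZ _))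
      (by rw [show Fin.rev (1 : Fin 2) = 0 from rfl, mul_comm, h2]; ring)
      (by rw [show Fin.rev (0 : Fin 2) = 1 from rfl, mul_comm, h1]; ring) h0'
    refine ⟨cellTwist g, fun i => ⟨(hg i).2.1, ?_, ?_, ?_⟩⟩
    · rw [cellX'_twist]; exact (hg i).1
    · rw [cellZ_twist, (hg _).2.2.2, Fin.rev_rev, neg_neg]
    · rw [cellZbar_twist, (hg _).2.2.1, Fin.rev_rev, neg_neg]
  · exact exists_cell_of_ne_zero hZ hW h1 h2 h0

end CellCoordinates

/-! ### The algebra of the coordinates; density of the torus -/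

section CellAlgebra
variable {k : Type u} [Field k] [CharZero k]

variable (k) in
/-- The algebra of functions on the cell generated by the coordinates and the inverses of the
invertible ones. -/
def cellAlg : Subalgebra k (coxeterCell k affineA1 → k) :=
  Algebra.adjoin k (Set.range cellX ∪ Set.range cellX' ∪ Set.range cellZ ∪ Set.range cellZbar ∪
    Set.range (fun i => (cellZ i)⁻¹) ∪ Set.range (fun i => (cellZbar i)⁻¹))

theorem cellX_mem (i : Fin 2) : cellX i ∈ cellAlg k :=
  Algebra.subset_adjoin (by simp)

theorem cellX'_mem (i : Fin 2) : cellX' i ∈ cellAlg k :=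
  Algebra.subset_adjoin (by simp)

theorem cellZ_mem (i : Fin 2) : cellZ i ∈ cellAlg k :=
  Algebra.subset_adjoin (by simp)

theorem cellZbar_mem (i : Fin 2) : cellZbar i ∈ cellAlg k :=
  Algebra.subset_adjoin (by simp)

theorem cellZ_inv_mem (i : Fin 2) : (cellZ i)⁻¹ ∈ cellAlg k :=
  Algebra.subset_adjoin (by simp)

theorem cellZbar_inv_mem (i : Fin 2) : (cellZbar i)⁻¹ ∈ cellAlg k :=
  Algebra.subset_adjoin (by simp)

theorem cellAlg_le {R : Subalgebra k (coxeterCell k affineA1 → k)} (hX : ∀ i, cellX i ∈ R)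
    (hX' : ∀ i, cellX' i ∈ R) (hZ : ∀ i, cellZ i ∈ R) (hW : ∀ i, cellZbar i ∈ R)
    (hZ' : ∀ i, (cellZ i)⁻¹ ∈ R) (hW' : ∀ i, (cellZbar i)⁻¹ ∈ R) : cellAlg k ≤ R := by
  refine Algebra.adjoin_le ?_
  rintro F (((((⟨i, rfl⟩ | ⟨i, rfl⟩) | ⟨i, rfl⟩) | ⟨i, rfl⟩) | ⟨i, rfl⟩) | ⟨i, rfl⟩)
  exacts [hX i, hX' i, hZ i, hW i, hZ' i, hW' i]

theorem comp_cellTwist_mem {F : coxeterCell k affineA1 → k} (hF : F ∈ cellAlg k) :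
    (fun g => F (cellTwist g)) ∈ cellAlg k := by
  set R : Subalgebra k (coxeterCell k affineA1 → k) :=
    (cellAlg k).comap (AlgHom.ofLinearMap (LinearMap.funLeft k k cellTwist) rfl fun _ _ => rfl)
  have hR : ∀ G, G ∈ R ↔ (fun g => G (cellTwist g)) ∈ cellAlg k := fun G => Iff.rfl
  refine (hR F).1 (cellAlg_le (R := R) (fun i => ?_) (fun i => ?_) (fun i => ?_) (fun i => ?_)
    (fun i => ?_) (fun i => ?_) hF)
  · exact (hR _).2 (cellX'_mem i)
  · rw [hR]; simpa only [cellX'_twist] using cellX_mem i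
  · rw [hR]; simp only [cellZ_twist]; exact neg_mem (cellZbar_mem i.rev)
  · rw [hR]; simp only [cellZbar_twist]; exact neg_mem (cellZ_mem i.rev)
  · rw [hR]; simp only [Pi.inv_apply, cellZ_twist, inv_neg]; exact neg_mem (cellZbar_inv_mem i.rev)
  · rw [hR]; simp only [Pi.inv_apply, cellZbar_twist, inv_neg]; exact neg_mem (cellZ_inv_mem i.rev)

theorem cellAlg_le_coordinateRing :
    cellAlg k ≤ coordinateRing k affineA1 (coxeterCell k affineA1) := by
  have hπ : ∀ i j : Fin 2, affineA1 (Fin.revPerm i) (Fin.revPerm j) = affineA1 i j := fun i j => by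
    fin_cases i <;> fin_cases j <;> rfl
  have h1 : ∀ i : Fin 2, (fun g : coxeterCell k affineA1 => minorRight k affineA1 i g) ∈
      coordinateRing k affineA1 (coxeterCell k affineA1) := fun i =>
    coordinateRing_of_polynomialFunctions (minorRight_mem_polynomialFunctions i)
  have h2 : ∀ i : Fin 2, (fun g : coxeterCell k affineA1 => minorLeft k affineA1 i g) ∈
      coordinateRing k affineA1 (coxeterCell k affineA1) := fun i =>
    coordinateRing_of_polynomialFunctions (minorLeft_mem_polynomialFunctions i)
  have hZ : ∀ i : Fin 2, cellZ i ∈ coordinateRing k affineA1 (coxeterCell k affineA1) := by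
    have h0 : (cellZ 0 : coxeterCell k affineA1 → k) ∈ coordinateRing k affineA1 _ := by
      convert h1 0 using 1; funext g; exact cellZ_zero g
    refine Fin.forall_fin_two.2 ⟨h0, ?_⟩
    convert mul_mem (h1 1) (pow_mem (inv_mem_coordinateRing h0 (cellZ_ne_zero 0)) 2) using 1
    funext g
    simp [cellZ_one, cellZ_zero]
  have hW : ∀ i : Fin 2, cellZbar i ∈ coordinateRing k affineA1 (coxeterCell k affineA1) := by
    have h0 : (cellZbar 0 : coxeterCell k affineA1 → k) ∈ coordinateRing k affineA1 _ := by
      convert h2 0 using 1; funext g; exact cellZbar_zero g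
    refine Fin.forall_fin_two.2 ⟨h0, ?_⟩
    convert mul_mem (h2 1) (pow_mem (inv_mem_coordinateRing h0 (cellZbar_ne_zero 0)) 2) using 1
    funext g
    simp [cellZbar_one, cellZbar_zero]
  exact cellAlg_le
    (fun i => coordinateRing_of_polynomialFunctions (fundMinor_mem_polynomialFunctions i))
    (fun i => coordinateRing_of_polynomialFunctions
      (comp_twist_mem_polynomialFunctions hπ (fundMinor_mem_polynomialFunctions i)))
    hZ hW (fun i => inv_mem_coordinateRing (hZ i) (cellZ_ne_zero i))
    (fun i => inv_mem_coordinateRing (hW i) (cellZbar_ne_zero i))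

section Curves
open Polynomial

/-- Along the curves in a chart on which the coordinates `y'` and `y` are polynomials, the functions
in `cellAlg` are polynomials divided by powers of the frozen coordinate `b² y' y - 1`. -/
theorem exists_polynomial_of_mem {F : coxeterCell k affineA1 → k} (hF : F ∈ cellAlg k)
    (s t p b : kˣ) (u v : k[X]) : ∃ (q : k[X]) (M : ℕ), ∀ (τ : k)
      (h : (b : k) ^ 2 * u.eval τ * v.eval τ ≠ 1),
      F (chartCell s t p b (u.eval τ) (v.eval τ) h) * ((b : k) ^ 2 * u.eval τ * v.eval τ - 1) ^ M
        = q.eval τ := by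
  set R : Subalgebra k (coxeterCell k affineA1 → k) :=
    { carrier := {F | ∃ (q : k[X]) (M : ℕ), ∀ (τ : k)
        (h : (b : k) ^ 2 * u.eval τ * v.eval τ ≠ 1), F (chartCell s t p b (u.eval τ) (v.eval τ) h) *
          ((b : k) ^ 2 * u.eval τ * v.eval τ - 1) ^ M = q.eval τ}
      mul_mem' := by
        rintro F G ⟨q, M, h1⟩ ⟨q', M', h2⟩
        refine ⟨q * q', M + M', fun τ h => ?_⟩
        rw [eval_mul, ← h1 τ h, ← h2 τ h, Pi.mul_apply]
        ring
      add_mem' := by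
        rintro F G ⟨q, M, h1⟩ ⟨q', M', h2⟩
        refine ⟨q * (C ((b : k) ^ 2) * u * v - 1) ^ M' + q' * (C ((b : k) ^ 2) * u * v - 1) ^ M,
          M + M', fun τ h => ?_⟩
        simp only [eval_add, eval_mul, eval_pow, eval_sub, eval_C, eval_one, ← h1 τ h, ← h2 τ h,
          Pi.add_apply]
        ring
      algebraMap_mem' := fun c => ⟨C c, 0, fun τ h => by simp⟩ }
  have hp := p.ne_zero
  have hb := b.ne_zero
  have hR : ∀ G (q : k[X]), (∀ (τ : k) (h : (b : k) ^ 2 * u.eval τ * v.eval τ ≠ 1),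
      G (chartCell s t p b (u.eval τ) (v.eval τ) h) = q.eval τ) → G ∈ R := fun G q H =>
    ⟨q, 0, fun τ h => by rw [pow_zero, mul_one, H]⟩
  refine cellAlg_le (R := R) (Fin.forall_fin_two.2 ⟨?_, ?_⟩) (Fin.forall_fin_two.2 ⟨?_, ?_⟩)
    (Fin.forall_fin_two.2 ⟨?_, ?_⟩) (Fin.forall_fin_two.2 ⟨?_, ?_⟩)
    (Fin.forall_fin_two.2 ⟨?_, ?_⟩) (Fin.forall_fin_two.2 ⟨?_, ?_⟩) hF
  · exact hR _ (C (p : k)) fun τ h => by rw [cellX_zero_chart, eval_C]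
  · exact hR _ (C (b : k) * v) fun τ h => by rw [cellX_one_chart, eval_mul, eval_C]
  · exact hR _ (C (b : k) * u) fun τ h => by rw [cellX'_zero_chart, eval_mul, eval_C]
  · refine hR _ (C (p : k)⁻¹ + C (s * t * p : k) * (C (b : k) * u) ^ 2) fun τ h => ?_
    simp [cellX'_one_chart]
  · exact hR _ (C (p * t : k)) fun τ h => by rw [cellZ_zero_chart, eval_C]
  · exact hR _ (C (b / p ^ 2 : k)) fun τ h => by rw [cellZ_one_chart, eval_C]
  · exact hR _ (C (p * s : k)) fun τ h => by rw [cellZbar_zero_chart, eval_C]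
  · refine hR _ (-C (b : k)⁻¹ + C (b : k) * u * v) fun τ h => ?_
    simp [cellZbar_one_chart]
  · exact hR _ (C (p * t : k)⁻¹) fun τ h => by rw [Pi.inv_apply, cellZ_zero_chart, eval_C]
  · exact hR _ (C (b / p ^ 2 : k)⁻¹) fun τ h => by rw [Pi.inv_apply, cellZ_one_chart, eval_C]
  · exact hR _ (C (p * s : k)⁻¹) fun τ h => by rw [Pi.inv_apply, cellZbar_zero_chart, eval_C]
  · refine ⟨C (b : k), 1, fun τ h => ?_⟩
    have h1 := chart_ne_zero h
    rw [Pi.inv_apply, cellZbar_one_chart, eval_C, pow_one]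
    rw [inv_mul_eq_iff_eq_mul₀ h1]
    field_simp
    ring

theorem polynomial_eq_zero_of_eval {q c : k[X]} (hc : c ≠ 0)
    (h : ∀ τ, τ ≠ 0 → c.eval τ ≠ 0 → q.eval τ = 0) : q = 0 := by
  have : q * (X * c) = 0 := Polynomial.funext fun τ => by
    rw [eval_mul, eval_mul, eval_X, eval_zero]
    rcases eq_or_ne τ 0 with rfl | h1
    · simp
    · rcases eq_or_ne (c.eval τ) 0 with h2 | h2
      · rw [h2]; simp
      · rw [h τ h1 h2, zero_mul]
  exact (mul_eq_zero.1 this).resolve_right (mul_ne_zero X_ne_zero hc)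

theorem sub_one_ne_zero_of_eval {c : k[X]} (h : c.eval 0 = 0) : c - 1 ≠ 0 := fun h' => by
  have := congrArg (eval 0) h'
  rw [eval_sub, h, eval_one, eval_zero, zero_sub] at this
  exact neg_ne_zero.2 one_ne_zero this

/-- The points with `Δ_{ω_0} ≠ 0` and `Δ_{ω_1} ≠ 0` are dense in the cell. -/
theorem eq_zero_of_eq_zero_on_torus {F : coxeterCell k affineA1 → k} (hF : F ∈ cellAlg k)
    (h : ∀ g, cellX 0 g ≠ 0 → cellX 1 g ≠ 0 → F g = 0) : F = 0 := by
  have h1 : ∀ g, cellX 0 g ≠ 0 → F g = 0 := fun g hg => by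
    obtain ⟨s, t, p, b, y', y, hy, rfl⟩ := exists_chartCell hg
    -- along the curve on which only `y` varies, `Δ_{ω_1} = b y` vanishes at one point
    obtain ⟨q, M, hq⟩ := exists_polynomial_of_mem hF s t p b (C y') X
    have hq0 : q = 0 := by
      refine polynomial_eq_zero_of_eval (c := C ((b : k) ^ 2) * C y' * X - 1)
        (sub_one_ne_zero_of_eval (by simp)) fun τ h1 h2 => ?_
      have h3 : (b : k) ^ 2 * (C y').eval τ * X.eval τ ≠ 1 := by
        simpa [sub_ne_zero] using h2
      rw [← hq τ h3, h _ (by rw [cellX_zero_chart]; exact p.ne_zero)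
        (by rw [cellX_one_chart, eval_X]; exact mul_ne_zero b.ne_zero h1), zero_mul]
    have h3 := hq y (by simpa using hy)
    rw [hq0, eval_zero] at h3
    simp only [eval_C, eval_X] at h3
    exact (mul_eq_zero.1 h3).resolve_right (pow_ne_zero _ (sub_ne_zero.2 hy))
  funext g
  refine cell_cases (C := fun g => F g = 0) (fun s t p b y' y hy => h1 _ ?_)
    (fun s t p b y' y hy => ?_) g
  · rw [cellX_zero_chart]; exact p.ne_zero
  -- in the twisted chart `Δ_{ω_0} = b y'`, and only `y'` varies
  · obtain ⟨q, M, hq⟩ := exists_polynomial_of_mem (comp_cellTwist_mem hF) s t p b X (C y)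
    have hq0 : q = 0 := by
      refine polynomial_eq_zero_of_eval (c := C ((b : k) ^ 2) * X * C y - 1)
        (sub_one_ne_zero_of_eval (by simp)) fun τ h2 h3 => ?_
      have h4 : (b : k) ^ 2 * X.eval τ * (C y).eval τ ≠ 1 := by
        simpa [sub_ne_zero] using h3
      rw [← hq τ h4, h1 _ (by
        rw [cellX_twist, cellX'_zero_chart, eval_X]; exact mul_ne_zero b.ne_zero h2), zero_mul]
    have h3 := hq y' (by simpa using hy)
    rw [hq0, eval_zero] at h3
    simp only [eval_C, eval_X] at h3
    exact (mul_eq_zero.1 h3).resolve_right (pow_ne_zero _ (sub_ne_zero.2 hy))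

end Curves

end CellAlgebra

/-! ### The coordinate ring of the cell -/

section Nullstellensatz

/-- The weak Nullstellensatz: a proper ideal of a finitely generated algebra over an algebraically
closed field is contained in the kernel of a character. -/
theorem exists_algHom_of_ne_top {k S : Type*} [Field k] [IsAlgClosed k] [CommRing S] [Algebra k S]
    [Algebra.FiniteType k S] {I : Ideal S} (hI : I ≠ ⊤) : ∃ χ : S →ₐ[k] k, ∀ q ∈ I, χ q = 0 := by
  obtain ⟨M, hM, hIM⟩ := Ideal.exists_le_maximal I hI
  let := Ideal.Quotient.field M
  have hfin : Module.Finite k (S ⧸ M) := finite_of_finite_type_of_isJacobsonRing k _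
  have hbij : Function.Bijective (algebraMap k (S ⧸ M)) :=
    IsAlgClosed.algebraMap_bijective_of_isIntegral
  refine ⟨((AlgEquiv.ofBijective (Algebra.ofId k (S ⧸ M)) hbij).symm.toAlgHom).comp
    (Ideal.Quotient.mkₐ k M), fun q hq => ?_⟩
  have : Ideal.Quotient.mkₐ k M q = 0 := Ideal.Quotient.eq_zero_iff_mem.2 (hIM hq)
  rw [AlgHom.comp_apply, this, map_zero]

variable {k : Type u} [Field k] [CharZero k]

/-- On the chart `Δ_{ω_0} ≠ 0` the polynomial functions are quotients of elements of `cellAlg` by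
powers of `Δ_{ω_0}`. -/
theorem exists_mul_cellX_pow {F : Grp k affineA1 → k} (hF : F ∈ polynomialFunctions k affineA1) :
    ∃ G ∈ cellAlg k, ∃ N : ℕ, ∀ g : coxeterCell k affineA1, cellX 0 g ≠ 0 →
      F g * cellX 0 g ^ N = G g := by
  set U := {g : coxeterCell k affineA1 // cellX 0 g ≠ 0}
  set R : Subalgebra k (U → k) :=
    { carrier := {φ | ∃ G ∈ cellAlg k, ∃ N : ℕ, ∀ g : U, φ g * cellX 0 g.1 ^ N = G g.1}
      mul_mem' := by
        rintro φ φ' ⟨G, hG, N, h⟩ ⟨G', hG', N', h'⟩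
        refine ⟨G * G', mul_mem hG hG', N + N', fun g => ?_⟩
        rw [Pi.mul_apply, Pi.mul_apply, ← h, ← h']
        ring
      add_mem' := by
        rintro φ φ' ⟨G, hG, N, h⟩ ⟨G', hG', N', h'⟩
        refine ⟨G * cellX 0 ^ N' + G' * cellX 0 ^ N,
          add_mem (mul_mem hG (pow_mem (cellX_mem 0) _)) (mul_mem hG' (pow_mem (cellX_mem 0) _)),
          N + N', fun g => ?_⟩
        simp only [Pi.mul_apply, Pi.add_apply, Pi.pow_apply, ← h, ← h']
        ring
      algebraMap_mem' := fun c => ⟨_, Subalgebra.algebraMap_mem _ c, 0, fun g => by simp⟩ }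
  have hR : ∀ (φ : U → k) (N : ℕ) (G), G ∈ cellAlg k →
      (∀ g : U, φ g * cellX 0 g.1 ^ N = G g.1) → φ ∈ R := fun φ N G hG h => ⟨G, hG, N, h⟩
  have hb : ∀ g : U, cellZ 1 g.1 * cellX 0 g.1 ^ 2 ≠ 0 := fun g =>
    mul_ne_zero (cellZ_ne_zero 1 _) (pow_ne_zero 2 g.2)
  have hb' : (fun g : U => (cellZ 1 g.1 * cellX 0 g.1 ^ 2)⁻¹) ∈ R :=
    hR _ 2 _ (cellZ_inv_mem 1) fun g => by
      have := g.2
      have := cellZ_ne_zero 1 g.1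
      rw [Pi.inv_apply]
      field_simp
  have hq : ∀ G ∈ cellAlg k, (fun g : U => G g.1 / cellX 0 g.1) ∈ R := fun G hG =>
    hR _ 1 _ hG fun g => by rw [pow_one, div_mul_cancel₀ _ g.2]
  have hr : ∀ G ∈ cellAlg k, (fun g : U => G g.1) ∈ R := fun G hG => hR _ 0 _ hG fun g => by simp
  -- the chart, with the parameters expressed by the coordinates of the cell
  have hfam : IsRegularFamily R fun g : U => xbar k affineA1 0 (cellZbar 0 g.1 / cellX 0 g.1) *
      corootElt k affineA1 0 (Units.mk0 _ g.2) *
      xbar k affineA1 1 (cellX' 0 g.1 * (cellZ 1 g.1 * cellX 0 g.1 ^ 2)⁻¹) *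
      corootElt k affineA1 1 (Units.mk0 _ (hb g)) * (sbar k affineA1 1)⁻¹ *
      xbar k affineA1 1 (cellX 1 g.1 * (cellZ 1 g.1 * cellX 0 g.1 ^ 2)⁻¹) *
      x k affineA1 0 (cellZ 0 g.1 / cellX 0 g.1) := by
    refine ((((((isRegularFamily_xbar 0 (hq _ (cellZbar_mem 0))).mul
      (isRegularFamily_corootElt 0 ?_ ?_)).mul
      (isRegularFamily_xbar 1 (mul_mem (hr _ (cellX'_mem 0)) hb'))).mul
      (isRegularFamily_corootElt 1 ?_ ?_)).mul (isRegularFamily_const _)).mul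
      (isRegularFamily_xbar 1 (mul_mem (hr _ (cellX_mem 1)) hb'))).mul
      (isRegularFamily_x 0 (hq _ (cellZ_mem 0)))
    · exact hr _ (cellX_mem 0)
    · convert hq 1 (one_mem _) using 1
      funext g
      rw [Pi.one_apply, one_div, Units.val_mk0]
    · exact hr _ (mul_mem (cellZ_mem 1) (pow_mem (cellX_mem 0) 2))
    · exact hb'
  obtain ⟨G, hG, N, h⟩ := hfam.comp_mem hF
  refine ⟨G, hG, N, fun g hg => ?_⟩
  rw [← h ⟨g, hg⟩]
  congr 2
  obtain ⟨s, t, p, b, y', y, hy, rfl⟩ := exists_chartCell hg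
  have hb0 : cellZ 1 (chartCell s t p b y' y hy) * cellX 0 (chartCell s t p b y' y hy) ^ 2 = b := by
    rw [cellZ_one_chart, cellX_zero_chart, div_mul_cancel₀ _ (pow_ne_zero 2 p.ne_zero)]
  have e1 : Units.mk0 _ hg = p := Units.ext (cellX_zero_chart hy)
  have e2 : Units.mk0 (cellZ 1 (chartCell s t p b y' y hy) *
    cellX 0 (chartCell s t p b y' y hy) ^ 2) (hb ⟨_, hg⟩) = b := Units.ext hb0
  have hp := p.ne_zero
  have hbn := b.ne_zero
  simp only [↓e1, ↓e2, ↓hb0]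
  simp only [cellX_zero_chart, cellX_one_chart, cellX'_zero_chart, cellZ_zero_chart,
    cellZbar_zero_chart, mul_div_cancel_left₀ _ hp, mul_right_comm (b : k) _ (b : k)⁻¹,
    mul_inv_cancel₀ hbn, one_mul]
  rfl

/-- Polynomial functions restrict to elements of `cellAlg`: they do so up to powers of `cellX 0` on one
chart and of `cellX' 0` on the other, and these two functions generate the unit ideal. -/
theorem polynomialFunctions_restrict_mem {F : Grp k affineA1 → k}
    (hF : F ∈ polynomialFunctions k affineA1) :
    (fun g : coxeterCell k affineA1 => F g) ∈ cellAlg k := by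
  have hπ : ∀ i j : Fin 2, affineA1 (Fin.revPerm i) (Fin.revPerm j) = affineA1 i j := fun i j => by
    fin_cases i <;> fin_cases j <;> rfl
  obtain ⟨G, hG, N, h⟩ := exists_mul_cellX_pow hF
  obtain ⟨G', hG', N', h'⟩ := exists_mul_cellX_pow (comp_twist_mem_polynomialFunctions hπ hF)
  set F' : coxeterCell k affineA1 → k := fun g => F g with hF'
  have h1 : F' * cellX 0 ^ (N + 1) ∈ cellAlg k := by
    convert mul_mem hG (cellX_mem 0) using 1
    funext g
    rcases eq_or_ne (cellX 0 g) 0 with h0 | h0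
    · simp [h0]
    · simp only [Pi.mul_apply, Pi.pow_apply, ← h g h0, hF']
      ring
  have h2 : F' * cellX' 0 ^ (N' + 1) ∈ cellAlg k := by
    convert mul_mem (comp_cellTwist_mem hG') (cellX'_mem 0) using 1
    funext g
    rcases eq_or_ne (cellX' 0 g) 0 with h0 | h0
    · simp [h0]
    · have h3 := h' (cellTwist g) h0
      rw [show twist Fin.revPerm hπ (cellTwist g : Grp k affineA1) = g from
        swapTwist_swapTwist _] at h3
      simp only [Pi.mul_apply, Pi.pow_apply, ← h3, hF', cellX_twist]
      ring
  -- the functions `Δ_{ω_0}` and its twist generate the unit ideal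
  have hcop : IsCoprime (⟨cellX 0, cellX_mem 0⟩ : cellAlg k) ⟨cellX' 0, cellX'_mem 0⟩ := by
    refine ⟨⟨-(cellX 0 * (cellZ 1 * cellZbar 1)), neg_mem (mul_mem (cellX_mem 0)
      (mul_mem (cellZ_mem 1) (cellZbar_mem 1)))⟩, ⟨cellX 1, cellX_mem 1⟩, Subtype.ext ?_⟩
    funext g
    change -(cellX 0 g * (cellZ 1 g * cellZbar 1 g)) * cellX 0 g + cellX 1 g * cellX' 0 g = 1
    rw [(cell_relations g).1]
    ring
  obtain ⟨⟨u, hu⟩, ⟨v, hv⟩, huv⟩ := (hcop.pow (m := N + 1) (n := N' + 1))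
  have huv' : u * cellX 0 ^ (N + 1) + v * cellX' 0 ^ (N' + 1) = 1 := congrArg Subtype.val huv
  have : F' = u * (F' * cellX 0 ^ (N + 1)) + v * (F' * cellX' 0 ^ (N' + 1)) := by
    rw [mul_left_comm, mul_left_comm v, ← mul_add, huv', mul_one]
  rw [this]
  exact add_mem (mul_mem hu h1) (mul_mem hv h2)

instance finiteType_cellAlg : Algebra.FiniteType k (cellAlg k) := by
  refine (Subalgebra.fg_iff_finiteType _).1 (Subalgebra.fg_def.2 ⟨_, ?_, rfl⟩)
  simp only [Set.finite_union, Set.finite_range, and_self]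

/-- Every character of `cellAlg` is the evaluation at a point of the cell. -/
theorem exists_eval_eq (χ : cellAlg k →ₐ[k] k) :
    ∃ g : coxeterCell k affineA1, ∀ F : cellAlg k, χ F = (F : coxeterCell k affineA1 → k) g := by
  set X : Fin 2 → cellAlg k := fun i => ⟨cellX i, cellX_mem i⟩
  set X' : Fin 2 → cellAlg k := fun i => ⟨cellX' i, cellX'_mem i⟩
  set Z : Fin 2 → cellAlg k := fun i => ⟨cellZ i, cellZ_mem i⟩
  set W : Fin 2 → cellAlg k := fun i => ⟨cellZbar i, cellZbar_mem i⟩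
  set Zi : Fin 2 → cellAlg k := fun i => ⟨(cellZ i)⁻¹, cellZ_inv_mem i⟩
  set Wi : Fin 2 → cellAlg k := fun i => ⟨(cellZbar i)⁻¹, cellZbar_inv_mem i⟩
  have hZ : ∀ i, χ (Zi i) * χ (Z i) = 1 := fun i => by
    rw [← map_mul, ← map_one χ]
    exact congrArg χ (Subtype.ext (funext fun g => inv_mul_cancel₀ (cellZ_ne_zero i g)))
  have hW : ∀ i, χ (Wi i) * χ (W i) = 1 := fun i => by
    rw [← map_mul, ← map_one χ]
    exact congrArg χ (Subtype.ext (funext fun g => inv_mul_cancel₀ (cellZbar_ne_zero i g)))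
  obtain ⟨g, hg⟩ := exists_cell (X := fun i => χ (X i)) (X' := fun i => χ (X' i))
    (Z := fun i => χ (Z i)) (W := fun i => χ (W i)) (fun i => right_ne_zero_of_mul_eq_one (hZ i))
    (fun i => right_ne_zero_of_mul_eq_one (hW i))
    (by
      simp only [← map_mul, ← map_pow, ← map_one χ, ← map_add]
      exact congrArg χ (Subtype.ext (funext fun g => (cell_relations g).1)))
    (by
      simp only [← map_mul, ← map_pow, ← map_one χ, ← map_add]
      exact congrArg χ (Subtype.ext (funext fun g => (cell_relations g).2)))
  refine ⟨g, ?_⟩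
  set R : Subalgebra k (coxeterCell k affineA1 → k) :=
    (AlgHom.equalizer χ ((Pi.evalAlgHom k _ g).comp (cellAlg k).val)).map (cellAlg k).val
  have hR : ∀ F : cellAlg k, χ F = (F : coxeterCell k affineA1 → k) g → F.1 ∈ R := fun F hF =>
    ⟨F, hF, rfl⟩
  have hle : cellAlg k ≤ R := by
    refine cellAlg_le (fun i => hR (X i) (hg i).1.symm) (fun i => hR (X' i) (hg i).2.1.symm)
      (fun i => hR (Z i) (hg i).2.2.1.symm) (fun i => hR (W i) (hg i).2.2.2.symm)
      (fun i => hR (Zi i) ?_) (fun i => hR (Wi i) ?_)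
    · rw [eq_inv_of_mul_eq_one_left (hZ i), ← (hg i).2.2.1]; rfl
    · rw [eq_inv_of_mul_eq_one_left (hW i), ← (hg i).2.2.2]; rfl
  intro F
  obtain ⟨F', h1, h2⟩ := hle F.2
  rw [← Subtype.ext h2]
  exact h1

/-- The regular functions on the cell: the ideal of possible denominators of a regular function has
no zero on the cell, so that it contains `1` by the Nullstellensatz. -/
theorem coordinateRing_eq_cellAlg [IsAlgClosed k] :
    coordinateRing k affineA1 (coxeterCell k affineA1) = cellAlg k := by
  refine le_antisymm (fun F hF => ?_) cellAlg_le_coordinateRing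
  let I : Ideal (cellAlg k) :=
    { carrier := {q | (q : coxeterCell k affineA1 → k) * F ∈ cellAlg k}
      zero_mem' := by simp
      add_mem' := fun {q q'} (h : q.1 * F ∈ cellAlg k) (h' : q'.1 * F ∈ cellAlg k) => by
        have := add_mem h h'
        rwa [← add_mul] at this
      smul_mem' := fun c q (h : q.1 * F ∈ cellAlg k) => by
        have := mul_mem c.2 h
        rwa [← mul_assoc] at this }
  have hI : ∀ q : cellAlg k, q ∈ I ↔ (q : coxeterCell k affineA1 → k) * F ∈ cellAlg k :=
    fun q => Iff.rfl
  by_cases htop : I = ⊤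
  · have := (hI 1).1 (htop ▸ Submodule.mem_top)
    simpa using this
  exfalso
  obtain ⟨χ, hχ⟩ := exists_algHom_of_ne_top (k := k) htop
  obtain ⟨g, hg⟩ := exists_eval_eq χ
  obtain ⟨P, hP, Q, hQ, hQg, H⟩ := hF g
  have hQm := polynomialFunctions_restrict_mem hQ
  have hPm := polynomialFunctions_restrict_mem hP
  -- the denominator `Q` is squared since `F = P / Q` is known only where `Q ≠ 0`
  have hmem : (⟨_, mul_mem hQm hQm⟩ : cellAlg k) ∈ I := by
    rw [hI]
    convert mul_mem hQm hPm using 1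
    funext g
    change Q g * Q g * F g = Q g * P g
    rcases eq_or_ne (Q g) 0 with h0 | h0
    · rw [h0, zero_mul, zero_mul, zero_mul]
    · rw [H g h0]
      field_simp
  have h1 := hχ _ hmem
  rw [hg] at h1
  exact mul_ne_zero hQg hQg h1

end Nullstellensatz

/-! ### Mutation and lower bounds in rank two -/

section Mutation
variable {K ι φ : Type*} [Field K] [Fintype ι] [Fintype φ] [DecidableEq ι] [DecidableEq φ]
  {s : Seed K ι φ}

theorem Seed.mutate_var_ne {l : ι} {i : ι ⊕ φ} (h : i ≠ .inl l) :
    (s.mutate l).var i = s.var i := Function.update_of_ne h _ _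

theorem Seed.mutate_var_inl (l : ι) : (s.mutate l).var (.inl l)
    = (∏ i, s.var i ^ (s.mat i l).toNat + ∏ i, s.var i ^ (-s.mat i l).toNat) / s.var (.inl l) :=
  Function.update_self ..

end Mutation

section RankTwoSeeds
variable {k K φ : Type*} [Field k] [Field K] [Algebra k K] [Fintype φ] [DecidableEq φ]

/-- The monomial in the frozen variables in which the exponents are the positive parts of the
entries of column `l`. -/
def Seed.posMonomial (s : Seed K (Fin 2) φ) (l : Fin 2) : K :=
  ∏ j, s.var (.inr j) ^ (s.mat (.inr j) l).toNat

/-- The monomial in the frozen variables in which the exponents are the negative parts of the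
entries of column `l`. -/
def Seed.negMonomial (s : Seed K (Fin 2) φ) (l : Fin 2) : K :=
  ∏ j, s.var (.inr j) ^ (-s.mat (.inr j) l).toNat

/-- The mutable part of the exchange matrix is that of the Kronecker quiver; `ε = ± 2` is the entry
in row `1` and column `0`. -/
def Seed.IsKronecker (s : Seed K (Fin 2) φ) : Prop :=
  ∀ l, s.mat (.inl l) l = 0 ∧ (s.mat (.inl l.rev) l = 2 ∧ s.mat (.inl l) l.rev = -2 ∨
    s.mat (.inl l.rev) l = -2 ∧ s.mat (.inl l) l.rev = 2)

variable {s : Seed K (Fin 2) φ}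

theorem prod_fin_two_rev {M : Type*} [CommMonoid M] (f : Fin 2 → M) (l : Fin 2) :
    ∏ i, f i = f l * f l.rev := by
  rcases eq_or_eq_rev 0 l with rfl | rfl
  · exact Fin.prod_univ_two f
  · rw [Fin.rev_rev, mul_comm]; exact Fin.prod_univ_two f

theorem Seed.mutate_var_self (l : Fin 2) (h : s.mat (.inl l) l = 0) :
    (s.mutate l).var (.inl l) = (s.var (.inl l.rev) ^ (s.mat (.inl l.rev) l).toNat * s.posMonomial l +
      s.var (.inl l.rev) ^ (-s.mat (.inl l.rev) l).toNat * s.negMonomial l) / s.var (.inl l) := by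
  rw [Seed.mutate_var_inl, Fintype.prod_sum_type, Fintype.prod_sum_type,
    prod_fin_two_rev _ l, prod_fin_two_rev _ l, h]
  simp [Seed.posMonomial, Seed.negMonomial]

theorem Seed.IsKronecker.mutate (h : s.IsKronecker) (l : Fin 2) : (s.mutate l).IsKronecker := by
  have hl := h l
  have hr := h l.rev
  rw [Fin.rev_rev] at hr
  have hne : l.rev ≠ l := (ne_rev l).symm
  have h1 : (s.mutate l).mat (.inl l) l = -s.mat (.inl l) l := by simp [Seed.mutate]
  have h2 : (s.mutate l).mat (.inl l.rev) l = -s.mat (.inl l.rev) l := by simp [Seed.mutate]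
  have h3 : (s.mutate l).mat (.inl l) l.rev = -s.mat (.inl l) l.rev := by simp [Seed.mutate]
  have h4 : (s.mutate l).mat (.inl l.rev) l.rev = 0 := by
    simp only [Seed.mutate, Matrix.of_apply, Sum.inl.injEq, hne, or_self, if_false, hr.1]
    rcases hl.2 with h | h <;> rw [h.1, h.2] <;> simp
  have key : (s.mutate l).mat (.inl l) l = 0 ∧
      ((s.mutate l).mat (.inl l.rev) l = 2 ∧ (s.mutate l).mat (.inl l) l.rev = -2 ∨
        (s.mutate l).mat (.inl l.rev) l = -2 ∧ (s.mutate l).mat (.inl l) l.rev = 2) := by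
    rw [h1, h2, h3, hl.1]
    omega
  intro i
  rcases eq_or_eq_rev l i with rfl | rfl
  · exact key
  · rw [Fin.rev_rev]
    exact ⟨h4, by have := key.2; tauto⟩

variable (k) in
/-- The algebra generated by the cluster of a seed, the clusters of the adjacent seeds, the frozen
variables and their inverses. -/
def Seed.lowerBound (s : Seed K (Fin 2) φ) : Subalgebra k K :=
  Algebra.adjoin k (Set.range (fun i => s.var (.inl i)) ∪
    Set.range (fun i => (s.mutate i).var (.inl i)) ∪ Set.range (fun j => s.var (.inr j)) ∪
    Set.range (fun j => (s.var (.inr j))⁻¹))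

theorem Seed.var_mem_lowerBound (i : Fin 2) : s.var (.inl i) ∈ s.lowerBound k :=
  Algebra.subset_adjoin (by simp)

theorem Seed.mutate_var_mem_lowerBound (i : Fin 2) :
    (s.mutate i).var (.inl i) ∈ s.lowerBound k :=
  Algebra.subset_adjoin (by simp)

theorem Seed.frozen_mem_lowerBound (j : φ) : s.var (.inr j) ∈ s.lowerBound k :=
  Algebra.subset_adjoin (by simp)

theorem Seed.frozen_inv_mem_lowerBound (j : φ) : (s.var (.inr j))⁻¹ ∈ s.lowerBound k :=
  Algebra.subset_adjoin (by simp)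

theorem Seed.lowerBound_le {R : Subalgebra k K} (h1 : ∀ i, s.var (.inl i) ∈ R)
    (h2 : ∀ i, (s.mutate i).var (.inl i) ∈ R) (h3 : ∀ j, s.var (.inr j) ∈ R)
    (h4 : ∀ j, (s.var (.inr j))⁻¹ ∈ R) : s.lowerBound k ≤ R := by
  refine Algebra.adjoin_le ?_
  rintro y (((⟨i, rfl⟩ | ⟨i, rfl⟩) | ⟨i, rfl⟩) | ⟨i, rfl⟩)
  exacts [h1 i, h2 i, h3 i, h4 i]

theorem Seed.monomial_mem_lowerBound (f : φ → ℕ) :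
    ∏ j, s.var (.inr j) ^ f j ∈ s.lowerBound k ∧ (∏ j, s.var (.inr j) ^ f j)⁻¹ ∈ s.lowerBound k :=
  ⟨prod_mem fun j _ => pow_mem (frozen_mem_lowerBound j) _, by
    rw [← Finset.prod_inv_distrib]
    exact prod_mem fun j _ => by
      rw [← inv_pow]; exact pow_mem (frozen_inv_mem_lowerBound j) _⟩

/-- The computation behind the Laurent phenomenon in rank two: `w` is obtained from a seed with
cluster `u`, `v` and adjacent cluster variables `u'`, `v'` by the mutation in direction `u` followed
by the mutation in direction `v`. -/
theorem mem_of_exchange {R : Subalgebra k K} {u v u' v' w a b c d a' b' : K}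
    (hv : v ∈ R) (hu' : u' ∈ R) (hv' : v' ∈ R) (ha : a ∈ R) (hb : b ∈ R) (hc : c ∈ R)
    (ha' : a' ∈ R) (hd : d⁻¹ ∈ R) (hv0 : v ≠ 0) (hd0 : d ≠ 0) (ha0 : a' ≠ 0)
    (h1 : u * u' = a * v ^ 2 + b) (h2 : v * v' = c * u ^ 2 + d) (h3 : v * w = a' * u' ^ 2 + b')
    (h4 : a' * c * b ^ 2 = b' * d) : w ∈ R := by
  have h5 : w = a' * d⁻¹ * (v' * u' ^ 2 - c * (a ^ 2 * v ^ 3 + 2 * (a * b * v))) := by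
    refine mul_left_cancel₀ (mul_ne_zero hv0 hd0) ?_
    have h6 : v * (v' * u' ^ 2 - c * (a ^ 2 * v ^ 3 + 2 * (a * b * v))) = d * u' ^ 2 + c * b ^ 2 := by
      have : (u * u') ^ 2 = (a * v ^ 2 + b) ^ 2 := by rw [h1]
      linear_combination u' ^ 2 * h2 + c * this
    have h7 : v * d * (a' * d⁻¹ * (v' * u' ^ 2 - c * (a ^ 2 * v ^ 3 + 2 * (a * b * v))))
        = a' * (v * (v' * u' ^ 2 - c * (a ^ 2 * v ^ 3 + 2 * (a * b * v)))) := by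
      field_simp
    rw [h7, h6]
    linear_combination d * h3 - h4
  have h2R : (2 : K) ∈ R := by
    have := add_mem (one_mem R) (one_mem R)
    rwa [one_add_one_eq_two] at this
  rw [h5]
  exact mul_mem (mul_mem ha' hd) (sub_mem (mul_mem hv' (pow_mem hu' 2)) (mul_mem hc
    (add_mem (mul_mem (pow_mem ha 2) (pow_mem hv 3)) (mul_mem h2R (mul_mem (mul_mem ha hb) hv)))))

/-- Mutation does not enlarge the lower bound. -/
theorem Seed.lowerBound_mutate_le (h : s.IsKronecker) (h0 : ∀ i, s.var i ≠ 0) (l : Fin 2) :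
    (s.mutate l).lowerBound k ≤ s.lowerBound k := by
  have hne : l.rev ≠ l := (ne_rev l).symm
  have hfr : ∀ j, (s.mutate l).var (.inr j) = s.var (.inr j) := fun j =>
    Seed.mutate_var_ne (by simp)
  have hrev : (s.mutate l).var (.inl l.rev) = s.var (.inl l.rev) :=
    Seed.mutate_var_ne (by simpa using hne)
  have h' := h.mutate l
  have hE := (h l).2
  have hE1 := (h l).1
  have hE2 := (h l.rev).1
  have hE1' := (h' l).1
  have hE2' := (h' l.rev).1
  have hmat1 : (s.mutate l).mat (.inl l) l.rev = -s.mat (.inl l) l.rev := by simp [Seed.mutate]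
  have hmat2 : (s.mutate l).mat (.inl l.rev) l = -s.mat (.inl l.rev) l := by simp [Seed.mutate]
  have hcol : ∀ j, (s.mutate l).mat (.inr j) l = -s.mat (.inr j) l := fun j => by
    simp [Seed.mutate]
  have hcol' : ∀ j, (s.mutate l).mat (.inr j) l.rev = s.mat (.inr j) l.rev
      + max (s.mat (.inr j) l) 0 * max (s.mat (.inl l) l.rev) 0
      - max (-s.mat (.inr j) l) 0 * max (-s.mat (.inl l) l.rev) 0 := fun j => by
    simp [Seed.mutate, hne]
  -- the coefficients in all exchange relations are units of the lower bound
  have hmon : ∀ t : Seed K (Fin 2) φ, (∀ j, t.var (.inr j) = s.var (.inr j)) → ∀ i,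
      (t.posMonomial i ∈ s.lowerBound k ∧ (t.posMonomial i)⁻¹ ∈ s.lowerBound k ∧
        t.posMonomial i ≠ 0) ∧ (t.negMonomial i ∈ s.lowerBound k ∧
        (t.negMonomial i)⁻¹ ∈ s.lowerBound k ∧ t.negMonomial i ≠ 0) := fun t ht i => by
    have h1 : ∀ f : φ → ℕ, ∏ j, s.var (.inr j) ^ f j ≠ 0 := fun f =>
      Finset.prod_ne_zero_iff.2 fun j _ => pow_ne_zero _ (h0 _)
    simp only [Seed.posMonomial, Seed.negMonomial, ht]
    exact ⟨⟨(monomial_mem_lowerBound _).1, (monomial_mem_lowerBound _).2, h1 _⟩,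
      ⟨(monomial_mem_lowerBound _).1, (monomial_mem_lowerBound _).2, h1 _⟩⟩
  have hl0 := h0 (.inl l)
  have hr0 := h0 (.inl l.rev)
  have e1 : s.var (.inl l) * (s.mutate l).var (.inl l) = _ :=
    (congrArg _ (Seed.mutate_var_self l hE1)).trans (mul_div_cancel₀ _ hl0)
  have e2 : s.var (.inl l.rev) * (s.mutate l.rev).var (.inl l.rev) = _ :=
    (congrArg _ (Seed.mutate_var_self l.rev hE2)).trans (mul_div_cancel₀ _ hr0)
  have e3 : s.var (.inl l.rev) * ((s.mutate l).mutate l.rev).var (.inl l.rev) = _ :=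
    congrArg _ (Seed.mutate_var_self l.rev hE2')
  have hm0 := hmon s (fun _ => rfl)
  have hm1 := hmon _ hfr
  rw [Fin.rev_rev, hrev, mul_div_cancel₀ _ hr0] at e3
  rw [Fin.rev_rev] at e2
  refine Seed.lowerBound_le (fun i => ?_) (fun i => ?_) (fun j => ?_) (fun j => ?_)
  · rcases eq_or_eq_rev l i with rfl | rfl
    · exact mutate_var_mem_lowerBound _
    · rw [hrev]; exact var_mem_lowerBound _
  · rcases eq_or_eq_rev l i with hi | rfl
    · subst i
      -- mutating twice in the same direction
      rw [Seed.mutate_var_self l hE1', hrev]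
      have hp : (s.mutate l).posMonomial l = s.negMonomial l := by
        simp only [Seed.posMonomial, Seed.negMonomial, hcol, hfr]
      have hq : (s.mutate l).negMonomial l = s.posMonomial l := by
        simp only [Seed.posMonomial, Seed.negMonomial, hcol, hfr, neg_neg]
      rw [hp, hq, hmat2, neg_neg, add_comm, ← e1]
      rcases eq_or_ne ((s.mutate l).var (.inl l)) 0 with hz | hz
      · rw [hz, div_zero]; exact zero_mem _
      · rw [mul_div_cancel_right₀ _ hz]; exact var_mem_lowerBound _
    · rcases hE with hE | hE
      · rw [hE.1] at e1
        rw [hE.2] at e2 hmat1 hcol'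
        rw [hmat1] at e3
        refine mem_of_exchange (a := s.posMonomial l) (b := s.negMonomial l)
          (c := s.negMonomial l.rev) (d := s.posMonomial l.rev)
          (a' := (s.mutate l).posMonomial l.rev) (b' := (s.mutate l).negMonomial l.rev)
          (var_mem_lowerBound l.rev) (mutate_var_mem_lowerBound l)
          (mutate_var_mem_lowerBound l.rev) (hm0 _).1.1 (hm0 _).2.1 (hm0 _).2.1 (hm1 _).1.1
          (hm0 _).1.2.1 hr0 (hm0 _).1.2.2 (hm1 _).1.2.2 (e1.trans ?_) (e2.trans ?_) (e3.trans ?_) ?_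
        · simp; ring
        · simp; ring
        · simp; ring
        -- the coefficient condition of `mem_of_exchange` is the mutation rule for the frozen rows
        · simp only [Seed.posMonomial, Seed.negMonomial, hcol', hfr, ← Finset.prod_pow, ← pow_mul,
            ← Finset.prod_mul_distrib, ← pow_add]
          refine Finset.prod_congr rfl fun j _ => congrArg _ ?_
          norm_num
          omega
      · rw [hE.1] at e1
        rw [hE.2] at e2 hmat1 hcol'
        rw [hmat1] at e3
        refine mem_of_exchange (a := s.negMonomial l) (b := s.posMonomial l)
          (c := s.posMonomial l.rev) (d := s.negMonomial l.rev)
          (a' := (s.mutate l).negMonomial l.rev) (b' := (s.mutate l).posMonomial l.rev)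
          (var_mem_lowerBound l.rev) (mutate_var_mem_lowerBound l)
          (mutate_var_mem_lowerBound l.rev) (hm0 _).2.1 (hm0 _).1.1 (hm0 _).1.1 (hm1 _).2.1
          (hm0 _).2.2.1 hr0 (hm0 _).2.2.2 (hm1 _).2.2.2 (e1.trans ?_) (e2.trans ?_) (e3.trans ?_) ?_
        · simp; ring
        · simp; ring
        · simp; ring
        · simp only [Seed.posMonomial, Seed.negMonomial, hcol', hfr, ← Finset.prod_pow, ← pow_mul,
            ← Finset.prod_mul_distrib, ← pow_add]
          refine Finset.prod_congr rfl fun j _ => congrArg _ ?_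
          norm_num
          omega
  · rw [hfr]; exact frozen_mem_lowerBound j
  · rw [hfr]; exact frozen_inv_mem_lowerBound j

end RankTwoSeeds

/-! ### Cluster variables do not vanish -/

section Positivity
variable {k σ : Type*} [Field k] [CharZero k]

variable (k σ) in
/-- The rational functions which are quotients of nonzero polynomials with natural coefficients. -/
def subtractionFree : Set (FractionRing (MvPolynomial σ k)) :=
  {y | ∃ p q : MvPolynomial σ ℕ, p ≠ 0 ∧ q ≠ 0 ∧
    y * algebraMap _ _ (MvPolynomial.map (Nat.castRingHom k) q)
      = algebraMap _ _ (MvPolynomial.map (Nat.castRingHom k) p)}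

theorem map_natCast_ne_zero {p : MvPolynomial σ ℕ} (hp : p ≠ 0) :
    algebraMap (MvPolynomial σ k) (FractionRing (MvPolynomial σ k))
      (MvPolynomial.map (Nat.castRingHom k) p) ≠ 0 := fun h => hp (by
  have h1 := (IsFractionRing.injective (MvPolynomial σ k) (FractionRing (MvPolynomial σ k)))
    (h.trans (map_zero _).symm)
  exact MvPolynomial.map_injective (Nat.castRingHom k) Nat.cast_injective
    (h1.trans (map_zero _).symm))

theorem natPolynomial_mul_ne_zero {p q : MvPolynomial σ ℕ} (hp : p ≠ 0) (hq : q ≠ 0) :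
    p * q ≠ 0 := fun h => by
  have := mul_ne_zero (map_natCast_ne_zero (k := ℚ) hp) (map_natCast_ne_zero (k := ℚ) hq)
  rw [← map_mul, ← map_mul, h, map_zero, map_zero] at this
  exact this rfl

theorem natPolynomial_add_ne_zero {p q : MvPolynomial σ ℕ} (hp : p ≠ 0) : p + q ≠ 0 := fun h =>
  hp (MvPolynomial.ext _ _ fun m => by
    have := congrArg (MvPolynomial.coeff m) h
    rw [MvPolynomial.coeff_add, MvPolynomial.coeff_zero] at this
    rw [MvPolynomial.coeff_zero]
    omega)

theorem ne_zero_of_subtractionFree {y} (hy : y ∈ subtractionFree k σ) : y ≠ 0 := by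
  rintro rfl
  obtain ⟨p, q, hp, hq, h⟩ := hy
  rw [zero_mul] at h
  exact map_natCast_ne_zero hp h.symm

theorem one_subtractionFree : 1 ∈ subtractionFree k σ :=
  ⟨1, 1, one_ne_zero, one_ne_zero, by rw [one_mul]⟩

theorem X_subtractionFree (i : σ) :
    algebraMap _ _ (MvPolynomial.X i : MvPolynomial σ k) ∈ subtractionFree k σ :=
  ⟨MvPolynomial.X i, 1, MvPolynomial.X_ne_zero i, one_ne_zero, by simp⟩

theorem mul_subtractionFree {y z} (hy : y ∈ subtractionFree k σ) (hz : z ∈ subtractionFree k σ) :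
    y * z ∈ subtractionFree k σ := by
  obtain ⟨p, q, hp, hq, h⟩ := hy
  obtain ⟨p', q', hp', hq', h'⟩ := hz
  refine ⟨p * p', q * q', natPolynomial_mul_ne_zero hp hp', natPolynomial_mul_ne_zero hq hq', ?_⟩
  rw [map_mul, map_mul, map_mul, map_mul, ← h, ← h']
  ring

theorem add_subtractionFree {y z} (hy : y ∈ subtractionFree k σ) (hz : z ∈ subtractionFree k σ) :
    y + z ∈ subtractionFree k σ := by
  obtain ⟨p, q, hp, hq, h⟩ := hy
  obtain ⟨p', q', hp', hq', h'⟩ := hz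
  refine ⟨p * q' + p' * q, q * q',
    natPolynomial_add_ne_zero (natPolynomial_mul_ne_zero hp hq'), natPolynomial_mul_ne_zero hq hq', ?_⟩
  simp only [map_mul, map_add, ← h, ← h']
  ring

theorem div_subtractionFree {y z} (hy : y ∈ subtractionFree k σ) (hz : z ∈ subtractionFree k σ) :
    y / z ∈ subtractionFree k σ := by
  have hz0 := ne_zero_of_subtractionFree hz
  obtain ⟨p, q, hp, hq, h⟩ := hy
  obtain ⟨p', q', hp', hq', h'⟩ := hz
  refine ⟨p * q', q * p', natPolynomial_mul_ne_zero hp hq', natPolynomial_mul_ne_zero hq hp', ?_⟩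
  simp only [map_mul, ← h, ← h']
  field_simp

theorem prod_pow_subtractionFree {ι : Type*} [Fintype ι] {f : ι → FractionRing (MvPolynomial σ k)}
    (hf : ∀ i, f i ∈ subtractionFree k σ) (m : ι → ℕ) :
    ∏ i, f i ^ m i ∈ subtractionFree k σ := by
  refine Finset.prod_induction _ (· ∈ subtractionFree k σ) (fun _ _ => mul_subtractionFree)
    one_subtractionFree fun i _ => ?_
  induction m i with
  | zero => rw [pow_zero]; exact one_subtractionFree
  | succ n ih => rw [pow_succ]; exact mul_subtractionFree ih (hf i)

theorem Seed.mutate_subtractionFree {ι φ : Type*} [Fintype ι] [Fintype φ] [DecidableEq ι]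
    [DecidableEq φ] {s : Seed (FractionRing (MvPolynomial σ k)) ι φ}
    (hs : ∀ i, s.var i ∈ subtractionFree k σ) (l : ι) (i : ι ⊕ φ) :
    (s.mutate l).var i ∈ subtractionFree k σ := by
  rcases eq_or_ne i (.inl l) with rfl | h
  · rw [Seed.mutate_var_inl]
    exact div_subtractionFree (add_subtractionFree (prod_pow_subtractionFree hs _)
      (prod_pow_subtractionFree hs _)) (hs _)
  · rw [Seed.mutate_var_ne h]
    exact hs i

end Positivity

/-! ### Generators of the cluster algebra -/

section ClusterAlgebra
variable {k : Type*} [Field k]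

local notation "dpSeed" => initialSeed k (dpMatrix affineA1)

variable (k) in
/-- The initial cluster variable `x_{ω_i}` as a rational function. -/
def dpX (i : Fin 2) : DPField k 2 := (dpSeed).var (.inl i)

variable (k) in
/-- The frozen variable `z_i` as a rational function. -/
def dpZ (i : Fin 2) : DPField k 2 := (dpSeed).var (.inr (.inl i))

variable (k) in
/-- The frozen variable `z_{\bar i}` as a rational function. -/
def dpZbar (i : Fin 2) : DPField k 2 := (dpSeed).var (.inr (.inr i))

variable (k) in
/-- Two further cluster variables: the one obtained from the initial seed by mutation at the second
node, and the one obtained from the resulting seed by mutation at the first node. -/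
def dpX' : Fin 2 → DPField k 2 :=
  ![(dpX k 0 ^ 2 * (dpZ k 1 * dpZbar k 1) + 1) / dpX k 1,
    (((dpX k 0 ^ 2 * (dpZ k 1 * dpZbar k 1) + 1) / dpX k 1) ^ 2 * (dpZ k 0 * dpZbar k 0) + 1) /
      dpX k 0]

theorem var_initialSeed_ne_zero (i : Fin 2 ⊕ (Fin 2 ⊕ Fin 2)) :
    (dpSeed).var i ≠ 0 := fun h =>
  MvPolynomial.X_ne_zero (R := k) i (IsFractionRing.injective _ (DPField k 2)
    (h.trans (map_zero _).symm))

theorem dpX_ne_zero (i : Fin 2) : dpX k i ≠ 0 := var_initialSeed_ne_zero _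

theorem dpZ_ne_zero (i : Fin 2) : dpZ k i ≠ 0 := var_initialSeed_ne_zero _

theorem dpZbar_ne_zero (i : Fin 2) : dpZbar k i ≠ 0 := var_initialSeed_ne_zero _

theorem dpX_mul_dpX'_zero :
    dpX k 1 * dpX' k 0 = dpX k 0 ^ 2 * (dpZ k 1 * dpZbar k 1) + 1 :=
  mul_div_cancel₀ _ (dpX_ne_zero 1)

theorem dpX_mul_dpX'_one :
    dpX k 0 * dpX' k 1 = dpX' k 0 ^ 2 * (dpZ k 0 * dpZbar k 0) + 1 :=
  mul_div_cancel₀ _ (dpX_ne_zero 0)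

theorem posMonomial_initialSeed (l : Fin 2) :
    (dpSeed).posMonomial l = dpZ k l * dpZbar k l := by
  have h1 : ∀ i, (dpSeed).mat (.inr (.inl i)) l
    = (1 : Matrix (Fin 2) (Fin 2) ℤ) i l := fun _ => rfl
  have h2 : ∀ i, (dpSeed).mat (.inr (.inr i)) l
    = (1 : Matrix (Fin 2) (Fin 2) ℤ) i l := fun _ => rfl
  rw [Seed.posMonomial, Fintype.prod_sum_type]
  simp only [h1, h2, Matrix.one_apply, dpZ, dpZbar]
  congr 1 <;>
  · rw [Finset.prod_eq_single l]
    · simp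
    · intro j _ hj
      simp [hj]
    · simp

theorem negMonomial_initialSeed (l : Fin 2) :
    (dpSeed).negMonomial l = 1 := by
  have h1 : ∀ i, (dpSeed).mat (.inr (.inl i)) l
    = (1 : Matrix (Fin 2) (Fin 2) ℤ) i l := fun _ => rfl
  have h2 : ∀ i, (dpSeed).mat (.inr (.inr i)) l
    = (1 : Matrix (Fin 2) (Fin 2) ℤ) i l := fun _ => rfl
  rw [Seed.negMonomial, Fintype.prod_sum_type]
  simp only [h1, h2, Matrix.one_apply]
  have : ∀ i, (-if i = l then 1 else 0 : ℤ).toNat = 0 := fun i => by split_ifs <;> simp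
  simp only [this, pow_zero, Finset.prod_const_one, mul_one]

theorem isKronecker_initialSeed : (dpSeed).IsKronecker := by
  have h : ∀ i j, (dpSeed).mat (.inl i) j = coxeterMatrix affineA1 i j :=
    fun _ _ => rfl
  intro l
  rw [h, h, h]
  fin_cases l <;> simp [coxeterMatrix, affineA1]

theorem mutate_initialSeed_one :
    ((dpSeed).mutate 1).var (.inl 1) = dpX' k 0 := by
  rw [Seed.mutate_var_self 1 (isKronecker_initialSeed 1).1, posMonomial_initialSeed,
    negMonomial_initialSeed, show Fin.rev (1 : Fin 2) = 0 from rfl,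
    show (dpSeed).mat (.inl 0) 1 = 2 from rfl]
  simp [dpX', dpX]

theorem mutate_initialSeed_zero :
    ((dpSeed).mutate 0).var (.inl 0)
      = (dpZ k 0 * dpZbar k 0 + dpX k 1 ^ 2) / dpX k 0 := by
  rw [Seed.mutate_var_self 0 (isKronecker_initialSeed 0).1, posMonomial_initialSeed,
    negMonomial_initialSeed, show Fin.rev (0 : Fin 2) = 1 from rfl,
    show (dpSeed).mat (.inl 1) 0 = -2 from rfl]
  simp [dpX]

/-- The cluster algebra equals its lower bound at the initial seed. -/
theorem clusterDP_eq_lowerBound [CharZero k] :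
    clusterDP k affineA1 = (dpSeed).lowerBound k := by
  have key : ∀ s, Seed.Reachable (dpSeed) s →
      s.IsKronecker ∧ (∀ i, s.var i ∈ subtractionFree k _) ∧
        s.lowerBound k ≤ (dpSeed).lowerBound k := by
    intro s hs
    induction hs with
    | refl => exact ⟨isKronecker_initialSeed, fun i => X_subtractionFree i, le_rfl⟩
    | mutate l _ ih =>
      exact ⟨ih.1.mutate l, Seed.mutate_subtractionFree ih.2.1 l, (Seed.lowerBound_mutate_le ih.1
        (fun i => ne_zero_of_subtractionFree (ih.2.1 i)) l).trans ih.2.2⟩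
  refine le_antisymm (Algebra.adjoin_le ?_) (Seed.lowerBound_le (fun i => ?_) (fun i => ?_)
    (fun j => ?_) (fun j => ?_))
  · rintro y (⟨s, hs, i, rfl⟩ | ⟨j, rfl⟩ | ⟨j, rfl⟩)
    · exact (key s hs).2.2 (Seed.var_mem_lowerBound i)
    · exact Seed.frozen_mem_lowerBound j
    · exact Seed.frozen_inv_mem_lowerBound j
  · exact Algebra.subset_adjoin (Or.inl ⟨_, .refl, i, rfl⟩)
  · exact Algebra.subset_adjoin (Or.inl ⟨_, .mutate i .refl, i, rfl⟩)
  · exact Algebra.subset_adjoin (Or.inr (Or.inl ⟨j, rfl⟩))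
  · exact Algebra.subset_adjoin (Or.inr (Or.inr ⟨j, rfl⟩))

variable (k) in
/-- The generators of the cluster algebra which correspond to those of `cellAlg`. -/
def dpGenerators : Set (DPField k 2) :=
  Set.range (dpX k) ∪ Set.range (dpX' k) ∪ Set.range (dpZ k) ∪ Set.range (dpZbar k) ∪
    Set.range (fun i => (dpZ k i)⁻¹) ∪ Set.range (fun i => (dpZbar k i)⁻¹)

/-- The generators of the lower bound may be traded for those whose exchange relations hold on the
cell. -/
theorem clusterDP_eq_adjoin [CharZero k] :
    clusterDP k affineA1 = Algebra.adjoin k (dpGenerators k) := by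
  have hx0 := dpX_ne_zero (k := k) 0
  have hx1 := dpX_ne_zero (k := k) 1
  have r1 := dpX_mul_dpX'_zero (k := k)
  have r2 := dpX_mul_dpX'_one (k := k)
  rw [clusterDP_eq_lowerBound]
  apply le_antisymm
  · have hX : ∀ i, dpX k i ∈ Algebra.adjoin k (dpGenerators k) := fun i =>
      Algebra.subset_adjoin (by simp [dpGenerators])
    have hX' : ∀ i, dpX' k i ∈ Algebra.adjoin k (dpGenerators k) := fun i =>
      Algebra.subset_adjoin (by simp [dpGenerators])
    have hZ : ∀ i, dpZ k i ∈ Algebra.adjoin k (dpGenerators k) := fun i =>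
      Algebra.subset_adjoin (by simp [dpGenerators])
    have hW : ∀ i, dpZbar k i ∈ Algebra.adjoin k (dpGenerators k) := fun i =>
      Algebra.subset_adjoin (by simp [dpGenerators])
    refine Seed.lowerBound_le hX (Fin.forall_fin_two.2 ⟨?_, ?_⟩) (Sum.forall.2 ⟨hZ, hW⟩)
      (Sum.forall.2 ⟨fun i => Algebra.subset_adjoin ?_, fun i => Algebra.subset_adjoin ?_⟩)
    · rw [mutate_initialSeed_zero]
      have : (dpZ k 0 * dpZbar k 0 + dpX k 1 ^ 2) / dpX k 0 = dpX' k 1 * dpX k 1 ^ 2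
          - dpZ k 0 * dpZbar k 0 * (dpX k 0 ^ 3 * (dpZ k 1 * dpZbar k 1) ^ 2
            + 2 * (dpX k 0 * (dpZ k 1 * dpZbar k 1))) := by
        rw [div_eq_iff hx0]
        have r3 : (dpX k 1 * dpX' k 0) ^ 2 = (dpX k 0 ^ 2 * (dpZ k 1 * dpZbar k 1) + 1) ^ 2 := by
          rw [r1]
        linear_combination (-dpX k 1 ^ 2) * r2 - dpZ k 0 * dpZbar k 0 * r3
      have h2 : (2 : DPField k 2) ∈ Algebra.adjoin k (dpGenerators k) := ofNat_mem _ 2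
      have hZW := fun i => mul_mem (hZ i) (hW i)
      rw [this]
      exact sub_mem (mul_mem (hX' 1) (pow_mem (hX 1) 2)) (mul_mem (hZW 0)
        (add_mem (mul_mem (pow_mem (hX 0) 3) (pow_mem (hZW 1) 2))
          (mul_mem h2 (mul_mem (hX 0) (hZW 1)))))
    · rw [mutate_initialSeed_one]; exact hX' 0
    · exact Or.inl (Or.inr ⟨i, rfl⟩)
    · exact Or.inr ⟨i, rfl⟩
  · have hX (i : Fin 2) : dpX k i ∈ (dpSeed).lowerBound k :=
      Seed.var_mem_lowerBound (s := dpSeed) i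
    have hZ (i : Fin 2) : dpZ k i ∈ (dpSeed).lowerBound k :=
      Seed.frozen_mem_lowerBound (s := dpSeed) (.inl i)
    have hW (i : Fin 2) : dpZbar k i ∈ (dpSeed).lowerBound k :=
      Seed.frozen_mem_lowerBound (s := dpSeed) (.inr i)
    have hZ' (i : Fin 2) : (dpZ k i)⁻¹ ∈ (dpSeed).lowerBound k :=
      Seed.frozen_inv_mem_lowerBound (s := dpSeed) (.inl i)
    have hW' (i : Fin 2) : (dpZbar k i)⁻¹ ∈ (dpSeed).lowerBound k :=
      Seed.frozen_inv_mem_lowerBound (s := dpSeed) (.inr i)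
    have hX0 : dpX' k 0 ∈ (dpSeed).lowerBound k := by
      rw [← mutate_initialSeed_one]; exact Seed.mutate_var_mem_lowerBound 1
    have hm : (dpZ k 0 * dpZbar k 0 + dpX k 1 ^ 2) / dpX k 0
        ∈ (dpSeed).lowerBound k := by
      rw [← mutate_initialSeed_zero]; exact Seed.mutate_var_mem_lowerBound 0
    generalize (dpSeed).lowerBound k = R at *
    have h2 : (2 : DPField k 2) ∈ R := ofNat_mem R 2
    have hZW := fun i => mul_mem (hZ i) (hW i)
    have hX1 : dpX' k 1 ∈ R := by
      have : dpX' k 1 = (dpZ k 0 * dpZbar k 0 + dpX k 1 ^ 2) / dpX k 0 * dpX' k 0 ^ 2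
          - (dpX k 0 ^ 3 * (dpZ k 1 * dpZbar k 1) ^ 2
            + 2 * (dpX k 0 * (dpZ k 1 * dpZbar k 1))) := by
        refine mul_left_cancel₀ hx0 ?_
        have h3 : dpX k 0 * ((dpZ k 0 * dpZbar k 0 + dpX k 1 ^ 2) / dpX k 0)
          = dpZ k 0 * dpZbar k 0 + dpX k 1 ^ 2 := mul_div_cancel₀ _ hx0
        have r3 : (dpX k 1 * dpX' k 0) ^ 2 = (dpX k 0 ^ 2 * (dpZ k 1 * dpZbar k 1) + 1) ^ 2 := by
          rw [r1]
        linear_combination r2 - dpX' k 0 ^ 2 * h3 - r3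
      rw [this]
      exact sub_mem (mul_mem hm (pow_mem hX0 2)) (add_mem (mul_mem (pow_mem (hX 0) 3)
        (pow_mem (hZW 1) 2)) (mul_mem h2 (mul_mem (hX 0) (hZW 1))))
    refine Algebra.adjoin_le ?_
    rintro y (((((⟨i, rfl⟩ | ⟨i, rfl⟩) | ⟨i, rfl⟩) | ⟨i, rfl⟩) | ⟨i, rfl⟩) | ⟨i, rfl⟩)
    · exact hX i
    · exact (Fin.forall_fin_two (p := fun i => dpX' k i ∈ R)).2 ⟨hX0, hX1⟩ i
    · exact hZ i
    · exact hW i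
    · exact hZ' i
    · exact hW' i

end ClusterAlgebra

/-! ### The isomorphism -/

section Correspondence

/-- A subalgebra of a product is the graph of an isomorphism between its images if it meets the
factors trivially. -/
theorem exists_algEquiv_of_graph {k A B : Type*} [CommRing k] [CommRing A] [CommRing B]
    [Algebra k A] [Algebra k B] {T : Subalgebra k (A × B)} {C : Subalgebra k A} {R : Subalgebra k B}
    (hC : T.map (AlgHom.fst k A B) = C) (hR : T.map (AlgHom.snd k A B) = R)
    (h0 : ∀ p ∈ T, p.1 = 0 ↔ p.2 = 0) :
    ∃ Φ : C ≃ₐ[k] R, ∀ p ∈ T, ∀ h : p.1 ∈ C, (Φ ⟨p.1, h⟩ : B) = p.2 := by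
  subst hC hR
  let π₁ : T →ₐ[k] T.map (AlgHom.fst k A B) :=
    ((AlgHom.fst k A B).comp T.val).codRestrict _ fun p => ⟨p.1, p.2, rfl⟩
  let π₂ : T →ₐ[k] T.map (AlgHom.snd k A B) :=
    ((AlgHom.snd k A B).comp T.val).codRestrict _ fun p => ⟨p.1, p.2, rfl⟩
  have h1 : Function.Bijective π₁ := by
    refine ⟨(injective_iff_map_eq_zero π₁).2 fun p hp => ?_, ?_⟩
    · have : p.1.1 = 0 := congrArg Subtype.val hp
      exact Subtype.ext (Prod.ext this ((h0 _ p.2).1 this))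
    · rintro ⟨_, p, hp, rfl⟩
      exact ⟨⟨p, hp⟩, rfl⟩
  have h2 : Function.Bijective π₂ := by
    refine ⟨(injective_iff_map_eq_zero π₂).2 fun p hp => ?_, ?_⟩
    · have : p.1.2 = 0 := congrArg Subtype.val hp
      exact Subtype.ext (Prod.ext ((h0 _ p.2).2 this) this)
    · rintro ⟨_, p, hp, rfl⟩
      exact ⟨⟨p, hp⟩, rfl⟩
  refine ⟨(AlgEquiv.ofBijective π₁ h1).symm.trans (AlgEquiv.ofBijective π₂ h2), fun p hp h => ?_⟩
  have : (AlgEquiv.ofBijective π₁ h1).symm ⟨p.1, h⟩ = ⟨p, hp⟩ :=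
    (AlgEquiv.symm_apply_eq _).2 rfl
  rw [AlgEquiv.trans_apply, this]
  rfl

variable {k : Type u} [Field k] [CharZero k]

variable (k) in
/-- The pairs of corresponding generators of the cluster algebra and of `cellAlg`. -/
def pairGenerators : Set (DPField k 2 × (coxeterCell k affineA1 → k)) :=
  Set.range (fun i => (dpX k i, cellX i)) ∪ Set.range (fun i => (dpX' k i, cellX' i)) ∪
    Set.range (fun i => (dpZ k i, cellZ i)) ∪ Set.range (fun i => (dpZbar k i, cellZbar i)) ∪
    Set.range (fun i => ((dpZ k i)⁻¹, (cellZ i)⁻¹)) ∪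
    Set.range (fun i => ((dpZbar k i)⁻¹, (cellZbar i)⁻¹))

variable (k) in
/-- The subalgebra generated by `pairGenerators`; it turns out to be the graph of an isomorphism between
the cluster algebra and `cellAlg`. -/
def pairAlg : Subalgebra k (DPField k 2 × (coxeterCell k affineA1 → k)) :=
  Algebra.adjoin k (pairGenerators k)

theorem pairAlg_map_fst :
    (pairAlg k).map (AlgHom.fst k (DPField k 2) (coxeterCell k affineA1 → k))
      = clusterDP k affineA1 := by
  rw [clusterDP_eq_adjoin, pairAlg, AlgHom.map_adjoin]
  congr 1
  simp only [pairGenerators, dpGenerators, Set.image_union, ← Set.range_comp]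
  rfl

theorem pairAlg_map_snd :
    (pairAlg k).map (AlgHom.snd k (DPField k 2) (coxeterCell k affineA1 → k)) = cellAlg k := by
  rw [cellAlg, pairAlg, AlgHom.map_adjoin]
  congr 1
  simp only [pairGenerators, Set.image_union, ← Set.range_comp]
  rfl

/-- The coordinates of a point of the cell which correspond to the initial seed. -/
def cellPoint (g : coxeterCell k affineA1) : Fin 2 ⊕ (Fin 2 ⊕ Fin 2) → k :=
  Sum.elim (cellX · g) (Sum.elim (cellZ · g) (cellZbar · g))

open MvPolynomial in
/-- A pair of corresponding elements is given by the same quotient of polynomials in the initial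
seed, with a denominator that does not vanish on the torus. -/
theorem exists_fraction_of_mem_pairAlg {p : DPField k 2 × (coxeterCell k affineA1 → k)}
    (hp : p ∈ pairAlg k) : ∃ N D : MvPolynomial (Fin 2 ⊕ (Fin 2 ⊕ Fin 2)) k,
      (∀ v : Fin 2 ⊕ (Fin 2 ⊕ Fin 2) → k, (∀ i, v i ≠ 0) → eval v D ≠ 0) ∧
      p.1 * algebraMap _ (DPField k 2) D = algebraMap _ (DPField k 2) N ∧
      ∀ g, p.2 g * eval (cellPoint g) D = eval (cellPoint g) N := by
  induction hp using Algebra.adjoin_induction with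
  | mem p hp =>
    have hX (i : Fin 2) : algebraMap (MvPolynomial (Fin 2 ⊕ (Fin 2 ⊕ Fin 2)) k) (DPField k 2)
      (X (.inl i)) = dpX k i := rfl
    have hZ (i : Fin 2) : algebraMap (MvPolynomial (Fin 2 ⊕ (Fin 2 ⊕ Fin 2)) k) (DPField k 2)
      (X (.inr (.inl i))) = dpZ k i := rfl
    have hW (i : Fin 2) : algebraMap (MvPolynomial (Fin 2 ⊕ (Fin 2 ⊕ Fin 2)) k) (DPField k 2)
      (X (.inr (.inr i))) = dpZbar k i := rfl
    have cX : ∀ g i, cellPoint (k := k) g (.inl i) = cellX i g := fun _ _ => rfl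
    have cZ : ∀ g i, cellPoint (k := k) g (.inr (.inl i)) = cellZ i g := fun _ _ => rfl
    have cW : ∀ g i, cellPoint (k := k) g (.inr (.inr i)) = cellZbar i g := fun _ _ => rfl
    rcases hp with ((((⟨i, rfl⟩ | ⟨i, rfl⟩) | ⟨i, rfl⟩) | ⟨i, rfl⟩) | ⟨i, rfl⟩) | ⟨i, rfl⟩
    · exact ⟨X (.inl i), 1, by simp, by rw [map_one, mul_one, hX],
        fun g => by rw [map_one, mul_one, eval_X, cX]⟩
    · rcases eq_or_eq_rev 0 i with rfl | rfl
      · refine ⟨X (.inl 0) ^ 2 * (X (.inr (.inl 1)) * X (.inr (.inr 1))) + 1, X (.inl 1),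
          fun v hv => by rw [eval_X]; exact hv _, ?_, fun g => ?_⟩
        · simp only [map_add, map_mul, map_pow, map_one, hX, hZ, hW]
          rw [mul_comm, dpX_mul_dpX'_zero]
        · simp only [map_add, map_mul, map_pow, map_one, eval_X, cX, cZ, cW]
          rw [mul_comm, (cell_relations g).1]
      · refine ⟨(X (.inl 0) ^ 2 * (X (.inr (.inl 1)) * X (.inr (.inr 1))) + 1) ^ 2 *
            (X (.inr (.inl 0)) * X (.inr (.inr 0))) + X (.inl 1) ^ 2,
          X (.inl 0) * X (.inl 1) ^ 2, fun v hv => ?_, ?_, fun g => ?_⟩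
        · rw [map_mul, map_pow, eval_X, eval_X]
          exact mul_ne_zero (hv _) (pow_ne_zero 2 (hv _))
        · simp only [map_add, map_mul, map_pow, map_one, hX, hZ, hW,
            show Fin.rev (0 : Fin 2) = 1 from rfl]
          rw [← dpX_mul_dpX'_zero]
          linear_combination dpX k 1 ^ 2 * dpX_mul_dpX'_one (k := k)
        · simp only [map_add, map_mul, map_pow, map_one, eval_X, cX, cZ, cW,
            show Fin.rev (0 : Fin 2) = 1 from rfl]
          rw [← (cell_relations g).1]
          linear_combination cellX 1 g ^ 2 * (cell_relations g).2
    · exact ⟨X (.inr (.inl i)), 1, by simp, by rw [map_one, mul_one, hZ],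
        fun g => by rw [map_one, mul_one, eval_X, cZ]⟩
    · exact ⟨X (.inr (.inr i)), 1, by simp, by rw [map_one, mul_one, hW],
        fun g => by rw [map_one, mul_one, eval_X, cW]⟩
    · exact ⟨1, X (.inr (.inl i)), fun v hv => by rw [eval_X]; exact hv _,
        by rw [map_one, hZ, inv_mul_cancel₀ (dpZ_ne_zero i)],
        fun g => by
          rw [map_one, eval_X, cZ]; exact inv_mul_cancel₀ (cellZ_ne_zero i g)⟩
    · exact ⟨1, X (.inr (.inr i)), fun v hv => by rw [eval_X]; exact hv _,
        by rw [map_one, hW, inv_mul_cancel₀ (dpZbar_ne_zero i)],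
        fun g => by
          rw [map_one, eval_X, cW]; exact inv_mul_cancel₀ (cellZbar_ne_zero i g)⟩
  | algebraMap c =>
    refine ⟨C c, 1, by simp, ?_, fun g => ?_⟩
    · rw [map_one, mul_one]
      exact IsScalarTower.algebraMap_apply k (MvPolynomial _ k) _ c
    · rw [map_one, mul_one, eval_C]; rfl
  | add p q _ _ hp hq =>
    obtain ⟨N, D, h1, h2, h3⟩ := hp
    obtain ⟨N', D', h1', h2', h3'⟩ := hq
    refine ⟨N * D' + N' * D, D * D', fun v hv => ?_, ?_, fun g => ?_⟩
    · rw [map_mul]; exact mul_ne_zero (h1 v hv) (h1' v hv)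
    · rw [map_mul, map_add, map_mul, map_mul, ← h2, ← h2', Prod.fst_add]; ring
    · rw [map_mul, map_add, map_mul, map_mul, ← h3, ← h3', Prod.snd_add, Pi.add_apply]; ring
  | mul p q _ _ hp hq =>
    obtain ⟨N, D, h1, h2, h3⟩ := hp
    obtain ⟨N', D', h1', h2', h3'⟩ := hq
    refine ⟨N * N', D * D', fun v hv => ?_, ?_, fun g => ?_⟩
    · rw [map_mul]; exact mul_ne_zero (h1 v hv) (h1' v hv)
    · rw [map_mul, map_mul, ← h2, ← h2', Prod.fst_mul]; ring
    · rw [map_mul, map_mul, ← h3, ← h3', Prod.snd_mul, Pi.mul_apply]; ring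

theorem exists_cellPoint_eq {v : Fin 2 ⊕ (Fin 2 ⊕ Fin 2) → k} (hv : ∀ i, v i ≠ 0) :
    ∃ g, cellPoint g = v := by
  set X' : Fin 2 → k :=
    ![(v (.inl 0) ^ 2 * (v (.inr (.inl 1)) * v (.inr (.inr 1))) + 1) / v (.inl 1),
      (((v (.inl 0) ^ 2 * (v (.inr (.inl 1)) * v (.inr (.inr 1))) + 1) / v (.inl 1)) ^ 2 *
        (v (.inr (.inl 0)) * v (.inr (.inr 0))) + 1) / v (.inl 0)]
  obtain ⟨g, hg⟩ := exists_cell (X := fun i => v (.inl i)) (X' := X')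
    (Z := fun i => v (.inr (.inl i))) (W := fun i => v (.inr (.inr i))) (fun i => hv _)
    (fun i => hv _) (mul_div_cancel₀ _ (hv _)) (mul_div_cancel₀ _ (hv _))
  refine ⟨g, funext (Sum.forall.2 ⟨fun i => (hg i).1, Sum.forall.2 ⟨fun i => (hg i).2.2.1,
    fun i => (hg i).2.2.2⟩⟩)⟩

/-- An element of `pairAlg` is determined by either component, since the fraction of
`exists_fraction_of_mem_pairAlg` vanishes if and only if it vanishes on the torus. -/
theorem fst_eq_zero_iff_snd_eq_zero {p : DPField k 2 × (coxeterCell k affineA1 → k)}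
    (hp : p ∈ pairAlg k) : p.1 = 0 ↔ p.2 = 0 := by
  obtain ⟨N, D, h1, h2, h3⟩ := exists_fraction_of_mem_pairAlg hp
  constructor
  · intro h
    rw [h, zero_mul] at h2
    have hN : N = 0 := IsFractionRing.injective _ (DPField k 2) (h2.symm.trans (map_zero _).symm)
    refine eq_zero_of_eq_zero_on_torus
      (pairAlg_map_snd (k := k) ▸ ⟨p, hp, rfl⟩) fun g hx0 hx1 => ?_
    have h4 := h3 g
    rw [hN, map_zero] at h4
    exact (mul_eq_zero.1 h4).resolve_right (h1 _ (Sum.forall.2 ⟨Fin.forall_fin_two.2 ⟨hx0, hx1⟩,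
      Sum.forall.2 ⟨fun i => cellZ_ne_zero i g, fun i => cellZbar_ne_zero i g⟩⟩))
  · intro h
    -- the numerator vanishes at all points with nonzero coordinates
    have hN : N * ∏ i, MvPolynomial.X i = 0 := MvPolynomial.funext fun v => by
      rw [map_mul, map_prod, map_zero]
      simp only [MvPolynomial.eval_X]
      by_cases hv : ∀ i, v i ≠ 0
      · obtain ⟨g, rfl⟩ := exists_cellPoint_eq hv
        rw [← h3, h, Pi.zero_apply, zero_mul, zero_mul]
      · push Not at hv
        obtain ⟨i, hi⟩ := hv
        rw [Finset.prod_eq_zero (Finset.mem_univ i) hi, mul_zero]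
    have hN' : N = 0 := (mul_eq_zero.1 hN).resolve_right
      (Finset.prod_ne_zero_iff.2 fun i _ => MvPolynomial.X_ne_zero i)
    rw [hN', map_zero] at h2
    refine (mul_eq_zero.1 h2).resolve_right fun hD => ?_
    have hD0 : D = 0 := IsFractionRing.injective _ (DPField k 2) (hD.trans (map_zero _).symm)
    exact h1 (fun _ => 1) (fun _ => one_ne_zero) (by rw [hD0, map_zero])

/-- The isomorphism of the cluster algebra with the coordinate ring of the cell. -/
theorem exists_clusterDP_equiv [IsAlgClosed k] :
    ∃ Φ : clusterDP k affineA1 ≃ₐ[k] coordinateRing k affineA1 (coxeterCell k affineA1),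
      ∀ p ∈ pairAlg k, ∀ (h : p.1 ∈ clusterDP k affineA1), (Φ ⟨p.1, h⟩ : coxeterCell k affineA1 → k) = p.2 := by
  exact exists_algEquiv_of_graph pairAlg_map_fst
    (pairAlg_map_snd.trans coordinateRing_eq_cellAlg.symm) fun p => fst_eq_zero_iff_snd_eq_zero

theorem exists_isStandardIso [IsAlgClosed k] : ∃ Φ, IsStandardIso k affineA1 Φ := by
  obtain ⟨Φ, hΦ⟩ := exists_clusterDP_equiv (k := k)
  refine ⟨Φ, fun i g => ⟨?_, ?_, ?_⟩⟩
  · exact congrFun (hΦ (dpX k i, cellX i)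
      (Algebra.subset_adjoin (Or.inl (Or.inl (Or.inl (Or.inl (Or.inl ⟨i, rfl⟩)))))) _) g
  · exact congrFun (hΦ (dpZ k i, cellZ i)
      (Algebra.subset_adjoin (Or.inl (Or.inl (Or.inl (Or.inr ⟨i, rfl⟩))))) _) g
  · exact congrFun (hΦ (dpZbar k i, cellZbar i)
      (Algebra.subset_adjoin (Or.inl (Or.inl (Or.inr ⟨i, rfl⟩)))) _) g

end Correspondence

/-! ### The evaluation minor as an element of the cluster algebra -/

section EvaluationMinor
variable {k : Type u} [Field k] [CharZero k] {n : ℕ}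

/-- The points of the cell at which the initial cluster variables do not vanish are the factored
elements at which the minor of the evaluation representation has been computed. -/
theorem chartPt_eq_factored (s t p b y c : kˣ) (y' : k) (hc : (c : k) = -(b : k)⁻¹ + b * y' * y) :
    chartPt s t p b y' y = xbar k affineA1 0 s * xbar k affineA1 1 (p ^ 2 * c / (b * y) : kˣ) *
      corootElt k affineA1 0 p * corootElt k affineA1 1 (b * y) * x k affineA1 1 (y⁻¹ : kˣ) *
      x k affineA1 0 t := by
  have h1 : (sbar k affineA1 1)⁻¹ * xbar k affineA1 1 y
      = corootElt k affineA1 1 y * xbar k affineA1 1 (-y) * x k affineA1 1 (y⁻¹ : kˣ) := by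
    rw [x_eq, inv_inv, xbar_neg, ← mul_assoc, ← mul_assoc, ← mul_assoc,
      inv_mul_cancel_right, ← corootElt_mul affineA1_self, mul_inv_cancel, corootElt_one, one_mul]
  have h2 : xbar k affineA1 1 (p ^ 2 * c / (b * y) : kˣ) * corootElt k affineA1 0 p
      = corootElt k affineA1 0 p * xbar k affineA1 1 (c / (b * y) : kˣ) := by
    rw [corootElt_mul_xbar affineA1_self, show affineA1 0 1 = -2 from rfl]
    congr 2
    push_cast
    rw [mul_div_assoc]
    norm_cast
  have h3 : corootElt k affineA1 1 (b * y) * xbar k affineA1 1 (-y)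
      = xbar k affineA1 1 (-((b : k) ^ 2 * y)⁻¹) * corootElt k affineA1 1 (b * y) := by
    rw [corootElt_mul_xbar affineA1_self, affineA1_self]
    congr 2
    have := b.ne_zero
    have := y.ne_zero
    push_cast
    rw [zpow_neg]
    field_simp
  have h4 : xbar k affineA1 1 (c / (b * y) : kˣ)
      = xbar k affineA1 1 y' * xbar k affineA1 1 (-((b : k) ^ 2 * y)⁻¹) := by
    rw [← xbar_add]
    congr 1
    have := b.ne_zero
    have := y.ne_zero
    push_cast
    rw [hc]
    field_simp
    ring
  calc chartPt s t p b y' y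
      = xbar k affineA1 0 s * corootElt k affineA1 0 p * xbar k affineA1 1 y' *
        corootElt k affineA1 1 b * ((sbar k affineA1 1)⁻¹ * xbar k affineA1 1 y) *
        x k affineA1 0 t := by simp only [chartPt, mul_assoc]
    _ = xbar k affineA1 0 s * corootElt k affineA1 0 p * xbar k affineA1 1 y' *
        (corootElt k affineA1 1 (b * y) * xbar k affineA1 1 (-y)) * x k affineA1 1 (y⁻¹ : kˣ) *
        x k affineA1 0 t := by
      rw [h1, corootElt_mul affineA1_self]; simp only [mul_assoc]
    _ = xbar k affineA1 0 s * (corootElt k affineA1 0 p * (xbar k affineA1 1 y' *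
        xbar k affineA1 1 (-((b : k) ^ 2 * y)⁻¹))) * corootElt k affineA1 1 (b * y) *
        x k affineA1 1 (y⁻¹ : kˣ) * x k affineA1 0 t := by
      rw [h3]; simp only [mul_assoc]
    _ = _ := by rw [← h4, ← h2]; simp only [mul_assoc]

end EvaluationMinor

section EvaluationOnCell
variable {k : Type u} [Field k] [IsAlgClosed k] [CharZero k] {n : ℕ}

/-- The terms of the evaluation formula, rewritten from chart coordinates to cell coordinates. -/
theorem evaluation_monomial {s t p b y c : k} (hp : p ≠ 0) (hb : b ≠ 0) (hy : y ≠ 0)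
    {m l : ℕ} (hl : l ≤ m) (hm : m ≤ n) :
    p ^ n * (b * y) ^ n * ((t * s) ^ m * (y⁻¹ * (p ^ 2 * c / (b * y))) ^ (m - l) *
        (b * y / p) ^ ((n : ℤ) - 2 * l))
      = (p * s) ^ m * (p * t) ^ m * c ^ (m - l) * (b / p ^ 2) ^ (m - l) * p ^ (2 * (m - l)) *
        (b * y) ^ (2 * (n - m)) := by
  obtain ⟨e, rfl⟩ := Nat.exists_eq_add_of_le hl
  obtain ⟨f, rfl⟩ := Nat.exists_eq_add_of_le hm
  have h : (b * y / p) ^ (((l + e + f : ℕ) : ℤ) - 2 * l)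
      = (b * y) ^ (e + f) * p ^ l / (p ^ (e + f) * (b * y) ^ l) := by
    rw [show ((l + e + f : ℕ) : ℤ) - 2 * l = ((e + f : ℕ) : ℤ) - (l : ℕ) by push_cast; ring,
      zpow_sub₀ (div_ne_zero (mul_ne_zero hb hy) hp), zpow_natCast, zpow_natCast, div_pow, div_pow]
    field_simp
  rw [h, Nat.add_sub_cancel_left, Nat.add_sub_cancel_left]
  simp only [mul_pow, div_pow, inv_pow, pow_add, two_mul]
  field_simp
  ring

/-- The evaluation formula in the coordinates of the cell. It holds on the torus by
`evalMinor_factored`, and on the cell by density. -/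
theorem cellX_pow_mul_evalMinor (a : Fin n → kˣ) (g : coxeterCell k affineA1) :
    cellX 0 g ^ n * cellX 1 g ^ n * evalMinor a g
      = ∑ m ∈ Finset.range (n + 1), ∑ l ∈ Finset.range (m + 1),
        dCoeff a m l * cellZbar 0 g ^ m * cellZ 0 g ^ m * cellZbar 1 g ^ (m - l) *
          cellZ 1 g ^ (m - l) * cellX 0 g ^ (2 * (m - l)) * cellX 1 g ^ (2 * (n - m)) := by
  let L : coxeterCell k affineA1 → k := fun g => evalMinor a g
  have hL : L ∈ cellAlg k := polynomialFunctions_restrict_mem (evalMinor_mem_polynomialFunctions a)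
  have hR : (∑ m ∈ Finset.range (n + 1), ∑ l ∈ Finset.range (m + 1),
        dCoeff a m l • (cellZbar 0 ^ m * cellZ 0 ^ m * cellZbar 1 ^ (m - l) *
          cellZ 1 ^ (m - l) * cellX 0 ^ (2 * (m - l)) * cellX 1 ^ (2 * (n - m)))) ∈ cellAlg k :=
    sum_mem fun m _ => sum_mem fun l _ => (cellAlg k).smul_mem (mul_mem (mul_mem (mul_mem
      (mul_mem (mul_mem (pow_mem (cellZbar_mem 0) _) (pow_mem (cellZ_mem 0) _))
        (pow_mem (cellZbar_mem 1) _)) (pow_mem (cellZ_mem 1) _)) (pow_mem (cellX_mem 0) _))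
        (pow_mem (cellX_mem 1) _)) _
  have key := eq_zero_of_eq_zero_on_torus (sub_mem
    (mul_mem (mul_mem (pow_mem (cellX_mem 0) n) (pow_mem (cellX_mem 1) n)) hL) hR) ?_
  · have := congrFun key g
    simp only [Pi.sub_apply, Pi.mul_apply, Pi.pow_apply, Finset.sum_apply, Pi.smul_apply,
      smul_eq_mul, Pi.zero_apply, ← mul_assoc, L] at this
    exact sub_eq_zero.1 this
  · intro g h0 h1
    obtain ⟨s, t, p, b, y', y, h, rfl⟩ := exists_chartCell h0
    rw [cellX_one_chart] at h1
    have hy : y ≠ 0 := right_ne_zero_of_mul h1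
    lift y to kˣ using hy.isUnit
    have hL' : L (chartCell s t p b y' y h) = _ :=
      (congrArg (evalMinor a) (chartPt_eq_factored s t p b y
        (Units.mk0 _ (chart_ne_zero h)) y' rfl)).trans (evalMinor_factored a _ _ _ _ _ _)
    simp only [Pi.sub_apply, Pi.mul_apply, Pi.pow_apply, Finset.sum_apply, Pi.smul_apply,
      smul_eq_mul, hL', cellX_zero_chart, cellX_one_chart, cellZ_zero_chart, cellZ_one_chart,
      cellZbar_zero_chart, cellZbar_one_chart]
    rw [sub_eq_zero, Finset.mul_sum]
    refine Finset.sum_congr rfl fun m hm => ?_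
    rw [Finset.mul_sum]
    refine Finset.sum_congr rfl fun l hl => ?_
    rw [← evaluation_monomial p.ne_zero b.ne_zero hy
      (Nat.lt_succ_iff.1 (Finset.mem_range.1 hl)) (Nat.lt_succ_iff.1 (Finset.mem_range.1 hm))]
    push_cast
    rw [Units.val_mk0]
    ring

/-- A standard isomorphism sends the element of the evaluation formula to the minor of `V(a)`: after
clearing the denominators both sides are polynomials in the images of the initial variables. -/
theorem IsStandardIso.map_evalElement (a : Fin n → kˣ)
    {Φ : clusterDP k affineA1 ≃ₐ[k] coordinateRing k affineA1 (coxeterCell k affineA1)}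
    (hΦ : IsStandardIso k affineA1 Φ) :
    ∃ (hx : evalElement a ∈ clusterDP k affineA1)
      (hΔ : (fun g : coxeterCell k affineA1 => evalMinor a g) ∈
        coordinateRing k affineA1 (coxeterCell k affineA1)),
      Φ ⟨evalElement a, hx⟩ = ⟨fun g : coxeterCell k affineA1 => evalMinor a g, hΔ⟩ := by
  have hΔ := coordinateRing_of_polynomialFunctions (X := coxeterCell k affineA1)
    (evalMinor_mem_polynomialFunctions a)
  obtain ⟨w, hw⟩ := Φ.surjective ⟨_, hΔ⟩
  have h1 : clX k affineA1 0 ^ n * clX k affineA1 1 ^ n * w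
      = ∑ m ∈ Finset.range (n + 1), ∑ l ∈ Finset.range (m + 1),
        dCoeff a m l • (clZbar k affineA1 0 ^ m * clZ k affineA1 0 ^ m *
          clZbar k affineA1 1 ^ (m - l) * clZ k affineA1 1 ^ (m - l) *
          clX k affineA1 0 ^ (2 * (m - l)) * clX k affineA1 1 ^ (2 * (n - m))) := by
    refine Φ.injective (Subtype.ext (funext fun g => ?_))
    have hX : ∀ i, (Φ (clX k affineA1 i) : coxeterCell k affineA1 → k) g = cellX i g :=
      fun i => (hΦ i g).1
    have hZ : ∀ i, (Φ (clZ k affineA1 i) : coxeterCell k affineA1 → k) g = cellZ i g :=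
      fun i => (hΦ i g).2.1
    have hW : ∀ i, (Φ (clZbar k affineA1 i) : coxeterCell k affineA1 → k) g = cellZbar i g :=
      fun i => (hΦ i g).2.2
    simp only [map_mul, map_pow, map_sum, map_smul, hw, Subalgebra.coe_mul, Subalgebra.coe_pow,
      AddSubmonoidClass.coe_finsetSum, Subalgebra.coe_smul, Pi.mul_apply, Pi.pow_apply,
      Finset.sum_apply, Pi.smul_apply, smul_eq_mul, hX, hZ, hW, ← mul_assoc]
    exact cellX_pow_mul_evalMinor a g
  have h2 : (w : DPField k 2) = evalElement a := by
    have h := congrArg (Subtype.val) h1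
    simp only [Subalgebra.coe_mul, Subalgebra.coe_pow, AddSubmonoidClass.coe_finsetSum,
      Algebra.smul_def, ← mul_assoc, Subalgebra.coe_algebraMap] at h
    have hx : ∀ i, (clX k affineA1 i : DPField k 2) ≠ 0 := dpX_ne_zero
    rw [evalElement, ← h, inv_pow, inv_pow]
    have h0 := hx 0
    have h1 := hx 1
    field_simp
  refine ⟨h2 ▸ w.2, hΔ, ?_⟩
  rw [← hw]
  exact congrArg Φ (Subtype.ext h2.symm)

end EvaluationOnCell

end KacMoody

end

theorem mainTheorem5 (k : Type*) [Field k] [IsAlgClosed k] [CharZero k]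
    (n : ℕ) (a : Fin n → kˣ) :
    (∀ t₁' t₂' h₁ h₂ t₂ t₁ : kˣ,
      KacMoody.evalMinor a
          (KacMoody.xbar k KacMoody.affineA1 0 t₁' * KacMoody.xbar k KacMoody.affineA1 1 t₂' *
            KacMoody.corootElt k KacMoody.affineA1 0 h₁ *
            KacMoody.corootElt k KacMoody.affineA1 1 h₂ *
            KacMoody.x k KacMoody.affineA1 1 t₂ * KacMoody.x k KacMoody.affineA1 0 t₁) =
        ∑ m ∈ Finset.range (n + 1), ∑ l ∈ Finset.range (m + 1),
          KacMoody.dCoeff a m l * (t₁' : k) ^ m * (t₂' : k) ^ (m - l) *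
            (h₁ : k) ^ (2 * (l : ℤ) - (n : ℤ)) * (h₂ : k) ^ ((n : ℤ) - 2 * (l : ℤ)) *
            (t₂ : k) ^ (m - l) * (t₁ : k) ^ m) ∧
    (∃ Φ, KacMoody.IsStandardIso k KacMoody.affineA1 Φ) ∧
    ∀ Φ, KacMoody.IsStandardIso k KacMoody.affineA1 Φ →
      ∃ (hx : KacMoody.evalElement a ∈ KacMoody.clusterDP k KacMoody.affineA1)
        (hΔ : (fun g : KacMoody.coxeterCell k KacMoody.affineA1 => KacMoody.evalMinor a g) ∈
          KacMoody.coordinateRing k KacMoody.affineA1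
            (KacMoody.coxeterCell k KacMoody.affineA1)),
        Φ ⟨KacMoody.evalElement a, hx⟩ =
          ⟨fun g : KacMoody.coxeterCell k KacMoody.affineA1 => KacMoody.evalMinor a g, hΔ⟩ := by
  refine ⟨fun t₁' t₂' h₁ h₂ t₂ t₁ => ?_, KacMoody.exists_isStandardIso,
    fun Φ hΦ => KacMoody.IsStandardIso.map_evalElement a hΦ⟩
  rw [KacMoody.evalMinor_factored]
  refine Finset.sum_congr rfl fun m _ => Finset.sum_congr rfl fun l _ => ?_
  rw [div_zpow, div_eq_mul_inv, ← zpow_neg, neg_sub, mul_pow, mul_pow]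
  ring
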